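/- **Setting.** Let $\Omega\subset\mathbb R^2$ be a bounded, connected, nonempty open set with a geometrically conforming finite mesh $\mathscr T$ of possibly curved triangles: each element $T$ is the image of the closed unit triangle under an orientation preserving diffeomorphism that is smooth up to the boundary; the elements fill $\overline\Omega$, their interiors lie in $\Omega$, two different elements are disjoint or meet exactly in one common vertex or one common edge, and each edge, without its endpoints, lies in $\Omega$ (interior edge) or in $\partial\Omega$ (boundary edge). *Piecewise smooth* means: on each (closed) element, smooth up to its boundary, possibly with different values from the two sides of an edge. Let $\mathrm{Reg}(\mathscr T)$ be the piecewise smooth symmetric covariant 2-tensor fields $\sigma=\sigma_{ij}dx^i\otimes dx^j$ that are $tt$-continuous: on each interior edge $E$, the value $\sigma(X,X)$ from the two sides agrees for all $X$ tangent to $E$. Let $g\in \mathrm{Reg}^+(\mathscr T)$, that is, $g\in\mathrm{Reg}(\mathscr T)$ is positive definite on each element. On $\partial T$, let $\hat t,\hat n$ be the $g$-unit tangent in the (counterclockwise) boundary orientation and the $g$-unit normal such that $(\hat t,\hat n)$ is positively oriented (so $\hat n$ points into $T$). Let $\mathring{\mathcal W}_g(\mathscr T)$ be the piecewise smooth vector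 fields $W$ that are $g$-normal continuous, i.e. $g(W|_{T_+},\hat n_+)+g(W|_{T_-},\hat n_-)=0$ on each interior edge shared by $T_\pm$, and satisfy $g(W,\hat n)=0$ on the boundary edges. **Glued manifold.** Let $\breve M$ be $\Omega$ without the mesh vertices, and let $d_g(p,q)$ be the infimum of the $g$-lengths of the piecewise $C^1$ paths from $p$ to $q$ that run in $\breve M$ except possibly for their endpoints (paths made of finitely many $C^1$ pieces, each in one element). The *glued smooth structure* on $\breve M$ is the maximal atlas given by the Cartesian coordinates inside elements and by the following coordinates near each point $z$ of an interior edge $E$ shared by $T_+$ and $T_-$: if $\pi(p)$ is the $d_g$-nearest point of $E$ to $p$, then $\breve x^1(p)=\pm d_g(\pi(p),p)$ for $p\in T_\pm$, and $\breve x^2(p)$ is the signed $g$-length of the part of $E$ from $z$ to $\pi(p)$, counted positively in the direction $\hat t_+$ (on neighbourhoods of $z$ in $\breve M$ that meet no other edge and are so small that this is well defined and, from either side up to $E$, diffeomorphic). Let $\mathring{\mathfrak X}(\breve M)$ be the vector fields on $\breve M$ that are smooth for this structure and have relatively compact support in $\breve M$. For $\varepsilon>0$ let $\breve M_\varepsilon$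 be the set of the points $q\in\Omega$ with $d_g(q,V)>\varepsilon$ for all mesh vertices $V$. **Pairings.** On each element let $\nabla$ be the Levi-Civita connection of $g$, let $(\mathrm{curl}_g\sigma)(Z)=\star\big[(X,Y)\mapsto(\nabla_X\sigma)(Z,Y)-(\nabla_Y\sigma)(Z,X)\big]$, and $(\mathrm{rot}_gX)^{mp}=\varepsilon^{pi}(\nabla_iX)^m/\sqrt{\det g}$, where $\varepsilon^{12}=1=-\varepsilon^{21}$ and $\varepsilon^{11}=\varepsilon^{22}=0$. For $\varphi\in\mathring{\mathfrak X}(\breve M)$ and $W\in\mathring{\mathcal W}_g(\mathscr T)$ put $$\langle \mathrm{curl}_g\sigma,\varphi\rangle=\sum_{T}\int_{(T,g)}\sigma(\mathrm{rot}_g\varphi),\qquad \langle \mathrm{curl}_g\sigma,W\rangle=\sum_{T}\Big(\int_{(T,g)}(\mathrm{curl}_g\sigma)(W)-\int_{(\partial T,g)}g(W,\hat n)\,\sigma(\hat n,\hat t)\Big).$$ For an open set $O\subset\mathbb R^2$ let $W^p(\mathrm{div},O)$ be the space of the $w\in L^p(O)^2$ with weak (Euclidean) divergence in $L^p(O)$,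 with norm $(\|w\|_{L^p}^p+\|\mathrm{div}\,w\|_{L^p}^p)^{1/p}$. **Proposition.** Let $\sigma\in\mathrm{Reg}(\mathscr T)$ and $W\in\mathring{\mathcal W}_g(\mathscr T)$. For all $\varepsilon_1>0$ and $\varepsilon_0>0$ there exist $p>2$, $\varepsilon_2\in(0,\varepsilon_0]$, finitely many charts $(U_i,\breve\Phi_i)$, $i\in I$, of the glued smooth structure that cover $\breve M_{\varepsilon_2}$, functions $\psi_i$, smooth on the glued manifold $\breve M$, that form a partition of unity on $\breve M_{\varepsilon_2}$ subordinate to the $U_i$ (that is, $\psi_i\ge 0$, $\sum_i\psi_i\le1$ on $\breve M$, $\sum_i\psi_i=1$ on $\breve M_{\varepsilon_2}$, and the support of $\psi_i$, closed in $\breve M$, lies in $U_i$), and a field $\varphi=\sum_{i\in I}\varphi_i\in\mathring{\mathfrak X}(\breve M)$, with $\varphi_i\in\mathring{\mathfrak X}(\breve M)$ compactly supported in $U_i$, such that $$\big|\langle \mathrm{curl}_g\sigma,\varphi\rangle-\langle \mathrm{curl}_g\sigma,W\rangle\big|\le\varepsilon_1\quad\text{and}\quad \big\|(\breve\Phi_i)_*(\varphi_i-\psi_iW)\big\|_{W^p(\mathrm{div},\,\breve\Phi_i(U_i\cap\breve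 M_{\varepsilon_2}))}\le\varepsilon_1\ \text{ for all } i\in I.$$ -/

import Mathlib

open Set MeasureTheory
open scoped ContDiff

noncomputable section

/-- The Euclidean plane, with Cartesian coordinates `x 0`, `x 1`. -/
abbrev Plane : Type := EuclideanSpace ℝ (Fin 2)

/-- The vector with components `v`. -/
def planeVec (v : Fin 2 → ℝ) : Plane := WithLp.toLp 2 v

/-- The coordinate vector `∂_a`. -/
def coordVec (a : Fin 2) : Plane := EuclideanSpace.single a (1 : ℝ)

/-- The alternating symbol. -/
def altSymb (a b : Fin 2) : ℝ := !![0, 1; -1, 0] a b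

/-- The value `A(u, v)` of the covariant 2-tensor with components `A`. -/
def tensorApp (A : Matrix (Fin 2) (Fin 2) ℝ) (u v : Plane) : ℝ :=
  ∑ a, ∑ b, A a b * u a * v b

/-- The closed unit triangle. -/
def refTriangle : Set Plane := {x | 0 ≤ x 0 ∧ 0 ≤ x 1 ∧ x 0 + x 1 ≤ 1}

/-- The three edges of the unit triangle, parametrized counterclockwise by `s ∈ [0,1]`. -/
def refEdge (k : Fin 3) (s : ℝ) : Plane :=
  match k with
  | 0 => planeVec ![s, 0]
  | 1 => planeVec ![1 - s, s]
  | 2 => planeVec ![0, 1 - s]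

/-- `f` is smooth on the closed set `S`, up to its boundary: it is there the restriction of a
smooth function on the plane. -/
def SmoothUpTo (S : Set Plane) {F : Type} [NormedAddCommGroup F] [NormedSpace ℝ F]
    (f : Plane → F) : Prop :=
  ∃ f' : Plane → F, ContDiff ℝ ∞ f' ∧ EqOn f f' S

/-- A geometrically conforming mesh of the planar set `Ω` by (possibly curved) triangles indexed
by `ι`. The element with index `i` is the image of the closed unit triangle under `map i`, which is
on that triangle an orientation preserving diffeomorphism, smooth up to the boundary. -/
structure CurvedMesh (Ω : Set Plane) (ι : Type) where
  map : ι → Plane → Plane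
  smooth : ∀ i, ContDiff ℝ ∞ (map i)
  injOn : ∀ i, InjOn (map i) refTriangle
  det_pos : ∀ i, ∀ x ∈ refTriangle, 0 < (fderiv ℝ (map i) x).det
  /-- The elements fill the closure of the domain. -/
  cover : closure Ω = ⋃ i, map i '' refTriangle
  /-- The domain contains the interior of each element, -/
  interior_subset : ∀ i, interior (map i '' refTriangle) ⊆ Ω
  /-- and each edge, without its endpoints, is either inside the domain or on its boundary. -/
  edge_dichotomy : ∀ i k,
    (∀ s ∈ Ioo (0 : ℝ) 1, map i (refEdge k s) ∈ Ω) ∨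
      (∀ s ∈ Ioo (0 : ℝ) 1, map i (refEdge k s) ∉ Ω)
  /-- Distinct elements are disjoint or meet exactly in a common vertex or a common edge. -/
  conforming : ∀ i j, i ≠ j →
    (map i '' refTriangle) ∩ (map j '' refTriangle) = ∅ ∨
    (∃ k l, (map i '' refTriangle) ∩ (map j '' refTriangle) = {map i (refEdge k 0)} ∧
      map i (refEdge k 0) = map j (refEdge l 0)) ∨
    (∃ k l, (map i '' refTriangle) ∩ (map j '' refTriangle)
        = (fun s => map i (refEdge k s)) '' Icc 0 1 ∧
      (fun s => map i (refEdge k s)) '' Icc 0 1 = (fun s => map j (refEdge l s)) '' Icc 0 1)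

namespace CurvedMesh

/-- The (closed) mesh element with index `i`. -/
def elem {Ω : Set Plane} {ι : Type} (M : CurvedMesh Ω ι) (i : ι) : Set Plane :=
  M.map i '' refTriangle

/-- The parametrization of the `k`-th edge of an element, along the boundary orientation. -/
def edgeParam {Ω : Set Plane} {ι : Type} (M : CurvedMesh Ω ι) (i : ι) (k : Fin 3) (s : ℝ) :
    Plane :=
  M.map i (refEdge k s)

/-- The `k`-th (closed) edge of an element. -/
def edge {Ω : Set Plane} {ι : Type} (M : CurvedMesh Ω ι) (i : ι) (k : Fin 3) : Set Plane :=
  M.edgeParam i k '' Icc 0 1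

/-- The tangent vector `τ` (not normalized) along an edge, in the boundary orientation. -/
def tangent {Ω : Set Plane} {ι : Type} (M : CurvedMesh Ω ι) (i : ι) (k : Fin 3) (s : ℝ) :
    Plane :=
  deriv (M.edgeParam i k) s

/-- The set of mesh vertices. -/
def vertices {Ω : Set Plane} {ι : Type} (M : CurvedMesh Ω ι) : Set Plane :=
  {V | ∃ i k, V = M.edgeParam i k 0}

/-- The domain with the mesh vertices removed. -/
def punctured {Ω : Set Plane} {ι : Type} (M : CurvedMesh Ω ι) : Set Plane := Ω \ M.vertices

end CurvedMesh

/-- Piecewise tensor fields with two lower indices: on each element, a field of matrices of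
components `σ_{ab}`. Only the values of `σ i` on the element `i` matter; on an edge, the two
adjacent elements may give different values. -/
abbrev PwTensor (ι : Type) : Type := ι → Plane → Matrix (Fin 2) (Fin 2) ℝ

/-- Piecewise vector fields: on each element, a field of vectors of components with respect to the
Cartesian frame `∂_0, ∂_1`. Only the values of `W i` on the element `i` matter. -/
abbrev PwField (ι : Type) : Type := ι → Plane → Plane

namespace CurvedMesh

/-- Piecewise smooth, symmetric and tangential-tangential continuous tensor fields. -/
structure IsRegge {Ω : Set Plane} {ι : Type} (M : CurvedMesh Ω ι) (σ : PwTensor ι) : Prop where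
  smooth : ∀ i a b, SmoothUpTo (M.elem i) (fun p => σ i p a b)
  symm : ∀ i, ∀ p ∈ M.elem i, (σ i p).IsSymm
  /-- The values from both sides of an interior edge agree on its tangent vectors. -/
  tt_cont : ∀ i k j l, ∀ s ∈ Ioo (0 : ℝ) 1, ∀ s' ∈ Ioo (0 : ℝ) 1,
    M.edgeParam i k s = M.edgeParam j l s' → M.edgeParam i k s ∈ Ω →
    tensorApp (σ i (M.edgeParam i k s)) (M.tangent i k s) (M.tangent i k s)
      = tensorApp (σ j (M.edgeParam i k s)) (M.tangent i k s) (M.tangent i k s)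

/-- Regge metrics: positive definite Regge tensor fields. -/
structure IsReggeMetric {Ω : Set Plane} {ι : Type} (M : CurvedMesh Ω ι) (g : PwTensor ι) :
    Prop where
  regge : M.IsRegge g
  pos : ∀ i, ∀ p ∈ M.elem i, ∀ X : Plane, X ≠ 0 → 0 < tensorApp (g i p) X X

/-! ### Unit tangents, unit normals, integrals -/

/-- The `g`-unit tangent along an edge of the element `i`. -/
def unitTangent {Ω : Set Plane} {ι : Type} (M : CurvedMesh Ω ι) (g : PwTensor ι)
    (i : ι) (k : Fin 3) (s : ℝ) : Plane :=
  (Real.sqrt (tensorApp (g i (M.edgeParam i k s)) (M.tangent i k s) (M.tangent i k s)))⁻¹ •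
    M.tangent i k s

/-- The vector `N` with `g(N, X) = (dx^1 ∧ dx^2)(τ, X)` for all `X`, that is
`N^a = - g^{ab} ε_{bc} τ^c`. -/
def normalVec {Ω : Set Plane} {ι : Type} (M : CurvedMesh Ω ι) (g : PwTensor ι)
    (i : ι) (k : Fin 3) (s : ℝ) : Plane :=
  planeVec fun a => - ∑ b, ∑ c,
    (g i (M.edgeParam i k s))⁻¹ a b * altSymb b c * M.tangent i k s c

/-- The (inward) `g`-unit normal along an edge of the element `i`. -/
def unitNormal {Ω : Set Plane} {ι : Type} (M : CurvedMesh Ω ι) (g : PwTensor ι)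
    (i : ι) (k : Fin 3) (s : ℝ) : Plane :=
  (Real.sqrt (tensorApp (g i (M.edgeParam i k s)) (M.normalVec g i k s)
    (M.normalVec g i k s)))⁻¹ • M.normalVec g i k s

/-- The integral of `f` over the Riemannian manifold `(T, g)`, for the element `T` of index `i`. -/
def elemIntegral {Ω : Set Plane} {ι : Type} (M : CurvedMesh Ω ι) (g : PwTensor ι) (i : ι)
    (f : Plane → ℝ) : ℝ :=
  ∫ p in M.elem i, f p * Real.sqrt (g i p).det

/-- The integral over `(∂T, g)` of the function whose value at the point of parameter `s` of the
edge `k` is `f k s`. -/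
def bdryIntegral {Ω : Set Plane} {ι : Type} (M : CurvedMesh Ω ι) (g : PwTensor ι) (i : ι)
    (f : Fin 3 → ℝ → ℝ) : ℝ :=
  ∑ k, ∫ s in (0 : ℝ)..1, f k s *
    Real.sqrt (tensorApp (g i (M.edgeParam i k s)) (M.tangent i k s) (M.tangent i k s))

/-! ### Covariant derivatives on an element -/

/-- The partial derivative in the direction `∂_a` on an element (one-sided at its boundary). -/
def pd {Ω : Set Plane} {ι : Type} (M : CurvedMesh Ω ι) (i : ι) (a : Fin 2) (f : Plane → ℝ)
    (p : Plane) : ℝ :=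
  fderivWithin ℝ f (M.elem i) p (coordVec a)

/-- Christoffel symbols of the first kind. -/
def christoffel₁ {Ω : Set Plane} {ι : Type} (M : CurvedMesh Ω ι) (g : PwTensor ι) (i : ι)
    (a b c : Fin 2) (p : Plane) : ℝ :=
  (1 / 2) * (M.pd i a (fun q => g i q b c) p + M.pd i b (fun q => g i q c a) p
    - M.pd i c (fun q => g i q a b) p)

/-- Christoffel symbols of the second kind, `Γ_{ab}^c`. -/
def christoffel₂ {Ω : Set Plane} {ι : Type} (M : CurvedMesh Ω ι) (g : PwTensor ι) (i : ι)
    (a b c : Fin 2) (p : Plane) : ℝ :=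
  ∑ d, (g i p)⁻¹ c d * M.christoffel₁ g i a b d p

/-- The component `(∇_a σ)_{bc}` of the covariant derivative of a tensor field. -/
def covDerivTensor {Ω : Set Plane} {ι : Type} (M : CurvedMesh Ω ι) (g σ : PwTensor ι) (i : ι)
    (a b c : Fin 2) (p : Plane) : ℝ :=
  M.pd i a (fun q => σ i q b c) p
    - ∑ m, M.christoffel₂ g i a b m p * σ i p m c
    - ∑ m, M.christoffel₂ g i a c m p * σ i p b m

/-- The component `(∇_a X)^b` of the covariant derivative of a vector field. -/
def covDerivField {Ω : Set Plane} {ι : Type} (M : CurvedMesh Ω ι) (g : PwTensor ι)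
    (X : PwField ι) (i : ι) (a b : Fin 2) (p : Plane) : ℝ :=
  M.pd i a (fun q => X i q b) p + ∑ c, M.christoffel₂ g i a c b p * X i p c

/-- The component `(curl_g σ)(∂_a)` of the covariant curl on an element: the Hodge star of the
2-form `(X, Y) ↦ (∇_X σ)(∂_a, Y) - (∇_Y σ)(∂_a, X)`. -/
def curlComp {Ω : Set Plane} {ι : Type} (M : CurvedMesh Ω ι) (g σ : PwTensor ι) (i : ι)
    (a : Fin 2) (p : Plane) : ℝ :=
  (M.covDerivTensor g σ i 0 a 1 p - M.covDerivTensor g σ i 1 a 0 p) / Real.sqrt (g i p).det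

/-- The function `(curl_g σ)(W)` on the element `i`. -/
def curlApp {Ω : Set Plane} {ι : Type} (M : CurvedMesh Ω ι) (g σ : PwTensor ι) (W : PwField ι)
    (i : ι) (p : Plane) : ℝ :=
  ∑ a, M.curlComp g σ i a p * W i p a

/-- The component `(rot_g X)^{mq}` of the covariant rotation on an element, where
`(rot_g X)(μ, η) = μ(∇_Z X)` with `Z = (⋆η)^♯`, that is `Z^l = η_q ε^{ql} / √(det g)`. -/
def rotComp {Ω : Set Plane} {ι : Type} (M : CurvedMesh Ω ι) (g : PwTensor ι) (X : PwField ι)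
    (i : ι) (m q : Fin 2) (p : Plane) : ℝ :=
  (∑ l, altSymb q l * M.covDerivField g X i l m p) / Real.sqrt (g i p).det

/-! ### The two pairings -/

/-- The pairing of `curl_g σ` with a smooth compactly supported field `φ` on the glued manifold:
the integral of `σ(rot_g φ)` over the manifold. -/
def curlPairing {Ω : Set Plane} {ι : Type} [Fintype ι] (M : CurvedMesh Ω ι) (g σ : PwTensor ι)
    (φ : PwField ι) : ℝ :=
  ∑ i, M.elemIntegral g i (fun p => ∑ m, ∑ q, σ i p m q * M.rotComp g φ i m q p)

/-- The extended pairing of `curl_g σ` with a `g`-normal continuous field `W`. -/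
def curlPairingExt {Ω : Set Plane} {ι : Type} [Fintype ι] (M : CurvedMesh Ω ι)
    (g σ : PwTensor ι) (W : PwField ι) : ℝ :=
  (∑ i, M.elemIntegral g i (M.curlApp g σ W i))
    - ∑ i, M.bdryIntegral g i (fun k s =>
        tensorApp (g i (M.edgeParam i k s)) (W i (M.edgeParam i k s)) (M.unitNormal g i k s) *
        tensorApp (σ i (M.edgeParam i k s)) (M.unitNormal g i k s) (M.unitTangent g i k s))

/-- Piecewise smooth, `g`-normal continuous vector fields with vanishing `g`-normal component on
the boundary of the domain. -/
structure IsNormalCont {Ω : Set Plane} {ι : Type} (M : CurvedMesh Ω ι) (g : PwTensor ι)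
    (W : PwField ι) : Prop where
  smooth : ∀ i, SmoothUpTo (M.elem i) (W i)
  jump : ∀ i k j l, i ≠ j → ∀ s ∈ Ioo (0 : ℝ) 1, ∀ s' ∈ Ioo (0 : ℝ) 1,
    M.edgeParam i k s = M.edgeParam j l s' → M.edgeParam i k s ∈ Ω →
    tensorApp (g i (M.edgeParam i k s)) (W i (M.edgeParam i k s)) (M.unitNormal g i k s)
      + tensorApp (g j (M.edgeParam j l s')) (W j (M.edgeParam j l s')) (M.unitNormal g j l s')
      = 0
  bdry : ∀ i k, ∀ s ∈ Ioo (0 : ℝ) 1, M.edgeParam i k s ∉ Ω →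
    tensorApp (g i (M.edgeParam i k s)) (W i (M.edgeParam i k s)) (M.unitNormal g i k s) = 0

/-! ### The distance -/

/-- `M.PathOfLength g p q ℓ`: there is a piecewise `C^1` path of `g`-length `ℓ` from `p` to `q`
which, except possibly for its endpoints, stays in the domain without the mesh vertices. It is a
concatenation of finitely many `C^1` curves, each running in one element and measured by the metric
of that element. -/
inductive PathOfLength {Ω : Set Plane} {ι : Type} (M : CurvedMesh Ω ι) (g : PwTensor ι) :
    Plane → Plane → ℝ → Prop where
  | single (i : ι) (c : ℝ → Plane) (hc : ContDiff ℝ 1 c)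
      (hmem : ∀ s ∈ Icc (0 : ℝ) 1, c s ∈ M.elem i)
      (hint : ∀ s ∈ Ioo (0 : ℝ) 1, c s ∈ M.punctured) :
      PathOfLength M g (c 0) (c 1)
        (∫ s in (0 : ℝ)..1, Real.sqrt (tensorApp (g i (c s)) (deriv c s) (deriv c s)))
  | concat (p q r : Plane) (ℓ ℓ' : ℝ) (hq : q ∈ M.punctured)
      (h : PathOfLength M g p q ℓ) (h' : PathOfLength M g q r ℓ') :
      PathOfLength M g p r (ℓ + ℓ')

/-- The distance generated by `g`. -/
def gdist {Ω : Set Plane} {ι : Type} (M : CurvedMesh Ω ι) (g : PwTensor ι) (p q : Plane) : ℝ :=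
  sInf {ℓ | M.PathOfLength g p q ℓ}

/-- The domain without the closed `g`-balls of radius `ε` around the mesh vertices. -/
def awayFromVertices {Ω : Set Plane} {ι : Type} (M : CurvedMesh Ω ι) (g : PwTensor ι) (ε : ℝ) :
    Set Plane :=
  {p ∈ Ω | ∀ V ∈ M.vertices, ε < M.gdist g p V}

/-! ### The glued smooth structure -/

/-- The adapted coordinates around the point `z` of parameter `s₀` of the interior edge `E`, the
`k`-th edge of `T₊` (index `i`), shared with `T₋` (index `j`). On a neighbourhood of `z` that meets
no other edge and no vertex, each point `p` has a unique `g`-nearest point `π(p)` on `E`; the first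
coordinate of `p` is `± d_g(π(p), p)` for `p` in `T_±`, and the second is the signed `g`-length of
the part of `E` from `z` to `π(p)`, counted in the direction of the tangent of `T₊`. The
neighbourhood has to be so small that these coordinates are diffeomorphic, up to the edge, on
either side. -/
structure IsEdgeChart {Ω : Set Plane} {ι : Type} (M : CurvedMesh Ω ι) (g : PwTensor ι)
    (i j : ι) (k : Fin 3) (s₀ : ℝ) (e : OpenPartialHomeomorph Plane Plane) : Prop where
  ne : i ≠ j
  s₀_mem : s₀ ∈ Ioo (0 : ℝ) 1
  shared : M.edge i k ⊆ M.elem j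
  mem_source : M.edgeParam i k s₀ ∈ e.source
  source_subset : e.source ⊆ M.punctured ∩ (M.elem i ∪ M.elem j)
  no_other_edge : ∀ i' k', e.source ∩ M.edge i' k' ⊆ M.edge i k
  coords : ∀ p ∈ e.source, ∃ s ∈ Ioo (0 : ℝ) 1,
    (∀ s' ∈ Ioo (0 : ℝ) 1, s' ≠ s →
      M.gdist g (M.edgeParam i k s) p < M.gdist g (M.edgeParam i k s') p) ∧
    (p ∈ M.elem i → e p 0 = M.gdist g (M.edgeParam i k s) p) ∧
    (p ∈ M.elem j → e p 0 = - M.gdist g (M.edgeParam i k s) p) ∧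
    e p 1 = ∫ r in s₀..s, Real.sqrt
      (tensorApp (g i (M.edgeParam i k r)) (M.tangent i k r) (M.tangent i k r))
  smooth : ∀ m, m = i ∨ m = j → ContDiffOn ℝ ∞ e (e.source ∩ M.elem m)
  nondeg : ∀ m, m = i ∨ m = j → ∀ p ∈ e.source ∩ M.elem m,
    (fderivWithin ℝ e (M.elem m) p).det ≠ 0

/-- Smooth compatibility of two charts. -/
def SmoothCompat (e f : OpenPartialHomeomorph Plane Plane) : Prop :=
  ContDiffOn ℝ ∞ (e.symm.trans f) (e.symm.trans f).source ∧
    ContDiffOn ℝ ∞ (f.symm.trans e) (f.symm.trans e).source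

/-- Charts of the glued smooth structure on the domain without the mesh vertices: the maximal atlas
given by the Cartesian coordinates inside the elements and the adapted coordinates around interior
edges. -/
structure IsGluedChart {Ω : Set Plane} {ι : Type} (M : CurvedMesh Ω ι) (g : PwTensor ι)
    (e : OpenPartialHomeomorph Plane Plane) : Prop where
  source_subset : e.source ⊆ M.punctured
  compat_elem : ∀ i, SmoothCompat e
    (OpenPartialHomeomorph.ofSet (interior (M.elem i)) isOpen_interior)
  compat_edge : ∀ i j k s₀ f, M.IsEdgeChart g i j k s₀ f → SmoothCompat e f

/-- Smooth functions on the glued manifold. -/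
def IsGluedSmoothFun {Ω : Set Plane} {ι : Type} (M : CurvedMesh Ω ι) (g : PwTensor ι)
    (f : Plane → ℝ) : Prop :=
  ∀ e, M.IsGluedChart g e → ContDiffOn ℝ ∞ (f ∘ e.symm) e.target

/-- Smooth vector fields on the glued manifold, given on each element by their Cartesian
components there: in every glued chart, the pushforwards from the elements (by one-sided derivatives
at the edges) fit together to one smooth field. -/
def IsGluedSmoothField {Ω : Set Plane} {ι : Type} (M : CurvedMesh Ω ι) (g : PwTensor ι)
    (X : PwField ι) : Prop :=
  ∀ e, M.IsGluedChart g e → ∃ Y : Plane → Plane, ContDiffOn ℝ ∞ Y e.target ∧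
    ∀ i, ∀ p ∈ M.elem i ∩ e.source, fderivWithin ℝ e (M.elem i) p (X i p) = Y (e p)

/-- The support of the field `X` is a compact subset of `U`. -/
def CompactSupportIn {Ω : Set Plane} {ι : Type} (M : CurvedMesh Ω ι) (X : PwField ι)
    (U : Set Plane) : Prop :=
  ∃ K, IsCompact K ∧ K ⊆ U ∧ ∀ i, ∀ p ∈ M.elem i, p ∉ K → X i p = 0

/-- Smooth vector fields on the glued manifold with relatively compact support. -/
structure IsTestField {Ω : Set Plane} {ι : Type} (M : CurvedMesh Ω ι) (g : PwTensor ι)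
    (X : PwField ι) : Prop where
  smooth : M.IsGluedSmoothField g X
  support : M.CompactSupportIn X M.punctured

/-- Smooth functions on the glued manifold which form a partition of unity on its subset `A`,
subordinate to the open sets `U n`. -/
structure IsPartitionOfUnityOn {Ω : Set Plane} {ι : Type} (M : CurvedMesh Ω ι) (g : PwTensor ι)
    (A : Set Plane) {N : ℕ} (U : Fin N → Set Plane) (ψ : Fin N → Plane → ℝ) : Prop where
  smooth : ∀ n, M.IsGluedSmoothFun g (ψ n)
  nonneg : ∀ n, ∀ p ∈ M.punctured, 0 ≤ ψ n p
  sum_le_one : ∀ p ∈ M.punctured, ∑ n, ψ n p ≤ 1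
  sum_eq_one : ∀ p ∈ A, ∑ n, ψ n p = 1
  support : ∀ n, closure (Function.support (ψ n) ∩ M.punctured) ∩ M.punctured ⊆ U n

/-- The pushforward of a piecewise vector field under a chart, defined outside of the image of the
mesh edges (a null set, where the value is set to zero). -/
def pushforward {Ω : Set Plane} {ι : Type} [Fintype ι] (M : CurvedMesh Ω ι)
    (e : OpenPartialHomeomorph Plane Plane) (X : PwField ι) (y : Plane) : Plane :=
  ∑ i, (interior (M.elem i)).indicator (fun p => fderiv ℝ e p (X i p)) (e.symm y)

end CurvedMesh

/-! ### The space `W^p(div)` -/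

/-- `d` is the weak (Euclidean) divergence of `w` on the open set `O`. -/
def IsWeakDiv (O : Set Plane) (w : Plane → Plane) (d : Plane → ℝ) : Prop :=
  LocallyIntegrableOn w O ∧ LocallyIntegrableOn d O ∧
    ∀ η : Plane → ℝ, ContDiff ℝ ∞ η → HasCompactSupport η → tsupport η ⊆ O →
      ∫ x in O, fderiv ℝ η x (w x) = - ∫ x in O, d x * η x

/-- The norm `(‖w‖_{L^p}^p + ‖div w‖_{L^p}^p)^{1/p}` of `W^p(div, O)`, with the value `⊤` if `w` is
not in this space. (The weak divergence is unique almost everywhere, so the infimum is over one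
value.) -/
def wpDivNorm (p : ℝ) (O : Set Plane) (w : Plane → Plane) : ENNReal :=
  ⨅ (d : Plane → ℝ) (_ : IsWeakDiv O w d),
    (eLpNorm w (ENNReal.ofReal p) (volume.restrict O) ^ p
      + eLpNorm d (ENNReal.ofReal p) (volume.restrict O) ^ p) ^ (1 / p)

end

/-! Along an interior edge take normal geodesic coordinates: r is the signed distance to the edge, s
the edge parameter of the foot. On either side the metric is dr² + a ds² there, so `g`-normal
continuity of `W` says exactly that its r-component is continuous across the axis r = 0; only the
s-component jumps. Let N be the purely normal field whose r-component is that of `W` on the axis,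
continued constantly in r. It is smooth in the glued structure. Now replace χW, with χ a member of
the partition of unity, by χN near the axis, through a cutoff η(r) of width δ. The error is η(r)u
with u = χ(N - W). The r-component of u vanishes on the axis, which has two consequences: it is
O(|r|), so η'(r)u_r stays bounded although η' has size 1/δ; and the weak divergence of the error has
no part on the axis. Error and divergence are therefore bounded uniformly in δ and live in a strip
whose area tends to zero, so the norm in W^p(div) tends to zero for every finite p. This is
`EdgeTube.exists_approx`. At boundary edges `W` is tangent to the boundary, and the same estimate
allows it to be cut off to zero there (`exists_inner_approx`).

For the pairings, Stokes' theorem on each element (`curlPairing_eq`) rewrites the pairing with φ as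
the integral of (curl σ)(φ) minus boundary integrals of σ(φ, τ). By construction φ is normal along
the edges, φ = c g(W, n) n with c in [0, 1] and c = 1 away from the vertices, so its boundary
integrand is c times that of the extended pairing with `W`. The two pairings thus differ by at most
a constant times the L¹ distance of φ and `W` on the elements plus the length of the edge ends
(`exists_pairing_bound`). The L¹ distance tends to zero by dominated convergence as δ tends to zero,
except for a contribution of the neighbourhood of the vertices, whose area is small by choice of its
radius. So the radius is fixed first, which fixes the charts and the partition of unity, and δ last.

The remaining work is geometric. The glued structure is defined through nearest points for the path
distance, and normal geodesic coordinates must be shown to realize it. Smooth dependence of flows on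
initial values (`exists_smooth_flow`) and the Gauss lemma (`exists_fermi_map`) give coordinates on
each side of an edge; `IsNeighbor.exists_edgeTube` pastes them into one homeomorphism. A potential
that grows no faster than arclength bounds from below the length of every path
(`EdgeTube.exists_potential`), whence the foot of the normal geodesic is the unique nearest point of
the edge (`EdgeTube.exists_gdist`). Hence an edge chart is a smooth product map in tube coordinates,
tubes are charts of the glued structure, and smoothness may be tested in tubes. -/

noncomputable section

open Filter Topology

/-! ### Smooth dependence of flows on time and initial value -/

section Nemytskii

variable {X : Type} [TopologicalSpace X] [CompactSpace X]
  {E F : Type} [NormedAddCommGroup E] [NormedSpace ℝ E] [NormedAddCommGroup F] [NormedSpace ℝ F]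

/-- Pointwise application of a continuous family of operators, as an operator. -/
def pointwiseApply : C(X, E →L[ℝ] F) →L[ℝ] C(X, E) →L[ℝ] C(X, F) :=
  LinearMap.mkContinuous₂
    (LinearMap.mk₂ ℝ (fun (A : C(X, E →L[ℝ] F)) (h : C(X, E)) =>
        (⟨fun x => A x (h x), A.continuous.clm_apply h.continuous⟩ : C(X, F)))
      (fun _ _ _ => by ext; simp) (fun _ _ _ => by ext; simp)
      (fun _ _ _ => by ext; simp) (fun _ _ _ => by ext; simp)) 1
    (fun A h => (ContinuousMap.norm_le _ (by positivity)).2 fun x => by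
      simpa using (A x).le_of_opNorm_le_of_le (A.norm_coe_le_norm x) (h.norm_coe_le_norm x))

/-- The superposition operator of a `C^1` map is differentiable. -/
lemma hasFDerivAt_postcomp {f : C(E, F)} {f' : C(E, E →L[ℝ] F)}
    (hf : ∀ x, HasFDerivAt f (f' x) x) (c : C(X, E)) :
    HasFDerivAt (fun c : C(X, E) => f.comp c) (pointwiseApply (f'.comp c)) c := by
  rw [hasFDerivAt_iff_isLittleO_nhds_zero, Asymptotics.isLittleO_iff]
  intro ε hε
  have hcont := (Metric.continuousAt_iff (f := fun d : C(X, E) => f'.comp d) (a := c)).1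
    (ContinuousMap.continuous_postcomp (X := X) f').continuousAt
  obtain ⟨δ, hδ, h⟩ := hcont ε hε
  filter_upwards [Metric.ball_mem_nhds (0 : C(X, E)) hδ] with v hv
  rw [mem_ball_zero_iff] at hv
  refine (ContinuousMap.norm_le _ (by positivity)).2 fun x => ?_
  -- The mean value inequality at each `x`, on the ball around `c x` of radius `‖v x‖`, needs `‖f' y
  -- - f' (c x)‖ ≤ ε` there, uniformly in `x`.
  have key := Convex.norm_image_sub_le_of_norm_hasFDerivWithin_le' (f := f) (f' := f')
    (φ := f' (c x)) (C := ε) (s := Metric.closedBall (c x) ‖v x‖) (x := c x) (y := c x + v x)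
    (fun y _ => (hf y).hasFDerivWithinAt) (fun y hy => ?_) (convex_closedBall _ _)
    (Metric.mem_closedBall_self (norm_nonneg _)) (by simp)
  · have h1 : ‖v x‖ ≤ ‖v‖ := v.norm_coe_le_norm x
    simp only [add_sub_cancel_left] at key
    exact key.trans (by gcongr)
  -- A point `y` of that ball is the value at `x` of a translate of `c` within `δ` of `c`, so
  -- continuity of `d ↦ f' ∘ d` at the single point `c` gives the uniform estimate, with no
  -- compactness in `E`.
  · set w : C(X, E) := c + ContinuousMap.const X (y - c x)
    have hw : dist w c < δ := by
      rw [dist_eq_norm]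
      refine lt_of_le_of_lt ((ContinuousMap.norm_le _ (norm_nonneg (v x))).2 fun z => ?_)
        ((v.norm_coe_le_norm x).trans_lt hv)
      simpa [w, dist_eq_norm] using hy
    have h2 := (ContinuousMap.dist_apply_le_dist (f := f'.comp w) (g := f'.comp c) x).trans (h hw).le
    simpa [w, dist_eq_norm] using h2

/-- The derivative is the superposition operator of `f'` followed by the bounded linear map
`pointwiseApply`, so each degree of smoothness follows from the previous one. The target `F` is
quantified inside because the induction passes to `E →L[ℝ] F`. -/
lemma contDiff_postcomp_nat (n : ℕ) : ∀ {F : Type} [NormedAddCommGroup F] [NormedSpace ℝ F]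
    (f : C(E, F)), ContDiff ℝ n f → ContDiff ℝ n (fun c : C(X, E) => f.comp c) := by
  induction n with
  | zero =>
    intro F _ _ f _
    exact contDiff_zero.2 (ContinuousMap.continuous_postcomp f)
  | succ n ih =>
    intro F _ _ f hf
    have h1 := contDiff_succ_iff_hasFDerivAt.1 hf
    obtain ⟨f', hf', hd⟩ := h1
    refine contDiff_succ_iff_hasFDerivAt.2
      ⟨fun c => pointwiseApply ((⟨f', hf'.continuous⟩ : C(E, E →L[ℝ] F)).comp c), ?_, fun c =>
        hasFDerivAt_postcomp (f' := ⟨f', hf'.continuous⟩) hd c⟩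
    exact pointwiseApply.contDiff.comp (ih (⟨f', hf'.continuous⟩ : C(E, E →L[ℝ] F)) hf')

/-- The superposition operator of a smooth map is smooth. -/
lemma contDiff_postcomp (f : C(E, F)) (hf : ContDiff ℝ ∞ f) :
    ContDiff ℝ ∞ (fun c : C(X, E) => f.comp c) :=
  contDiff_infty.2 fun n => contDiff_postcomp_nat n f (contDiff_infty.1 hf n)

end Nemytskii

section Flow

variable {E : Type} [NormedAddCommGroup E] [NormedSpace ℝ E]

/-- The primitive vanishing at `0` of a continuous function on the unit interval. -/
def unitPrimitive : C(Icc (0 : ℝ) 1, E) →L[ℝ] C(Icc (0 : ℝ) 1, E) :=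
  LinearMap.mkContinuous
    { toFun := fun c => ⟨fun t => ∫ u in (0 : ℝ)..t, IccExtend zero_le_one c u, by
        have h : Continuous fun t : ℝ => ∫ u in (0 : ℝ)..t, IccExtend zero_le_one c u :=
          intervalIntegral.continuous_primitive
            (fun a b => (c.continuous.Icc_extend' (h := zero_le_one)).intervalIntegrable a b) 0
        exact h.comp continuous_subtype_val⟩
      map_add' := fun c d => by
        ext t
        exact intervalIntegral.integral_add
          ((c.continuous.Icc_extend' (h := zero_le_one)).intervalIntegrable _ _)
          ((d.continuous.Icc_extend' (h := zero_le_one)).intervalIntegrable _ _)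
      map_smul' := fun a c => by
        ext t
        exact intervalIntegral.integral_smul _ _ } 1
    (fun c => (ContinuousMap.norm_le _ (by positivity)).2 fun t => by
      have h := intervalIntegral.norm_integral_le_of_norm_le_const (a := (0 : ℝ)) (b := t)
        (f := IccExtend zero_le_one c) (C := ‖c‖) (fun u _ => c.norm_coe_le_norm _)
      refine h.trans ?_
      rw [sub_zero, abs_of_nonneg t.2.1, mul_comm]
      exact mul_le_mul_of_nonneg_right t.2.2 (norm_nonneg _))

lemma norm_unitPrimitive_apply_le (c : C(Icc (0 : ℝ) 1, E)) : ‖unitPrimitive c‖ ≤ ‖c‖ := by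
  have h : ‖(unitPrimitive : C(Icc (0 : ℝ) 1, E) →L[ℝ] C(Icc (0 : ℝ) 1, E))‖ ≤ 1 :=
    LinearMap.mkContinuous_norm_le _ zero_le_one _
  exact (ContinuousLinearMap.le_of_opNorm_le _ h c).trans (one_mul _).le

/-- The fixed points of a smooth family of contractions depend smoothly on the parameter. -/
theorem exists_contDiffOn_fixedPoint {P C : Type} [NormedAddCommGroup P] [NormedSpace ℝ P]
    [CompleteSpace P] [NormedAddCommGroup C] [NormedSpace ℝ C] [CompleteSpace C]
    (G : P × C → C) (hG : ContDiff ℝ ∞ G) {U : Set P} (hU : IsOpen U) (K : P → NNReal)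
    (hK : ∀ q ∈ U, ContractingWith (K q) (fun c => G (q, c))) :
    ∃ c : P → C, ContDiffOn ℝ ∞ c U ∧
      ∀ q ∈ U, G (q, c q) = c q ∧ ∀ d, G (q, d) = d → d = c q := by
  have hex : ∀ q, ∃ c : C, q ∈ U → G (q, c) = c ∧ ∀ d, G (q, d) = d → d = c := by
    intro q
    by_cases hq : q ∈ U
    · exact ⟨(hK q hq).fixedPoint, fun _ => ⟨(hK q hq).fixedPoint_isFixedPt, fun d hd =>
        (hK q hq).fixedPoint_unique hd⟩⟩
    · exact ⟨0, fun h => absurd h hq⟩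
  choose c hcG using hex
  refine ⟨c, fun q hq => ContDiffAt.contDiffWithinAt ?_, hcG⟩
  -- Fixed points are the zeros of `Φ`. Its partial derivative in the second variable is `1 - A`
  -- with `‖A‖ < 1`, invertible by the Neumann series, so the implicit function theorem applies.
  let Φ : P × C → C := fun u => u.2 - G u
  have hΦ : ContDiff ℝ ∞ Φ := contDiff_snd.sub hG
  set A : C →L[ℝ] C := fderiv ℝ (fun d => G (q, d)) (c q)
  have hGd : DifferentiableAt ℝ (fun d => G (q, d)) (c q) :=
    (hG.comp (contDiff_prodMk_right q)).differentiable (by simp) _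
  have hA : ‖A‖ < 1 :=
    (norm_fderiv_le_of_lipschitz ℝ (hK q hq).2).trans_lt (hK q hq).1
  have hinr : fderiv ℝ Φ (q, c q) ∘L .inr ℝ P C = ContinuousLinearMap.id ℝ C - A := by
    have h2 := ((hΦ.differentiable (by simp)) (q, c q)).hasFDerivAt.comp (c q)
      (hasFDerivAt_prodMk_right q (c q))
    exact h2.unique ((hasFDerivAt_id _).sub hGd.hasFDerivAt)
  have hinv : (fderiv ℝ Φ (q, c q) ∘L .inr ℝ P C).IsInvertible := by
    rw [hinr]
    exact ⟨ContinuousLinearEquiv.unitsEquiv ℝ C (Units.oneSub A hA), by ext1 x; rfl⟩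
  have hΦq := hΦ.contDiffAt (x := (q, c q))
  -- Uniqueness of fixed points identifies the implicit function with `c` near `q`, although `c` was
  -- obtained by choice pointwise.
  refine (hΦq.contDiffAt_implicitFunction (by simp) hinv).congr_of_eventuallyEq ?_
  filter_upwards [hΦq.eventually_apply_implicitFunction (by simp) hinv, hU.mem_nhds hq] with v hv hv1
  refine ((hcG v hv1).2 _ ?_).symm
  have h0 : Φ (q, c q) = 0 := by simp [Φ, (hcG q hq).1]
  rw [h0] at hv
  exact (sub_eq_zero.1 hv).symm

/-- The Picard operator of the autonomous equation `y' = r f(y)`, `y(0) = x` on the unit interval. -/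
def picardOp (f : C(E, E)) (u : (ℝ × E) × C(Icc (0 : ℝ) 1, E)) : C(Icc (0 : ℝ) 1, E) :=
  ContinuousLinearMap.const ℝ (Icc (0 : ℝ) 1) u.1.2 + u.1.1 • unitPrimitive (f.comp u.2)

lemma picardOp_apply (f : C(E, E)) (r : ℝ) (x : E) (c : C(Icc (0 : ℝ) 1, E)) (t : Icc (0 : ℝ) 1) :
    picardOp f ((r, x), c) t = x + r • ∫ u in (0 : ℝ)..t, f (IccExtend zero_le_one c u) := rfl

lemma contDiff_picardOp (f : C(E, E)) (hf : ContDiff ℝ ∞ f) : ContDiff ℝ ∞ (picardOp f) := by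
  have h1 : ContDiff ℝ ∞ (fun u : (ℝ × E) × C(Icc (0 : ℝ) 1, E) =>
      (ContinuousLinearMap.const ℝ (Icc (0 : ℝ) 1) u.1.2 : C(Icc (0 : ℝ) 1, E))) :=
    (ContinuousLinearMap.const ℝ (Icc (0 : ℝ) 1) : E →L[ℝ] _).contDiff.comp
      (contDiff_snd.comp contDiff_fst)
  have h2 : ContDiff ℝ ∞ (fun u : (ℝ × E) × C(Icc (0 : ℝ) 1, E) => u.1.1) :=
    contDiff_fst.comp contDiff_fst
  have h3 : ContDiff ℝ ∞ (fun u : (ℝ × E) × C(Icc (0 : ℝ) 1, E) => unitPrimitive (f.comp u.2)) :=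
    unitPrimitive.contDiff.comp ((contDiff_postcomp f hf).comp contDiff_snd)
  exact h1.add (h2.fun_smul h3)

omit [NormedSpace ℝ E] in
lemma norm_postcomp_sub_le {X : Type} [TopologicalSpace X] [CompactSpace X] (f : C(E, E))
    {L : NNReal} (hL : LipschitzWith L f) (c d : C(X, E)) :
    ‖f.comp c - f.comp d‖ ≤ L * dist c d := by
  refine (ContinuousMap.norm_le _ (by positivity)).2 fun t => ?_
  have h := hL.dist_le_mul (c t) (d t)
  rw [dist_eq_norm] at h
  exact h.trans (mul_le_mul_of_nonneg_left (ContinuousMap.dist_apply_le_dist t) L.2)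

lemma contractingWith_picardOp (f : C(E, E)) {L : NNReal} (hL : LipschitzWith L f) (q : ℝ × E)
    (hq : |q.1| * L < 1) :
    ContractingWith (Real.toNNReal (|q.1| * L)) (fun c => picardOp f (q, c)) := by
  refine ⟨?_, LipschitzWith.of_dist_le_mul fun c d => ?_⟩
  · rw [← NNReal.coe_lt_coe, Real.coe_toNNReal _ (by positivity)]
    exact hq
  · rw [Real.coe_toNNReal _ (by positivity)]
    have h1 : picardOp f (q, c) - picardOp f (q, d)
        = q.1 • unitPrimitive (f.comp c - f.comp d) := by
      rw [map_sub, smul_sub]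
      exact add_sub_add_left_eq_sub _ _ _
    have h2 : ‖unitPrimitive (f.comp c - f.comp d)‖ ≤ ‖f.comp c - f.comp d‖ :=
      norm_unitPrimitive_apply_le _
    have h3 : ‖f.comp c - f.comp d‖ ≤ L * dist c d := norm_postcomp_sub_le f hL c d
    rw [dist_eq_norm, h1, norm_smul, Real.norm_eq_abs, mul_assoc]
    exact mul_le_mul_of_nonneg_left (h2.trans h3) (abs_nonneg q.1)

variable [CompleteSpace E]

/-- A compactly supported smooth vector field has a flow, for a uniform time, that depends smoothly
on time and initial value. -/
theorem exists_smooth_flow (f : E → E) (hf : ContDiff ℝ ∞ f) (hc : HasCompactSupport f) :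
    ∃ τ > 0, ∃ Y : ℝ × E → E, ContDiffOn ℝ ∞ Y (Ioo (-τ) τ ×ˢ univ) ∧ (∀ x, Y (0, x) = x) ∧
      ∀ r ∈ Ioo (-τ) τ, ∀ x, HasDerivAt (fun r => Y (r, x)) (f (Y (r, x))) r := by
  obtain ⟨L, hL⟩ := hf.lipschitzWith_of_hasCompactSupport hc (by simp)
  let fc : C(E, E) := ⟨f, hf.continuous⟩
  -- Time enters as the parameter `r` of the equation y' = r f(y) on the unit interval, whose
  -- solution at 1 is the flow at time `r`. For `|r| < τ` one has `|r| * L < 1`, a contraction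
  -- whatever the initial value.
  let τ : ℝ := 1 / (L + 1)
  have hτ : 0 < τ := by positivity
  have hτL : ∀ r ∈ Ioo (-τ) τ, |r| * L < 1 := by
    intro r hr
    have h1 : |r| < τ := abs_lt.2 hr
    have : |r| * (L + 1) < 1 := by rwa [lt_div_iff₀ (by positivity)] at h1
    nlinarith [abs_nonneg r]
  let one : Icc (0 : ℝ) 1 := ⟨1, by simp⟩
  have hopen : IsOpen (Ioo (-τ) τ ×ˢ (univ : Set E)) := isOpen_Ioo.prod isOpen_univ
  obtain ⟨c, hcs, hcG⟩ := exists_contDiffOn_fixedPoint (picardOp fc) (contDiff_picardOp fc hf)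
    hopen _ (fun q hq => contractingWith_picardOp fc hL q (hτL _ hq.1))
  have hceq : ∀ r ∈ Ioo (-τ) τ, ∀ (x : E) (t : Icc (0 : ℝ) 1),
      c (r, x) t = x + r • ∫ u in (0 : ℝ)..t, f (IccExtend zero_le_one (c (r, x)) u) := by
    intro r hr x t
    conv_lhs => rw [← (hcG (r, x) ⟨hr, mem_univ _⟩).1]
    rfl
  -- Rescaled solutions are solutions for the rescaled parameter, by uniqueness. Thus
  -- differentiating the value at 1 in `r` amounts to differentiating one solution in `t`.
  have hscale : ∀ r ∈ Ioo (-τ) τ, ∀ x : E, ∀ t : Icc (0 : ℝ) 1,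
      c (r, x) t = c ((t : ℝ) * r, x) one := by
    intro r hr x t
    have htr : (t : ℝ) * r ∈ Ioo (-τ) τ := by
      rw [mem_Ioo, ← abs_lt] at hr ⊢
      rw [abs_mul, abs_of_nonneg t.2.1]
      nlinarith [t.2.2, t.2.1, abs_nonneg r]
    let d : C(Icc (0 : ℝ) 1, E) := (c (r, x)).comp ⟨fun u => ⟨t * u, mul_nonneg t.2.1 u.2.1,
      mul_le_one₀ t.2.2 u.2.1 u.2.2⟩, by fun_prop⟩
    have hd : d = c ((t : ℝ) * r, x) := by
      refine (hcG (t * r, x) ⟨htr, mem_univ _⟩).2 d ?_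
      ext u
      have h1 : d u = x + r • ∫ v in (0 : ℝ)..(t * u), f (IccExtend zero_le_one (c (r, x)) v) :=
        hceq r hr x _
      rw [h1, picardOp_apply, mul_comm (t : ℝ) r, mul_smul]
      congr 2
      have h2 := intervalIntegral.smul_integral_comp_mul_left (a := 0) (b := u)
        (fun v => f (IccExtend zero_le_one (c (r, x)) v)) (t : ℝ)
      rw [mul_zero] at h2
      rw [← h2]
      congr 1
      refine intervalIntegral.integral_congr fun v hv => ?_
      rw [uIcc_of_le u.2.1] at hv
      have hv1 : v ∈ Icc (0 : ℝ) 1 := ⟨hv.1, hv.2.trans u.2.2⟩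
      have hv2 : (t : ℝ) * v ∈ Icc (0 : ℝ) 1 :=
        ⟨mul_nonneg t.2.1 hv1.1, mul_le_one₀ t.2.2 hv1.1 hv1.2⟩
      rw [IccExtend_of_mem _ _ hv1, IccExtend_of_mem _ _ hv2]
      rfl
    rw [← hd]
    change _ = c (r, x) _
    congr 1
    ext
    simp [one]
  have hY : ContDiffOn ℝ ∞ (fun q => c q one) (Ioo (-τ) τ ×ˢ univ) := fun q hq =>
    (ContinuousMap.evalCLM ℝ one :
      C(Icc (0 : ℝ) 1, E) →L[ℝ] E).contDiff.contDiffAt.comp_contDiffWithinAt q (hcs q hq)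
  refine ⟨τ, hτ, fun q => c q one, hY, fun x => ?_, fun r hr x => ?_⟩
  · simpa using hceq 0 (by simp [hτ]) x one
  -- Writing `r = t * R` with `t` in `[0, 1)` places `r` on the solution curve with parameter `R`.
  -- The derivative of `u ↦ c (u * R, x) one` at `t` is then computed by the chain rule and by the
  -- integral equation, and `R ≠ 0` is cancelled.
  · obtain ⟨R, hR, hR0, t, ht, rfl⟩ :
        ∃ R ∈ Ioo (-τ) τ, R ≠ 0 ∧ ∃ t ∈ Ico (0 : ℝ) 1, r = t * R := by
      have hr' := abs_lt.2 hr
      rcases eq_or_ne r 0 with rfl | h0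
      · exact ⟨τ / 2, ⟨by linarith, by linarith⟩, by positivity, 0, by simp⟩
      obtain ⟨m, hm1, hm2⟩ := exists_between hr'
      have hm0 : 0 < m := (abs_nonneg r).trans_lt hm1
      have habs : 0 < |r| := abs_pos.2 h0
      refine ⟨m / |r| * r, ?_, by positivity, |r| / m, ⟨by positivity, (div_lt_one hm0).2 hm1⟩,
        by field_simp⟩
      rw [mem_Ioo, ← abs_lt, abs_mul, abs_div, abs_abs, div_mul_cancel₀ _ habs.ne', abs_of_pos hm0]
      exact hm2
    have hdiff : DifferentiableAt ℝ (fun r => c (r, x) one) (t * R) := by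
      have h1 : DifferentiableAt ℝ (fun q => c q one) (t * R, x) :=
        ((hY (t * R, x) ⟨hr, mem_univ _⟩).contDiffAt
          (hopen.mem_nhds ⟨hr, mem_univ _⟩)).differentiableAt (by simp)
      have h2 : DifferentiableAt ℝ (fun r : ℝ => (r, x)) (t * R) :=
        (hasFDerivAt_prodMk_left (t * R) x).differentiableAt
      exact DifferentiableAt.fun_comp' (t * R) h1 h2
    have h1 : HasDerivAt (fun u : ℝ => c (u * R, x) one)
        (R • deriv (fun r => c (r, x) one) (t * R)) t := by
      have := hdiff.hasDerivAt.scomp t ((hasDerivAt_id t).mul_const R)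
      rw [one_mul] at this
      exact this
    have hcont : Continuous fun u => f (IccExtend zero_le_one (c (R, x)) u) :=
      hf.continuous.comp ((c (R, x)).continuous.Icc_extend' (h := zero_le_one))
    have h2 : HasDerivWithinAt (fun u : ℝ => c (u * R, x) one) (R • f (c (t * R, x) one))
        (Icc 0 1) t := by
      have h3 : HasDerivAt (fun u : ℝ => x + R • ∫ v in (0 : ℝ)..u,
          f (IccExtend zero_le_one (c (R, x)) v))
          (R • f (IccExtend zero_le_one (c (R, x)) t)) t :=
        ((intervalIntegral.integral_hasDerivAt_right (hcont.intervalIntegrable _ _)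
          (hcont.stronglyMeasurableAtFilter _ _) hcont.continuousAt).const_smul R).const_add x
      have ht1 : t ∈ Icc (0 : ℝ) 1 := ⟨ht.1, ht.2.le⟩
      rw [IccExtend_of_mem _ _ ht1, hscale R hR x ⟨t, ht1⟩] at h3
      refine h3.hasDerivWithinAt.congr (fun u hu => ?_) ?_
      · rw [← hceq R hR x ⟨u, hu⟩, hscale R hR x ⟨u, hu⟩]
      · rw [← hceq R hR x ⟨t, ht1⟩, hscale R hR x ⟨t, ht1⟩]
    have h4 := (uniqueDiffOn_Icc zero_lt_one t ⟨ht.1, ht.2.le⟩).eq_deriv _ h1.hasDerivWithinAt h2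
    have h5 := smul_right_injective E hR0 h4
    rw [← h5]
    exact hdiff.hasDerivAt

end Flow

noncomputable section

open Filter Topology

/-! ### Plane geometry -/

lemma plane_ext {x y : Plane} (h0 : x 0 = y 0) (h1 : x 1 = y 1) : x = y := by
  ext a; fin_cases a <;> assumption

@[simp] lemma planeVec_apply (v : Fin 2 → ℝ) (a : Fin 2) : planeVec v a = v a := rfl

lemma plane_eq_coordVec (x : Plane) : x = x 0 • coordVec 0 + x 1 • coordVec 1 := by
  apply plane_ext <;> simp [coordVec]

/-- The plane, as a product. -/
def planeProd : Plane ≃L[ℝ] ℝ × ℝ :=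
  (EuclideanSpace.equiv (Fin 2) ℝ).trans (ContinuousLinearEquiv.finTwoArrow ℝ ℝ)

@[simp] lemma planeProd_apply (x : Plane) : planeProd x = (x 0, x 1) := rfl

@[simp] lemma planeProd_symm_apply (q : ℝ × ℝ) : planeProd.symm q = planeVec ![q.1, q.2] := by
  rw [ContinuousLinearEquiv.symm_apply_eq]; simp

/-- The coordinate functions. -/
abbrev coordL (a : Fin 2) : Plane →L[ℝ] ℝ := EuclideanSpace.proj a

/-- The oriented area spanned by two vectors. -/
def cross (u v : Plane) : ℝ := u 0 * v 1 - u 1 * v 0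

lemma clm_apply_coord {F : Type} [NormedAddCommGroup F] [NormedSpace ℝ F] (A : Plane →L[ℝ] F)
    (v : Plane) : A v = v 0 • A (coordVec 0) + v 1 • A (coordVec 1) := by
  conv_lhs => rw [plane_eq_coordVec v]
  simp

lemma clm_det_eq (A : Plane →L[ℝ] Plane) :
    A.det = A (coordVec 0) 0 * A (coordVec 1) 1 - A (coordVec 1) 0 * A (coordVec 0) 1 := by
  have h : A.det = LinearMap.det (A : Plane →ₗ[ℝ] Plane) := rfl
  rw [h, ← LinearMap.det_toMatrix (EuclideanSpace.basisFun (Fin 2) ℝ).toBasis, Matrix.det_fin_two]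
  simp [LinearMap.toMatrix_apply, coordVec]

lemma cross_map (A : Plane →L[ℝ] Plane) (u v : Plane) : cross (A u) (A v) = A.det * cross u v := by
  rw [clm_det_eq, clm_apply_coord A u, clm_apply_coord A v]
  simp [cross]; ring

lemma cross_coordVec : cross (coordVec 0) (coordVec 1) = 1 := by simp [cross, coordVec]

lemma isUnit_of_det_ne_zero {A : Plane →L[ℝ] Plane} (h : A.det ≠ 0) :
    ∃ B : Plane ≃L[ℝ] Plane, (B : Plane →L[ℝ] Plane) = A :=
  ⟨A.toContinuousLinearEquivOfDetNeZero h, by ext1; simp⟩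

lemma ne_zero_of_det_ne_zero {A : Plane →L[ℝ] Plane} (h : A.det ≠ 0) {v : Plane} (hv : v ≠ 0) :
    A v ≠ 0 := by
  obtain ⟨B, rfl⟩ := isUnit_of_det_ne_zero h
  simpa using hv

lemma det_ne_zero_of_comp_eq_id {A B : Plane →L[ℝ] Plane}
    (h : A ∘L B = ContinuousLinearMap.id ℝ Plane) : A.det ≠ 0 ∧ B.det ≠ 0 := by
  have h1 : A.det * B.det = 1 := by
    have := cross_map (A ∘L B) (coordVec 0) (coordVec 1)
    rw [ContinuousLinearMap.comp_apply, ContinuousLinearMap.comp_apply, cross_map, cross_map, ← mul_assoc,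
      cross_coordVec, mul_one, mul_one] at this
    rw [this, h, clm_det_eq]
    simp [coordVec]
  constructor <;> rintro h0 <;> simp [h0] at h1

lemma continuous_det : Continuous (fun A : Plane →L[ℝ] Plane => A.det) := by
  simp_rw [clm_det_eq]
  have h : ∀ a b : Fin 2, Continuous fun A : Plane →L[ℝ] Plane => A (coordVec a) b := fun a b =>
    (coordL b).continuous.comp ((ContinuousLinearMap.apply ℝ Plane (coordVec a)).continuous)
  exact ((h 0 0).mul (h 1 1)).sub ((h 1 0).mul (h 0 1))

/-- Two vectors without a common left side are antiparallel. -/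
lemma antiparallel_of_disjoint_sides {a b : Plane} (ha : a ≠ 0) (hb : b ≠ 0)
    (h : ∀ v, 0 < cross a v → ¬ 0 < cross b v) : ∃ c : ℝ, 0 < c ∧ b = (-c) • a := by
  have haa : 0 < a 0 ^ 2 + a 1 ^ 2 := by
    rcases lt_or_eq_of_le (show 0 ≤ a 0 ^ 2 + a 1 ^ 2 by positivity) with h | h
    · exact h
    · exact absurd (plane_ext (by simp; nlinarith [sq_nonneg (a 0), sq_nonneg (a 1)])
        (by simp; nlinarith [sq_nonneg (a 0), sq_nonneg (a 1)])) ha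
  have hc : cross a b = 0 := by
    by_contra hne
    have hpos : 0 < cross a b * cross a b := mul_self_pos.2 hne
    -- With d = `cross a b`, the vector d(b - a) has cross product d² with `a` and with `b`, so it
    -- lies to the left of both unless d = 0.
    refine h (cross a b • b - cross a b • a) ?_ ?_ <;>
    · simp only [cross, PiLp.sub_apply, PiLp.smul_apply, smul_eq_mul] at hpos ⊢
      nlinarith
  set m := (a 0 * b 0 + a 1 * b 1) / (a 0 ^ 2 + a 1 ^ 2)
  have hbm : b = m • a := by
    simp only [cross] at hc
    apply plane_ext <;> simp only [m, PiLp.smul_apply, smul_eq_mul] <;> field_simp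
    · linear_combination (-a 1) * hc
    · linear_combination a 0 * hc
  refine ⟨-m, ?_, by simpa using hbm⟩
  by_contra hm
  have hm0 : m ≠ 0 := by rintro h0; rw [h0, zero_smul] at hbm; exact hb hbm
  have hm1 : 0 < m := lt_of_le_of_ne (by linarith) hm0.symm
  -- If `b` were a positive multiple of `a`, the quarter turn of `a` would lie to the left of both.
  refine h (planeVec ![-a 1, a 0]) ?_ ?_
  · simp [cross]; nlinarith
  · rw [hbm]; simp [cross]; nlinarith

/-! ### Diffeomorphisms near compact sets -/

/-- Local injectivity from the inverse function theorem, together with injectivity on the compact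
set, gives injectivity on a neighbourhood of it. This prolongs the element parametrizations and the
geodesic maps beyond their closed domains, so that smoothness up to the boundary becomes ordinary
smoothness. -/
lemma ContDiff.exists_openPartialHomeomorph_of_injOn {f : Plane → Plane} (hf : ContDiff ℝ ∞ f)
    {K : Set Plane} (hK : IsCompact K) (hinj : InjOn f K)
    (hdet : ∀ x ∈ K, (fderiv ℝ f x).det ≠ 0) :
    ∃ e : OpenPartialHomeomorph Plane Plane, K ⊆ e.source ∧ (⇑e = f) ∧
      ContDiffOn ℝ ∞ e.symm e.target ∧ ∀ x ∈ e.source, (fderiv ℝ f x).det ≠ 0 := by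
  have hD : IsOpen {x | (fderiv ℝ f x).det ≠ 0} :=
    isOpen_ne.preimage (continuous_det.comp (hf.continuous_fderiv (by simp)))
  have hstrict : ∀ x, (fderiv ℝ f x).det ≠ 0 → ∃ B : Plane ≃L[ℝ] Plane,
      HasStrictFDerivAt f (B : Plane →L[ℝ] Plane) x := by
    intro x hx
    obtain ⟨B, hB⟩ := isUnit_of_det_ne_zero hx
    exact ⟨B, hB ▸ hf.contDiffAt.hasStrictFDerivAt (by simp)⟩
  obtain ⟨t, ht, hKt, hit⟩ := hinj.exists_isOpen_superset hK
    (fun x _ => hf.continuous.continuousAt) (fun x hx => by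
      obtain ⟨B, hB⟩ := hstrict x (hdet x hx)
      exact ⟨_, (hB.toOpenPartialHomeomorph f).open_source.mem_nhds
        hB.mem_toOpenPartialHomeomorph_source, (hB.toOpenPartialHomeomorph f).injOn⟩)
  have hV := ht.inter hD
  set V := t ∩ {x | (fderiv ℝ f x).det ≠ 0}
  have hiV : InjOn f V := hit.mono inter_subset_left
  let e : OpenPartialHomeomorph Plane Plane :=
    OpenPartialHomeomorph.ofContinuousOpenRestrict (hiV.toPartialEquiv f V) hf.continuous.continuousOn
      (by
        rw [isOpenMap_iff_nhds_le]
        rintro ⟨x, hx⟩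
        obtain ⟨B, hB⟩ := hstrict x hx.2
        change 𝓝 (f x) ≤ map (f ∘ Subtype.val) (𝓝 _)
        rw [← Filter.map_map, map_nhds_subtype_coe_eq_nhds hx (hV.mem_nhds hx),
          hB.map_nhds_eq_of_equiv]) hV
  refine ⟨e, fun x hx => ⟨hKt hx, hdet x hx⟩, rfl, fun y hy => ?_, fun x hx => hx.2⟩
  have hx : e.symm y ∈ V := e.map_target hy
  obtain ⟨B, hB⟩ := hstrict _ hx.2
  exact (e.contDiffAt_symm hy hB.hasFDerivAt hf.contDiffAt).contDiffWithinAt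

/-! ### The reference triangle -/

/-- The barycentric coordinate of the unit triangle that vanishes on its `k`-th edge. -/
def refBary (k : Fin 3) (x : Plane) : ℝ :=
  match k with
  | 0 => x 1
  | 1 => 1 - x 0 - x 1
  | 2 => x 0

/-- The direction of the `k`-th edge of the unit triangle. -/
def refDir (k : Fin 3) : Plane :=
  match k with
  | 0 => planeVec ![1, 0]
  | 1 => planeVec ![-1, 1]
  | 2 => planeVec ![0, -1]

/-- The parameter along the `k`-th edge of the unit triangle. -/
def refCoord (k : Fin 3) (x : Plane) : ℝ :=
  match k with
  | 0 => x 0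
  | 1 => x 1
  | 2 => 1 - x 1

lemma contDiff_coord (a : Fin 2) : ContDiff ℝ ∞ (fun x : Plane => x a) := (coordL a).contDiff

lemma contDiff_refBary (k : Fin 3) : ContDiff ℝ ∞ (refBary k) := by
  fin_cases k
  · exact contDiff_coord 1
  · exact (contDiff_const.sub (contDiff_coord 0)).sub (contDiff_coord 1)
  · exact contDiff_coord 0

lemma contDiff_refCoord (k : Fin 3) : ContDiff ℝ ∞ (refCoord k) := by
  fin_cases k
  · exact contDiff_coord 0
  · exact contDiff_coord 1
  · exact contDiff_const.sub (contDiff_coord 1)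

lemma refEdge_eq (k : Fin 3) (s : ℝ) : refEdge k s = refEdge k 0 + s • refDir k := by
  fin_cases k <;> apply plane_ext <;> simp [refEdge, refDir] <;> ring

lemma contDiff_refEdge (k : Fin 3) : ContDiff ℝ ∞ (refEdge k) := by
  rw [show refEdge k = fun s => refEdge k 0 + s • refDir k from funext (refEdge_eq k)]
  exact contDiff_const.add (contDiff_id.smul contDiff_const)

lemma hasDerivAt_refEdge (k : Fin 3) (s : ℝ) : HasDerivAt (refEdge k) (refDir k) s := by
  rw [show refEdge k = fun s => refEdge k 0 + s • refDir k from funext (refEdge_eq k)]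
  simpa using ((hasDerivAt_id s).smul_const (refDir k)).const_add (refEdge k 0)

lemma refDir_ne_zero (k : Fin 3) : refDir k ≠ 0 := by
  intro h
  have h0 := congrArg (fun x : Plane => x 0) h
  have h1 := congrArg (fun x : Plane => x 1) h
  fin_cases k <;> simp [refDir] at h0 h1

/-- The coordinate is affine and increases to the left of its edge; this fixes the orientation
conventions for everything that follows. -/
lemma refBary_add (k : Fin 3) (x v : Plane) : refBary k (x + v) = refBary k x + cross (refDir k) v := by
  fin_cases k <;> simp [refBary, refDir, cross] <;> ring

lemma hasFDerivAt_refBary (k : Fin 3) (x : Plane) : ∃ A : Plane →L[ℝ] ℝ,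
    HasFDerivAt (refBary k) A x ∧ ∀ v, A v = cross (refDir k) v := by
  refine ⟨refDir k 0 • coordL 1 - refDir k 1 • coordL 0, ?_, fun v => by simp [cross]⟩
  have h : refBary k = fun y => (refDir k 0 • coordL 1 - refDir k 1 • coordL 0) y + refBary k 0 := by
    funext y
    have := refBary_add k 0 y
    rw [zero_add] at this
    rw [this]; simp [cross]; ring
  rw [h]
  exact (ContinuousLinearMap.hasFDerivAt _).add_const _

@[simp] lemma refBary_refEdge (k : Fin 3) (s : ℝ) : refBary k (refEdge k s) = 0 := by
  fin_cases k <;> simp [refBary, refEdge]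

@[simp] lemma refCoord_refEdge (k : Fin 3) (s : ℝ) : refCoord k (refEdge k s) = s := by
  fin_cases k <;> simp [refCoord, refEdge]

lemma refBary_refEdge_pos {k l : Fin 3} (hkl : l ≠ k) {s : ℝ} (hs : s ∈ Ioo (0 : ℝ) 1) :
    0 < refBary l (refEdge k s) := by
  obtain ⟨h0, h1⟩ := hs
  fin_cases k <;> fin_cases l <;> simp [refBary, refEdge] at hkl ⊢ <;> linarith

lemma mem_refTriangle_iff {x : Plane} : x ∈ refTriangle ↔ ∀ k, 0 ≤ refBary k x := by
  rw [Fin.forall_fin_succ, Fin.forall_fin_two]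
  simp only [refTriangle, mem_ofPred_eq, refBary]
  constructor
  · rintro ⟨h0, h1, h2⟩; exact ⟨h1, by simp; linarith, h0⟩
  · rintro ⟨h0, h1, h2⟩; simp at h1 h2; exact ⟨h2, h0, by linarith⟩

lemma refEdge_mem {k : Fin 3} {s : ℝ} (hs : s ∈ Icc (0 : ℝ) 1) : refEdge k s ∈ refTriangle := by
  obtain ⟨h0, h1⟩ := hs
  fin_cases k <;> simp [refEdge, refTriangle] <;> (constructor <;> linarith)

lemma eq_refEdge_of_refBary_eq_zero {k : Fin 3} {x : Plane} (h : refBary k x = 0) :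
    x = refEdge k (refCoord k x) := by
  fin_cases k <;> simp [refBary] at h <;> apply plane_ext <;> simp [refEdge, refCoord] <;> linarith

lemma refCoord_mem {k : Fin 3} {x : Plane} (hx : x ∈ refTriangle) : refCoord k x ∈ Icc (0 : ℝ) 1 := by
  obtain ⟨h0, h1, h2⟩ := hx
  fin_cases k <;> simp [refCoord] <;> constructor <;> linarith

lemma refBary_combo (k : Fin 3) (x y : Plane) {a b : ℝ} (hab : a + b = 1) :
    refBary k (a • x + b • y) = a * refBary k x + b * refBary k y := by
  fin_cases k <;> simp [refBary]
  linear_combination -hab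

lemma convex_refTriangle : Convex ℝ refTriangle := by
  intro x hx y hy a b ha hb hab
  rw [mem_refTriangle_iff] at *
  intro k
  rw [refBary_combo k x y hab]
  exact add_nonneg (mul_nonneg ha (hx k)) (mul_nonneg hb (hy k))

lemma isCompact_refTriangle : IsCompact refTriangle := by
  have hcl : IsClosed refTriangle := by
    have : refTriangle = ⋂ k, refBary k ⁻¹' Ici 0 := by
      ext x; simp [mem_refTriangle_iff]
    rw [this]
    exact isClosed_iInter fun k => isClosed_Ici.preimage (contDiff_refBary k).continuous
  refine (Metric.isCompact_of_isClosed_isBounded hcl ?_)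
  have hsub : refTriangle ⊆ planeProd ⁻¹' (Icc 0 1 ×ˢ Icc 0 1) := by
    rintro x ⟨h0, h1, h2⟩
    simp only [mem_preimage, planeProd_apply, mem_prod, mem_Icc]
    refine ⟨⟨h0, ?_⟩, h1, ?_⟩ <;> linarith
  have hb : IsCompact (planeProd ⁻¹' (Icc (0 : ℝ) 1 ×ˢ Icc (0 : ℝ) 1)) :=
    planeProd.toHomeomorph.isCompact_preimage.2 (isCompact_Icc.prod isCompact_Icc)
  exact hb.isBounded.subset hsub

lemma exists_cross_pos {u : Plane} (hu : u ≠ 0) : ∃ v, 0 < cross u v := by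
  by_contra! h
  obtain ⟨c, hc, h1⟩ := antiparallel_of_disjoint_sides hu hu fun v hv => absurd hv (h v).not_gt
  have h2 : (1 + c) • u = 0 := by
    rw [add_smul, one_smul, ← add_zero (c • u)]
    nth_rewrite 1 [h1]
    simp
  rcases smul_eq_zero.1 h2 with h3 | h3
  · linarith
  · exact hu h3

lemma mem_interior_refTriangle_iff {x : Plane} : x ∈ interior refTriangle ↔ ∀ k, 0 < refBary k x := by
  constructor
  · intro hx k
    refine lt_of_le_of_ne (mem_refTriangle_iff.1 (interior_subset hx) k) fun h0 => ?_
    obtain ⟨v, hv⟩ := exists_cross_pos (refDir_ne_zero k)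
    have hcont : ContinuousAt (fun t : ℝ => x + t • (-v)) 0 := by fun_prop
    have hev := hcont.eventually (show ∀ᶠ y in 𝓝 (x + (0 : ℝ) • (-v)), y ∈ refTriangle by
      rw [zero_smul, add_zero]; exact mem_interior_iff_mem_nhds.1 hx)
    obtain ⟨t, ht, ht0⟩ := ((hev.filter_mono nhdsWithin_le_nhds).and
      (self_mem_nhdsWithin (s := Ioi (0 : ℝ)))).exists
    have h1 := mem_refTriangle_iff.1 ht k
    rw [refBary_add, ← h0] at h1
    have h2 : cross (refDir k) (t • -v) = -(t * cross (refDir k) v) := by simp [cross]; ring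
    rw [h2] at h1
    have := mul_pos ht0 hv
    linarith
  · intro h
    have hopen : IsOpen (⋂ k, refBary k ⁻¹' Ioi 0) :=
      isOpen_iInter_of_finite fun k => isOpen_Ioi.preimage (contDiff_refBary k).continuous
    refine interior_maximal (fun y hy => mem_refTriangle_iff.2 fun k => ?_) hopen (mem_iInter.2 h)
    exact (mem_iInter.1 hy k).le

lemma interior_refTriangle_nonempty : (interior refTriangle).Nonempty := by
  refine ⟨planeVec ![1 / 3, 1 / 3], mem_interior_refTriangle_iff.2 fun k => ?_⟩
  fin_cases k <;> simp [refBary]; norm_num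

/-! ### Elements and edges of a mesh -/

namespace CurvedMesh

variable {Ω : Set Plane} {ι : Type} (M : CurvedMesh Ω ι)

lemma exists_homeo (i : ι) : ∃ e : OpenPartialHomeomorph Plane Plane, refTriangle ⊆ e.source ∧
    (⇑e = M.map i) ∧ ContDiffOn ℝ ∞ e.symm e.target ∧
      ∀ x ∈ e.source, (fderiv ℝ (M.map i) x).det ≠ 0 :=
  (M.smooth i).exists_openPartialHomeomorph_of_injOn isCompact_refTriangle (M.injOn i)
    fun x hx => (M.det_pos i x hx).ne'

/-- The parametrization of an element, as a diffeomorphism near the unit triangle. -/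
def homeo (i : ι) : OpenPartialHomeomorph Plane Plane := (M.exists_homeo i).choose

lemma subset_homeo_source (i : ι) : refTriangle ⊆ (M.homeo i).source :=
  (M.exists_homeo i).choose_spec.1

@[simp] lemma coe_homeo (i : ι) : ⇑(M.homeo i) = M.map i := (M.exists_homeo i).choose_spec.2.1

lemma contDiffOn_homeo_symm (i : ι) : ContDiffOn ℝ ∞ (M.homeo i).symm (M.homeo i).target :=
  (M.exists_homeo i).choose_spec.2.2.1

lemma elem_subset_target (i : ι) : M.elem i ⊆ (M.homeo i).target := by
  rintro _ ⟨x, hx, rfl⟩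
  rw [← M.coe_homeo]
  exact (M.homeo i).map_source (M.subset_homeo_source i hx)

lemma homeo_symm_map (i : ι) {x : Plane} (hx : x ∈ refTriangle) : (M.homeo i).symm (M.map i x) = x := by
  rw [← M.coe_homeo]
  exact (M.homeo i).left_inv (M.subset_homeo_source i hx)

lemma homeo_symm_mem (i : ι) {p : Plane} (hp : p ∈ M.elem i) : (M.homeo i).symm p ∈ refTriangle := by
  obtain ⟨x, hx, rfl⟩ := hp
  rwa [M.homeo_symm_map i hx]

lemma map_homeo_symm (i : ι) {p : Plane} (hp : p ∈ (M.homeo i).target) :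
    M.map i ((M.homeo i).symm p) = p := by
  rw [← M.coe_homeo]
  exact (M.homeo i).right_inv hp

/-- The barycentric coordinates on an element, as functions on the plane (smooth near the
element). -/
def bary (i : ι) (k : Fin 3) (p : Plane) : ℝ := refBary k ((M.homeo i).symm p)

lemma contDiffOn_bary (i : ι) (k : Fin 3) : ContDiffOn ℝ ∞ (M.bary i k) (M.homeo i).target :=
  (contDiff_refBary k).comp_contDiffOn (M.contDiffOn_homeo_symm i)

lemma mem_elem_iff (i : ι) {p : Plane} (hp : p ∈ (M.homeo i).target) :
    p ∈ M.elem i ↔ ∀ k, 0 ≤ M.bary i k p := by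
  refine ⟨fun h => mem_refTriangle_iff.1 (M.homeo_symm_mem i h), fun h => ?_⟩
  exact ⟨_, mem_refTriangle_iff.2 h, M.map_homeo_symm i hp⟩

lemma mem_interior_elem_of_bary_pos (i : ι) {p : Plane} (hp : p ∈ (M.homeo i).target)
    (h : ∀ k, 0 < M.bary i k p) : p ∈ interior (M.elem i) := by
  have hev : ∀ᶠ q in 𝓝 p, q ∈ (M.homeo i).target ∧ ∀ k, 0 < M.bary i k q := by
    refine Filter.Eventually.and ((M.homeo i).open_target.mem_nhds hp) (eventually_all.2 fun k => ?_)
    exact ((M.contDiffOn_bary i k).continuousOn.continuousAt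
      ((M.homeo i).open_target.mem_nhds hp)).eventually (lt_mem_nhds (h k))
  rw [mem_interior_iff_mem_nhds]
  filter_upwards [hev] with q hq
  exact (M.mem_elem_iff i hq.1).2 fun k => (hq.2 k).le

lemma mem_interior_elem_iff (i : ι) {p : Plane} :
    p ∈ interior (M.elem i) ↔ p ∈ M.elem i ∧ ∀ k, 0 < M.bary i k p := by
  refine ⟨fun h => ⟨_root_.interior_subset h, ?_⟩,
    fun h => M.mem_interior_elem_of_bary_pos i (M.elem_subset_target i h.1) h.2⟩
  have hp : p ∈ (M.homeo i).target := M.elem_subset_target i (_root_.interior_subset h)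
  refine mem_interior_refTriangle_iff.1 ?_
  rw [mem_interior_iff_mem_nhds]
  have hx := (M.homeo i).map_target hp
  have hc := ((M.homeo i).continuousAt hx).eventually (show ∀ᶠ q in 𝓝 _, q ∈ M.elem i by
    rw [(M.homeo i).right_inv hp]; exact mem_interior_iff_mem_nhds.1 h)
  filter_upwards [hc, (M.homeo i).open_source.mem_nhds hx] with y hy hys
  have := M.homeo_symm_mem i hy
  rwa [(M.homeo i).left_inv hys] at this

lemma isCompact_elem (i : ι) : IsCompact (M.elem i) :=
  isCompact_refTriangle.image (M.smooth i).continuous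

lemma isClosed_elem (i : ι) : IsClosed (M.elem i) := (M.isCompact_elem i).isClosed

lemma map_mem_elem (i : ι) {x : Plane} (hx : x ∈ refTriangle) : M.map i x ∈ M.elem i := ⟨x, hx, rfl⟩

/-- The element is the image of a convex set with interior under a map with invertible derivative.
This makes `fderivWithin` on an element meaningful at edges and vertices. -/
lemma uniqueDiffOn_elem (i : ι) : UniqueDiffOn ℝ (M.elem i) := by
  rintro _ ⟨x, hx, rfl⟩
  have h1 : UniqueDiffWithinAt ℝ refTriangle x :=
    uniqueDiffOn_convex convex_refTriangle interior_refTriangle_nonempty x hx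
  have h2 := (((M.smooth i).differentiable (by simp)) x).hasFDerivAt.hasFDerivWithinAt (s := refTriangle)
  refine h2.uniqueDiffWithinAt h1 ?_
  obtain ⟨B, hB⟩ := isUnit_of_det_ne_zero (M.det_pos i x hx).ne'
  rw [← hB]
  exact B.surjective.denseRange

lemma bary_map (i : ι) (k : Fin 3) {x : Plane} (hx : x ∈ refTriangle) :
    M.bary i k (M.map i x) = refBary k x := by
  rw [bary, M.homeo_symm_map i hx]

lemma bary_edgeParam (i : ι) (k l : Fin 3) {s : ℝ} (hs : s ∈ Icc (0 : ℝ) 1) :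
    M.bary i l (M.edgeParam i k s) = refBary l (refEdge k s) := M.bary_map i l (refEdge_mem hs)

lemma edgeParam_mem_elem (i : ι) (k : Fin 3) {s : ℝ} (hs : s ∈ Icc (0 : ℝ) 1) :
    M.edgeParam i k s ∈ M.elem i := M.map_mem_elem i (refEdge_mem hs)

lemma edge_subset_elem (i : ι) (k : Fin 3) : M.edge i k ⊆ M.elem i := by
  rintro _ ⟨s, hs, rfl⟩
  exact M.edgeParam_mem_elem i k hs

lemma mem_edge_of_bary_eq_zero (i : ι) (k : Fin 3) {p : Plane} (hp : p ∈ M.elem i)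
    (h : M.bary i k p = 0) : p ∈ M.edge i k := by
  have hx := M.homeo_symm_mem i hp
  refine ⟨refCoord k ((M.homeo i).symm p), refCoord_mem hx, ?_⟩
  rw [edgeParam, ← eq_refEdge_of_refBary_eq_zero h, M.map_homeo_symm i (M.elem_subset_target i hp)]

lemma edgeParam_injOn (i : ι) (k : Fin 3) : InjOn (M.edgeParam i k) (Icc 0 1) := by
  intro s hs t ht h
  have := M.injOn i (refEdge_mem hs) (refEdge_mem ht) h
  simpa using congrArg (refCoord k) this

/-- An inner point of an edge lies on no other edge of the element. -/
lemma edge_eq_of_edgeParam_mem (i : ι) {k l : Fin 3} {s : ℝ} (hs : s ∈ Ioo (0 : ℝ) 1)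
    (h : M.edgeParam i k s ∈ M.edge i l) : l = k := by
  by_contra hkl
  obtain ⟨t, ht, h⟩ := h
  have h1 := refBary_refEdge_pos hkl hs
  have := M.injOn i (refEdge_mem ht) (refEdge_mem (Ioo_subset_Icc_self hs)) h
  rw [← this] at h1
  simp at h1

lemma not_mem_interior_of_mem_edge (i : ι) {k : Fin 3} {p : Plane} (h : p ∈ M.edge i k) :
    p ∉ interior (M.elem i) := by
  obtain ⟨s, hs, rfl⟩ := h
  intro h
  have := ((M.mem_interior_elem_iff i).1 h).2 k
  rw [M.bary_edgeParam i k k hs] at this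
  simp at this

lemma edgeParam_zero_mem_edge (i : ι) (k : Fin 3) : M.edgeParam i k 0 ∈ M.edge i k :=
  ⟨0, by simp, rfl⟩

lemma edgeParam_zero_ne (i : ι) {k l : Fin 3} {s : ℝ} (hs : s ∈ Ioo (0 : ℝ) 1) :
    M.edgeParam i k s ≠ M.edgeParam i l 0 := by
  intro h
  have hl : l = k := M.edge_eq_of_edgeParam_mem i hs (h ▸ M.edgeParam_zero_mem_edge i l)
  subst hl
  have := M.edgeParam_injOn i l (Ioo_subset_Icc_self hs) (by simp) h
  exact hs.1.ne' this

/-- A nonempty intersection of distinct elements is a vertex or an edge of `i`, and neither meets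
the interior of `i`. -/
lemma interior_disjoint {i j : ι} (hij : i ≠ j) {p : Plane} (hp : p ∈ interior (M.elem i)) :
    p ∉ M.elem j := by
  intro hj
  have hmem : p ∈ M.map i '' refTriangle ∩ M.map j '' refTriangle := ⟨_root_.interior_subset hp, hj⟩
  rcases M.conforming i j hij with h | ⟨k, l, h, -⟩ | ⟨k, l, h, -⟩ <;> rw [h] at hmem
  · exact hmem
  · rw [mem_singleton_iff] at hmem
    exact M.not_mem_interior_of_mem_edge i (M.edgeParam_zero_mem_edge i k)
      (by rw [hmem] at hp; exact hp)
  · exact M.not_mem_interior_of_mem_edge i hmem hp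

lemma contDiff_edgeParam (i : ι) (k : Fin 3) : ContDiff ℝ ∞ (M.edgeParam i k) :=
  (M.smooth i).comp (contDiff_refEdge k)

lemma hasDerivAt_edgeParam (i : ι) (k : Fin 3) (s : ℝ) :
    HasDerivAt (M.edgeParam i k) (M.tangent i k s) s :=
  ((M.contDiff_edgeParam i k).differentiable (by simp) s).hasDerivAt

lemma tangent_eq (i : ι) (k : Fin 3) (s : ℝ) :
    M.tangent i k s = fderiv ℝ (M.map i) (refEdge k s) (refDir k) :=
  ((((M.smooth i).differentiable (by simp)) _).hasFDerivAt.comp_hasDerivAt s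
    (hasDerivAt_refEdge k s)).deriv

lemma contDiff_tangent (i : ι) (k : Fin 3) : ContDiff ℝ ∞ (M.tangent i k) :=
  ((contDiff_infty_iff_deriv (𝕜 := ℝ)).1 (M.contDiff_edgeParam i k)).2

lemma tangent_ne_zero (i : ι) (k : Fin 3) {s : ℝ} (hs : s ∈ Icc (0 : ℝ) 1) : M.tangent i k s ≠ 0 := by
  rw [tangent_eq]
  exact ne_zero_of_det_ne_zero (M.det_pos i _ (refEdge_mem hs)).ne' (refDir_ne_zero k)

/-- The derivative of a barycentric coordinate at a point of the edge where it vanishes. -/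
lemma hasFDerivAt_bary (i : ι) (k : Fin 3) {s : ℝ} (hs : s ∈ Icc (0 : ℝ) 1) :
    ∃ A : Plane →L[ℝ] ℝ, HasFDerivAt (M.bary i k) A (M.edgeParam i k s) ∧
      ∃ c : ℝ, 0 < c ∧ ∀ v, A v = c * cross (M.tangent i k s) v := by
  set x := refEdge k s
  have hx : x ∈ refTriangle := refEdge_mem hs
  have hdet := M.det_pos i x hx
  obtain ⟨B, hB⟩ := isUnit_of_det_ne_zero hdet.ne'
  have hx' : (M.homeo i).symm (M.map i x) = x := M.homeo_symm_map i hx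
  have h1 : HasFDerivAt (M.homeo i).symm (B.symm : Plane →L[ℝ] Plane) (M.map i x) := by
    refine (M.homeo i).hasFDerivAt_symm (M.elem_subset_target i (M.map_mem_elem i hx)) ?_
    rw [hx', hB, M.coe_homeo]
    exact ((M.smooth i).differentiable (by simp) _).hasFDerivAt
  obtain ⟨A, hA, hA'⟩ := hasFDerivAt_refBary k x
  refine ⟨A ∘L B.symm, (hx'.symm ▸ hA).comp _ h1, (fderiv ℝ (M.map i) x).det⁻¹, inv_pos.2 hdet,
    fun v => ?_⟩
  have h2 := cross_map (fderiv ℝ (M.map i) x) (refDir k) (B.symm v)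
  rw [M.tangent_eq, ContinuousLinearMap.comp_apply, hA', eq_inv_mul_iff_mul_eq₀ hdet.ne']
  refine h2.symm.trans ?_
  rw [← hB]
  simp

lemma hasDerivAt_bary_line (i : ι) (k : Fin 3) {s : ℝ} (hs : s ∈ Icc (0 : ℝ) 1) (v : Plane) :
    ∃ c : ℝ, 0 < c ∧ HasDerivAt (fun t : ℝ => M.bary i k (M.edgeParam i k s + t • v))
      (c * cross (M.tangent i k s) v) 0 := by
  obtain ⟨A, hA, c, hc, hAc⟩ := M.hasFDerivAt_bary i k hs
  refine ⟨c, hc, ?_⟩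
  have h1 : HasDerivAt (fun t : ℝ => M.edgeParam i k s + t • v) v 0 := by
    simpa using ((hasDerivAt_id (0 : ℝ)).smul_const v).const_add (M.edgeParam i k s)
  have h2 : HasFDerivAt (M.bary i k) A (M.edgeParam i k s + (0 : ℝ) • v) := by simpa using hA
  rw [← hAc]
  exact HasFDerivAt.comp_hasDerivAt (l := M.bary i k) 0 h2 h1

/-- Near an inner point of an edge, the element is the set where the barycentric coordinate of
that edge is nonnegative. -/
lemma eventually_mem_elem_iff (i : ι) (k : Fin 3) {s : ℝ} (hs : s ∈ Ioo (0 : ℝ) 1) :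
    ∀ᶠ p in 𝓝 (M.edgeParam i k s), p ∈ (M.homeo i).target ∧ (∀ l, l ≠ k → 0 < M.bary i l p) ∧
      (p ∈ M.elem i ↔ 0 ≤ M.bary i k p) ∧ (p ∈ interior (M.elem i) ↔ 0 < M.bary i k p) := by
  have hs' := Ioo_subset_Icc_self hs
  have ht := M.elem_subset_target i (M.edgeParam_mem_elem i k hs')
  have h1 : ∀ᶠ p in 𝓝 (M.edgeParam i k s), ∀ l, l ≠ k → 0 < M.bary i l p := by
    refine eventually_all.2 fun l => ?_
    by_cases hl : l = k
    · exact Eventually.of_forall fun p h => absurd hl h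
    · have h2 : 0 < M.bary i l (M.edgeParam i k s) := by
        rw [M.bary_edgeParam i k l hs']; exact refBary_refEdge_pos hl hs
      filter_upwards [((M.contDiffOn_bary i l).continuousOn.continuousAt
        ((M.homeo i).open_target.mem_nhds ht)).eventually (lt_mem_nhds h2)] with p hp _ using hp
  filter_upwards [h1, (M.homeo i).open_target.mem_nhds ht] with p hp hpt
  have key : p ∈ M.elem i ↔ 0 ≤ M.bary i k p := by
    rw [M.mem_elem_iff i hpt]
    refine ⟨fun h => h k, fun h l => ?_⟩
    by_cases hl : l = k
    · exact hl ▸ h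
    · exact (hp l hl).le
  refine ⟨hpt, hp, key, fun h => ((M.mem_interior_elem_iff i).1 h).2 k, fun h => ?_⟩
  refine M.mem_interior_elem_of_bary_pos i hpt fun l => ?_
  by_cases hl : l = k
  · exact hl ▸ h
  · exact hp l hl

/-- The barycentric coordinate of the edge vanishes at the base point and has derivative a positive
multiple of `cross τ v` along the line, so its sign tells the two directions apart: the element lies
on the left of its edges. -/
lemma eventually_line_mem_interior (i : ι) (k : Fin 3) {s : ℝ} (hs : s ∈ Ioo (0 : ℝ) 1) {v : Plane}
    (hv : 0 < cross (M.tangent i k s) v) :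
    ∀ᶠ t in 𝓝[>] (0 : ℝ), M.edgeParam i k s + t • v ∈ interior (M.elem i) ∧
      M.edgeParam i k s + t • (-v) ∉ M.elem i := by
  have hs' := Ioo_subset_Icc_self hs
  have hcont : ∀ w : Plane, Tendsto (fun t : ℝ => M.edgeParam i k s + t • w) (𝓝[>] 0)
      (𝓝 (M.edgeParam i k s)) := fun w => by
    have h : ContinuousAt (fun t : ℝ => M.edgeParam i k s + t • w) 0 := by fun_prop
    have h2 := h.tendsto
    rw [zero_smul, add_zero] at h2
    exact h2.mono_left nhdsWithin_le_nhds
  obtain ⟨c, hc, h1⟩ := M.hasDerivAt_bary_line i k hs' v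
  obtain ⟨c', hc', h2⟩ := M.hasDerivAt_bary_line i k hs' (-v)
  have hz : M.bary i k (M.edgeParam i k s) = 0 := by rw [M.bary_edgeParam i k k hs']; simp
  have hn : cross (M.tangent i k s) (-v) = - cross (M.tangent i k s) v := by simp [cross]; ring
  have h1' := h1.hasDerivWithinAt (s := Ioi 0)
  have h2' := h2.hasDerivWithinAt (s := Ioi 0)
  rw [hasDerivWithinAt_iff_tendsto_slope' (by simp)] at h1' h2'
  have e1 := h1'.eventually (lt_mem_nhds (mul_pos hc hv))
  have e2 := h2'.eventually (gt_mem_nhds (show c' * cross (M.tangent i k s) (-v) < 0 by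
    rw [hn]; nlinarith [mul_pos hc' hv]))
  filter_upwards [e1, e2, (hcont v).eventually (M.eventually_mem_elem_iff i k hs),
    (hcont (-v)).eventually (M.eventually_mem_elem_iff i k hs), self_mem_nhdsWithin] with t h3 h4 h5 h6 h7
  have ht : (0 : ℝ) < t := h7
  simp only [slope, sub_zero, zero_smul, add_zero, hz, vsub_eq_sub, smul_eq_mul] at h3 h4
  constructor
  · exact h5.2.2.2.2 (by have := mul_pos ht h3; rwa [mul_inv_cancel_left₀ ht.ne'] at this)
  · rw [h6.2.2.1]
    intro h
    have : 0 ≤ t⁻¹ * M.bary i k (M.edgeParam i k s + t • -v) := mul_nonneg (by positivity) h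
    linarith

end CurvedMesh

end

noncomputable section

open Filter Topology

namespace CurvedMesh

variable {Ω : Set Plane} {ι : Type} (M : CurvedMesh Ω ι)

/-! ### Neighbouring elements -/

/-- The parameter along the `k`-th edge, as a function on the plane (smooth near the element). -/
def edgeCoord (i : ι) (k : Fin 3) (p : Plane) : ℝ := refCoord k ((M.homeo i).symm p)

lemma contDiffOn_edgeCoord (i : ι) (k : Fin 3) :
    ContDiffOn ℝ ∞ (M.edgeCoord i k) (M.homeo i).target :=
  (contDiff_refCoord k).comp_contDiffOn (M.contDiffOn_homeo_symm i)

lemma edgeCoord_edgeParam (i : ι) (k : Fin 3) {s : ℝ} (hs : s ∈ Icc (0 : ℝ) 1) :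
    M.edgeCoord i k (M.edgeParam i k s) = s := by
  rw [edgeCoord, edgeParam, M.homeo_symm_map i (refEdge_mem hs), refCoord_refEdge]

lemma edgeParam_edgeCoord (i : ι) (k : Fin 3) {p : Plane} (hp : p ∈ M.edge i k) :
    M.edgeCoord i k p ∈ Icc (0 : ℝ) 1 ∧ M.edgeParam i k (M.edgeCoord i k p) = p := by
  obtain ⟨s, hs, rfl⟩ := hp
  rw [M.edgeCoord_edgeParam i k hs]
  exact ⟨hs, rfl⟩

/-- Two edges that are equal as sets have the same inner points. -/
lemma edgeCoord_mem_Ioo {i j : ι} {k l : Fin 3} (h : M.edge i k = M.edge j l) {s : ℝ}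
    (hs : s ∈ Ioo (0 : ℝ) 1) :
    M.edgeCoord j l (M.edgeParam i k s) ∈ Ioo (0 : ℝ) 1 := by
  have hmem : ∀ t ∈ Icc (0 : ℝ) 1, M.edgeParam i k t ∈ M.edge j l := fun t ht => h ▸ ⟨t, ht, rfl⟩
  set φ : ℝ → ℝ := fun t => M.edgeCoord j l (M.edgeParam i k t)
  have hφ : ∀ t ∈ Icc (0 : ℝ) 1, φ t ∈ Icc (0 : ℝ) 1 := fun t ht =>
    (M.edgeParam_edgeCoord j l (hmem t ht)).1
  have hcont : ContinuousOn φ (Icc 0 1) :=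
    (M.contDiffOn_edgeCoord j l).continuousOn.comp (M.contDiff_edgeParam i k).continuous.continuousOn
      fun t ht => M.elem_subset_target j (M.edge_subset_elem j l (hmem t ht))
  have hinj : InjOn φ (Icc 0 1) := by
    intro t ht u hu htu
    apply M.edgeParam_injOn i k ht hu
    rw [← (M.edgeParam_edgeCoord j l (hmem t ht)).2, ← (M.edgeParam_edgeCoord j l (hmem u hu)).2]
    exact congrArg _ htu
  have hs' := Ioo_subset_Icc_self hs
  have h0 : (0 : ℝ) ∈ Icc (0 : ℝ) 1 := by simp
  have h1 : (1 : ℝ) ∈ Icc (0 : ℝ) 1 := by simp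
  rcases hcont.strictMonoOn_of_injOn_Icc' zero_le_one hinj with hm | hm
  · exact ⟨(hφ 0 h0).1.trans_lt (hm h0 hs' hs.1), (hm hs' h1 hs.2).trans_le (hφ 1 h1).2⟩
  · exact ⟨(hφ 1 h1).1.trans_lt (hm hs' h1 hs.2), (hm h0 hs' hs.1).trans_le (hφ 0 h0).2⟩

lemma edgeParam_mem_edge (i : ι) (k : Fin 3) {s : ℝ} (hs : s ∈ Ioo (0 : ℝ) 1) :
    M.edgeParam i k s ∈ M.edge i k := ⟨s, Ioo_subset_Icc_self hs, rfl⟩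

lemma exists_edge_eq {i j : ι} (hij : i ≠ j) {k : Fin 3} {s : ℝ} (hs : s ∈ Ioo (0 : ℝ) 1)
    (h : M.edgeParam i k s ∈ M.elem j) : ∃ l, M.edge i k = M.edge j l := by
  have hmem : M.edgeParam i k s ∈ M.map i '' refTriangle ∩ M.map j '' refTriangle :=
    ⟨M.edgeParam_mem_elem i k (Ioo_subset_Icc_self hs), h⟩
  rcases M.conforming i j hij with h | ⟨k', l, h, -⟩ | ⟨k', l, h, h'⟩ <;> rw [h] at hmem
  · exact absurd hmem (notMem_empty _)
  · exact absurd hmem (M.edgeParam_zero_ne i hs)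
  · have hk : k' = k := M.edge_eq_of_edgeParam_mem i hs hmem
    subst hk
    exact ⟨l, h'⟩

lemma exists_edgeParam_eq {i j : ι} (hij : i ≠ j) {k : Fin 3} {s : ℝ} (hs : s ∈ Ioo (0 : ℝ) 1)
    (h : M.edgeParam i k s ∈ M.elem j) :
    ∃ l, ∃ t ∈ Ioo (0 : ℝ) 1, M.edgeParam j l t = M.edgeParam i k s := by
  obtain ⟨l, hl⟩ := M.exists_edge_eq hij hs h
  exact ⟨l, _, M.edgeCoord_mem_Ioo hl hs, (M.edgeParam_edgeCoord j l
    (hl ▸ M.edgeParam_mem_edge i k hs)).2⟩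

/-- A direction to the left of both tangents would lead into the interiors of two distinct elements
at once. -/
lemma tangent_antiparallel {i j : ι} (hij : i ≠ j) {k l : Fin 3} {s t : ℝ} (hs : s ∈ Ioo (0 : ℝ) 1)
    (ht : t ∈ Ioo (0 : ℝ) 1) (h : M.edgeParam j l t = M.edgeParam i k s) :
    ∃ c : ℝ, 0 < c ∧ M.tangent j l t = (-c) • M.tangent i k s := by
  refine antiparallel_of_disjoint_sides (M.tangent_ne_zero i k (Ioo_subset_Icc_self hs))
    (M.tangent_ne_zero j l (Ioo_subset_Icc_self ht)) fun v hv hv' => ?_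
  have e1 := M.eventually_line_mem_interior i k hs hv
  have e2 := M.eventually_line_mem_interior j l ht hv'
  obtain ⟨u, hu1, hu2⟩ := (e1.and e2).exists
  rw [h] at hu2
  exact M.interior_disjoint hij hu1.1 (_root_.interior_subset hu2.1)

/-- With three distinct elements at an inner point of an edge, three tangents would be pairwise
antiparallel, which their signs forbid. -/
lemma eq_of_mem_elem {i j m : ι} (hij : i ≠ j) (him : i ≠ m) {k : Fin 3} {s : ℝ}
    (hs : s ∈ Ioo (0 : ℝ) 1) (hj : M.edgeParam i k s ∈ M.elem j) (hm : M.edgeParam i k s ∈ M.elem m) :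
    m = j := by
  by_contra hmj
  obtain ⟨l, t, ht, h1⟩ := M.exists_edgeParam_eq hij hs hj
  obtain ⟨l', t', ht', h2⟩ := M.exists_edgeParam_eq him hs hm
  obtain ⟨a, ha, h3⟩ := M.tangent_antiparallel hij hs ht h1
  obtain ⟨b, hb, h4⟩ := M.tangent_antiparallel him hs ht' h2
  obtain ⟨c, hc, h5⟩ := M.tangent_antiparallel (Ne.symm hmj) ht ht' (h2.trans h1.symm)
  rw [h3, h4, smul_smul] at h5
  have h6 := smul_left_injective ℝ (M.tangent_ne_zero i k (Ioo_subset_Icc_self hs)) h5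
  nlinarith [mul_pos hc ha]

lemma edgeParam_not_mem_interior (i j : ι) (k : Fin 3) {s : ℝ} (hs : s ∈ Ioo (0 : ℝ) 1) :
    M.edgeParam i k s ∉ interior (M.elem j) := by
  intro h
  by_cases hij : i = j
  · subst hij
    exact M.not_mem_interior_of_mem_edge i (M.edgeParam_mem_edge i k hs) h
  · exact M.interior_disjoint (Ne.symm hij) h (M.edgeParam_mem_elem i k (Ioo_subset_Icc_self hs))

lemma edgeParam_not_mem_vertices (i : ι) (k : Fin 3) {s : ℝ} (hs : s ∈ Ioo (0 : ℝ) 1) :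
    M.edgeParam i k s ∉ M.vertices := by
  rintro ⟨m, l, h⟩
  by_cases him : i = m
  · subst him
    exact M.edgeParam_zero_ne i hs h
  · obtain ⟨l', t, ht, h'⟩ := M.exists_edgeParam_eq him hs
      (h ▸ M.edgeParam_mem_elem m l (by simp) : M.edgeParam i k s ∈ M.elem m)
    exact M.edgeParam_zero_ne m ht (h'.trans h)

lemma interior_not_mem_vertices {i : ι} {p : Plane} (hp : p ∈ interior (M.elem i)) :
    p ∉ M.vertices := by
  rintro ⟨m, l, rfl⟩
  by_cases him : i = m
  · subst him
    exact M.not_mem_interior_of_mem_edge i (M.edgeParam_zero_mem_edge i l) hp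
  · exact M.interior_disjoint him hp (M.edgeParam_mem_elem m l (by simp))

lemma interior_subset_punctured (i : ι) : interior (M.elem i) ⊆ M.punctured := fun _ hp =>
  ⟨M.interior_subset i hp, M.interior_not_mem_vertices hp⟩

lemma edgeParam_one (i : ι) (k : Fin 3) : M.edgeParam i k 1 ∈ M.vertices := by
  refine ⟨i, k + 1, congrArg (M.map i) ?_⟩
  fin_cases k <;> apply plane_ext <;> simp [refEdge]

lemma mem_elem_cases (i : ι) {p : Plane} (hp : p ∈ M.elem i) :
    p ∈ M.vertices ∨ p ∈ interior (M.elem i) ∨ ∃ k, ∃ s ∈ Ioo (0 : ℝ) 1, p = M.edgeParam i k s := by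
  by_cases h : ∀ k, 0 < M.bary i k p
  · exact Or.inr (Or.inl ((M.mem_interior_elem_iff i).2 ⟨hp, h⟩))
  · push Not at h
    obtain ⟨k, hk⟩ := h
    have h0 := le_antisymm hk ((M.mem_elem_iff i (M.elem_subset_target i hp)).1 hp k)
    obtain ⟨s, hs, rfl⟩ := M.mem_edge_of_bary_eq_zero i k hp h0
    rcases eq_endpoints_or_mem_Ioo_of_mem_Icc hs with rfl | rfl | hs
    · exact Or.inl ⟨i, k, rfl⟩
    · exact Or.inl (M.edgeParam_one i k)
    · exact Or.inr (Or.inr ⟨k, s, hs, rfl⟩)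

lemma exists_mem_elem {p : Plane} (hp : p ∈ Ω) : ∃ i, p ∈ M.elem i := by
  have := subset_closure hp
  rw [M.cover] at this
  exact mem_iUnion.1 this

/-- The element `j` is the neighbour of the element `i` along its `k`-th edge. -/
structure IsNeighbor (i j : ι) (k : Fin 3) : Prop where
  ne : i ≠ j
  shared : M.edge i k ⊆ M.elem j
  mem : ∀ s ∈ Ioo (0 : ℝ) 1, M.edgeParam i k s ∈ Ω

variable {M}

lemma IsNeighbor.exists_edge_eq {i j : ι} {k : Fin 3} (h : M.IsNeighbor i j k) :
    ∃ l, M.edge i k = M.edge j l :=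
  M.exists_edge_eq h.ne (s := 1 / 2) (by norm_num) (h.shared (M.edgeParam_mem_edge i k (by norm_num)))

lemma IsNeighbor.symm {i j : ι} {k l : Fin 3} (h : M.IsNeighbor i j k)
    (hl : M.edge i k = M.edge j l) : M.IsNeighbor j i l where
  ne := h.ne.symm
  shared := hl ▸ M.edge_subset_elem i k
  mem s hs := by
    have hmem : M.edgeParam j l s ∈ M.edge i k := hl ▸ M.edgeParam_mem_edge j l hs
    rw [← (M.edgeParam_edgeCoord i k hmem).2]
    exact h.mem _ (M.edgeCoord_mem_Ioo hl.symm hs)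

lemma IsNeighbor.mem_punctured {i j : ι} {k : Fin 3} (h : M.IsNeighbor i j k) {s : ℝ}
    (hs : s ∈ Ioo (0 : ℝ) 1) : M.edgeParam i k s ∈ M.punctured :=
  ⟨h.mem s hs, M.edgeParam_not_mem_vertices i k hs⟩

lemma IsNeighbor.eq_or_eq {i j : ι} {k : Fin 3} (h : M.IsNeighbor i j k) {s : ℝ}
    (hs : s ∈ Ioo (0 : ℝ) 1) {m : ι} (hm : M.edgeParam i k s ∈ M.elem m) : m = i ∨ m = j := by
  by_cases him : i = m
  · exact Or.inl him.symm
  · exact Or.inr (M.eq_of_mem_elem h.ne him hs (h.shared (M.edgeParam_mem_edge i k hs)) hm)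

variable (M)

lemma eventually_mem_elem_of_mem [Finite ι] (hΩ : IsOpen Ω) {p : Plane} (hp : p ∈ Ω) :
    ∀ᶠ q in 𝓝 p, ∃ m, p ∈ M.elem m ∧ q ∈ M.elem m := by
  have h1 : ∀ᶠ q in 𝓝 p, ∀ m, p ∉ M.elem m → q ∉ M.elem m := by
    refine eventually_all.2 fun m => ?_
    by_cases hm : p ∈ M.elem m
    · exact Eventually.of_forall fun q h => absurd hm h
    · filter_upwards [(M.isClosed_elem m).isOpen_compl.mem_nhds hm] with q hq _ using hq
  filter_upwards [h1, hΩ.mem_nhds hp] with q hq hqΩ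
  obtain ⟨m, hm⟩ := M.exists_mem_elem hqΩ
  exact ⟨m, by_contra fun h => hq m h hm, hm⟩

lemma IsNeighbor.union_mem_nhds {M : CurvedMesh Ω ι} [Finite ι] (hΩ : IsOpen Ω) {i j : ι} {k : Fin 3}
    (h : M.IsNeighbor i j k) {s : ℝ} (hs : s ∈ Ioo (0 : ℝ) 1) :
    M.elem i ∪ M.elem j ∈ 𝓝 (M.edgeParam i k s) := by
  filter_upwards [M.eventually_mem_elem_of_mem hΩ (h.mem s hs)] with q ⟨m, hm, hq⟩
  rcases h.eq_or_eq hs hm with rfl | rfl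
  · exact Or.inl hq
  · exact Or.inr hq

/-- Were `i` the only element at that point, it would be a neighbourhood of the point, since
finitely many closed elements cover the domain; but a point of an edge is not interior to the
element. -/
lemma exists_isNeighbor [Finite ι] (hΩ : IsOpen Ω) (i : ι) (k : Fin 3) {s : ℝ}
    (hs : s ∈ Ioo (0 : ℝ) 1) (h : M.edgeParam i k s ∈ Ω) : ∃ j, M.IsNeighbor i j k := by
  have hall : ∀ s ∈ Ioo (0 : ℝ) 1, M.edgeParam i k s ∈ Ω := by
    rcases M.edge_dichotomy i k with h1 | h1
    · exact h1
    · exact absurd h (h1 s hs)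
  obtain ⟨j, hj, hij⟩ : ∃ j, M.edgeParam i k s ∈ M.elem j ∧ i ≠ j := by
    by_contra! hcon
    have hnb : M.elem i ∈ 𝓝 (M.edgeParam i k s) := by
      filter_upwards [M.eventually_mem_elem_of_mem hΩ h] with q ⟨m, hm, hq⟩
      rwa [hcon m hm]
    exact M.edgeParam_not_mem_interior i i k hs (mem_interior_iff_mem_nhds.2 hnb)
  obtain ⟨l, hl⟩ := M.exists_edge_eq hij hs hj
  exact ⟨j, hij, hl ▸ M.edge_subset_elem j l, hall⟩

/-- The change of parameter between two descriptions of a shared edge. -/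
lemma hasDerivAt_edgeCoord_edgeParam {i j : ι} {k l : Fin 3} (h : M.edge i k = M.edge j l) {s : ℝ}
    (hs : s ∈ Ioo (0 : ℝ) 1) :
    ContDiffAt ℝ ∞ (fun t => M.edgeCoord j l (M.edgeParam i k t)) s ∧
      deriv (fun t => M.edgeCoord j l (M.edgeParam i k t)) s ≠ 0 := by
  have hmem : ∀ t ∈ Ioo (0 : ℝ) 1, M.edgeParam i k t ∈ M.edge j l := fun t ht =>
    h ▸ M.edgeParam_mem_edge i k ht
  have hsm : ContDiffAt ℝ ∞ (fun t => M.edgeCoord j l (M.edgeParam i k t)) s :=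
    ((M.contDiffOn_edgeCoord j l).contDiffAt ((M.homeo j).open_target.mem_nhds
      (M.elem_subset_target j (M.edge_subset_elem j l (hmem s hs))))).comp s
      (M.contDiff_edgeParam i k).contDiffAt
  refine ⟨hsm, fun h0 => ?_⟩
  have h1 := (hsm.differentiableAt (by simp)).hasDerivAt
  have h2 := (M.hasDerivAt_edgeParam j l _).scomp s h1
  have h3 : HasDerivAt (M.edgeParam i k)
      (deriv (fun t => M.edgeCoord j l (M.edgeParam i k t)) s •
        M.tangent j l (M.edgeCoord j l (M.edgeParam i k s))) s := by
    refine h2.congr_of_eventuallyEq ?_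
    filter_upwards [isOpen_Ioo.mem_nhds hs] with t ht
    exact (M.edgeParam_edgeCoord j l (hmem t ht)).2.symm
  have h4 := h3.unique (M.hasDerivAt_edgeParam i k s)
  rw [h0, zero_smul] at h4
  exact M.tangent_ne_zero i k (Ioo_subset_Icc_self hs) h4.symm

end CurvedMesh

end

noncomputable section

open Filter Topology

set_option maxSynthPendingDepth 3

/-! ### Smooth cutoffs and extensions -/

section Cutoff

open scoped Manifold

variable {E : Type} [NormedAddCommGroup E] [NormedSpace ℝ E] [FiniteDimensional ℝ E]

lemma IsCompact.exists_smooth_cutoff {K U : Set E} (hK : IsCompact K) (hU : IsOpen U) (hKU : K ⊆ U) :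
    ∃ χ : E → ℝ, ContDiff ℝ ∞ χ ∧ HasCompactSupport χ ∧ tsupport χ ⊆ U ∧
      (∃ V, IsOpen V ∧ K ⊆ V ∧ ∀ x ∈ V, χ x = 1) ∧ ∀ x, χ x ∈ Icc (0 : ℝ) 1 := by
  have : ProperSpace E := FiniteDimensional.proper_real E
  obtain ⟨K', hK', hKK', hK'U⟩ := exists_compact_between hK hU hKU
  obtain ⟨f, hf0, hf1, hf⟩ := exists_contMDiffMap_zero_one_nhds_of_isClosed (n := ⊤) 𝓘(ℝ, E)
    (isOpen_interior (s := K')).isClosed_compl hK.isClosed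
    (by rwa [← subset_compl_iff_disjoint_left, compl_compl])
  have hts : tsupport f ⊆ interior K' := by
    intro x hx
    by_contra hxK
    have := (mem_nhdsSet_iff_forall.1 hf0) x hxK
    exact (notMem_tsupport_iff_eventuallyEq.2 this) hx
  obtain ⟨V, hV, hKV, hVf⟩ := eventually_nhdsSet_iff_exists.1 hf1
  exact ⟨f, f.contMDiff.contDiff, HasCompactSupport.of_support_subset_isCompact hK'
    ((subset_tsupport f).trans (hts.trans interior_subset)),
    hts.trans (interior_subset.trans hK'U), ⟨V, hV, hKV, hVf⟩, hf⟩

omit [FiniteDimensional ℝ E] in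
lemma contDiff_smul_of_tsupport_subset {F : Type} [NormedAddCommGroup F] [NormedSpace ℝ F]
    {χ : E → ℝ} {f : E → F} {U : Set E} (hU : IsOpen U) (hχ : ContDiff ℝ ∞ χ)
    (hs : tsupport χ ⊆ U) (hf : ContDiffOn ℝ ∞ f U) : ContDiff ℝ ∞ (fun x => χ x • f x) := by
  rw [contDiff_iff_contDiffAt]
  intro x
  by_cases hx : x ∈ U
  · exact hχ.contDiffAt.smul (hf.contDiffAt (hU.mem_nhds hx))
  · have h1 : χ =ᶠ[𝓝 x] 0 := notMem_tsupport_iff_eventuallyEq.1 fun h => hx (hs h)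
    refine contDiffAt_const (c := (0 : F)) |>.congr_of_eventuallyEq ?_
    filter_upwards [h1] with y hy
    simp [hy]

/-- A smooth map on an open set agrees, near a compact subset, with a smooth compactly supported map
on the whole space. -/
lemma ContDiffOn.exists_extension {F : Type} [NormedAddCommGroup F] [NormedSpace ℝ F]
    {f : E → F} {U K : Set E} (hf : ContDiffOn ℝ ∞ f U) (hU : IsOpen U) (hK : IsCompact K)
    (hKU : K ⊆ U) :
    ∃ f' : E → F, ContDiff ℝ ∞ f' ∧ HasCompactSupport f' ∧
      ∃ V, IsOpen V ∧ K ⊆ V ∧ V ⊆ U ∧ EqOn f' f V := by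
  obtain ⟨χ, hχ, hc, hs, ⟨V, hV, hKV, h1⟩, -⟩ := hK.exists_smooth_cutoff hU hKU
  exact ⟨fun x => χ x • f x, contDiff_smul_of_tsupport_subset hU hχ hs hf, hc.smul_right,
    V ∩ U, hV.inter hU, subset_inter hKV hKU, inter_subset_right, fun x hx => by simp [h1 x hx.1]⟩

end Cutoff

/-! ### Geodesics normal to a curve -/

/-- The vector field on the tangent bundle whose integral curves are the geodesics of the metric
`B`. -/
def geodesicField (B : Plane → Plane →L[ℝ] Plane →L[ℝ] ℝ) (q : Plane × Plane) : Plane × Plane :=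
  (q.2, (B q.1).inverse ((1 / 2 : ℝ) • ((ContinuousLinearMap.apply ℝ ℝ q.2) ∘L
    (ContinuousLinearMap.apply ℝ (Plane →L[ℝ] ℝ) q.2) ∘L fderiv ℝ B q.1)
      - fderiv ℝ B q.1 q.2 q.2))

lemma contDiffAt_geodesicField {B : Plane → Plane →L[ℝ] Plane →L[ℝ] ℝ} (hB : ContDiff ℝ ∞ B)
    {q : Plane × Plane} (hq : (B q.1).IsInvertible) : ContDiffAt ℝ ∞ (geodesicField B) q := by
  have hB1 : ContDiff ℝ ∞ (fun q : Plane × Plane => B q.1) := hB.comp contDiff_fst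
  have hB2 : ContDiff ℝ ∞ (fun q : Plane × Plane => fderiv ℝ B q.1) :=
    (hB.fderiv_right (m := ∞) le_rfl).comp contDiff_fst
  have hinv : ContDiffAt ℝ ∞ (fun q : Plane × Plane => (B q.1).inverse) q :=
    ContDiffAt.comp (g := ContinuousLinearMap.inverse) q hq.contDiffAt_map_inverse hB1.contDiffAt
  have ha : ∀ F : Type, ∀ [NormedAddCommGroup F] [NormedSpace ℝ F],
      ContDiff ℝ ∞ (fun q : Plane × Plane => ContinuousLinearMap.apply ℝ F q.2) := fun F _ _ =>
    (ContinuousLinearMap.apply ℝ F : Plane →L[ℝ] (Plane →L[ℝ] F) →L[ℝ] F).contDiff.comp contDiff_snd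
  refine contDiffAt_snd.prodMk (hinv.clm_apply (ContDiffAt.sub ?_ ?_))
  · exact (((ha ℝ).clm_comp ((ha (Plane →L[ℝ] ℝ)).clm_comp hB2)).contDiffAt).const_smul _
  · exact ((hB2.clm_apply contDiff_snd).clm_apply contDiff_snd).contDiffAt

/-- The geodesic equation with the index lowered. In this form the derivatives of B(v, v) and B(v,
w) along geodesics are computed without Christoffel symbols. -/
lemma geodesicField_snd {B : Plane → Plane →L[ℝ] Plane →L[ℝ] ℝ} {q : Plane × Plane}
    (hq : (B q.1).IsInvertible) (u : Plane) :
    B q.1 (geodesicField B q).2 u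
      = (1 / 2) * fderiv ℝ B q.1 u q.2 q.2 - fderiv ℝ B q.1 q.2 q.2 u := by
  obtain ⟨e, he⟩ := hq
  simp only [geodesicField, ← he, ContinuousLinearMap.inverse_equiv]
  simp

lemma hasDerivAt_const_of_Ioo {f : ℝ → ℝ} {ρ : ℝ} (h : ∀ r ∈ Ioo (-ρ) ρ, HasDerivAt f 0 r) {r : ℝ}
    (hr : r ∈ Ioo (-ρ) ρ) : f r = f 0 := by
  have h0 : (0 : ℝ) ∈ Ioo (-ρ) ρ := by
    rw [mem_Ioo, ← abs_lt] at hr ⊢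
    rw [abs_zero]; exact (abs_nonneg r).trans_lt hr
  exact isOpen_Ioo.is_const_of_deriv_eq_zero isPreconnected_Ioo
    (fun x hx => (h x hx).differentiableAt.differentiableWithinAt) (fun x hx => (h x hx).deriv) hr h0

lemma planeVec_eq_add (r s : ℝ) :
    planeVec ![r, s] = planeVec ![0, s] + r • coordVec 0 := by
  apply plane_ext <;> simp [coordVec]

lemma planeVec_eq_add' (r s : ℝ) :
    planeVec ![r, s] = planeVec ![r, 0] + s • coordVec 1 := by
  apply plane_ext <;> simp [coordVec]

lemma hasDerivAt_planeVec_fst (r s : ℝ) :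
    HasDerivAt (fun r => planeVec ![r, s]) (coordVec 0) r := by
  rw [show (fun r => planeVec ![r, s]) = fun r => planeVec ![0, s] + r • coordVec 0 from
    funext fun r => planeVec_eq_add r s]
  simpa using ((hasDerivAt_id r).smul_const (coordVec 0)).const_add (planeVec ![0, s])

lemma hasDerivAt_planeVec_snd (r s : ℝ) :
    HasDerivAt (fun s => planeVec ![r, s]) (coordVec 1) s := by
  rw [show (fun s => planeVec ![r, s]) = fun s => planeVec ![r, 0] + s • coordVec 1 from
    funext fun s => planeVec_eq_add' r s]
  simpa using ((hasDerivAt_id s).smul_const (coordVec 1)).const_add (planeVec ![r, 0])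

lemma planeVec_eta (y : Plane) : planeVec ![y 0, y 1] = y := by apply plane_ext <;> simp

lemma contDiff_planeVec : ContDiff ℝ ∞ (fun q : ℝ × ℝ => planeVec ![q.1, q.2]) := by
  simp_rw [← planeProd_symm_apply]
  exact planeProd.symm.contDiff

lemma continuous_planeVec_snd (r : ℝ) : Continuous fun s : ℝ => planeVec ![r, s] :=
  contDiff_planeVec.continuous.comp (Continuous.prodMk_right r)

/-- An open box in the plane. -/
def planeBox (ρ a b : ℝ) : Set Plane := {y | y 0 ∈ Ioo (-ρ) ρ ∧ y 1 ∈ Ioo a b}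

/-- A closed box in the plane. -/
def closedPlaneBox (ρ a b : ℝ) : Set Plane := {y | y 0 ∈ Icc (-ρ) ρ ∧ y 1 ∈ Icc a b}

lemma isOpen_planeBox (ρ a b : ℝ) : IsOpen (planeBox ρ a b) :=
  (isOpen_Ioo.preimage (contDiff_coord 0).continuous).inter
    (isOpen_Ioo.preimage (contDiff_coord 1).continuous)

lemma planeBox_subset_closed (ρ a b : ℝ) : planeBox ρ a b ⊆ closedPlaneBox ρ a b := fun _ hy =>
  ⟨Ioo_subset_Icc_self hy.1, Ioo_subset_Icc_self hy.2⟩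

lemma isCompact_closedPlaneBox (ρ a b : ℝ) : IsCompact (closedPlaneBox ρ a b) :=
  planeProd.toHomeomorph.isCompact_preimage.2 (isCompact_Icc.prod isCompact_Icc)

/-- An open set that contains a segment contains a box around it. -/
lemma exists_closedPlaneBox_subset {O : Set Plane} (hO : IsOpen O) {a b : ℝ}
    (h : ∀ s ∈ Icc a b, planeVec ![0, s] ∈ O) : ∃ ρ > 0, closedPlaneBox ρ a b ⊆ O := by
  have hO' : IsOpen (planeProd.symm ⁻¹' O) := hO.preimage planeProd.symm.continuous
  obtain ⟨u, v, hu, hv, h0, hI, huv⟩ := generalized_tube_lemma (isCompact_singleton (x := (0 : ℝ)))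
    (isCompact_Icc (a := a) (b := b)) hO' (by
      rintro ⟨r, s⟩ ⟨hr, hs⟩
      obtain rfl : r = 0 := hr
      rw [mem_preimage, planeProd_symm_apply]
      exact h s hs)
  obtain ⟨ε, hε, hball⟩ := Metric.isOpen_iff.1 hu 0 (h0 rfl)
  refine ⟨ε / 2, by positivity, fun y hy => ?_⟩
  have h1 : (y 0, y 1) ∈ u ×ˢ v := by
    refine ⟨hball ?_, hI hy.2⟩
    rw [mem_ball_zero_iff, Real.norm_eq_abs]
    exact (abs_le.2 hy.1).trans_lt (by linarith)
  have h2 := huv h1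
  rw [mem_preimage, planeProd_symm_apply] at h2
  rwa [planeVec_eta] at h2

/-- Geodesic coordinates along a curve: the map whose radial lines are the unit speed geodesics
normal to the curve; the curves of constant radius are orthogonal to them. -/
theorem exists_fermi_map (B : Plane → Plane →L[ℝ] Plane →L[ℝ] ℝ) (hB : ContDiff ℝ ∞ B)
    (hsymm : ∀ p u v, B p u v = B p v u) (γ n : ℝ → Plane) (hγ : ContDiff ℝ ∞ γ)
    (hn : ContDiff ℝ ∞ n) {a b : ℝ} (hinv : ∀ s ∈ Icc a b, (B (γ s)).IsInvertible)
    (hnn : ∀ s ∈ Icc a b, B (γ s) (n s) (n s) = 1)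
    (hnt : ∀ s ∈ Icc a b, B (γ s) (n s) (deriv γ s) = 0) :
    ∃ ρ > 0, ∃ F : Plane → Plane, ContDiff ℝ ∞ F ∧
      (∀ s ∈ Icc a b, F (planeVec ![0, s]) = γ s ∧
        fderiv ℝ F (planeVec ![0, s]) (coordVec 0) = n s) ∧
      ∀ y ∈ planeBox ρ a b, B (F y) (fderiv ℝ F y (coordVec 0)) (fderiv ℝ F y (coordVec 0)) = 1 ∧
        B (F y) (fderiv ℝ F y (coordVec 0)) (fderiv ℝ F y (coordVec 1)) = 0 := by
  have hinvO : IsOpen {q : Plane × Plane | (B q.1).IsInvertible} :=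
    (ContinuousLinearEquiv.isOpen (𝕜 := ℝ) (E := Plane) (F := Plane →L[ℝ] ℝ)).preimage
      (hB.continuous.comp continuous_fst)
  have hKc : IsCompact ((fun s => (γ s, n s)) '' Icc a b) :=
    isCompact_Icc.image (hγ.continuous.prodMk hn.continuous)
  -- The geodesic field is cut off around the compact set of initial data, so that a flow with
  -- uniform existence time is available; on `V` it is unchanged.
  obtain ⟨X, hX, hXc, V, hV, hKV, hVU, hXV⟩ := ContDiffOn.exists_extension (f := geodesicField B)
    (fun q hq => (contDiffAt_geodesicField hB hq).contDiffWithinAt) hinvO hKc (by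
      rintro _ ⟨s, hs, rfl⟩; exact hinv s hs)
  obtain ⟨τ, hτ, Y, hY, hY0, hYd⟩ := exists_smooth_flow X hX hXc
  let Z : Plane → Plane × Plane := fun y => Y (y 0, (γ (y 1), n (y 1)))
  have hstrip : IsOpen {y : Plane | y 0 ∈ Ioo (-τ) τ} :=
    isOpen_Ioo.preimage (contDiff_coord 0).continuous
  have hZ : ContDiffOn ℝ ∞ Z {y : Plane | y 0 ∈ Ioo (-τ) τ} := by
    refine hY.comp (ContDiff.contDiffOn ?_) fun y hy => ⟨hy, mem_univ _⟩
    exact (contDiff_coord 0).prodMk ((hγ.comp (contDiff_coord 1)).prodMk (hn.comp (contDiff_coord 1)))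
  have hK2 : IsCompact (closedPlaneBox (τ / 2) a b) := isCompact_closedPlaneBox _ _ _
  -- A globally smooth map replaces the flow, which is defined on a strip only.
  obtain ⟨Z', hZ', -, V', hV', hKV', hVU', hZV'⟩ := hZ.exists_extension hstrip hK2 (fun y hy => by
    obtain ⟨⟨h1, h2⟩, -⟩ := hy
    constructor <;> linarith)
  have hZ0 : ∀ s ∈ Icc a b, Z' (planeVec ![0, s]) = (γ s, n s) := by
    intro s hs
    rw [hZV' (hKV' ⟨by simp; linarith, by simpa using hs⟩)]
    simp [Z, hY0]
  obtain ⟨ρ, hρ, hbox⟩ := exists_closedPlaneBox_subset (a := a) (b := b)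
    (hV'.inter (hV.preimage hZ'.continuous)) (fun s hs =>
      ⟨hKV' ⟨by simp; linarith, by simpa using hs⟩, by
        rw [mem_preimage, hZ0 s hs]; exact hKV ⟨s, hs, rfl⟩⟩)
  have hZd : ∀ y ∈ V' ∩ Z' ⁻¹' V, fderiv ℝ Z' y (coordVec 0) = geodesicField B (Z' y) := by
    intro y hy
    have h1 : HasDerivAt (fun r => Z' (planeVec ![r, y 1])) (fderiv ℝ Z' y (coordVec 0)) (y 0) := by
      refine HasFDerivAt.comp_hasDerivAt (l := Z') (y 0) ?_ (hasDerivAt_planeVec_fst (y 0) (y 1))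
      rw [planeVec_eta]
      exact (hZ'.differentiable (by simp) y).hasFDerivAt
    have h2 : HasDerivAt (fun r => Z' (planeVec ![r, y 1])) (X (Z y)) (y 0) := by
      refine (hYd (y 0) (hVU' hy.1) (γ (y 1), n (y 1))).congr_of_eventuallyEq ?_
      have hc : ContinuousAt (fun r => planeVec ![r, y 1]) (y 0) :=
        (hasDerivAt_planeVec_fst (y 0) (y 1)).continuousAt
      filter_upwards [hc.eventually (show ∀ᶠ z in 𝓝 (planeVec ![y 0, y 1]), z ∈ V' by
        rw [planeVec_eta]; exact hV'.mem_nhds hy.1)] with r hr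
      rw [hZV' hr]
      simp [Z]
    rw [h1.unique h2, ← hZV' hy.1, hXV hy.2]
  set F : Plane → Plane := fun y => (Z' y).1
  set v : Plane → Plane := fun y => (Z' y).2
  have hF : ContDiff ℝ ∞ F := contDiff_fst.comp hZ'
  have hv : ContDiff ℝ ∞ v := contDiff_snd.comp hZ'
  have hO : IsOpen (V' ∩ Z' ⁻¹' V) := hV'.inter (hV.preimage hZ'.continuous)
  set O := V' ∩ Z' ⁻¹' V
  have hdF : ∀ y u, fderiv ℝ F y u = (fderiv ℝ Z' y u).1 := fun y u => by
    rw [show fderiv ℝ F y = _ from fderiv.fst (hZ'.differentiable (by simp) y)]; rfl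
  have hdv : ∀ y u, fderiv ℝ v y u = (fderiv ℝ Z' y u).2 := fun y u => by
    rw [show fderiv ℝ v y = _ from fderiv.snd (hZ'.differentiable (by simp) y)]; rfl
  have hFv : ∀ y ∈ O, fderiv ℝ F y (coordVec 0) = v y := fun y hy => by rw [hdF, hZd y hy]; rfl
  have hvA : ∀ y ∈ O, ∀ u, B (F y) (fderiv ℝ v y (coordVec 0)) u
      = (1 / 2) * fderiv ℝ B (F y) u (v y) (v y) - fderiv ℝ B (F y) (v y) (v y) u := fun y hy u => by
    rw [hdv, hZd y hy]
    exact geodesicField_snd (hVU hy.2) u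
  set w : Plane → Plane := fun y => fderiv ℝ F y (coordVec 1)
  have hw : ContDiff ℝ ∞ w := (hF.fderiv_right (m := ∞) le_rfl).clm_apply contDiff_const
  have hwv : ∀ y ∈ O, fderiv ℝ w y (coordVec 0) = fderiv ℝ v y (coordVec 1) := by
    intro y hy
    have hF2 : DifferentiableAt ℝ (fderiv ℝ F) y :=
      (hF.fderiv_right (m := ∞) le_rfl).differentiable (by simp) y
    have h1 : fderiv ℝ w y (coordVec 0) = fderiv ℝ (fderiv ℝ F) y (coordVec 0) (coordVec 1) := by
      simp only [w]
      rw [fderiv_clm_apply hF2 (differentiableAt_const _)]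
      simp
    have h2 : fderiv ℝ v y (coordVec 1) = fderiv ℝ (fderiv ℝ F) y (coordVec 1) (coordVec 0) := by
      have h3 : v =ᶠ[𝓝 y] fun z => fderiv ℝ F z (coordVec 0) := by
        filter_upwards [hO.mem_nhds hy] with z hz using (hFv z hz).symm
      rw [h3.fderiv_eq, fderiv_clm_apply hF2 (differentiableAt_const _)]
      simp
    rw [h1, h2]
    exact (hF.contDiffAt.isSymmSndFDerivAt (by
      simpa using (WithTop.coe_le_coe.2 le_top : ((2 : ℕ∞) : WithTop ℕ∞) ≤ ∞))) _ _
  have hder : ∀ w : Plane → Plane, ContDiff ℝ ∞ w → ∀ y u,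
      fderiv ℝ (fun y => B (F y) (v y) (w y)) y u = fderiv ℝ B (F y) (fderiv ℝ F y u) (v y) (w y)
        + B (F y) (fderiv ℝ v y u) (w y) + B (F y) (v y) (fderiv ℝ w y u) := by
    intro w hw y u
    have h1 : HasFDerivAt (fun y => B (F y)) (fderiv ℝ B (F y) ∘L fderiv ℝ F y) y :=
      (hB.differentiable (by simp) _).hasFDerivAt.comp y (hF.differentiable (by simp) _).hasFDerivAt
    have h2 := (h1.clm_apply (hv.differentiable (by simp) y).hasFDerivAt).clm_apply
      (hw.differentiable (by simp) y).hasFDerivAt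
    rw [h2.fderiv]
    simp
    ring
  have hconst : ∀ f : Plane → ℝ, ContDiff ℝ ∞ f →
      (∀ y ∈ planeBox ρ a b, fderiv ℝ f y (coordVec 0) = 0) → ∀ y ∈ planeBox ρ a b,
        f y = f (planeVec ![0, y 1]) := by
    intro f hf h y hy
    have h1 := hasDerivAt_const_of_Ioo (f := fun r => f (planeVec ![r, y 1])) (ρ := ρ)
      (fun r hr => ?_) hy.1
    · simp only [planeVec_eta] at h1; exact h1
    · rw [← h (planeVec ![r, y 1]) ⟨by simpa using hr, by simpa using hy.2⟩]
      exact HasFDerivAt.comp_hasDerivAt (l := f) r (hf.differentiable (by simp) _).hasFDerivAt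
        (hasDerivAt_planeVec_fst r (y 1))
  have hboxO : planeBox ρ a b ⊆ O := (planeBox_subset_closed _ _ _).trans hbox
  have hsm : ∀ w : Plane → Plane, ContDiff ℝ ∞ w → ContDiff ℝ ∞ fun y => B (F y) (v y) (w y) :=
    fun w hw => ((hB.comp hF).clm_apply hv).clm_apply hw
  -- Geodesics keep unit speed: the radial derivative of B(v, v) is (∂_v B)(v, v) + 2B(∂_0 v, v),
  -- which the geodesic equation makes zero.
  have hunit : ∀ y ∈ planeBox ρ a b, B (F y) (v y) (v y) = 1 := by
    intro y hy
    rw [hconst _ (hsm v hv) (fun z hz => ?_) y hy]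
    · have hy1 : y 1 ∈ Icc a b := Ioo_subset_Icc_self hy.2
      simp only [F, v, hZ0 _ hy1]
      exact hnn _ hy1
    · rw [hder v hv, hFv z (hboxO hz), hsymm _ (v z), hvA z (hboxO hz)]
      ring
  refine ⟨ρ, hρ, F, hF, fun s hs => ?_, fun y hy => ?_⟩
  · have hO0 : planeVec ![0, s] ∈ O := hbox ⟨by simp [hρ.le], by simpa using hs⟩
    rw [hFv _ hO0]
    simp [F, v, hZ0 s hs]
  · rw [hFv y (hboxO hy)]
    refine ⟨hunit y hy, ?_⟩
    change B (F y) (v y) (w y) = 0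
    -- Gauss lemma: since ∂_0 w = ∂_1 v, the radial derivative of B(v, w) is half of ∂_1 (B(v, v)),
    -- and B(v, v) = 1. On the curve itself B(v, w) = 0 because the initial velocity is normal.
    rw [hconst _ (hsm w hw) (fun z hz => ?_) y hy]
    · have hy1 : y 1 ∈ Icc a b := Ioo_subset_Icc_self hy.2
      simp only [F, v, w, hZ0 _ hy1]
      refine Eq.trans ?_ (hnt _ hy1)
      congr 1
      have h1 : HasDerivAt (fun s => F (planeVec ![0, s]))
          (fderiv ℝ F (planeVec ![0, y 1]) (coordVec 1)) (y 1) :=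
        HasFDerivAt.comp_hasDerivAt (l := F) (y 1) (hF.differentiable (by simp) _).hasFDerivAt
          (hasDerivAt_planeVec_snd 0 (y 1))
      refine h1.unique (((hγ.differentiable (by simp) _).hasDerivAt).congr_of_eventuallyEq ?_)
      filter_upwards [isOpen_Ioo.mem_nhds hy.2] with t ht
      simp [F, hZ0 t (Ioo_subset_Icc_self ht)]
    · have hone : fderiv ℝ (fun y => B (F y) (v y) (v y)) z (coordVec 1) = 0 := by
        have : (fun y => B (F y) (v y) (v y)) =ᶠ[𝓝 z] fun _ => 1 := by
          filter_upwards [(isOpen_planeBox ρ a b).mem_nhds hz] with y hy using hunit y hy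
        rw [this.fderiv_eq]; simp
      rw [hder v hv] at hone
      rw [hder w hw, hFv z (hboxO hz), hvA z (hboxO hz), hwv z (hboxO hz)]
      have h2 := hsymm (F z) (fderiv ℝ v z (coordVec 1)) (v z)
      change fderiv ℝ B (F z) (w z) (v z) (v z) + _ + _ = 0 at hone
      linarith

end

noncomputable section

open Filter Topology

set_option maxSynthPendingDepth 3

/-! ### Bilinear forms and normals -/

lemma tensorApp_expand (A : Matrix (Fin 2) (Fin 2) ℝ) (u v : Plane) :
    tensorApp A u v = A 0 0 * u 0 * v 0 + A 0 1 * u 0 * v 1 + (A 1 0 * u 1 * v 0 + A 1 1 * u 1 * v 1) := by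
  simp [tensorApp, Fin.sum_univ_two]

/-- The bilinear form of a matrix. -/
def tensorL (A : Matrix (Fin 2) (Fin 2) ℝ) : Plane →L[ℝ] Plane →L[ℝ] ℝ :=
  ∑ a, ∑ b, A a b • (coordL a).smulRight (coordL b)

@[simp] lemma tensorL_apply (A : Matrix (Fin 2) (Fin 2) ℝ) (u v : Plane) :
    tensorL A u v = tensorApp A u v := by
  simp [tensorL, tensorApp_expand, Fin.sum_univ_two]
  ring

lemma tensorApp_comm {A : Matrix (Fin 2) (Fin 2) ℝ} (hA : A.IsSymm) (u v : Plane) :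
    tensorApp A u v = tensorApp A v u := by
  rw [tensorApp_expand, tensorApp_expand, hA.apply 0 1]; ring

lemma tensorApp_smul_left (A : Matrix (Fin 2) (Fin 2) ℝ) (c : ℝ) (u v : Plane) :
    tensorApp A (c • u) v = c * tensorApp A u v := by
  simp only [← tensorL_apply, map_smul]; rfl

lemma tensorApp_smul_right (A : Matrix (Fin 2) (Fin 2) ℝ) (c : ℝ) (u v : Plane) :
    tensorApp A u (c • v) = c * tensorApp A u v := by
  simp only [← tensorL_apply, map_smul, smul_eq_mul]

lemma tensorApp_add_left (A : Matrix (Fin 2) (Fin 2) ℝ) (u u' v : Plane) :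
    tensorApp A (u + u') v = tensorApp A u v + tensorApp A u' v := by
  simp only [← tensorL_apply, map_add]; rfl

lemma tensorApp_add_right (A : Matrix (Fin 2) (Fin 2) ℝ) (u v v' : Plane) :
    tensorApp A u (v + v') = tensorApp A u v + tensorApp A u v' := by
  simp only [← tensorL_apply, map_add]

/-- Positive definite symmetric matrices, through their quadratic form. -/
structure IsMetricMatrix (A : Matrix (Fin 2) (Fin 2) ℝ) : Prop where
  symm : A.IsSymm
  pos : ∀ X : Plane, X ≠ 0 → 0 < tensorApp A X X

namespace IsMetricMatrix

variable {A : Matrix (Fin 2) (Fin 2) ℝ} (hA : IsMetricMatrix A)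
include hA

lemma pos_zero_zero : 0 < A 0 0 := by
  have h := hA.pos (coordVec 0) (fun h => by simpa [coordVec] using congrArg (fun x : Plane => x 0) h)
  simpa [tensorApp_expand, coordVec] using h

lemma det_pos : 0 < A.det := by
  have h0 := hA.pos_zero_zero
  have h := hA.pos (planeVec ![-A 0 1, A 0 0]) (fun h => by
    have := congrArg (fun x : Plane => x 1) h
    simp at this
    exact h0.ne' this)
  rw [tensorApp_expand] at h
  simp at h
  rw [Matrix.det_fin_two, hA.symm.apply 0 1] at *
  have : 0 < A 0 0 * (A 0 0 * A 1 1 - A 0 1 * A 0 1) := by nlinarith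
  exact (mul_pos_iff_of_pos_left h0).1 this

lemma isInvertible : (tensorL A).IsInvertible := by
  have hinj : Function.Injective (tensorL A : Plane →ₗ[ℝ] Plane →L[ℝ] ℝ) := by
    rw [← LinearMap.ker_eq_bot, LinearMap.ker_eq_bot']
    intro u hu
    by_contra h
    have := hA.pos u h
    rw [← tensorL_apply] at this
    have h2 : tensorL A u = 0 := hu
    simp [h2] at this
  have hfr : Module.finrank ℝ Plane = Module.finrank ℝ (Plane →L[ℝ] ℝ) := by
    rw [← (LinearMap.toContinuousLinearMap (𝕜 := ℝ) (E := Plane) (F' := ℝ)).finrank_eq,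
      Module.finrank_linearMap, Module.finrank_self, mul_one]
  exact ⟨(LinearEquiv.ofInjectiveOfFinrankEq _ hinj hfr).toContinuousLinearEquiv, by ext; rfl⟩

end IsMetricMatrix

/-- The vector `N` with `A(N, X) = cross τ X`. -/
def normalOf (A : Matrix (Fin 2) (Fin 2) ℝ) (τ : Plane) : Plane :=
  planeVec fun a => - ∑ b, ∑ c, A⁻¹ a b * altSymb b c * τ c

/-- The unit vector `A`-normal to `τ` on its left. -/
def unitNormalOf (A : Matrix (Fin 2) (Fin 2) ℝ) (τ : Plane) : Plane :=
  (Real.sqrt (tensorApp A (normalOf A τ) (normalOf A τ)))⁻¹ • normalOf A τ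

lemma normalOf_eq (A : Matrix (Fin 2) (Fin 2) ℝ) (τ : Plane) :
    normalOf A τ = A.det⁻¹ • planeVec ![-(A 1 1 * τ 1 + A 0 1 * τ 0), A 1 0 * τ 1 + A 0 0 * τ 0] := by
  apply plane_ext <;>
  simp [normalOf, Matrix.inv_def, Matrix.adjugate_fin_two, altSymb, Fin.sum_univ_two,
    Ring.inverse_eq_inv'] <;> ring

lemma tensorApp_normalOf {A : Matrix (Fin 2) (Fin 2) ℝ} (hs : A.IsSymm) (hd : A.det ≠ 0)
    (τ X : Plane) : tensorApp A (normalOf A τ) X = cross τ X := by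
  rw [normalOf_eq, tensorApp_smul_left, inv_mul_eq_iff_eq_mul₀ hd, Matrix.det_fin_two]
  have h := hs.apply 0 1
  simp [tensorApp_expand, cross, h]
  ring

lemma tensorApp_normalOf_self {A : Matrix (Fin 2) (Fin 2) ℝ} (hs : A.IsSymm) (hd : A.det ≠ 0)
    (τ : Plane) : tensorApp A (normalOf A τ) (normalOf A τ) = A.det⁻¹ * tensorApp A τ τ := by
  have h := hs.apply 0 1
  rw [tensorApp_normalOf hs hd, normalOf_eq]
  simp [cross, tensorApp_expand, h]
  ring

lemma normalOf_smul (A : Matrix (Fin 2) (Fin 2) ℝ) (c : ℝ) (τ : Plane) :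
    normalOf A (c • τ) = c • normalOf A τ := by
  rw [normalOf_eq, normalOf_eq]
  apply plane_ext <;> simp <;> ring

/-- The unit normal depends on the direction of the tangent only, so it may be computed from any
parametrization of the edge with the right orientation. -/
lemma unitNormalOf_smul (A : Matrix (Fin 2) (Fin 2) ℝ) {c : ℝ} (hc : 0 < c) (τ : Plane) :
    unitNormalOf A (c • τ) = unitNormalOf A τ := by
  rw [unitNormalOf, unitNormalOf, normalOf_smul, tensorApp_smul_left, tensorApp_smul_right, ← mul_assoc,
    Real.sqrt_mul (mul_self_nonneg c), Real.sqrt_mul_self hc.le, smul_smul]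
  congr 1
  field_simp

section

variable {A : Matrix (Fin 2) (Fin 2) ℝ} (hA : IsMetricMatrix A) {τ : Plane} (hτ : τ ≠ 0)
include hA hτ

lemma tensorApp_normalOf_self_pos : 0 < tensorApp A (normalOf A τ) (normalOf A τ) := by
  rw [tensorApp_normalOf_self hA.symm hA.det_pos.ne']
  exact mul_pos (inv_pos.2 hA.det_pos) (hA.pos τ hτ)

lemma tensorApp_unitNormalOf_self : tensorApp A (unitNormalOf A τ) (unitNormalOf A τ) = 1 := by
  have h := tensorApp_normalOf_self_pos hA hτ
  rw [unitNormalOf, tensorApp_smul_left, tensorApp_smul_right]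
  have h2 := Real.mul_self_sqrt h.le
  have h3 := (Real.sqrt_pos.2 h).ne'
  field_simp
  nlinarith

omit hτ in
lemma tensorApp_unitNormalOf (X : Plane) : tensorApp A (unitNormalOf A τ) X
    = (Real.sqrt (tensorApp A (normalOf A τ) (normalOf A τ)))⁻¹ * cross τ X := by
  rw [unitNormalOf, tensorApp_smul_left, tensorApp_normalOf hA.symm hA.det_pos.ne' τ X]

omit hτ in
lemma tensorApp_unitNormalOf_tangent : tensorApp A (unitNormalOf A τ) τ = 0 := by
  rw [tensorApp_unitNormalOf hA]; simp [cross]; right; ring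

lemma cross_unitNormalOf_pos : 0 < cross τ (unitNormalOf A τ) := by
  have h := tensorApp_unitNormalOf_self hA hτ
  rw [tensorApp_unitNormalOf hA] at h
  by_contra hc
  have h2 : (Real.sqrt (tensorApp A (normalOf A τ) (normalOf A τ)))⁻¹ * cross τ (unitNormalOf A τ) ≤ 0 :=
    mul_nonpos_of_nonneg_of_nonpos (by positivity) (not_lt.1 hc)
  linarith

end

namespace CurvedMesh

variable {Ω : Set Plane} {ι : Type} {M : CurvedMesh Ω ι}

lemma IsReggeMetric.isMetricMatrix {g : PwTensor ι} (hg : M.IsReggeMetric g) {i : ι} {p : Plane}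
    (hp : p ∈ M.elem i) : IsMetricMatrix (g i p) := ⟨hg.regge.symm i p hp, hg.pos i p hp⟩

/-- A Regge tensor on an element extends to a smooth symmetric tensor on the plane. -/
lemma IsRegge.exists_extension {σ : PwTensor ι} (hσ : M.IsRegge σ) (i : ι) :
    ∃ G : Plane → Matrix (Fin 2) (Fin 2) ℝ, (∀ a b, ContDiff ℝ ∞ fun p => G p a b) ∧
      (∀ p, (G p).IsSymm) ∧ ∀ p ∈ M.elem i, σ i p = G p := by
  choose f hf hfe using fun a b => hσ.smooth i a b
  refine ⟨fun p => Matrix.of ![![f 0 0 p, f 0 1 p], ![f 0 1 p, f 1 1 p]], ?_, ?_, ?_⟩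
  · intro a b
    fin_cases a <;> fin_cases b
    · exact hf 0 0
    · exact hf 0 1
    · exact hf 0 1
    · exact hf 1 1
  · intro p
    ext a b
    fin_cases a <;> fin_cases b <;> simp
  · intro p hp
    ext a b
    have hs := (hσ.symm i p hp).apply 0 1
    fin_cases a <;> fin_cases b
    · exact hfe 0 0 hp
    · exact hfe 0 1 hp
    · exact hs.trans (hfe 0 1 hp)
    · exact hfe 1 1 hp

end CurvedMesh

lemma contDiff_tensorL {G : Plane → Matrix (Fin 2) (Fin 2) ℝ}
    (hG : ∀ a b, ContDiff ℝ ∞ fun p => G p a b) : ContDiff ℝ ∞ fun p => tensorL (G p) :=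
  ContDiff.sum fun a _ => ContDiff.sum fun b _ => (hG a b).smul contDiff_const

lemma contDiffAt_planeVec {E : Type} [NormedAddCommGroup E] [NormedSpace ℝ E] {f : E → Fin 2 → ℝ} {x : E}
    (h : ∀ a, ContDiffAt ℝ ∞ (fun y => f y a) x) : ContDiffAt ℝ ∞ (fun y => planeVec (f y)) x :=
  ((EuclideanSpace.equiv (Fin 2) ℝ).symm.contDiff (n := ∞)).contDiffAt.comp x (contDiffAt_pi.2 h)

lemma ContDiffAt.plane_apply {E : Type} [NormedAddCommGroup E] [NormedSpace ℝ E] {f : E → Plane} {x : E}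
    (h : ContDiffAt ℝ ∞ f x) (a : Fin 2) : ContDiffAt ℝ ∞ (fun y => f y a) x :=
  (coordL a).contDiff.contDiffAt.comp x h

lemma ContDiffAt.tensorApp {E : Type} [NormedAddCommGroup E] [NormedSpace ℝ E]
    {A : E → Matrix (Fin 2) (Fin 2) ℝ} {u v : E → Plane} {x : E}
    (hA : ∀ a b, ContDiffAt ℝ ∞ (fun y => A y a b) x) (hu : ContDiffAt ℝ ∞ u x)
    (hv : ContDiffAt ℝ ∞ v x) : ContDiffAt ℝ ∞ (fun y => tensorApp (A y) (u y) (v y)) x := by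
  simp only [tensorApp_expand]
  exact ((((hA 0 0).mul (hu.plane_apply 0)).mul (hv.plane_apply 0)).add
    (((hA 0 1).mul (hu.plane_apply 0)).mul (hv.plane_apply 1))).add
    ((((hA 1 0).mul (hu.plane_apply 1)).mul (hv.plane_apply 0)).add
    (((hA 1 1).mul (hu.plane_apply 1)).mul (hv.plane_apply 1)))

lemma ContDiffAt.matrix_det {E : Type} [NormedAddCommGroup E] [NormedSpace ℝ E]
    {A : E → Matrix (Fin 2) (Fin 2) ℝ} {x : E} (hA : ∀ a b, ContDiffAt ℝ ∞ (fun y => A y a b) x) :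
    ContDiffAt ℝ ∞ (fun y => (A y).det) x := by
  simp only [Matrix.det_fin_two]
  exact ((hA 0 0).mul (hA 1 1)).sub ((hA 0 1).mul (hA 1 0))

lemma ContDiffAt.unitNormalOf {E : Type} [NormedAddCommGroup E] [NormedSpace ℝ E]
    {A : E → Matrix (Fin 2) (Fin 2) ℝ} {τ : E → Plane} {x : E}
    (hA : ∀ a b, ContDiffAt ℝ ∞ (fun y => A y a b) x) (hτ : ContDiffAt ℝ ∞ τ x)
    (hm : IsMetricMatrix (A x)) (h0 : τ x ≠ 0) :
    ContDiffAt ℝ ∞ (fun y => unitNormalOf (A y) (τ y)) x := by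
  have hN : ContDiffAt ℝ ∞ (fun y => normalOf (A y) (τ y)) x := by
    simp only [normalOf_eq]
    refine ((ContDiffAt.matrix_det hA).inv hm.det_pos.ne').smul (contDiffAt_planeVec fun a => ?_)
    fin_cases a
    · exact (((hA 1 1).mul (hτ.plane_apply 1)).add ((hA 0 1).mul (hτ.plane_apply 0))).neg
    · exact ((hA 1 0).mul (hτ.plane_apply 1)).add ((hA 0 0).mul (hτ.plane_apply 0))
  have hpos := tensorApp_normalOf_self_pos hm h0
  exact (((ContDiffAt.tensorApp hA hN hN).sqrt hpos.ne').inv (Real.sqrt_pos.2 hpos).ne').smul hN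

end

/-! ### One-sided geodesic coordinates along an edge -/

noncomputable section

open Filter Topology

set_option maxSynthPendingDepth 3

namespace CurvedMesh

variable {Ω : Set Plane} {ι : Type}

/-- The curve `γ` parametrizes an edge of the element `m`, in the boundary orientation if `ς = 1`,
against it if `ς = -1`. -/
structure IsSideCurve (M : CurvedMesh Ω ι) (m : ι) (γ : ℝ → Plane) (ς : ℝ) : Prop where
  smooth : ContDiff ℝ ∞ γ
  injOn : InjOn γ (Ioo 0 1)
  sign : ς = 1 ∨ ς = -1
  tangent : ∃ l, ∀ s ∈ Ioo (0 : ℝ) 1, ∃ t ∈ Ioo (0 : ℝ) 1, M.edgeParam m l t = γ s ∧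
    ∃ c : ℝ, 0 < c ∧ M.tangent m l t = c • ς • deriv γ s

/-- Geodesic coordinates normal to an edge, on the side of the element `m`. -/
structure IsSideMap (M : CurvedMesh Ω ι) (g : PwTensor ι) (m : ι) (γ : ℝ → Plane) (ς a b ρ : ℝ)
    (f : OpenPartialHomeomorph Plane Plane) : Prop where
  smooth : ContDiff ℝ ∞ f
  smooth_symm : ContDiffOn ℝ ∞ f.symm f.target
  det_ne : ∀ y ∈ f.source, (fderiv ℝ f y).det ≠ 0
  box : closedPlaneBox ρ a b ⊆ f.source
  curve : ∀ s ∈ Icc a b, f (planeVec ![0, s]) = γ s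
  radial : ∀ s ∈ Icc a b, fderiv ℝ f (planeVec ![0, s]) (coordVec 0)
    = ς • unitNormalOf (g m (γ s)) (ς • deriv γ s)
  mem_iff : ∀ y ∈ closedPlaneBox ρ a b, f y ∈ M.elem m ↔ 0 ≤ ς * y 0
  interior_iff : ∀ y ∈ closedPlaneBox ρ a b, f y ∈ interior (M.elem m) ↔ 0 < ς * y 0
  gauss : ∀ y ∈ closedPlaneBox ρ a b, 0 ≤ ς * y 0 →
    tensorApp (g m (f y)) (fderiv ℝ f y (coordVec 0)) (fderiv ℝ f y (coordVec 0)) = 1 ∧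
    tensorApp (g m (f y)) (fderiv ℝ f y (coordVec 0)) (fderiv ℝ f y (coordVec 1)) = 0

lemma closedPlaneBox_mono {ρ' ρ a b : ℝ} (h : ρ' ≤ ρ) : closedPlaneBox ρ' a b ⊆ closedPlaneBox ρ a b :=
  fun _ hy => ⟨⟨by linarith [hy.1.1], by linarith [hy.1.2]⟩, hy.2⟩

lemma IsSideMap.mono {M : CurvedMesh Ω ι} {g : PwTensor ι} {m : ι} {γ : ℝ → Plane} {ς a b ρ ρ' : ℝ}
    {f : OpenPartialHomeomorph Plane Plane} (h : M.IsSideMap g m γ ς a b ρ f) (hρ : ρ' ≤ ρ) :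
    M.IsSideMap g m γ ς a b ρ' f where
  smooth := h.smooth
  smooth_symm := h.smooth_symm
  det_ne := h.det_ne
  box := (closedPlaneBox_mono hρ).trans h.box
  curve := h.curve
  radial := h.radial
  mem_iff y hy := h.mem_iff y (closedPlaneBox_mono hρ hy)
  interior_iff y hy := h.interior_iff y (closedPlaneBox_mono hρ hy)
  gauss y hy := h.gauss y (closedPlaneBox_mono hρ hy)

lemma isSideCurve_edgeParam (M : CurvedMesh Ω ι) (i : ι) (k : Fin 3) :
    M.IsSideCurve i (M.edgeParam i k) 1 where
  smooth := M.contDiff_edgeParam i k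
  injOn := (M.edgeParam_injOn i k).mono Ioo_subset_Icc_self
  sign := Or.inl rfl
  tangent := ⟨k, fun s hs => ⟨s, hs, rfl, 1, one_pos, by rw [one_smul, one_smul]; rfl⟩⟩

lemma IsNeighbor.isSideCurve {M : CurvedMesh Ω ι} {i j : ι} {k : Fin 3} (h : M.IsNeighbor i j k) :
    M.IsSideCurve j (M.edgeParam i k) (-1) where
  smooth := M.contDiff_edgeParam i k
  injOn := (M.edgeParam_injOn i k).mono Ioo_subset_Icc_self
  sign := Or.inr rfl
  tangent := by
    obtain ⟨l, hl⟩ := h.exists_edge_eq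
    refine ⟨l, fun s hs => ?_⟩
    have h1 := M.edgeCoord_mem_Ioo hl hs
    have h2 := (M.edgeParam_edgeCoord j l (hl ▸ M.edgeParam_mem_edge i k hs)).2
    obtain ⟨c, hc, hc'⟩ := M.tangent_antiparallel h.ne hs h1 h2
    exact ⟨_, h1, h2, c, hc, by rw [hc', smul_smul, mul_neg_one]; rfl⟩

section

variable {M : CurvedMesh Ω ι} {m : ι} {γ : ℝ → Plane} {ς : ℝ}

lemma IsSideCurve.mem_elem (h : M.IsSideCurve m γ ς) {s : ℝ} (hs : s ∈ Ioo (0 : ℝ) 1) :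
    γ s ∈ M.elem m := by
  obtain ⟨l, hl⟩ := h.tangent
  obtain ⟨t, ht, h1, -⟩ := hl s hs
  exact h1 ▸ M.edgeParam_mem_elem m l (Ioo_subset_Icc_self ht)

lemma IsSideCurve.smul_deriv_ne_zero (h : M.IsSideCurve m γ ς) {s : ℝ} (hs : s ∈ Ioo (0 : ℝ) 1) :
    ς • deriv γ s ≠ 0 := by
  obtain ⟨l, hl⟩ := h.tangent
  obtain ⟨t, ht, -, c, hc, h2⟩ := hl s hs
  intro h0
  rw [h0, smul_zero] at h2
  exact M.tangent_ne_zero m l (Ioo_subset_Icc_self ht) h2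

lemma IsSideCurve.sign_mul (h : M.IsSideCurve m γ ς) : ς * ς = 1 := by
  rcases h.sign with rfl | rfl <;> norm_num

/-- A function vanishing on a segment and increasing across it has the sign of the transversal
coordinate. -/
lemma sign_of_deriv_pos {u : ℝ → ℝ} {ρ : ℝ} (hρ : 0 ≤ ρ) (hd : ∀ r ∈ Icc (-ρ) ρ, 0 < deriv u r)
    (h0 : u 0 = 0) {r : ℝ} (hr : r ∈ Icc (-ρ) ρ) : (0 ≤ u r ↔ 0 ≤ r) ∧ (0 < u r ↔ 0 < r) := by
  have hm : StrictMonoOn u (Icc (-ρ) ρ) := by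
    refine strictMonoOn_of_deriv_pos (convex_Icc _ _) (fun x hx => ?_) fun x hx =>
      hd x (_root_.interior_subset hx)
    exact (differentiableAt_of_deriv_ne_zero (hd x hx).ne').continuousAt.continuousWithinAt
  have h00 : (0 : ℝ) ∈ Icc (-ρ) ρ := ⟨by linarith, hρ⟩
  have h1 := hm.le_iff_le h00 hr
  have h2 := hm.lt_iff_lt h00 hr
  rw [h0] at h1 h2
  exact ⟨h1, h2⟩

lemma cross_smul_smul (c d : ℝ) (u v : Plane) : cross (c • u) (d • v) = c * d * cross u v := by
  simp [cross]; ring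

lemma cross_swap (u v : Plane) : cross u v = - cross v u := by simp [cross]; ring

/-- The geodesic map along the curve, for a smooth extension of the metric beyond the element. The
sign `ς` lets the first coordinate increase from the element on the right of the curve to the one on
its left: the initial velocity is `ς` times the inward normal of `m`. Along radial lines the
barycentric coordinate of the edge is monotone, so the sign of the first coordinate decides
membership in the element. -/
theorem IsSideCurve.exists_isSideMap {g : PwTensor ι} (hg : M.IsReggeMetric g)
    (h : M.IsSideCurve m γ ς) {a b : ℝ} (ha : 0 < a) (hb : b < 1) {O : Set Plane}
    (hO : IsOpen O) (hγO : ∀ s ∈ Icc a b, γ s ∈ O) :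
    ∃ ρ > 0, ∃ f, M.IsSideMap g m γ ς a b ρ f ∧ ∀ y ∈ closedPlaneBox ρ a b, f y ∈ O := by
  obtain ⟨G, hG, hGs, hGe⟩ := hg.regge.exists_extension m
  -- The geodesic map is built over an interval that contains `[a, b]` in its interior, so that
  -- derivatives along the axis are two-sided at `a` and `b` as well.
  have hsub : Icc (a / 2) ((b + 1) / 2) ⊆ Ioo (0 : ℝ) 1 := fun s hs => by
    constructor <;> linarith [hs.1, hs.2]
  have hab : Icc a b ⊆ Ioo (a / 2) ((b + 1) / 2) := fun s hs => by
    constructor <;> linarith [hs.1, hs.2]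
  have hmet : ∀ s ∈ Ioo (0 : ℝ) 1, IsMetricMatrix (G (γ s)) := fun s hs => by
    rw [← hGe _ (h.mem_elem hs)]; exact hg.isMetricMatrix (h.mem_elem hs)
  have hdγ : ContDiff ℝ ∞ (deriv γ) := ((contDiff_infty_iff_deriv (𝕜 := ℝ)).1 h.smooth).2
  have hn0 : ContDiffOn ℝ ∞ (fun s => ς • unitNormalOf (G (γ s)) (ς • deriv γ s)) (Ioo 0 1) := by
    intro s hs
    exact ((ContDiffAt.unitNormalOf (fun a b => ((hG a b).comp h.smooth).contDiffAt)
      (hdγ.contDiffAt.const_smul ς) (hmet s hs) (h.smul_deriv_ne_zero hs)).const_smul ς).contDiffWithinAt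
  obtain ⟨n, hn, -, V, hV, hIV, -, hnV⟩ := hn0.exists_extension isOpen_Ioo isCompact_Icc hsub
  have hneq : ∀ s ∈ Icc (a / 2) ((b + 1) / 2), n s = ς • unitNormalOf (G (γ s)) (ς • deriv γ s) :=
    fun s hs => hnV (hIV hs)
  have hsig := h.sign_mul
  obtain ⟨ρ₁, hρ₁, F, hF, hF0, hgauss⟩ := exists_fermi_map (fun p => tensorL (G p)) (contDiff_tensorL hG)
    (fun p u v => by rw [tensorL_apply, tensorL_apply, tensorApp_comm (hGs p)]) γ n h.smooth hn
    (a := a / 2) (b := (b + 1) / 2) (fun s hs => (hmet s (hsub hs)).isInvertible)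
    (fun s hs => by
      rw [tensorL_apply, hneq s hs, tensorApp_smul_left, tensorApp_smul_right,
        tensorApp_unitNormalOf_self (hmet s (hsub hs)) (h.smul_deriv_ne_zero (hsub hs)), mul_one, hsig])
    (fun s hs => by
      have h1 := tensorApp_unitNormalOf_tangent (hmet s (hsub hs)) (τ := ς • deriv γ s)
      rw [tensorApp_smul_right] at h1
      rw [tensorL_apply, hneq s hs, tensorApp_smul_left, h1])
  have hFs : ∀ s ∈ Icc a b, fderiv ℝ F (planeVec ![0, s]) (coordVec 1) = deriv γ s := by
    intro s hs
    have h1 : HasDerivAt (fun s => F (planeVec ![0, s]))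
        (fderiv ℝ F (planeVec ![0, s]) (coordVec 1)) s :=
      HasFDerivAt.comp_hasDerivAt (l := F) s (hF.differentiable (by simp) _).hasFDerivAt
        (hasDerivAt_planeVec_snd 0 s)
    rw [← h1.deriv]
    refine EventuallyEq.deriv_eq ?_
    filter_upwards [isOpen_Ioo.mem_nhds (hab hs)] with t ht
    exact (hF0 t (Ioo_subset_Icc_self ht)).1
  have hab' : Icc a b ⊆ Icc (a / 2) ((b + 1) / 2) := hab.trans Ioo_subset_Icc_self
  have hcross : ∀ s ∈ Icc a b, 0 < cross (ς • deriv γ s) (ς • n s) := by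
    intro s hs
    have hs' := hsub (hab' hs)
    rw [hneq s (hab' hs), smul_smul, hsig, one_smul]
    exact cross_unitNormalOf_pos (hmet s hs') (h.smul_deriv_ne_zero hs')
  set K : Set Plane := (fun s => planeVec ![0, s]) '' Icc a b
  have hK : IsCompact K := isCompact_Icc.image (continuous_planeVec_snd 0)
  obtain ⟨f, hKf, hfF, hfs, hfd⟩ := hF.exists_openPartialHomeomorph_of_injOn hK (by
    rintro _ ⟨s, hs, rfl⟩ _ ⟨t, ht, rfl⟩ hst
    simp only [(hF0 s (hab' hs)).1, (hF0 t (hab' ht)).1] at hst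
    rw [h.injOn (hsub (hab' hs)) (hsub (hab' ht)) hst]) (by
    rintro _ ⟨s, hs, rfl⟩
    have h1 := cross_map (fderiv ℝ F (planeVec ![0, s])) (coordVec 0) (coordVec 1)
    rw [cross_coordVec, mul_one, (hF0 s (hab' hs)).2, hFs s hs, cross_swap] at h1
    have h2 := hcross s hs
    rw [cross_smul_smul, hsig, one_mul] at h2
    simp only
    rw [← h1]
    exact neg_ne_zero.2 h2.ne')
  obtain ⟨l, hl⟩ := h.tangent
  have hdiffF : Differentiable ℝ F := hF.differentiable (by simp)
  set P : Plane → Prop := fun p => p ∈ (M.homeo m).target ∧ (∀ l', l' ≠ l → 0 < M.bary m l' p) ∧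
      (p ∈ M.elem m ↔ 0 ≤ M.bary m l p) ∧ (p ∈ interior (M.elem m) ↔ 0 < M.bary m l p)
  have hPopen : IsOpen {p | ∀ᶠ q in 𝓝 p, P q} := isOpen_setOfPred_eventually_nhds
  set O₁ : Set Plane := {y | F y ∈ (M.homeo m).target}
  have hO₁ : IsOpen O₁ := (M.homeo m).open_target.preimage hF.continuous
  set β : Plane → ℝ := fun y => M.bary m l (F y)
  have hβ : ContDiffOn ℝ ∞ β O₁ := (M.contDiffOn_bary m l).comp hF.contDiffOn fun y hy => hy
  have hβ' : ContinuousOn (fun y => ς * fderiv ℝ β y (coordVec 0)) O₁ :=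
    continuousOn_const.mul ((hβ.continuousOn_fderiv_of_isOpen hO₁ (by simp)).clm_apply continuousOn_const)
  have hO₂ : IsOpen (O₁ ∩ (fun y => ς * fderiv ℝ β y (coordVec 0)) ⁻¹' Ioi 0) :=
    hβ'.isOpen_inter_preimage hO₁ isOpen_Ioi
  have hO₃ : IsOpen {y : Plane | y 0 ∈ Ioo (-ρ₁) ρ₁ ∧ y 1 ∈ Ioo (a / 2) ((b + 1) / 2)} :=
    isOpen_planeBox _ _ _
  obtain ⟨ρ, hρ, hbox⟩ := exists_closedPlaneBox_subset (a := a) (b := b)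
    ((((f.open_source.inter (hPopen.preimage hF.continuous)).inter hO₂).inter hO₃).inter
      (hO.preimage hF.continuous)) (fun s hs => by
    have hs01 := hsub (hab' hs)
    obtain ⟨t, ht, het, c, hc, htan⟩ := hl s hs01
    have ht' := Ioo_subset_Icc_self ht
    have hFγ : F (planeVec ![0, s]) = M.edgeParam m l t := by rw [het, (hF0 s (hab' hs)).1]
    refine ⟨⟨⟨⟨hKf ⟨s, hs, rfl⟩, ?_⟩, ?_, ?_⟩, ⟨by simpa using hρ₁, by simpa using hab hs⟩⟩, ?_⟩
    · simp only [mem_preimage, hFγ]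
      exact M.eventually_mem_elem_iff m l ht
    · simp only [O₁, mem_ofPred_eq, hFγ]
      exact M.elem_subset_target m (M.edgeParam_mem_elem m l ht')
    · obtain ⟨A, hA, c', hc', hAc⟩ := M.hasFDerivAt_bary m l ht'
      have h1 : HasFDerivAt β (A ∘L fderiv ℝ F (planeVec ![0, s])) (planeVec ![0, s]) :=
        (hFγ ▸ hA : HasFDerivAt (M.bary m l) A (F (planeVec ![0, s]))).comp _ (hdiffF _).hasFDerivAt
      simp only [mem_preimage, mem_Ioi]
      rw [h1.fderiv, ContinuousLinearMap.comp_apply, hAc, htan, (hF0 s (hab' hs)).2]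
      have h2 := hcross s hs
      rw [← one_smul ℝ (n s), cross_smul_smul]
      rw [cross_smul_smul, hsig, one_mul] at h2
      rw [show ς • deriv γ s = ς • deriv γ s from rfl, ← one_smul ℝ (n s), cross_smul_smul,
        show ς * (c' * (c * 1 * (ς * 1 * cross (deriv γ s) (n s))))
          = (ς * ς) * (c' * c * cross (deriv γ s) (n s)) by ring, hsig, one_mul]
      positivity
    · simp only [mem_preimage, (hF0 s (hab' hs)).1]
      exact hγO s hs)
  -- On the box the radial derivative of `ς * β` is positive, and `β` vanishes on the axis.
  have hsign : ∀ y ∈ closedPlaneBox ρ a b, (0 ≤ ς * β y ↔ 0 ≤ y 0) ∧ (0 < ς * β y ↔ 0 < y 0) := by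
    intro y hy
    have h1 := sign_of_deriv_pos (u := fun r => ς * β (planeVec ![r, y 1])) hρ.le (fun r hr => ?_) ?_ hy.1
    · simp only [planeVec_eta] at h1; exact h1
    · have hb' := (hbox (show planeVec ![r, y 1] ∈ closedPlaneBox ρ a b from
        ⟨by simpa using hr, by simpa using hy.2⟩)).1.1.2
      have h2 : HasDerivAt (fun r => β (planeVec ![r, y 1]))
          (fderiv ℝ β (planeVec ![r, y 1]) (coordVec 0)) r :=
        HasFDerivAt.comp_hasDerivAt (l := β) r
          (((hβ.contDiffAt (hO₁.mem_nhds hb'.1)).differentiableAt (by simp)).hasFDerivAt)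
          (hasDerivAt_planeVec_fst r (y 1))
      rw [(h2.const_mul ς).deriv]
      exact hb'.2
    · obtain ⟨t, ht, het, -⟩ := hl (y 1) (hsub (hab' hy.2))
      simp only [β]
      rw [(hF0 _ (hab' hy.2)).1, ← het, M.bary_edgeParam m l l (Ioo_subset_Icc_self ht)]
      simp
  have hP : ∀ y ∈ closedPlaneBox ρ a b, P (F y) := fun y hy => (hbox hy).1.1.1.2.self_of_nhds
  refine ⟨ρ, hρ, f, ⟨hfF ▸ hF, hfs, hfF ▸ hfd, fun y hy => (hbox hy).1.1.1.1, fun s hs => ?_,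
    fun s hs => ?_, fun y hy => ?_, fun y hy => ?_, fun y hy hy0 => ?_⟩, fun y hy => ?_⟩
  · rw [hfF]; exact (hF0 s (hab' hs)).1
  · rw [hfF, (hF0 s (hab' hs)).2, hneq s (hab' hs), hGe _ (h.mem_elem (hsub (hab' hs)))]
  · rw [hfF, (hP y hy).2.2.1]
    have := (hsign y hy).1
    rcases h.sign with rfl | rfl
    · simpa [β] using this
    · constructor
      · intro h1
        by_contra h2
        have h3 := (hsign y hy).2.2 (by linarith)
        simp only [β] at h3
        linarith
      · intro h1
        by_contra h2
        have h3 := (hsign y hy).2.1 (by simp only [β]; linarith)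
        linarith
  · rw [hfF, (hP y hy).2.2.2]
    have := (hsign y hy).2
    rcases h.sign with rfl | rfl
    · simpa [β] using this
    · constructor
      · intro h1
        by_contra h2
        have h3 := (hsign y hy).1.2 (by linarith)
        simp only [β] at h3
        linarith
      · intro h1
        by_contra h2
        have h3 := (hsign y hy).1.1 (by simp only [β]; linarith)
        linarith
  · have h1 := hgauss y (hbox hy).1.2
    have hmem : F y ∈ M.elem m := by
      rw [(hP y hy).2.2.1]
      rcases h.sign with rfl | rfl
      · have := (hsign y hy).1.2 (by linarith)
        simpa [β] using this
      · by_contra h2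
        have h3 := (hsign y hy).2.1 (by simp only [β]; linarith)
        linarith
    simp only [tensorL_apply] at h1
    rw [hfF, hGe _ hmem]
    exact h1
  · rw [hfF]
    exact (hbox hy).2

end

end CurvedMesh

end

/-! ### Two-sided tubes around interior edges -/

noncomputable section

open Filter Topology

lemma ContinuousOn.of_isClosed_cover {X Y : Type} [TopologicalSpace X] [TopologicalSpace Y] {f : X → Y}
    {Q A B : Set X} (hA : IsClosed A) (hB : IsClosed B) (hQ : Q ⊆ A ∪ B) (h1 : ContinuousOn f (Q ∩ A))
    (h2 : ContinuousOn f (Q ∩ B)) : ContinuousOn f Q := by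
  intro y hy
  have key : ∀ C : Set X, IsClosed C → ContinuousOn f (Q ∩ C) → ContinuousWithinAt f (Q ∩ C) y := by
    intro C hC h
    by_cases hyC : y ∈ C
    · exact h y ⟨hy, hyC⟩
    · have : y ∉ closure (Q ∩ C) := fun h' =>
        hyC (hC.closure_subset_iff.2 inter_subset_right h')
      rw [ContinuousWithinAt, notMem_closure_iff_nhdsWithin_eq_bot.1 this]
      exact tendsto_bot
  refine ((key A hA h1).union (key B hB h2)).mono ?_
  rw [← inter_union_distrib_left]
  exact fun z hz => ⟨hz, hQ hz⟩

namespace CurvedMesh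

variable {Ω : Set Plane} {ι : Type}

/-- Geodesic coordinates on both sides of an interior edge, and the chart `e` they form. -/
structure EdgeTube (M : CurvedMesh Ω ι) (g : PwTensor ι) (i j : ι) (k : Fin 3) where
  (a b ρ : ℝ)
  (fp fm e : OpenPartialHomeomorph Plane Plane)
  neighbor : M.IsNeighbor i j k
  a_pos : 0 < a
  a_lt_b : a < b
  b_lt_one : b < 1
  ρ_pos : 0 < ρ
  side_p : M.IsSideMap g i (M.edgeParam i k) 1 a b ρ fp
  side_m : M.IsSideMap g j (M.edgeParam i k) (-1) a b ρ fm
  target_eq : e.target = planeBox ρ a b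
  symm_p : ∀ y ∈ planeBox ρ a b, 0 ≤ y 0 → e.symm y = fp y
  symm_m : ∀ y ∈ planeBox ρ a b, y 0 ≤ 0 → e.symm y = fm y

lemma plane_eq_of_fst_zero {y : Plane} (h : y 0 = 0) : y = planeVec ![0, y 1] := by
  rw [← h, planeVec_eta]

/-- The two side maps agree on the axis and map the closed half boxes into different elements, whose
interiors are disjoint; so their pasting is injective, and continuous in both directions by the
closed cover. Its image is open because only the two neighbours meet at an inner point of the edge.
In Cartesian coordinates it is in general only continuous across the edge. -/
theorem IsNeighbor.exists_edgeTube [Finite ι] {M : CurvedMesh Ω ι} {g : PwTensor ι}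
    (hΩ : IsOpen Ω) (hg : M.IsReggeMetric g) {i j : ι} {k : Fin 3} (h : M.IsNeighbor i j k) {a b : ℝ}
    (ha : 0 < a) (hab : a < b) (hb : b < 1) {O : Set Plane} (hO : IsOpen O)
    (hγO : ∀ s ∈ Icc a b, M.edgeParam i k s ∈ O) :
    ∃ T : M.EdgeTube g i j k, T.a = a ∧ T.b = b ∧ T.e.source ⊆ O := by
  obtain ⟨ρ₁, hρ₁, fp, hfp, hfpO⟩ :=
    (M.isSideCurve_edgeParam i k).exists_isSideMap hg ha hb hO hγO
  obtain ⟨ρ₂, hρ₂, fm, hfm, hfmO⟩ := h.isSideCurve.exists_isSideMap hg ha hb hO hγO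
  set ρ := min ρ₁ ρ₂
  have hρ : 0 < ρ := lt_min hρ₁ hρ₂
  replace hfp := hfp.mono (min_le_left ρ₁ ρ₂)
  replace hfm := hfm.mono (min_le_right ρ₁ ρ₂)
  replace hfpO : ∀ y ∈ closedPlaneBox ρ a b, fp y ∈ O := fun y hy =>
    hfpO y (closedPlaneBox_mono (min_le_left ρ₁ ρ₂) hy)
  replace hfmO : ∀ y ∈ closedPlaneBox ρ a b, fm y ∈ O := fun y hy =>
    hfmO y (closedPlaneBox_mono (min_le_right ρ₁ ρ₂) hy)
  set Q := planeBox ρ a b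
  have hQ : IsOpen Q := isOpen_planeBox ρ a b
  have hQc : Q ⊆ closedPlaneBox ρ a b := planeBox_subset_closed ρ a b
  have hpi : ∀ y ∈ Q, 0 ≤ y 0 → fp y ∈ M.elem i := fun y hy h0 =>
    (hfp.mem_iff y (hQc hy)).2 (by linarith)
  have hpint : ∀ y ∈ Q, 0 < y 0 → fp y ∈ interior (M.elem i) := fun y hy h0 =>
    (hfp.interior_iff y (hQc hy)).2 (by linarith)
  have hmj : ∀ y ∈ Q, y 0 ≤ 0 → fm y ∈ M.elem j := fun y hy h0 =>
    (hfm.mem_iff y (hQc hy)).2 (by linarith)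
  have hmint : ∀ y ∈ Q, y 0 < 0 → fm y ∈ interior (M.elem j) := fun y hy h0 =>
    (hfm.interior_iff y (hQc hy)).2 (by linarith)
  have hmni : ∀ y ∈ Q, y 0 < 0 → fm y ∉ M.elem i := fun y hy h0 =>
    M.interior_disjoint h.ne.symm (hmint y hy h0)
  have hpnj : ∀ y ∈ Q, 0 < y 0 → fp y ∉ M.elem j := fun y hy h0 =>
    M.interior_disjoint h.ne (hpint y hy h0)
  have hpγ : ∀ y ∈ Q, y 0 = 0 → fp y = M.edgeParam i k (y 1) := fun y hy h0 => by
    conv_lhs => rw [plane_eq_of_fst_zero h0]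
    exact hfp.curve _ (Ioo_subset_Icc_self hy.2)
  have hmγ : ∀ y ∈ Q, y 0 = 0 → fm y = M.edgeParam i k (y 1) := fun y hy h0 => by
    conv_lhs => rw [plane_eq_of_fst_zero h0]
    exact hfm.curve _ (Ioo_subset_Icc_self hy.2)
  have hpm : ∀ y ∈ Q, y 0 = 0 → fp y = fm y := fun y hy h0 => by rw [hpγ y hy h0, hmγ y hy h0]
  classical
  let G : Plane → Plane := fun y => if 0 ≤ y 0 then fp y else fm y
  let J : Plane → Plane := fun p => if p ∈ M.elem i then fp.symm p else fm.symm p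
  have hGp : ∀ y, 0 ≤ y 0 → G y = fp y := fun y h0 => if_pos h0
  have hGm : ∀ y ∈ Q, y 0 ≤ 0 → G y = fm y := by
    intro y hy h0
    rcases h0.lt_or_eq with h1 | h1
    · exact if_neg (not_le.2 h1)
    · rw [hGp y h1.ge, hpm y hy h1]
  have hps : ∀ y ∈ Q, fp.symm (fp y) = y := fun y hy => fp.left_inv (hfp.box (hQc hy))
  have hms : ∀ y ∈ Q, fm.symm (fm y) = y := fun y hy => fm.left_inv (hfm.box (hQc hy))
  have hJG : ∀ y ∈ Q, J (G y) = y := by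
    intro y hy
    rcases le_or_gt 0 (y 0) with h0 | h0
    · rw [hGp y h0]
      simp only [J, if_pos (hpi y hy h0)]
      exact hps y hy
    · rw [hGm y hy h0.le]
      simp only [J, if_neg (hmni y hy h0)]
      exact hms y hy
  have hGQ : ContinuousOn G Q := by
    refine ContinuousOn.of_isClosed_cover (A := {y | 0 ≤ y 0}) (B := {y | y 0 ≤ 0})
      (isClosed_Ici.preimage (contDiff_coord 0).continuous)
      (isClosed_Iic.preimage (contDiff_coord 0).continuous) (fun y _ => le_total 0 (y 0)) ?_ ?_
    · exact hfp.smooth.continuous.continuousOn.congr fun y hy => hGp y hy.2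
    · exact hfm.smooth.continuous.continuousOn.congr fun y hy => hGm y hy.1 hy.2
  have hSi : ∀ y ∈ Q, G y ∈ M.elem i → 0 ≤ y 0 := by
    intro y hy hyi
    by_contra h0
    rw [hGm y hy (not_le.1 h0).le] at hyi
    exact hmni y hy (not_le.1 h0) hyi
  have hSj : ∀ y ∈ Q, G y ∈ M.elem j → y 0 ≤ 0 := by
    intro y hy hyi
    by_contra h0
    rw [hGp y (not_le.1 h0).le] at hyi
    exact hpnj y hy (not_le.1 h0) hyi
  have hJS : ContinuousOn J (G '' Q) := by
    refine ContinuousOn.of_isClosed_cover (M.isClosed_elem i) (M.isClosed_elem j) ?_ ?_ ?_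
    · rintro _ ⟨y, hy, rfl⟩
      rcases le_total 0 (y 0) with h0 | h0
      · exact Or.inl (by rw [hGp y h0]; exact hpi y hy h0)
      · exact Or.inr (by rw [hGm y hy h0]; exact hmj y hy h0)
    · refine (fp.continuousOn_symm.mono ?_).congr fun p hp => if_pos hp.2
      rintro _ ⟨⟨y, hy, rfl⟩, hyi⟩
      rw [hGp y (hSi y hy hyi)]
      exact fp.map_source (hfp.box (hQc hy))
    · refine (fm.continuousOn_symm.mono ?_).congr ?_
      · rintro _ ⟨⟨y, hy, rfl⟩, hyj⟩
        rw [hGm y hy (hSj y hy hyj)]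
        exact fm.map_source (hfm.box (hQc hy))
      · rintro _ ⟨⟨y, hy, rfl⟩, hyj⟩
        rw [hJG y hy, hGm y hy (hSj y hy hyj), hms y hy]
  have hSopen : IsOpen (G '' Q) := by
    rw [isOpen_iff_mem_nhds]
    rintro _ ⟨y, hy, rfl⟩
    rcases lt_trichotomy 0 (y 0) with h0 | h0 | h0
    · have hopen : IsOpen (fp '' (Q ∩ {y | 0 < y 0})) := fp.isOpen_image_of_subset_source
        (hQ.inter (isOpen_Ioi.preimage (contDiff_coord 0).continuous))
        (inter_subset_left.trans (hQc.trans hfp.box))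
      rw [hGp y h0.le]
      refine mem_of_superset (hopen.mem_nhds ⟨y, ⟨hy, h0⟩, rfl⟩) ?_
      rintro _ ⟨z, hz, rfl⟩
      exact ⟨z, hz.1, hGp z (le_of_lt hz.2)⟩
    -- A point near the axis lies in `i` or in `j`, and the inverse of the corresponding side map
    -- brings it to the half box of the right sign.
    · have hzi := h.union_mem_nhds hΩ (s := y 1) ⟨ha.trans hy.2.1, hy.2.2.trans hb⟩
      have hyp := hfp.box (hQc hy)
      have hym := hfm.box (hQc hy)
      have e1 : ∀ᶠ q in 𝓝 (fp y), q ∈ fp.target ∧ fp.symm q ∈ Q := by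
        refine Filter.Eventually.and (fp.open_target.mem_nhds (fp.map_source hyp)) ?_
        exact (fp.continuousAt_symm (fp.map_source hyp)).eventually
          (by rw [hps y hy]; exact hQ.mem_nhds hy)
      have e2 : ∀ᶠ q in 𝓝 (fm y), q ∈ fm.target ∧ fm.symm q ∈ Q := by
        refine Filter.Eventually.and (fm.open_target.mem_nhds (fm.map_source hym)) ?_
        exact (fm.continuousAt_symm (fm.map_source hym)).eventually
          (by rw [hms y hy]; exact hQ.mem_nhds hy)
      rw [← hpm y hy h0.symm] at e2
      rw [← hpγ y hy h0.symm] at hzi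
      rw [hGp y h0.le]
      filter_upwards [e1, e2, hzi] with q hq1 hq2 hq
      rcases hq with hq | hq
      · refine ⟨fp.symm q, hq1.2, ?_⟩
        have h2 := (hfp.mem_iff _ (hQc hq1.2)).1 (by rwa [fp.right_inv hq1.1])
        rw [hGp _ (by linarith), fp.right_inv hq1.1]
      · refine ⟨fm.symm q, hq2.2, ?_⟩
        have h2 := (hfm.mem_iff _ (hQc hq2.2)).1 (by rwa [fm.right_inv hq2.1])
        rw [hGm _ hq2.2 (by linarith), fm.right_inv hq2.1]
    · have hopen : IsOpen (fm '' (Q ∩ {y | y 0 < 0})) := fm.isOpen_image_of_subset_source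
        (hQ.inter (isOpen_Iio.preimage (contDiff_coord 0).continuous))
        (inter_subset_left.trans (hQc.trans hfm.box))
      rw [hGm y hy h0.le]
      refine mem_of_superset (hopen.mem_nhds ⟨y, ⟨hy, h0⟩, rfl⟩) ?_
      rintro _ ⟨z, hz, rfl⟩
      exact ⟨z, hz.1, hGm z hz.1 (le_of_lt hz.2)⟩
  let e : OpenPartialHomeomorph Plane Plane :=
    { toFun := J
      invFun := G
      source := G '' Q
      target := Q
      map_source' := by rintro _ ⟨y, hy, rfl⟩; rwa [hJG y hy]
      map_target' := fun y hy => ⟨y, hy, rfl⟩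
      left_inv' := by rintro _ ⟨y, hy, rfl⟩; rw [hJG y hy]
      right_inv' := fun y hy => hJG y hy
      open_source := hSopen
      open_target := hQ
      continuousOn_toFun := hJS
      continuousOn_invFun := hGQ }
  refine ⟨⟨a, b, ρ, fp, fm, e, h, ha, hab, hb, hρ, hfp, hfm, rfl, fun y _ h0 => hGp y h0, hGm⟩,
    rfl, rfl, ?_⟩
  rintro _ ⟨y, hy, rfl⟩
  rcases le_total 0 (y 0) with h0 | h0
  · rw [hGp y h0]; exact hfpO y (hQc hy)
  · rw [hGm y hy h0]; exact hfmO y (hQc hy)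

namespace EdgeTube

variable {M : CurvedMesh Ω ι} {g : PwTensor ι} {i j : ι} {k : Fin 3} (T : M.EdgeTube g i j k)

/-- `f` is the side map of the tube in the element `m`, which is the side of sign `ς`. -/
def HasSide (m : ι) (f : OpenPartialHomeomorph Plane Plane) (ς : ℝ) : Prop :=
  (m = i ∧ f = T.fp ∧ ς = 1) ∨ (m = j ∧ f = T.fm ∧ ς = -1)

lemma hasSide_p : T.HasSide i T.fp 1 := Or.inl ⟨rfl, rfl, rfl⟩

lemma hasSide_m : T.HasSide j T.fm (-1) := Or.inr ⟨rfl, rfl, rfl⟩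

/-- The box of the coordinates of the tube. -/
def box : Set Plane := planeBox T.ρ T.a T.b

lemma isOpen_box : IsOpen T.box := isOpen_planeBox _ _ _

lemma box_subset : T.box ⊆ closedPlaneBox T.ρ T.a T.b := planeBox_subset_closed _ _ _

lemma e_mem_box {p : Plane} (hp : p ∈ T.e.source) : T.e p ∈ T.box := by
  have := T.e.map_source hp
  rwa [T.target_eq] at this

lemma symm_mem_source {y : Plane} (hy : y ∈ T.box) : T.e.symm y ∈ T.e.source :=
  T.e.map_target (by rw [T.target_eq]; exact hy)

lemma e_symm {y : Plane} (hy : y ∈ T.box) : T.e (T.e.symm y) = y :=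
  T.e.right_inv (by rw [T.target_eq]; exact hy)

lemma Ioo_mem {s : ℝ} (hs : s ∈ Icc T.a T.b) : s ∈ Ioo (0 : ℝ) 1 :=
  ⟨T.a_pos.trans_le hs.1, hs.2.trans_lt T.b_lt_one⟩

variable {T} {m : ι} {f : OpenPartialHomeomorph Plane Plane} {ς : ℝ}

lemma HasSide.sign (h : T.HasSide m f ς) : ς = 1 ∨ ς = -1 := by
  rcases h with ⟨-, -, h⟩ | ⟨-, -, h⟩
  · exact Or.inl h
  · exact Or.inr h

lemma HasSide.sign_mul (h : T.HasSide m f ς) : ς * ς = 1 := by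
  rcases h.sign with rfl | rfl <;> norm_num

lemma HasSide.eq_or_eq (h : T.HasSide m f ς) : m = i ∨ m = j := by
  rcases h with ⟨h, -⟩ | ⟨h, -⟩
  · exact Or.inl h
  · exact Or.inr h

lemma HasSide.isSideMap (h : T.HasSide m f ς) :
    M.IsSideMap g m (M.edgeParam i k) ς T.a T.b T.ρ f := by
  rcases h with ⟨rfl, rfl, rfl⟩ | ⟨rfl, rfl, rfl⟩
  · exact T.side_p
  · exact T.side_m

lemma HasSide.isSideCurve (h : T.HasSide m f ς) : M.IsSideCurve m (M.edgeParam i k) ς := by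
  rcases h with ⟨rfl, rfl, rfl⟩ | ⟨rfl, rfl, rfl⟩
  · exact M.isSideCurve_edgeParam _ k
  · exact T.neighbor.isSideCurve

lemma HasSide.symm_eq (h : T.HasSide m f ς) {y : Plane} (hy : y ∈ T.box) (h0 : 0 ≤ ς * y 0) :
    T.e.symm y = f y := by
  rcases h with ⟨rfl, rfl, rfl⟩ | ⟨rfl, rfl, rfl⟩
  · exact T.symm_p y hy (by linarith)
  · exact T.symm_m y hy (by linarith)

/-- On the side of `m` this is the sign property of its side map; on the other side the point is
interior to the neighbour, hence outside `m`. -/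
lemma HasSide.symm_mem_iff (h : T.HasSide m f ς) {y : Plane} (hy : y ∈ T.box) :
    (T.e.symm y ∈ M.elem m ↔ 0 ≤ ς * y 0) ∧ (T.e.symm y ∈ interior (M.elem m) ↔ 0 < ς * y 0) := by
  have hyc := T.box_subset hy
  by_cases h0 : 0 ≤ ς * y 0
  · rw [h.symm_eq hy h0]
    exact ⟨h.isSideMap.mem_iff y hyc, h.isSideMap.interior_iff y hyc⟩
  · have key : T.e.symm y ∉ M.elem m := by
      rcases h with ⟨rfl, rfl, rfl⟩ | ⟨rfl, rfl, rfl⟩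
      · rw [T.hasSide_m.symm_eq hy (by linarith)]
        exact M.interior_disjoint T.neighbor.ne.symm ((T.side_m.interior_iff y hyc).2 (by linarith))
      · rw [T.hasSide_p.symm_eq hy (by linarith)]
        exact M.interior_disjoint T.neighbor.ne ((T.side_p.interior_iff y hyc).2 (by linarith))
    exact ⟨iff_of_false key h0, iff_of_false (fun h' => key (_root_.interior_subset h'))
      (fun h' => h0 h'.le)⟩

lemma HasSide.mem_iff (h : T.HasSide m f ς) {p : Plane} (hp : p ∈ T.e.source) :
    (p ∈ M.elem m ↔ 0 ≤ ς * T.e p 0) ∧ (p ∈ interior (M.elem m) ↔ 0 < ς * T.e p 0) := by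
  have := h.symm_mem_iff (T.e_mem_box hp)
  rwa [T.e.left_inv hp] at this

lemma HasSide.f_e (h : T.HasSide m f ς) {p : Plane} (hp : p ∈ T.e.source) (hm : p ∈ M.elem m) :
    f (T.e p) = p := by
  rw [← h.symm_eq (T.e_mem_box hp) ((h.mem_iff hp).1.1 hm), T.e.left_inv hp]

lemma HasSide.e_mem_source (h : T.HasSide m f ς) {p : Plane} (hp : p ∈ T.e.source) :
    T.e p ∈ f.source := h.isSideMap.box (T.box_subset (T.e_mem_box hp))

lemma HasSide.e_eq (h : T.HasSide m f ς) {p : Plane} (hp : p ∈ T.e.source) (hm : p ∈ M.elem m) :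
    T.e p = f.symm p := by
  conv_rhs => rw [← h.f_e hp hm]
  exact (f.left_inv (h.e_mem_source hp)).symm

lemma HasSide.mem_target (h : T.HasSide m f ς) {p : Plane} (hp : p ∈ T.e.source)
    (hm : p ∈ M.elem m) : p ∈ f.target := by
  rw [← h.f_e hp hm]; exact f.map_source (h.e_mem_source hp)

variable (T)

lemma exists_hasSide_of_sign (y : Plane) : ∃ m f ς, T.HasSide m f ς ∧ 0 ≤ ς * y 0 := by
  rcases le_total 0 (y 0) with h | h
  · exact ⟨_, _, _, T.hasSide_p, by linarith⟩
  · exact ⟨_, _, _, T.hasSide_m, by linarith⟩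

lemma mem_punctured {p : Plane} (hp : p ∈ T.e.source) : p ∈ M.punctured := by
  obtain ⟨m, f, ς, h, h0⟩ := T.exists_hasSide_of_sign (T.e p)
  rcases h0.lt_or_eq with h1 | h1
  · exact M.interior_subset_punctured m ((h.mem_iff hp).2.2 h1)
  · have h2 : T.e p 0 = 0 := by rcases h.sign with rfl | rfl <;> linarith
    have h3 := h.f_e hp ((h.mem_iff hp).1.2 h0)
    have hbox := T.box_subset (T.e_mem_box hp)
    rw [plane_eq_of_fst_zero h2, h.isSideMap.curve _ hbox.2] at h3
    rw [← h3]
    exact T.neighbor.mem_punctured (T.Ioo_mem hbox.2)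

lemma exists_mem_elem {p : Plane} (hp : p ∈ T.e.source) :
    ∃ m f ς, T.HasSide m f ς ∧ p ∈ M.elem m := by
  obtain ⟨m, f, ς, h, h0⟩ := T.exists_hasSide_of_sign (T.e p)
  exact ⟨m, f, ς, h, (h.mem_iff hp).1.2 h0⟩

lemma e_fst_eq_zero_iff {p : Plane} (hp : p ∈ T.e.source) :
    T.e p 0 = 0 ↔ p = M.edgeParam i k (T.e p 1) := by
  have hbox := T.box_subset (T.e_mem_box hp)
  constructor
  · intro h2
    have h3 := T.hasSide_p.f_e hp ((T.hasSide_p.mem_iff hp).1.2 (by simp [h2]))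
    rw [plane_eq_of_fst_zero h2, T.side_p.curve _ hbox.2] at h3
    exact h3.symm
  · intro h
    have h1 := (T.hasSide_p.mem_iff hp).2.not.1
      (h ▸ M.edgeParam_not_mem_interior i i k (T.Ioo_mem hbox.2))
    have h2 := (T.hasSide_m.mem_iff hp).2.not.1
      (h ▸ M.edgeParam_not_mem_interior i j k (T.Ioo_mem hbox.2))
    linarith

lemma exists_hasSide {p : Plane} (hp : p ∈ T.e.source) {m : ι} (hm : p ∈ M.elem m) :
    ∃ f ς, T.HasSide m f ς := by
  suffices m = i ∨ m = j by
    rcases this with rfl | rfl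
    · exact ⟨_, _, T.hasSide_p⟩
    · exact ⟨_, _, T.hasSide_m⟩
  by_contra! hcon
  rcases lt_trichotomy 0 (T.e p 0) with h0 | h0 | h0
  · exact M.interior_disjoint hcon.1.symm ((T.hasSide_p.mem_iff hp).2.2 (by linarith)) hm
  · have hbox := T.box_subset (T.e_mem_box hp)
    rw [(T.e_fst_eq_zero_iff hp).1 h0.symm] at hm
    rcases T.neighbor.eq_or_eq (T.Ioo_mem hbox.2) hm with h | h
    · exact hcon.1 h
    · exact hcon.2 h
  · exact M.interior_disjoint hcon.2.symm ((T.hasSide_m.mem_iff hp).2.2 (by linarith)) hm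

lemma edgeParam_mem_source {s : ℝ} (hs : s ∈ Ioo T.a T.b) :
    M.edgeParam i k s ∈ T.e.source ∧ T.e (M.edgeParam i k s) = planeVec ![0, s] := by
  have hbox : planeVec ![0, s] ∈ T.box := ⟨by simp [T.ρ_pos], by simpa using hs⟩
  have h1 : T.e.symm (planeVec ![0, s]) = M.edgeParam i k s := by
    rw [T.hasSide_p.symm_eq hbox (by simp), T.side_p.curve _ (Ioo_subset_Icc_self hs)]
  rw [← h1]
  exact ⟨T.symm_mem_source hbox, T.e_symm hbox⟩

lemma source_subset : T.e.source ⊆ M.punctured ∩ (M.elem i ∪ M.elem j) := by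
  intro p hp
  refine ⟨T.mem_punctured hp, ?_⟩
  obtain ⟨m, f, ς, h, hm⟩ := T.exists_mem_elem hp
  rcases h.eq_or_eq with rfl | rfl
  · exact Or.inl hm
  · exact Or.inr hm

/-- The only edge in the tube is the middle one. -/
lemma mem_edge_of_mem_edge {p : Plane} (hp : p ∈ T.e.source) {m : ι} {l : Fin 3}
    (h : p ∈ M.edge m l) : T.e p 0 = 0 := by
  have hnot : ∀ m', p ∉ interior (M.elem m') := by
    intro m' hm'
    by_cases hmm : m' = m
    · subst hmm; exact M.not_mem_interior_of_mem_edge _ h hm'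
    · exact M.interior_disjoint hmm hm' (M.edge_subset_elem m l h)
  have h1 := (T.hasSide_p.mem_iff hp).2.not.1 (hnot i)
  have h2 := (T.hasSide_m.mem_iff hp).2.not.1 (hnot j)
  linarith

variable {T}

lemma HasSide.contDiffOn_symm (h : T.HasSide m f ς) : ContDiffOn ℝ ∞ f.symm f.target :=
  h.isSideMap.smooth_symm

lemma HasSide.eventuallyEq (h : T.HasSide m f ς) {p : Plane} (hp : p ∈ T.e.source) :
    T.e =ᶠ[𝓝[M.elem m] p] f.symm := by
  filter_upwards [self_mem_nhdsWithin, mem_nhdsWithin_of_mem_nhds (T.e.open_source.mem_nhds hp)]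
    with q hq hqs using h.e_eq hqs hq

lemma HasSide.hasFDerivAt_symm (h : T.HasSide m f ς) {p : Plane} (hp : p ∈ f.target) :
    HasFDerivAt f.symm (fderiv ℝ f.symm p) p :=
  ((h.contDiffOn_symm.contDiffAt (f.open_target.mem_nhds hp)).differentiableAt (by simp)).hasFDerivAt

lemma HasSide.hasFDerivWithinAt (h : T.HasSide m f ς) {p : Plane} (hp : p ∈ T.e.source)
    (hm : p ∈ M.elem m) : HasFDerivWithinAt T.e (fderiv ℝ f.symm p) (M.elem m) p :=
  (h.hasFDerivAt_symm (h.mem_target hp hm)).hasFDerivWithinAt.congr_of_eventuallyEq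
    (h.eventuallyEq hp) (h.e_eq hp hm)

lemma HasSide.fderivWithin (h : T.HasSide m f ς) {p : Plane} (hp : p ∈ T.e.source)
    (hm : p ∈ M.elem m) : fderivWithin ℝ T.e (M.elem m) p = fderiv ℝ f.symm p :=
  (h.hasFDerivWithinAt hp hm).fderivWithin (M.uniqueDiffOn_elem m p hm)

lemma HasSide.comp_fderiv (h : T.HasSide m f ς) {y : Plane} (hy : y ∈ f.source) :
    fderiv ℝ f.symm (f y) ∘L fderiv ℝ f y = ContinuousLinearMap.id ℝ Plane ∧
      fderiv ℝ f y ∘L fderiv ℝ f.symm (f y) = ContinuousLinearMap.id ℝ Plane := by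
  have h1 := h.hasFDerivAt_symm (f.map_source hy)
  have h2 : HasFDerivAt f (fderiv ℝ f y) y :=
    (h.isSideMap.smooth.differentiable (by simp) y).hasFDerivAt
  constructor
  · refine (h1.comp y h2).unique ((hasFDerivAt_id y).congr_of_eventuallyEq ?_)
    filter_upwards [f.open_source.mem_nhds hy] with z hz using f.left_inv hz
  · have h3 : HasFDerivAt f (fderiv ℝ f y) (f.symm (f y)) := by rwa [f.left_inv hy]
    refine (h3.comp (f y) h1).unique ((hasFDerivAt_id (f y)).congr_of_eventuallyEq ?_)
    filter_upwards [f.open_target.mem_nhds (f.map_source hy)] with z hz using f.right_inv hz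

lemma HasSide.fderivWithin_det_ne (h : T.HasSide m f ς) {p : Plane} (hp : p ∈ T.e.source)
    (hm : p ∈ M.elem m) : (_root_.fderivWithin ℝ T.e (M.elem m) p).det ≠ 0 := by
  rw [h.fderivWithin hp hm]
  have h1 := h.comp_fderiv (h.e_mem_source hp)
  rw [h.f_e hp hm] at h1
  exact (det_ne_zero_of_comp_eq_id h1.1).1

lemma HasSide.contDiffOn (h : T.HasSide m f ς) : ContDiffOn ℝ ∞ T.e (T.e.source ∩ M.elem m) :=
  (h.contDiffOn_symm.mono fun _ hp => h.mem_target hp.1 hp.2).congr fun _ hp => h.e_eq hp.1 hp.2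

lemma HasSide.contDiffAt_interior (h : T.HasSide m f ς) {p : Plane} (hp : p ∈ T.e.source)
    (hm : p ∈ interior (M.elem m)) :
    ContDiffAt ℝ ∞ T.e p ∧ HasFDerivAt T.e (fderiv ℝ f.symm p) p := by
  have hnb : M.elem m ∈ 𝓝 p := mem_interior_iff_mem_nhds.1 hm
  exact ⟨h.contDiffOn.contDiffAt (inter_mem (T.e.open_source.mem_nhds hp) hnb),
    (h.hasFDerivWithinAt hp (_root_.interior_subset hm)).hasFDerivAt hnb⟩

end EdgeTube

end CurvedMesh

end

/-! ### Lengths of paths and the nearest point of an edge -/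

noncomputable section

open Filter Topology

set_option maxSynthPendingDepth 3

namespace CurvedMesh

variable {Ω : Set Plane} {ι : Type} {M : CurvedMesh Ω ι} {g : PwTensor ι}

lemma PathOfLength.nonneg {p q : Plane} {ℓ : ℝ} (h : M.PathOfLength g p q ℓ) : 0 ≤ ℓ := by
  induction h with
  | single i c hc hmem hint =>
    exact intervalIntegral.integral_nonneg zero_le_one fun _ _ => Real.sqrt_nonneg _
  | concat p q r ℓ ℓ' hq h h' ih ih' => exact add_nonneg ih ih'

lemma PathOfLength.gdist_le {p q : Plane} {ℓ : ℝ} (h : M.PathOfLength g p q ℓ) :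
    M.gdist g p q ≤ ℓ := csInf_le ⟨0, fun _ h => h.nonneg⟩ h

/-- A calibration principle: a function that grows at most by the length on every C¹ piece bounds
the length of all concatenations from below. -/
lemma PathOfLength.sub_le {h : Plane → ℝ}
    (hh : ∀ i c, ContDiff ℝ 1 c → (∀ s ∈ Icc (0 : ℝ) 1, c s ∈ M.elem i) → h (c 1) - h (c 0)
      ≤ ∫ s in (0 : ℝ)..1, Real.sqrt (tensorApp (g i (c s)) (deriv c s) (deriv c s)))
    {p q : Plane} {ℓ : ℝ} (hp : M.PathOfLength g p q ℓ) : h q - h p ≤ ℓ := by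
  induction hp with
  | single i c hc hmem hint => exact hh i c hc hmem
  | concat p q r ℓ ℓ' hq h h' ih ih' => linarith

lemma continuous_tensorApp {E : Type} [TopologicalSpace E] {A : E → Matrix (Fin 2) (Fin 2) ℝ} {u v : E → Plane}
    (hA : ∀ a b, Continuous fun y => A y a b) (hu : Continuous u) (hv : Continuous v) :
    Continuous fun y => tensorApp (A y) (u y) (v y) := by
  have h : ∀ {w : E → Plane}, Continuous w → ∀ a : Fin 2, Continuous fun y => w y a := fun hw a =>
    (coordL a).continuous.comp hw
  simp only [tensorApp]
  exact continuous_finsetSum _ fun a _ => continuous_finsetSum _ fun b _ =>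
    ((hA a b).mul (h hu a)).mul (h hv b)

/-- A function of the parameter of a curve whose slopes are at most the speed of the curve. -/
lemma IsReggeMetric.sub_le_integral_speed (hg : M.IsReggeMetric g) {i : ι} {c : ℝ → Plane}
    (hc : ContDiff ℝ 1 c) (hmem : ∀ s ∈ Icc (0 : ℝ) 1, c s ∈ M.elem i) {H : ℝ → ℝ}
    (hH : ContinuousOn H (Icc 0 1))
    (bound : ∀ x ∈ Ico (0 : ℝ) 1, ∀ r, Real.sqrt (tensorApp (g i (c x)) (deriv c x) (deriv c x)) < r →
      ∀ᶠ z in 𝓝[>] x, slope H x z < r) :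
    H 1 - H 0 ≤ ∫ s in (0 : ℝ)..1, Real.sqrt (tensorApp (g i (c s)) (deriv c s) (deriv c s)) := by
  obtain ⟨G, hG, -, hGe⟩ := hg.regge.exists_extension i
  set v : ℝ → ℝ := fun s => Real.sqrt (tensorApp (G (c s)) (deriv c s) (deriv c s))
  have hv : Continuous v := (continuous_tensorApp (fun a b => (hG a b).continuous.comp hc.continuous)
    (hc.continuous_deriv le_rfl) (hc.continuous_deriv le_rfl)).sqrt
  have hB : ∀ x, HasDerivAt (fun x => H 0 + ∫ s in (0 : ℝ)..x, v s) (v x) x := fun x =>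
    (intervalIntegral.integral_hasDerivAt_right (hv.intervalIntegrable _ _)
      (hv.stronglyMeasurableAtFilter _ _) hv.continuousAt).const_add _
  -- The mean value inequality for right slopes suffices; the potential need not be differentiable,
  -- being truncated and made from a norm.
  have h1 := image_le_of_liminf_slope_right_le_deriv_boundary hH (B := fun x => H 0 + ∫ s in (0 : ℝ)..x, v s)
    (B' := v) (by simp) (fun x _ => (hB x).continuousAt.continuousWithinAt)
    (fun x _ => (hB x).hasDerivWithinAt) (fun x hx r hr => by
      refine (bound x hx r ?_).frequently
      rwa [hGe _ (hmem x (Ico_subset_Icc_self hx))]) (right_mem_Icc.2 zero_le_one)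
  have h2 : ∫ s in (0 : ℝ)..1, Real.sqrt (tensorApp (g i (c s)) (deriv c s) (deriv c s))
      = ∫ s in (0 : ℝ)..1, v s := by
    refine intervalIntegral.integral_congr fun s hs => ?_
    rw [uIcc_of_le zero_le_one] at hs
    simp only [v, hGe _ (hmem s hs)]
  rw [h2]
  linarith

/-- The norm on the plane with weight `κ` on the second coordinate. -/
def weightL (κ : ℝ) : Plane →L[ℝ] Plane :=
  (coordL 0).smulRight (coordVec 0) + (κ • coordL 1).smulRight (coordVec 1)

lemma weightL_norm (κ : ℝ) (y : Plane) : ‖weightL κ y‖ = Real.sqrt (y 0 ^ 2 + κ ^ 2 * y 1 ^ 2) := by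
  have h0 : weightL κ y 0 = y 0 := by simp [weightL, coordVec, coordL]
  have h1 : weightL κ y 1 = κ * y 1 := by simp [weightL, coordVec, coordL]
  rw [EuclideanSpace.norm_eq, Fin.sum_univ_two, h0, h1, Real.norm_eq_abs, Real.norm_eq_abs, sq_abs,
    sq_abs]
  congr 1; ring

lemma abs_fst_le_weightL_norm (κ : ℝ) (y : Plane) : |y 0| ≤ ‖weightL κ y‖ := by
  rw [weightL_norm, ← Real.sqrt_sq_eq_abs]
  exact Real.sqrt_le_sqrt (by nlinarith [sq_nonneg (κ * y 1)])

lemma abs_snd_le_weightL_norm (κ : ℝ) (y : Plane) : κ * |y 1| ≤ ‖weightL κ y‖ := by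
  rw [weightL_norm]
  refine Real.le_sqrt_of_sq_le ?_
  rw [mul_pow, sq_abs]
  nlinarith [sq_nonneg (y 0)]

/-- Norm and truncation are 1-Lipschitz, so the slope in question is at most the norm of the slope
of `F`, which tends to `‖v‖` from the right. -/
lemma slope_min_norm_lt {F : ℝ → Plane} {v : Plane} {x r K : ℝ} (h : HasDerivWithinAt F v (Ioi x) x)
    (hr : ‖v‖ < r) : ∀ᶠ z in 𝓝[>] x, slope (fun z => - min K ‖F z‖) x z < r := by
  have h1 : Tendsto (slope F x) (𝓝[>] x) (𝓝 v) := by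
    have := hasDerivWithinAt_iff_tendsto_slope.1 h
    rwa [sdiff_singleton_eq_self (by simp)] at this
  filter_upwards [h1.norm.eventually_lt_const hr, self_mem_nhdsWithin] with z hz hzx
  refine lt_of_le_of_lt ?_ hz
  have hzx' : 0 < z - x := sub_pos.2 hzx
  rw [slope_def_field, slope_def_module, norm_smul, norm_inv, Real.norm_of_nonneg hzx'.le,
    div_eq_inv_mul]
  refine mul_le_mul_of_nonneg_left ?_ (by positivity)
  have h3 := abs_min_sub_min_le_max K ‖F x‖ K ‖F z‖
  have h4 := abs_norm_sub_norm_le (F z) (F x)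
  rw [sub_self, abs_zero, max_eq_right (abs_nonneg _)] at h3
  rw [abs_sub_comm] at h4
  linarith [le_abs_self (min K ‖F x‖ - min K ‖F z‖)]

namespace EdgeTube

variable {i j m : ι} {k : Fin 3} {T : M.EdgeTube g i j k} {f : OpenPartialHomeomorph Plane Plane}
  {ς : ℝ}

/-- By the Gauss lemma the pulled-back metric is diagonal with first entry 1. -/
lemma HasSide.tensorApp_fderiv (h : T.HasSide m f ς) (hg : M.IsReggeMetric g) {y : Plane}
    (hy : y ∈ closedPlaneBox T.ρ T.a T.b) (h0 : 0 ≤ ς * y 0) (v : Plane) :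
    tensorApp (g m (f y)) (fderiv ℝ f y v) (fderiv ℝ f y v) = v 0 ^ 2 + v 1 ^ 2 *
      tensorApp (g m (f y)) (fderiv ℝ f y (coordVec 1)) (fderiv ℝ f y (coordVec 1)) := by
  obtain ⟨h1, h2⟩ := h.isSideMap.gauss y hy h0
  have hs := (hg.isMetricMatrix ((h.isSideMap.mem_iff y hy).2 h0)).symm
  have h3 := tensorApp_comm hs (fderiv ℝ f y (coordVec 1)) (fderiv ℝ f y (coordVec 0))
  rw [clm_apply_coord _ v]
  simp only [tensorApp_add_left, tensorApp_add_right, tensorApp_smul_left, tensorApp_smul_right,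
    h1, h2, h3]
  ring

lemma HasSide.exists_lower (h : T.HasSide m f ς) (hg : M.IsReggeMetric g) :
    ∃ κ > 0, ∀ y ∈ closedPlaneBox T.ρ T.a T.b, 0 ≤ ς * y 0 →
      κ ^ 2 ≤ tensorApp (g m (f y)) (fderiv ℝ f y (coordVec 1)) (fderiv ℝ f y (coordVec 1)) := by
  obtain ⟨G, hG, -, hGe⟩ := hg.regge.exists_extension m
  set Q := closedPlaneBox T.ρ T.a T.b ∩ {y | 0 ≤ ς * y 0}
  have hQ : IsCompact Q := (isCompact_closedPlaneBox _ _ _).inter_right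
    (isClosed_Ici.preimage (continuous_const.mul (contDiff_coord 0).continuous))
  have hGg : ∀ y ∈ Q, g m (f y) = G (f y) := fun y hy =>
    hGe _ ((h.isSideMap.mem_iff y hy.1).2 hy.2)
  have hf := h.isSideMap.smooth
  have hF : Continuous fun y => fderiv ℝ f y (coordVec 1) :=
    (hf.continuous_fderiv (by simp)).clm_apply continuous_const
  have hcont : Continuous fun y => tensorApp (G (f y)) (fderiv ℝ f y (coordVec 1))
      (fderiv ℝ f y (coordVec 1)) :=
    continuous_tensorApp (fun a b => (hG a b).continuous.comp hf.continuous) hF hF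
  have hpos : ∀ y ∈ Q, 0 < tensorApp (G (f y)) (fderiv ℝ f y (coordVec 1))
      (fderiv ℝ f y (coordVec 1)) := by
    intro y hy
    rw [← hGg y hy]
    refine hg.pos m _ ((h.isSideMap.mem_iff y hy.1).2 hy.2) _ fun h0 => ?_
    have hd := h.isSideMap.det_ne y (h.isSideMap.box hy.1)
    rw [clm_det_eq, h0] at hd
    simp at hd
  obtain ⟨κ, hκ, hκ'⟩ : ∃ κ > 0, ∀ y ∈ Q, κ ≤ tensorApp (G (f y)) (fderiv ℝ f y (coordVec 1))
      (fderiv ℝ f y (coordVec 1)) := by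
    rcases Q.eq_empty_or_nonempty with he | hne
    · exact ⟨1, one_pos, by simp [he]⟩
    · obtain ⟨y, hy, hmin⟩ := hQ.exists_isMinOn hne hcont.continuousOn
      exact ⟨_, hpos y hy, fun z hz => hmin hz⟩
  refine ⟨Real.sqrt κ, Real.sqrt_pos.2 hκ, fun y hy h0 => ?_⟩
  rw [Real.sq_sqrt hκ.le, hGg y ⟨hy, h0⟩]
  exact hκ' y ⟨hy, h0⟩

variable (T)

/-- The second diagonal entry of the pulled-back metric is at least κ², by compactness on each side.
Keeping the weight 1 on the first coordinate is essential: it makes the lower bound for the distance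
to the edge sharp. -/
lemma exists_speed_bound (hg : M.IsReggeMetric g) : ∃ κ > 0, κ ≤ 1 ∧ ∀ m f ς, T.HasSide m f ς →
    ∀ y ∈ T.box, 0 ≤ ς * y 0 → ∀ v : Plane,
      ‖weightL κ v‖ ≤ Real.sqrt (tensorApp (g m (f y)) (fderiv ℝ f y v) (fderiv ℝ f y v)) := by
  obtain ⟨κ₁, h1, h1'⟩ := T.hasSide_p.exists_lower hg
  obtain ⟨κ₂, h2, h2'⟩ := T.hasSide_m.exists_lower hg
  have hκ : 0 < min 1 (min κ₁ κ₂) := lt_min one_pos (lt_min h1 h2)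
  refine ⟨min 1 (min κ₁ κ₂), hκ, min_le_left _ _, ?_⟩
  intro m f ς h y hy h0 v
  rw [weightL_norm, h.tensorApp_fderiv hg (T.box_subset hy) h0]
  refine Real.sqrt_le_sqrt ?_
  have key : min 1 (min κ₁ κ₂) ^ 2 ≤ tensorApp (g m (f y)) (_root_.fderiv ℝ f y (coordVec 1))
      (_root_.fderiv ℝ f y (coordVec 1)) := by
    rcases h with ⟨rfl, rfl, rfl⟩ | ⟨rfl, rfl, rfl⟩
    · exact (pow_le_pow_left₀ hκ.le ((min_le_right _ _).trans (min_le_left _ _)) 2).trans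
        (h1' y (T.box_subset hy) h0)
    · exact (pow_le_pow_left₀ hκ.le ((min_le_right _ _).trans (min_le_right _ _)) 2).trans
        (h2' y (T.box_subset hy) h0)
  nlinarith [mul_le_mul_of_nonneg_left key (sq_nonneg (v 1))]

variable {T}

/-- The radial line runs at constant speed, equal to the absolute value of the first coordinate,
which gives the upper bound for the distance. -/
lemma HasSide.radial_path (h : T.HasSide m f ς) {q : Plane}
    (hq : q ∈ T.e.source) (hm : q ∈ M.elem m) :
    M.PathOfLength g (M.edgeParam i k (T.e q 1)) q |T.e q 0| := by
  have hbox := T.e_mem_box hq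
  have h0 := (h.mem_iff hq).1.1 hm
  set r := T.e q 0
  set s := T.e q 1
  let c : ℝ → Plane := fun u => f (planeVec ![u * r, s])
  have hy : ∀ u ∈ Icc (0 : ℝ) 1, planeVec ![u * r, s] ∈ T.box ∧ 0 ≤ ς * (planeVec ![u * r, s]) 0 := by
    intro u hu
    have h1 : |u * r| ≤ |r| := by
      rw [abs_mul, abs_of_nonneg hu.1]
      exact mul_le_of_le_one_left (abs_nonneg _) hu.2
    have h2 : |u * r| < T.ρ := h1.trans_lt (abs_lt.2 hbox.1)
    refine ⟨⟨by simpa using abs_lt.1 h2, by simpa using hbox.2⟩, ?_⟩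
    have : ς * (planeVec ![u * r, s]) 0 = u * (ς * r) := by simp; ring
    rw [this]; exact mul_nonneg hu.1 h0
  have hc : ContDiff ℝ ∞ c := h.isSideMap.smooth.comp
    (contDiff_planeVec.comp ((contDiff_id.mul contDiff_const).prodMk contDiff_const))
  have hd : ∀ u, deriv c u = r • _root_.fderiv ℝ f (planeVec ![u * r, s]) (coordVec 0) := by
    intro u
    have h1 : HasDerivAt (fun u => planeVec ![u * r, s]) (r • coordVec 0) u := by
      have := (hasDerivAt_planeVec_fst (u * r) s).scomp u ((hasDerivAt_id u).mul_const r)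
      rw [one_mul] at this
      exact this
    rw [← map_smul]
    exact (HasFDerivAt.comp_hasDerivAt (l := f) u
      (h.isSideMap.smooth.differentiable (by simp) _).hasFDerivAt h1).deriv
  have key := PathOfLength.single (M := M) (g := g) m c (hc.of_le (by simp))
    (fun u hu => (h.isSideMap.mem_iff _ (T.box_subset (hy u hu).1)).2 (hy u hu).2)
    (fun u hu => by
      have hu' := hy u (Ioo_subset_Icc_self hu)
      simp only [c]
      rw [← h.symm_eq hu'.1 hu'.2]
      exact T.mem_punctured (T.symm_mem_source hu'.1))
  have e0 : c 0 = M.edgeParam i k s := by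
    simp only [c, zero_mul]; exact h.isSideMap.curve s (Ioo_subset_Icc_self hbox.2)
  have e1 : c 1 = q := by
    simp only [c, one_mul, r, s, planeVec_eta]; exact h.f_e hq hm
  have e2 : ∫ u in (0 : ℝ)..1, Real.sqrt (tensorApp (g m (c u)) (deriv c u) (deriv c u)) = |r| := by
    rw [intervalIntegral.integral_congr (g := fun _ => |r|)]
    · simp
    · intro u hu
      rw [uIcc_of_le zero_le_one] at hu
      simp only [hd, tensorApp_smul_left, tensorApp_smul_right]
      rw [(h.isSideMap.gauss _ (T.box_subset (hy u hu).1) (hy u hu).2).1, mul_one,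
        Real.sqrt_mul_self_eq_abs]
  rwa [e0, e1, e2] at key

lemma edge_path {M : CurvedMesh Ω ι} {g : PwTensor ι} (hij : M.IsNeighbor i j k) {s t : ℝ}
    (hs : s ∈ Ioo (0 : ℝ) 1) (ht : t ∈ Ioo (0 : ℝ) 1) :
    ∃ ℓ, M.PathOfLength g (M.edgeParam i k s) (M.edgeParam i k t) ℓ := by
  have hmem : ∀ u ∈ Icc (0 : ℝ) 1, s + u * (t - s) ∈ Ioo (0 : ℝ) 1 := by
    intro u hu
    have := (convex_Ioo (0 : ℝ) 1) hs ht (sub_nonneg.2 hu.2) hu.1 (by ring)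
    simp only [smul_eq_mul] at this
    convert this using 1; ring
  have hc : ContDiff ℝ ∞ fun u => M.edgeParam i k (s + u * (t - s)) :=
    (M.contDiff_edgeParam i k).comp (contDiff_const.add (contDiff_id.mul contDiff_const))
  have key := PathOfLength.single (M := M) (g := g) i _ (hc.of_le (by simp))
    (fun u hu => M.edgeParam_mem_elem i k (Ioo_subset_Icc_self (hmem u hu)))
    (fun u hu => hij.mem_punctured (hmem u (Ioo_subset_Icc_self hu)))
  have h1 : s + 1 * (t - s) = t := by ring
  simp only [zero_mul, add_zero, h1] at key
  exact ⟨_, key⟩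

/-- The distance is a real infimum, with value 0 on the empty set; lower bounds for lengths pass to
it only when some path exists. -/
lemma exists_path {q : Plane} (T : M.EdgeTube g i j k)
    (hq : q ∈ T.e.source) {s : ℝ} (hs : s ∈ Ioo (0 : ℝ) 1) :
    ∃ ℓ, M.PathOfLength g (M.edgeParam i k s) q ℓ := by
  obtain ⟨m, f, ς, h, hm⟩ := T.exists_mem_elem hq
  have ht := T.Ioo_mem (T.box_subset (T.e_mem_box hq)).2
  obtain ⟨ℓ, hℓ⟩ := edge_path (g := g) T.neighbor hs ht
  exact ⟨_, PathOfLength.concat _ _ _ _ _ (T.neighbor.mem_punctured ht) hℓ (h.radial_path hq hm)⟩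

/-- A lower bound for the length of the paths that end near a point of the edge. -/
lemma exists_potential (T : M.EdgeTube g i j k) (hg : M.IsReggeMetric g) {s₀ : ℝ}
    (hs₀ : s₀ ∈ Ioo T.a T.b) : ∃ κ > 0, ∃ δ > 0, ∀ q ∈ T.e.source, |T.e q 0| < δ → |T.e q 1 - s₀| < δ →
      ∀ p ℓ, M.PathOfLength g p q ℓ →
        (p ∈ T.e.source → min δ ‖weightL κ (T.e p - T.e q)‖ ≤ ℓ) ∧ (p ∉ T.e.source → δ ≤ ℓ) := by
  classical
  obtain ⟨κ, hκ, hκ1, hspeed⟩ := T.exists_speed_bound hg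
  obtain ⟨R, hR, hR1, hR2, hR3⟩ : ∃ R > 0, R < T.ρ ∧ R < s₀ - T.a ∧ R < T.b - s₀ := by
    have hpos : 0 < min T.ρ (min (s₀ - T.a) (T.b - s₀)) :=
      lt_min T.ρ_pos (lt_min (by linarith [hs₀.1]) (by linarith [hs₀.2]))
    obtain ⟨R, h1, h2⟩ := exists_between hpos
    exact ⟨R, h1, by have := lt_min_iff.1 h2; exact ⟨this.1, (lt_min_iff.1 this.2).1,
      (lt_min_iff.1 this.2).2⟩⟩
  -- For `q` within κR/2 of the base point, the weighted ball of radius κR/2 around `T.e q` stays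
  -- inside the box of half-width `R`: horizontally because κ ≤ 1, vertically because dividing by
  -- the weight gives R/2.
  refine ⟨κ, hκ, κ * R / 2, by positivity, fun q hq hq0 hq1 => ?_⟩
  set K := κ * R / 2 with hK
  have hK0 : 0 < K := by positivity
  have hKR : K ≤ R / 2 := by rw [hK]; nlinarith
  set B := closedPlaneBox R (s₀ - R) (s₀ + R)
  have hBbox : B ⊆ T.box := fun y hy =>
    ⟨⟨by linarith [hy.1.1], by linarith [hy.1.2]⟩, ⟨by linarith [hy.2.1], by linarith [hy.2.2]⟩⟩
  have hsub : ∀ y, ‖weightL κ (y - T.e q)‖ ≤ K → y ∈ B := by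
    intro y hy
    have h1 := (abs_fst_le_weightL_norm κ (y - T.e q)).trans hy
    have h2 := (abs_snd_le_weightL_norm κ (y - T.e q)).trans hy
    have h3 : |(y - T.e q) 1| ≤ R / 2 := by
      by_contra h
      have := mul_lt_mul_of_pos_left (not_le.1 h) hκ
      rw [hK] at h2; linarith
    simp only [PiLp.sub_apply, abs_le, abs_lt] at h1 h3 hq0 hq1
    exact ⟨⟨by linarith, by linarith⟩, ⟨by linarith, by linarith⟩⟩
  set C := T.e.symm '' B
  have hCs : C ⊆ T.e.source := by rintro _ ⟨y, hy, rfl⟩; exact T.symm_mem_source (hBbox hy)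
  have hC : IsClosed C := by
    refine ((isCompact_closedPlaneBox _ _ _).image_of_continuousOn
      (T.e.continuousOn_symm.mono ?_)).isClosed
    rw [T.target_eq]; exact hBbox
  -- The potential is minus the truncated weighted distance to `q`. It already has the value `-K`
  -- outside the compact set `C`, so its extension by `-K` is continuous, and along any path it
  -- increases at most at the speed of the path.
  let h : Plane → ℝ := fun p =>
    if p ∈ T.e.source then - min K ‖weightL κ (T.e p - T.e q)‖ else -K
  have hout : ∀ p ∉ C, h p = -K := by
    intro p hp
    by_cases hps : p ∈ T.e.source
    · simp only [h, if_pos hps]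
      rw [min_eq_left]
      by_contra hlt
      exact hp ⟨T.e p, hsub _ (not_le.1 hlt).le, T.e.left_inv hps⟩
    · exact if_neg hps
  have hq' : h q = 0 := by
    simp only [h, if_pos hq, sub_self, map_zero, norm_zero, min_eq_right hK0.le, neg_zero]
  have hmain : ∀ p ℓ, M.PathOfLength g p q ℓ → h q - h p ≤ ℓ := by
    intro p ℓ hp
    refine PathOfLength.sub_le (fun m c hc hmem => ?_) hp
    have hev : ∀ x, c x ∈ C → (fun z => h (c z)) =ᶠ[𝓝 x]
        fun z => - min K ‖weightL κ (T.e (c z) - T.e q)‖ := by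
      intro x hx
      filter_upwards [hc.continuous.continuousAt.eventually_mem
        (T.e.open_source.mem_nhds (hCs hx))] with z hz
      exact if_pos hz
    have hev2 : ∀ x, c x ∉ C → (fun z => h (c z)) =ᶠ[𝓝 x] fun z => -K := by
      intro x hx
      filter_upwards [hc.continuous.continuousAt.eventually_mem (hC.isOpen_compl.mem_nhds hx)] with z hz
      exact hout _ hz
    refine hg.sub_le_integral_speed hc hmem (H := fun z => h (c z)) ?_ ?_
    · intro x hx
      refine ContinuousAt.continuousWithinAt ?_
      by_cases hxC : c x ∈ C
      · refine ContinuousAt.congr ?_ (hev x hxC).symm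
        have h1 : ContinuousAt (fun z => T.e (c z)) x :=
          (T.e.continuousAt (hCs hxC)).comp hc.continuous.continuousAt
        exact (continuousAt_const.min ((weightL κ).continuous.continuousAt.comp
          (h1.sub continuousAt_const)).norm).neg
      · exact continuousAt_const.congr (hev2 x hxC).symm
    · intro x hx r hr
      by_cases hxC : c x ∈ C
      · obtain ⟨f, ς, hs⟩ := T.exists_hasSide (hCs hxC) (hmem x (Ico_subset_Icc_self hx))
        have hcx := hmem x (Ico_subset_Icc_self hx)
        have hy := T.e_mem_box (hCs hxC)
        have h0 := (hs.mem_iff (hCs hxC)).1.1 hcx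
        have hd1 : HasDerivAt (fun z => f.symm (c z)) (fderiv ℝ f.symm (c x) (deriv c x)) x :=
          HasFDerivAt.comp_hasDerivAt (l := f.symm) x (hs.hasFDerivAt_symm (hs.mem_target (hCs hxC) hcx))
            (hc.differentiable (by simp) x).hasDerivAt
        -- To the right of `x` the path remains in one element, where the merely continuous chart
        -- coincides with the smooth inverse of a side map.
        have hev3 : ∀ᶠ z in 𝓝[>] x, T.e (c z) = f.symm (c z) := by
          filter_upwards [Ioo_mem_nhdsGT hx.2, mem_nhdsWithin_of_mem_nhds
            (hc.continuous.continuousAt.eventually_mem (T.e.open_source.mem_nhds (hCs hxC)))] with z hz hzs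
          exact hs.e_eq hzs (hmem z ⟨hx.1.trans hz.1.le, hz.2.le⟩)
        have hd2 : HasDerivWithinAt (fun z => weightL κ (T.e (c z) - T.e q))
            (weightL κ (fderiv ℝ f.symm (c x) (deriv c x))) (Ioi x) x := by
          refine HasDerivWithinAt.congr_of_eventuallyEq
            (f := fun z => weightL κ (f.symm (c z) - T.e q)) ?_ ?_ ?_
          · exact ((weightL κ).hasFDerivAt.comp_hasDerivAt x (hd1.sub_const _)).hasDerivWithinAt
          · filter_upwards [hev3] with z hz
            rw [hz]
          · simp only [hs.e_eq (hCs hxC) hcx]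
        have hinv := (hs.comp_fderiv (hs.e_mem_source (hCs hxC))).2
        rw [hs.f_e (hCs hxC) hcx] at hinv
        have hlt : ‖weightL κ (fderiv ℝ f.symm (c x) (deriv c x))‖ < r := by
          refine lt_of_le_of_lt (hspeed m f ς hs _ hy h0 _) ?_
          have e1 : fderiv ℝ f (T.e (c x)) (fderiv ℝ f.symm (c x) (deriv c x)) = deriv c x := by
            have := congrArg (fun A : Plane →L[ℝ] Plane => A (deriv c x)) hinv
            simpa using this
          rwa [e1, hs.f_e (hCs hxC) hcx]
        filter_upwards [slope_min_norm_lt (K := K) hd2 hlt,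
          mem_nhdsWithin_of_mem_nhds (hev x hxC)] with z hz hz2
        rw [slope_def_field] at hz ⊢
        rwa [show h (c z) = _ from hz2, show h (c x) = _ from (hev x hxC).eq_of_nhds]
      · filter_upwards [mem_nhdsWithin_of_mem_nhds (hev2 x hxC)] with z hz
        rw [slope_def_field, show h (c z) = _ from hz, hout _ hxC, sub_self, zero_div]
        exact lt_of_le_of_lt (Real.sqrt_nonneg _) hr
  intro p ℓ hp
  have h1 := hmain p ℓ hp
  rw [hq', zero_sub] at h1
  constructor
  · intro hps
    simp only [h, if_pos hps, neg_neg] at h1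
    exact h1
  · intro hps
    simp only [h, if_neg hps, neg_neg] at h1
    exact h1

/-- Near the edge, the closest point of the edge is the foot of the normal geodesic. -/
theorem exists_gdist (T : M.EdgeTube g i j k) (hg : M.IsReggeMetric g) {s₀ : ℝ}
    (hs₀ : s₀ ∈ Ioo T.a T.b) : ∃ δ > 0, ∀ q ∈ T.e.source, |T.e q 0| < δ → |T.e q 1 - s₀| < δ →
      M.gdist g (M.edgeParam i k (T.e q 1)) q = |T.e q 0| ∧
      ∀ s ∈ Ioo (0 : ℝ) 1, s ≠ T.e q 1 →
        M.gdist g (M.edgeParam i k (T.e q 1)) q < M.gdist g (M.edgeParam i k s) q := by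
  obtain ⟨κ, hκ, δ, hδ, H⟩ := T.exists_potential hg hs₀
  refine ⟨δ, hδ, fun q hq h0 h1 => ?_⟩
  obtain ⟨m, f, ς, hm, hqm⟩ := T.exists_mem_elem hq
  have hbox := T.box_subset (T.e_mem_box hq)
  have hle := (hm.radial_path hq hqm).gdist_le
  have hfst : ∀ s, |T.e q 0| ≤ ‖weightL κ (planeVec ![0, s] - T.e q)‖ := fun s => by
    refine le_trans (le_of_eq ?_) (abs_fst_le_weightL_norm κ _)
    simp [abs_neg]
  have hge : ∀ s ∈ Ioo (0 : ℝ) 1, ∀ B, |T.e q 0| ≤ B → B ≤ δ →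
      (M.edgeParam i k s ∈ T.e.source → B ≤ ‖weightL κ (T.e (M.edgeParam i k s) - T.e q)‖) →
      B ≤ M.gdist g (M.edgeParam i k s) q := by
    intro s hs B hB hBδ himp
    refine le_csInf (T.exists_path hq hs) fun ℓ hℓ => ?_
    by_cases hps : M.edgeParam i k s ∈ T.e.source
    · exact (le_min hBδ (himp hps)).trans ((H q hq h0 h1 _ ℓ hℓ).1 hps)
    · exact hBδ.trans ((H q hq h0 h1 _ ℓ hℓ).2 hps)
  have hsrc : ∀ s ∈ Ioo (0 : ℝ) 1, M.edgeParam i k s ∈ T.e.source →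
      T.e (M.edgeParam i k s) = planeVec ![0, s] := by
    intro s hs hps
    have h2 : T.e (M.edgeParam i k s) 0 = 0 := T.mem_edge_of_mem_edge hps (M.edgeParam_mem_edge i k hs)
    have h3 := (T.e_fst_eq_zero_iff hps).1 h2
    have hb := T.box_subset (T.e_mem_box hps)
    have h4 := M.edgeParam_injOn i k (Ioo_subset_Icc_self hs) (Ioo_subset_Icc_self (T.Ioo_mem hb.2)) h3
    rw [plane_eq_of_fst_zero h2, ← h4]
  have heq : M.gdist g (M.edgeParam i k (T.e q 1)) q = |T.e q 0| := by
    refine le_antisymm hle (hge _ (T.Ioo_mem hbox.2) _ le_rfl h0.le fun hps => ?_)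
    rw [hsrc _ (T.Ioo_mem hbox.2) hps]
    exact hfst _
  refine ⟨heq, fun s hs hne => ?_⟩
  -- Strictness comes from the positive weight of the second coordinate; it makes the foot the
  -- unique nearest point of the edge.
  have hlt : |T.e q 0| < ‖weightL κ (planeVec ![0, s] - T.e q)‖ := by
    rw [weightL_norm]
    refine Real.lt_sqrt_of_sq_lt ?_
    have : 0 < (s - T.e q 1) ^ 2 := by positivity [sub_ne_zero.2 hne]
    have h4 : (planeVec ![0, s] - T.e q) 0 = - T.e q 0 := by simp
    have h5 : (planeVec ![0, s] - T.e q) 1 = s - T.e q 1 := by simp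
    rw [sq_abs, h4, h5, neg_sq]
    have : 0 < κ ^ 2 * (s - T.e q 1) ^ 2 := by positivity
    linarith
  rw [heq]
  refine lt_of_lt_of_le (lt_min h0 hlt) (hge s hs _ (le_min h0.le hlt.le) (min_le_left _ _) fun hps => ?_)
  rw [hsrc s hs hps]
  exact min_le_right _ _

end EdgeTube

end CurvedMesh

end

/-! ### Tubes as charts of the glued structure -/

noncomputable section

open Filter Topology

set_option maxSynthPendingDepth 3

lemma clm_det_comp (A B : Plane →L[ℝ] Plane) : (A ∘L B).det = A.det * B.det := by
  have := cross_map (A ∘L B) (coordVec 0) (coordVec 1)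
  rw [ContinuousLinearMap.comp_apply, ContinuousLinearMap.comp_apply, cross_map, cross_map,
    cross_coordVec, mul_one, mul_one] at this
  exact this.symm

namespace CurvedMesh

/-- Smooth compatibility of two charts at a point. -/
def CompatAt (e f : OpenPartialHomeomorph Plane Plane) (p : Plane) : Prop :=
  ContDiffAt ℝ ∞ (f ∘ e.symm) (e p) ∧ ContDiffAt ℝ ∞ (e ∘ f.symm) (f p)

section Compat

variable {e f h : OpenPartialHomeomorph Plane Plane} {p : Plane}

lemma CompatAt.symm (H : CompatAt e f p) : CompatAt f e p := ⟨H.2, H.1⟩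

lemma contDiffAt_comp_symm {F : Type} [NormedAddCommGroup F] [NormedSpace ℝ F] {u : Plane → F}
    (he : p ∈ e.source) (hf : p ∈ f.source) (hu : ContDiffAt ℝ ∞ (u ∘ f.symm) (f p))
    (H : ContDiffAt ℝ ∞ (f ∘ e.symm) (e p)) : ContDiffAt ℝ ∞ (u ∘ e.symm) (e p) := by
  have h1 : ContDiffAt ℝ ∞ ((u ∘ f.symm) ∘ (f ∘ e.symm)) (e p) := by
    refine ContDiffAt.comp (e p) ?_ H
    rwa [Function.comp_apply, e.left_inv he]
  refine h1.congr_of_eventuallyEq ?_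
  filter_upwards [(e.continuousAt_symm (e.map_source he)).eventually_mem
    (by rw [e.left_inv he]; exact f.open_source.mem_nhds hf)] with y hy
  simp [f.left_inv hy]

lemma CompatAt.trans (he : p ∈ e.source) (hf : p ∈ f.source) (hh : p ∈ h.source)
    (H : CompatAt e f p) (H' : CompatAt f h p) : CompatAt e h p :=
  ⟨contDiffAt_comp_symm he hf H'.1 H.1, contDiffAt_comp_symm hh hf H.2 H'.2⟩

lemma smoothCompat_iff : SmoothCompat e f ↔ ∀ p ∈ e.source ∩ f.source, CompatAt e f p := by
  have key : ∀ e f : OpenPartialHomeomorph Plane Plane,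
      ContDiffOn ℝ ∞ (e.symm.trans f) (e.symm.trans f).source ↔
        ∀ p ∈ e.source ∩ f.source, ContDiffAt ℝ ∞ (f ∘ e.symm) (e p) := by
    intro e f
    rw [(e.symm.trans f).open_source.contDiffOn_iff, OpenPartialHomeomorph.trans_source]
    constructor
    · intro H p hp
      exact H ⟨e.map_source hp.1, by
        rw [mem_preimage]; erw [e.left_inv hp.1]; exact hp.2⟩
    · intro H y hy
      have h1 := H (e.symm y) ⟨e.map_target hy.1, hy.2⟩
      rwa [e.right_inv hy.1] at h1
  rw [SmoothCompat, key, key]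
  exact ⟨fun H p hp => ⟨H.1 p hp, H.2 p hp.symm⟩, fun H => ⟨fun p hp => (H p hp).1,
    fun p hp => (H p hp.symm).2⟩⟩

/-- By the inverse function theorem, a smooth transition with invertible derivative has a smooth
inverse, so one direction suffices. -/
lemma compatAt_of_det (he : p ∈ e.source) (hf : p ∈ f.source)
    (H : ContDiffAt ℝ ∞ (f ∘ e.symm) (e p)) (hd : (fderiv ℝ (f ∘ e.symm) (e p)).det ≠ 0) :
    CompatAt e f p := by
  refine ⟨H, ?_⟩
  obtain ⟨B, hB⟩ := isUnit_of_det_ne_zero hd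
  have h1 : (e.symm.trans f).symm (f p) = e p := by
    simp [OpenPartialHomeomorph.trans_symm_eq_symm_trans_symm, f.left_inv hf]
  have h2 := (e.symm.trans f).contDiffAt_symm (n := ∞) (f₀' := B) (a := f p)
    (by simp [f.map_source hf, f.left_inv hf, he])
    (by rw [h1, hB]; exact (H.differentiableAt (by simp)).hasFDerivAt) (by rw [h1]; exact H)
  exact h2

lemma compatAt_ofSet {U : Set Plane} (hU : IsOpen U) (he : p ∈ e.source) (hp : p ∈ U)
    (H : ContDiffAt ℝ ∞ e p) (hd : (fderiv ℝ e p).det ≠ 0) :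
    CompatAt (OpenPartialHomeomorph.ofSet U hU) e p :=
  compatAt_of_det hp he (by simpa using H) (by simpa using hd)

end Compat

end CurvedMesh

/-- The map `(r, s) ↦ (θ r, Λ s)`. -/
def diagMap (θ : ℝ) (Λ : ℝ → ℝ) (y : Plane) : Plane := planeVec ![θ * y 0, Λ (y 1)]

lemma diagMap_contDiffAt (θ : ℝ) {Λ : ℝ → ℝ} {y : Plane} (h : ContDiffAt ℝ ∞ Λ (y 1)) :
    ContDiffAt ℝ ∞ (diagMap θ Λ) y :=
  contDiff_planeVec.contDiffAt.comp y ((contDiffAt_const.mul (contDiff_coord 0).contDiffAt).prodMk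
    (ContDiffAt.comp y h (contDiff_coord 1).contDiffAt))

lemma diagMap_det {θ : ℝ} {Λ : ℝ → ℝ} {y : Plane} (h : DifferentiableAt ℝ Λ (y 1)) (hθ : θ ≠ 0)
    (hΛ : deriv Λ (y 1) ≠ 0) : (fderiv ℝ (diagMap θ Λ) y).det ≠ 0 := by
  have h1 : HasFDerivAt (fun z : Plane => θ * z 0) (θ • coordL 0) y :=
    (coordL 0).hasFDerivAt.const_mul θ
  have h2 : HasFDerivAt (fun z : Plane => Λ (z 1)) (deriv Λ (y 1) • coordL 1) y :=
    HasDerivAt.comp_hasFDerivAt (h₂ := Λ) y h.hasDerivAt (coordL 1).hasFDerivAt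
  have h3 : HasFDerivAt (diagMap θ Λ) ((planeProd.symm : ℝ × ℝ →L[ℝ] Plane) ∘L
      ((θ • coordL 0).prod (deriv Λ (y 1) • coordL 1))) y := by
    have := (planeProd.symm : ℝ × ℝ →L[ℝ] Plane).hasFDerivAt.comp y (h1.prodMk h2)
    refine this.congr_of_eventuallyEq (Eventually.of_forall fun z => ?_)
    simp [diagMap]
  rw [h3.fderiv, clm_det_eq]
  simp [coordVec, hθ, hΛ]

namespace CurvedMesh

variable {Ω : Set Plane} {ι : Type} (M : CurvedMesh Ω ι) (g : PwTensor ι)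

/-- The `g`-length of an edge from the parameter `s₀` to the parameter `s`. -/
def edgeLength (i : ι) (k : Fin 3) (s₀ s : ℝ) : ℝ :=
  ∫ r in s₀..s, Real.sqrt (tensorApp (g i (M.edgeParam i k r)) (M.tangent i k r) (M.tangent i k r))

variable {M g}

/-- The metric may be replaced by a smooth extension under the integral, and the speed is positive,
so its square root is smooth and the derivative of the length does not vanish. -/
lemma edgeLength_contDiffOn (hg : M.IsReggeMetric g) (i : ι) (k : Fin 3) {s₀ : ℝ}
    (hs₀ : s₀ ∈ Ioo (0 : ℝ) 1) : ContDiffOn ℝ ∞ (M.edgeLength g i k s₀) (Ioo 0 1) ∧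
      ∀ s ∈ Ioo (0 : ℝ) 1, deriv (M.edgeLength g i k s₀) s ≠ 0 := by
  obtain ⟨G, hG, -, hGe⟩ := hg.regge.exists_extension i
  have hγ := M.contDiff_edgeParam i k
  have hτ := M.contDiff_tangent i k
  set w : ℝ → ℝ := fun r => tensorApp (G (M.edgeParam i k r)) (M.tangent i k r) (M.tangent i k r)
  have hw : ∀ s, ContDiffAt ℝ ∞ w s := fun s => ContDiffAt.tensorApp
    (fun a b => ((hG a b).comp hγ).contDiffAt) hτ.contDiffAt hτ.contDiffAt
  have hwg : ∀ s ∈ Ioo (0 : ℝ) 1, tensorApp (g i (M.edgeParam i k s)) (M.tangent i k s)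
      (M.tangent i k s) = w s := fun s hs => by
    simp only [w, hGe _ (M.edgeParam_mem_elem i k (Ioo_subset_Icc_self hs))]
  have hwpos : ∀ s ∈ Ioo (0 : ℝ) 1, 0 < w s := fun s hs => by
    rw [← hwg s hs]
    exact hg.pos i _ (M.edgeParam_mem_elem i k (Ioo_subset_Icc_self hs)) _
      (M.tangent_ne_zero i k (Ioo_subset_Icc_self hs))
  have hwc : Continuous fun s => Real.sqrt (w s) :=
    (continuous_iff_continuousAt.2 fun s => (hw s).continuousAt).sqrt
  have hder : ∀ s ∈ Ioo (0 : ℝ) 1, HasDerivAt (M.edgeLength g i k s₀) (Real.sqrt (w s)) s := by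
    intro s hs
    have h1 : HasDerivAt (fun s => ∫ r in s₀..s, Real.sqrt (w r)) (Real.sqrt (w s)) s :=
      intervalIntegral.integral_hasDerivAt_right (hwc.intervalIntegrable _ _)
        (hwc.stronglyMeasurableAtFilter _ _) hwc.continuousAt
    refine h1.congr_of_eventuallyEq ?_
    filter_upwards [isOpen_Ioo.mem_nhds hs] with t ht
    refine intervalIntegral.integral_congr fun r hr => ?_
    have hr' : r ∈ Ioo (0 : ℝ) 1 := ordConnected_Ioo.uIcc_subset hs₀ ht hr
    simp only [hwg r hr']
  refine ⟨(contDiffOn_infty_iff_deriv_of_isOpen isOpen_Ioo).2 ⟨fun s hs =>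
    (hder s hs).differentiableAt.differentiableWithinAt, ?_⟩, fun s hs => ?_⟩
  · refine ContDiffOn.congr (f := fun s => Real.sqrt (w s)) (fun s hs => ?_) fun s hs => (hder s hs).deriv
    exact ((hw s).sqrt (hwpos s hs).ne').contDiffWithinAt
  · rw [(hder s hs).deriv]
    exact (Real.sqrt_pos.2 (hwpos s hs)).ne'

lemma IsEdgeChart.contDiffAt {i j : ι} {k : Fin 3} {s₀ : ℝ} {f : OpenPartialHomeomorph Plane Plane}
    (hf : M.IsEdgeChart g i j k s₀ f) {m : ι} {p : Plane} (hp : p ∈ f.source)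
    (hm : p ∈ interior (M.elem m)) : ContDiffAt ℝ ∞ f p ∧ (fderiv ℝ f p).det ≠ 0 := by
  have hmij : m = i ∨ m = j := by
    rcases (hf.source_subset hp).2 with h | h
    · exact Or.inl (by_contra fun hne => M.interior_disjoint hne hm h)
    · exact Or.inr (by_contra fun hne => M.interior_disjoint hne hm h)
  have hnb : M.elem m ∈ 𝓝 p := mem_interior_iff_mem_nhds.1 hm
  refine ⟨(hf.smooth m hmij).contDiffAt (inter_mem (f.open_source.mem_nhds hp) hnb), ?_⟩
  have := hf.nondeg m hmij p ⟨hp, _root_.interior_subset hm⟩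
  rwa [fderivWithin_of_mem_nhds hnb] at this

namespace EdgeTube

variable {i j : ι} {k : Fin 3} (T : M.EdgeTube g i j k)

lemma compatAt_ofSet {p : Plane} (hp : p ∈ T.e.source) {m : ι} (hm : p ∈ interior (M.elem m)) :
    CompatAt (OpenPartialHomeomorph.ofSet (interior (M.elem m)) isOpen_interior) T.e p := by
  obtain ⟨f, ς, h⟩ := T.exists_hasSide hp (_root_.interior_subset hm)
  obtain ⟨h1, h2⟩ := h.contDiffAt_interior hp hm
  refine CurvedMesh.compatAt_ofSet _ hp hm h1 ?_
  have := h.fderivWithin_det_ne hp (_root_.interior_subset hm)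
  rwa [h.fderivWithin hp (_root_.interior_subset hm), ← h2.fderiv] at this

lemma e_fst_eq_or_interior {p : Plane} (hp : p ∈ T.e.source) :
    T.e p 0 = 0 ∨ ∃ m, p ∈ interior (M.elem m) := by
  rcases lt_trichotomy 0 (T.e p 0) with h | h | h
  · exact Or.inr ⟨i, (T.hasSide_p.mem_iff hp).2.2 (by linarith)⟩
  · exact Or.inl h.symm
  · exact Or.inr ⟨j, (T.hasSide_m.mem_iff hp).2.2 (by linarith)⟩

/-- Around the middle edge, any edge chart is a function of the tube coordinates. -/
lemma compatAt_edgeChart_of_fst_zero (hg : M.IsReggeMetric g) {i' j' : ι} {k' : Fin 3} {s₀' : ℝ}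
    {f : OpenPartialHomeomorph Plane Plane} (hf : M.IsEdgeChart g i' j' k' s₀' f) {p : Plane}
    (hp : p ∈ T.e.source) (hpf : p ∈ f.source) (h0 : T.e p 0 = 0) : CompatAt T.e f p := by
  have hbox := T.e_mem_box hp
  have hs := T.Ioo_mem (T.box_subset hbox).2
  set s := T.e p 1
  have hpγ : p = M.edgeParam i k s := (T.e_fst_eq_zero_iff hp).1 h0
  have hpk : p ∈ M.edge i k := hpγ ▸ M.edgeParam_mem_edge i k hs
  have hpk' : p ∈ M.edge i' k' := hf.no_other_edge i k ⟨hpf, hpk⟩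
  have hpk2 : M.edgeParam i k s ∈ M.edge i' k' := hpγ ▸ hpk'
  have hi' : i' = i ∨ i' = j :=
    T.neighbor.eq_or_eq hs (hpγ ▸ M.edge_subset_elem i' k' hpk')
  have hj' : j' = i ∨ j' = j := T.neighbor.eq_or_eq hs (hpγ ▸ hf.shared hpk')
  have hedge : M.edge i k = M.edge i' k' := by
    rcases hi' with rfl | rfl
    · rw [M.edge_eq_of_edgeParam_mem i' hs hpk2]
    · obtain ⟨l, hl⟩ := T.neighbor.exists_edge_eq
      have h1 := M.edgeCoord_mem_Ioo hl hs
      have h2 := (M.edgeParam_edgeCoord i' l (hl ▸ M.edgeParam_mem_edge i k hs)).2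
      rw [← h2] at hpk2
      rw [hl, M.edge_eq_of_edgeParam_mem i' h1 hpk2]
  set c : ℝ → ℝ := fun t => M.edgeCoord i' k' (M.edgeParam i k t)
  have hc : ∀ t ∈ Ioo (0 : ℝ) 1, c t ∈ Ioo (0 : ℝ) 1 ∧ M.edgeParam i' k' (c t) = M.edgeParam i k t :=
    fun t ht => ⟨M.edgeCoord_mem_Ioo hedge ht,
      (M.edgeParam_edgeCoord i' k' (hedge ▸ M.edgeParam_mem_edge i k ht)).2⟩
  -- `θ` is 1 if the chart has the same positive side as the tube and -1 if it describes the edge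
  -- from the other element.
  obtain ⟨θ, hθ, hθi, hθj⟩ : ∃ θ : ℝ, θ ≠ 0 ∧
      (∀ q ∈ f.source, q ∈ T.e.source → ∀ d, d = |T.e q 0| → (q ∈ M.elem i' → f q 0 = d) →
        (q ∈ M.elem j' → f q 0 = -d) → f q 0 = θ * T.e q 0) ∧ True := by
    rcases hi' with hi' | hi'
    · have hj : j' = j := by
        rcases hj' with h | h
        · exact absurd (hi'.trans h.symm) hf.ne
        · exact h
      subst hi' hj
      refine ⟨1, one_ne_zero, fun q _ hq d hd h1 h2 => ?_, trivial⟩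
      rcases (T.source_subset hq).2 with h | h
      · have := (T.hasSide_p.mem_iff hq).1.1 h
        rw [h1 h, hd, abs_of_nonneg (by linarith), one_mul]
      · have := (T.hasSide_m.mem_iff hq).1.1 h
        rw [h2 h, hd, abs_of_nonpos (by linarith), one_mul, neg_neg]
    · have hj : j' = i := by
        rcases hj' with h | h
        · exact h
        · exact absurd (hi'.trans h.symm) hf.ne
      subst hi' hj
      refine ⟨-1, by norm_num, fun q _ hq d hd h1 h2 => ?_, trivial⟩
      rcases (T.source_subset hq).2 with h | h
      · have := (T.hasSide_p.mem_iff hq).1.1 h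
        rw [h2 h, hd, abs_of_nonneg (by linarith)]; ring
      · have := (T.hasSide_m.mem_iff hq).1.1 h
        rw [h1 h, hd, abs_of_nonpos (by linarith)]; ring
  obtain ⟨δ, hδ, hdist⟩ := T.exists_gdist hg hbox.2
  set Λ : ℝ → ℝ := fun t => M.edgeLength g i' k' s₀' (c t)
  have hsrc : ∀ᶠ y in 𝓝 (T.e p), y ∈ T.box ∧ T.e.symm y ∈ f.source ∧ |y 0| < δ ∧ |y 1 - s| < δ := by
    have hc0 : ∀ a, Continuous fun y : Plane => y a := fun a => (contDiff_coord a).continuous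
    filter_upwards [T.isOpen_box.mem_nhds hbox,
      (T.e.continuousAt_symm (T.e.map_source hp)).eventually_mem
        (by rw [T.e.left_inv hp]; exact f.open_source.mem_nhds hpf),
      (isOpen_lt (hc0 0).abs continuous_const).mem_nhds (show |T.e p 0| < δ by rw [h0, abs_zero]; exact hδ),
      (isOpen_lt ((hc0 1).sub continuous_const).abs continuous_const).mem_nhds
        (show |T.e p 1 - s| < δ by rw [sub_self, abs_zero]; exact hδ)] with y h1 h2 h3 h4
    exact ⟨h1, h2, h3, h4⟩
  have heq : f ∘ T.e.symm =ᶠ[𝓝 (T.e p)] diagMap θ Λ := by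
    filter_upwards [hsrc] with y ⟨hy, hyf, hy0, hy1⟩
    have hq := T.symm_mem_source hy
    set q := T.e.symm y
    have hqy : T.e q = y := T.e_symm hy
    have ht : y 1 ∈ Ioo (0 : ℝ) 1 := T.Ioo_mem (T.box_subset hy).2
    obtain ⟨hd1, hd2⟩ := hdist q hq (by rwa [hqy]) (by rwa [hqy])
    rw [hqy] at hd1 hd2
    obtain ⟨s', hs', hmin, hp1, hp2, hp3⟩ := hf.coords q hyf
    -- Chart and tube each have a foot that is strictly nearer to `q` than all other inner points of
    -- the edge, so the two feet coincide. The chart is therefore determined by the tube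
    -- coordinates.
    have hs'c : s' = c (y 1) := by
      by_contra hne
      have h1 := hmin (c (y 1)) (hc _ ht).1 (Ne.symm hne)
      rw [(hc _ ht).2] at h1
      have hs'' := M.edgeCoord_mem_Ioo hedge.symm hs'
      have h3 := (M.edgeParam_edgeCoord i k (hedge ▸ M.edgeParam_mem_edge i' k' hs')).2
      have h2 := hd2 _ hs'' (fun h4 => by
        rw [h4, ← (hc _ ht).2] at h3
        exact hne (M.edgeParam_injOn i' k' (Ioo_subset_Icc_self hs')
          (Ioo_subset_Icc_self (hc _ ht).1) h3.symm))
      rw [h3] at h2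
      exact lt_asymm h1 h2
    subst hs'c
    rw [(hc _ ht).2] at hp1 hp2
    have hf0 := hθi q hyf hq _ (by rw [hd1, hqy]) hp1 hp2
    rw [hqy] at hf0
    apply plane_ext
    · simpa [diagMap] using hf0
    · exact hp3
  obtain ⟨hL1, hL2⟩ := edgeLength_contDiffOn hg i' k' hf.s₀_mem
  obtain ⟨hc1, hc2⟩ := M.hasDerivAt_edgeCoord_edgeParam hedge hs
  have hLs := hL1.contDiffAt (isOpen_Ioo.mem_nhds (hc s hs).1)
  have hΛ : ContDiffAt ℝ ∞ Λ s := ContDiffAt.comp s hLs hc1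
  refine compatAt_of_det hp hpf ((diagMap_contDiffAt θ hΛ).congr_of_eventuallyEq heq) ?_
  rw [heq.fderiv_eq]
  refine diagMap_det (hΛ.differentiableAt (by simp)) hθ ?_
  have hd := HasDerivAt.comp s (hLs.differentiableAt (by simp)).hasDerivAt
    (hc1.differentiableAt (by simp)).hasDerivAt
  rw [show deriv Λ (T.e p 1) = _ from hd.deriv]
  exact mul_ne_zero (hL2 _ (hc s hs).1) hc2

lemma compatAt_edgeChart (hg : M.IsReggeMetric g) {i' j' : ι} {k' : Fin 3} {s₀' : ℝ}
    {f : OpenPartialHomeomorph Plane Plane} (hf : M.IsEdgeChart g i' j' k' s₀' f) {p : Plane}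
    (hp : p ∈ T.e.source) (hpf : p ∈ f.source) : CompatAt T.e f p := by
  rcases T.e_fst_eq_or_interior hp with h0 | ⟨m, hm⟩
  · exact T.compatAt_edgeChart_of_fst_zero hg hf hp hpf h0
  · obtain ⟨h1, h2⟩ := hf.contDiffAt hpf hm
    exact (T.compatAt_ofSet hp hm).symm.trans hp (by exact hm) hpf
      (CurvedMesh.compatAt_ofSet isOpen_interior hpf hm h1 h2)

theorem isGluedChart (hg : M.IsReggeMetric g) : M.IsGluedChart g T.e where
  source_subset := fun _ hp => T.mem_punctured hp
  compat_elem m := smoothCompat_iff.2 fun _ hp => (T.compatAt_ofSet hp.1 hp.2).symm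
  compat_edge _ _ _ _ _ hf := smoothCompat_iff.2 fun _ hp => T.compatAt_edgeChart hg hf hp.1 hp.2

/-- The second tube coordinate is replaced by arclength. Existence is indispensable: charts of the
glued structure are defined by compatibility with edge charts, a condition that would say nothing at
an edge point without such a chart. -/
theorem exists_isEdgeChart (hg : M.IsReggeMetric g) {s₀ : ℝ} (hs₀ : s₀ ∈ Ioo T.a T.b) :
    ∃ f, M.IsEdgeChart g i j k s₀ f := by
  have hs₀1 := T.Ioo_mem (Ioo_subset_Icc_self hs₀)
  obtain ⟨δ, hδ, hdist⟩ := T.exists_gdist hg hs₀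
  obtain ⟨hL1, hL2⟩ := edgeLength_contDiffOn hg i k hs₀1
  set Λ := M.edgeLength g i k s₀
  have hΛ : ∀ s ∈ Ioo (0 : ℝ) 1, ContDiffAt ℝ ∞ Λ s := fun s hs =>
    hL1.contDiffAt (isOpen_Ioo.mem_nhds hs)
  set y₀ : Plane := planeVec ![0, s₀]
  have hA : ∀ y : Plane, y 1 ∈ Ioo (0 : ℝ) 1 → ContDiffAt ℝ ∞ (diagMap 1 Λ) y ∧
      (fderiv ℝ (diagMap 1 Λ) y).det ≠ 0 := fun y hy =>
    ⟨diagMap_contDiffAt 1 (hΛ _ hy), diagMap_det ((hΛ _ hy).differentiableAt (by simp)) one_ne_zero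
      (hL2 _ hy)⟩
  have hy₀ : y₀ 1 ∈ Ioo (0 : ℝ) 1 := by simpa [y₀] using hs₀1
  obtain ⟨hA1, hA2⟩ := hA y₀ hy₀
  obtain ⟨B, hB⟩ := isUnit_of_det_ne_zero hA2
  have hBd : HasFDerivAt (diagMap 1 Λ) (B : Plane →L[ℝ] Plane) y₀ := by
    rw [hB]; exact (hA1.differentiableAt (by simp)).hasFDerivAt
  set A := (hA1.toOpenPartialHomeomorph (diagMap 1 Λ) hBd (by simp)).restrOpen
    (planeBox δ (s₀ - δ) (s₀ + δ)) (isOpen_planeBox _ _ _)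
  have hAc : ∀ y, A y = diagMap 1 Λ y := fun y => rfl
  have hAs : ∀ y ∈ A.source, |y 0| < δ ∧ |y 1 - s₀| < δ := fun y hy =>
    ⟨abs_lt.2 hy.2.1, abs_lt.2 ⟨by linarith [hy.2.2.1], by linarith [hy.2.2.2]⟩⟩
  have hy₀A : y₀ ∈ A.source :=
    ⟨hA1.mem_toOpenPartialHomeomorph_source hBd (by simp), by simp [y₀, hδ], by simp [y₀, hδ]⟩
  obtain ⟨hsrc, hesrc⟩ := T.edgeParam_mem_source hs₀
  have hcoord : ∀ p ∈ (T.e.trans A).source, p ∈ T.e.source ∧ T.e p ∈ A.source := fun p hp => by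
    rwa [OpenPartialHomeomorph.trans_source] at hp
  have hval : ∀ p, (T.e.trans A) p 0 = T.e p 0 ∧ (T.e.trans A) p 1 = Λ (T.e p 1) := fun p => by
    simp [hAc, diagMap]
  have hside : ∀ m, m = i ∨ m = j → ∃ f ς, T.HasSide m f ς := by
    rintro m (rfl | rfl)
    · exact ⟨_, _, T.hasSide_p⟩
    · exact ⟨_, _, T.hasSide_m⟩
  refine ⟨T.e.trans A, ?_⟩
  constructor
  · exact T.neighbor.ne
  · exact hs₀1
  · exact T.neighbor.shared
  · rw [OpenPartialHomeomorph.trans_source]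
    exact ⟨hsrc, by rw [mem_preimage, hesrc]; exact hy₀A⟩
  · exact fun p hp => T.source_subset (hcoord p hp).1
  · rintro i' k' p ⟨hp, hpe⟩
    have hpT := (hcoord p hp).1
    have h0 := T.mem_edge_of_mem_edge hpT hpe
    rw [(T.e_fst_eq_zero_iff hpT).1 h0]
    exact M.edgeParam_mem_edge i k (T.Ioo_mem (T.box_subset (T.e_mem_box hpT)).2)
  · intro p hp
    obtain ⟨hpT, hpA⟩ := hcoord p hp
    obtain ⟨h1, h2⟩ := hAs _ hpA
    obtain ⟨hd1, hd2⟩ := hdist p hpT h1 h2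
    refine ⟨T.e p 1, T.Ioo_mem (T.box_subset (T.e_mem_box hpT)).2, hd2, fun hpi => ?_, fun hpj => ?_,
      (hval p).2⟩
    · rw [(hval p).1, hd1, abs_of_nonneg]
      have := (T.hasSide_p.mem_iff hpT).1.1 hpi
      linarith
    · rw [(hval p).1, hd1, abs_of_nonpos, neg_neg]
      have := (T.hasSide_m.mem_iff hpT).1.1 hpj
      linarith
  · intro m hm p hp
    obtain ⟨f, ς, h⟩ := hside m hm
    obtain ⟨hpT, hpA⟩ := hcoord p hp.1
    have hb := T.Ioo_mem (T.box_subset (T.e_mem_box hpT)).2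
    have h1 := (hA _ hb).1.comp_contDiffWithinAt p (h.contDiffOn p ⟨hpT, hp.2⟩)
    exact h1.mono fun q hq => ⟨(hcoord q hq.1).1, hq.2⟩
  · intro m hm p hp
    obtain ⟨f, ς, h⟩ := hside m hm
    obtain ⟨hpT, hpA⟩ := hcoord p hp.1
    have hb := T.Ioo_mem (T.box_subset (T.e_mem_box hpT)).2
    obtain ⟨h1, h2⟩ := hA _ hb
    have h3 := (h1.differentiableAt (by simp)).hasFDerivAt.comp_hasFDerivWithinAt p
      (h.hasFDerivWithinAt hpT hp.2)
    have h4 : fderivWithin ℝ (T.e.trans A) (M.elem m) p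
        = fderiv ℝ (diagMap 1 Λ) (T.e p) ∘L fderiv ℝ f.symm p :=
      HasFDerivWithinAt.fderivWithin h3 (M.uniqueDiffOn_elem m p hp.2)
    rw [h4, clm_det_comp]
    have h5 := h.fderivWithin_det_ne hpT hp.2
    rw [h.fderivWithin hpT hp.2] at h5
    exact mul_ne_zero h2 h5

/-- Any chart of the glued structure is compatible with the tube. -/
lemma compatAt_of_isGluedChart (hg : M.IsReggeMetric g) {e : OpenPartialHomeomorph Plane Plane}
    (he : M.IsGluedChart g e) {p : Plane} (hp : p ∈ T.e.source) (hpe : p ∈ e.source) :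
    CompatAt T.e e p := by
  rcases T.e_fst_eq_or_interior hp with h0 | ⟨m, hm⟩
  · have hbox := T.e_mem_box hp
    obtain ⟨f, hf⟩ := T.exists_isEdgeChart hg hbox.2
    have hpf : p ∈ f.source := by
      rw [(T.e_fst_eq_zero_iff hp).1 h0]; exact hf.mem_source
    exact (T.compatAt_edgeChart hg hf hp hpf).trans hp hpf hpe
      (h := e) (smoothCompat_iff.1 (he.compat_edge _ _ _ _ _ hf) p ⟨hpe, hpf⟩).symm
  · exact (T.compatAt_ofSet hp hm).symm.trans hp (by exact hm) hpe
      (smoothCompat_iff.1 (he.compat_elem m) p ⟨hpe, hm⟩).symm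

end EdgeTube

/-- The Cartesian coordinates inside an element. -/
def innerChart (M : CurvedMesh Ω ι) (i : ι) : OpenPartialHomeomorph Plane Plane :=
  OpenPartialHomeomorph.ofSet (interior (M.elem i)) isOpen_interior

lemma isGluedChart_innerChart (i : ι) : M.IsGluedChart g (M.innerChart i) where
  source_subset := M.interior_subset_punctured i
  compat_elem m := smoothCompat_iff.2 fun p hp =>
    ⟨by simpa [innerChart] using contDiffAt_id, by simpa [innerChart] using contDiffAt_id⟩
  compat_edge _ _ _ _ _ hf := smoothCompat_iff.2 fun _ hp =>
    compatAt_ofSet isOpen_interior hp.2 hp.1 (hf.contDiffAt hp.2 hp.1).1 (hf.contDiffAt hp.2 hp.1).2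

end CurvedMesh

end

/-! ### Stokes' theorem on an element and integration by parts -/

noncomputable section

open Filter Topology

set_option maxSynthPendingDepth 3

lemma measurePreserving_planeProd : MeasurePreserving planeProd volume volume :=
  (volume_preserving_finTwoArrow ℝ).comp (PiLp.volume_preserving_ofLp (Fin 2))

lemma measurePreserving_planeProd_symm : MeasurePreserving planeProd.symm volume volume :=
  measurePreserving_planeProd.symm planeProd.toHomeomorph.toMeasurableEquiv

lemma integral_plane (f : Plane → ℝ) : ∫ x, f x = ∫ q : ℝ × ℝ, f (planeVec ![q.1, q.2]) := by
  rw [← measurePreserving_planeProd_symm.integral_comp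
    planeProd.symm.toHomeomorph.measurableEmbedding]
  simp

section RefTriangle

/-- The unit triangle in the product of two lines. -/
def prodTriangle : Set (ℝ × ℝ) := {q | 0 ≤ q.1 ∧ 0 ≤ q.2 ∧ q.1 + q.2 ≤ 1}

lemma prodTriangle_inner (G : ℝ × ℝ → ℝ) (a : ℝ) : ∫ b, prodTriangle.indicator G (a, b)
    = (Icc (0 : ℝ) 1).indicator (fun a => ∫ b in (0 : ℝ)..(1 - a), G (a, b)) a := by
  by_cases ha : a ∈ Icc (0 : ℝ) 1
  · rw [indicator_of_mem ha, intervalIntegral.integral_of_le (by linarith [ha.2]),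
      ← integral_Icc_eq_integral_Ioc, ← integral_indicator measurableSet_Icc]
    congr 1
    funext b
    by_cases hb : b ∈ Icc (0 : ℝ) (1 - a)
    · rw [indicator_of_mem hb, indicator_of_mem]
      exact ⟨ha.1, hb.1, by simp only; linarith [hb.2]⟩
    · rw [indicator_of_notMem hb, indicator_of_notMem]
      exact fun h => hb ⟨h.2.1, by have := h.2.2; simp only at this; linarith⟩
  · rw [indicator_of_notMem ha]
    have : (fun b => prodTriangle.indicator G (a, b)) = fun _ => 0 := by
      funext b
      refine indicator_of_notMem (fun h => ha ⟨h.1, ?_⟩) _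
      have h1 := h.2.1; have h2 := h.2.2
      simp only at h1 h2; linarith
    rw [this, integral_zero]

lemma integral_refTriangle {f : Plane → ℝ} (hf : Continuous f) :
    (∫ x in refTriangle, f x = ∫ a in (0 : ℝ)..1, ∫ b in (0 : ℝ)..(1 - a), f (planeVec ![a, b])) ∧
    (∫ x in refTriangle, f x = ∫ b in (0 : ℝ)..1, ∫ a in (0 : ℝ)..(1 - b), f (planeVec ![a, b])) := by
  set G : ℝ × ℝ → ℝ := fun q => f (planeVec ![q.1, q.2])
  have hG : Continuous G := hf.comp contDiff_planeVec.continuous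
  have hmeas : MeasurableSet refTriangle := isCompact_refTriangle.measurableSet
  have hR : prodTriangle = planeProd.symm ⁻¹' refTriangle := by
    ext q; simp [prodTriangle, refTriangle]
  have hRc : IsCompact prodTriangle := by
    rw [hR]; exact planeProd.symm.toHomeomorph.isCompact_preimage.2 isCompact_refTriangle
  have h0 : ∫ x in refTriangle, f x = ∫ q, prodTriangle.indicator G q := by
    rw [← integral_indicator hmeas, integral_plane]
    rfl
  have hint : Integrable (prodTriangle.indicator G) (volume.prod volume) :=
    (integrable_indicator_iff hRc.measurableSet).2 (hG.continuousOn.integrableOn_compact hRc)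
  have hfin : ∀ H : ℝ → ℝ, ∫ a, (Icc (0 : ℝ) 1).indicator H a = ∫ a in (0 : ℝ)..1, H a := fun H => by
    rw [integral_indicator measurableSet_Icc, integral_Icc_eq_integral_Ioc,
      intervalIntegral.integral_of_le zero_le_one]
  constructor
  · rw [h0, Measure.volume_eq_prod, integral_prod _ hint]
    simp only [prodTriangle_inner, hfin]
    rfl
  · rw [h0, Measure.volume_eq_prod, integral_prod_symm _ hint]
    have hsw : ∀ a b : ℝ, prodTriangle.indicator G (a, b)
        = prodTriangle.indicator (G ∘ Prod.swap) (b, a) := by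
      intro a b
      have hiff : (a, b) ∈ prodTriangle ↔ (b, a) ∈ prodTriangle := by
        simp only [prodTriangle, mem_ofPred_eq]
        constructor <;> rintro ⟨h1, h2, h3⟩ <;> exact ⟨h2, h1, by linarith⟩
      by_cases h : (a, b) ∈ prodTriangle
      · rw [indicator_of_mem h, indicator_of_mem (hiff.1 h)]; rfl
      · rw [indicator_of_notMem h, indicator_of_notMem (fun h' => h (hiff.2 h'))]
    simp only [hsw, prodTriangle_inner, hfin]
    rfl

end RefTriangle

/-- The dot product of components. -/
def dotp (u v : Plane) : ℝ := u 0 * v 0 + u 1 * v 1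

/-- The scalar curl of the 1-form with components `α`. -/
def planeCurl (α : Plane → Plane) (p : Plane) : ℝ :=
  fderiv ℝ α p (coordVec 0) 1 - fderiv ℝ α p (coordVec 1) 0

lemma continuous_fderiv_coord {α : Plane → Plane} (hα : ContDiff ℝ ∞ α) (a b : Fin 2) :
    Continuous fun p => fderiv ℝ α p (coordVec a) b :=
  (coordL b).continuous.comp ((hα.continuous_fderiv (by simp)).clm_apply continuous_const)

lemma continuous_planeCurl {α : Plane → Plane} (hα : ContDiff ℝ ∞ α) : Continuous (planeCurl α) :=
  (continuous_fderiv_coord hα 0 1).sub (continuous_fderiv_coord hα 1 0)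

/-- Fubini in both orders and the fundamental theorem of calculus; the hypotenuse receives one
contribution from either order. -/
lemma integral_planeCurl_refTriangle {β : Plane → Plane} (hβ : ContDiff ℝ ∞ β) :
    ∫ x in refTriangle, planeCurl β x = ∑ k, ∫ s in (0 : ℝ)..1, dotp (β (refEdge k s)) (refDir k) := by
  have hcoord : ∀ a, Continuous fun p => β p a := fun a => (coordL a).continuous.comp hβ.continuous
  have hd : ∀ y : Plane, ∀ a, HasFDerivAt (fun z => β z a) (coordL a ∘L fderiv ℝ β y) y := fun y a =>
    (coordL a).hasFDerivAt.comp y (hβ.differentiable (by simp) y).hasFDerivAt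
  have h1 : ∀ b : ℝ, ∫ a in (0 : ℝ)..(1 - b), fderiv ℝ β (planeVec ![a, b]) (coordVec 0) 1
      = β (planeVec ![1 - b, b]) 1 - β (planeVec ![0, b]) 1 := fun b => by
    refine intervalIntegral.integral_eq_sub_of_hasDerivAt
      (f := fun a => β (planeVec ![a, b]) 1) (fun a _ => ?_) ?_
    · exact HasFDerivAt.comp_hasDerivAt (l := fun z => β z 1) a (hd _ 1) (hasDerivAt_planeVec_fst a b)
    · exact ((continuous_fderiv_coord hβ 0 1).comp (contDiff_planeVec.continuous.comp
        (continuous_id.prodMk continuous_const))).intervalIntegrable _ _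
  have h2 : ∀ a : ℝ, ∫ b in (0 : ℝ)..(1 - a), fderiv ℝ β (planeVec ![a, b]) (coordVec 1) 0
      = β (planeVec ![a, 1 - a]) 0 - β (planeVec ![a, 0]) 0 := fun a => by
    refine intervalIntegral.integral_eq_sub_of_hasDerivAt
      (f := fun b => β (planeVec ![a, b]) 0) (fun b _ => ?_) ?_
    · exact HasFDerivAt.comp_hasDerivAt (l := fun z => β z 0) b (hd _ 0) (hasDerivAt_planeVec_snd a b)
    · exact ((continuous_fderiv_coord hβ 1 0).comp (contDiff_planeVec.continuous.comp
        (continuous_const.prodMk continuous_id))).intervalIntegrable _ _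
  have hcurve : ∀ u v : ℝ → ℝ, Continuous u → Continuous v → ∀ a,
      IntervalIntegrable (fun s => β (planeVec ![u s, v s]) a) volume 0 1 := fun u v hu hv a =>
    ((hcoord a).comp (contDiff_planeVec.continuous.comp (hu.prodMk hv))).intervalIntegrable _ _
  have cid : Continuous fun s : ℝ => s := continuous_id
  have csub : Continuous fun s : ℝ => 1 - s := continuous_const.sub continuous_id
  have c0 : Continuous fun _ : ℝ => (0 : ℝ) := continuous_const
  have hint : ∀ a b, IntegrableOn (fun p => fderiv ℝ β p (coordVec a) b) refTriangle := fun a b =>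
    (continuous_fderiv_coord hβ a b).continuousOn.integrableOn_compact isCompact_refTriangle
  simp only [planeCurl]
  rw [integral_sub (hint 0 1) (hint 1 0), (integral_refTriangle (continuous_fderiv_coord hβ 0 1)).2,
    (integral_refTriangle (continuous_fderiv_coord hβ 1 0)).1]
  simp only [h1, h2]
  rw [intervalIntegral.integral_sub (hcurve _ _ csub cid 1) (hcurve _ _ c0 cid 1),
    intervalIntegral.integral_sub (hcurve _ _ cid csub 0) (hcurve _ _ cid c0 0), Fin.sum_univ_three]
  have e0 : ∀ s, dotp (β (refEdge 0 s)) (refDir 0) = β (planeVec ![s, 0]) 0 := fun s => by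
    simp [dotp, refEdge, refDir]
  have e1 : ∀ s, dotp (β (refEdge 1 s)) (refDir 1)
      = β (planeVec ![1 - s, s]) 1 - β (planeVec ![1 - s, s]) 0 := fun s => by
    simp [dotp, refEdge, refDir]; ring
  have e2 : ∀ s, dotp (β (refEdge 2 s)) (refDir 2) = - β (planeVec ![0, 1 - s]) 1 := fun s => by
    simp [dotp, refEdge, refDir]
  simp only [e0, e1, e2]
  rw [intervalIntegral.integral_sub (hcurve _ _ csub cid 1) (hcurve _ _ csub cid 0),
    intervalIntegral.integral_neg]
  have s1 : ∫ s in (0 : ℝ)..1, β (planeVec ![1 - s, s]) 0 = ∫ s in (0 : ℝ)..1, β (planeVec ![s, 1 - s]) 0 := by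
    have := intervalIntegral.integral_comp_sub_left (a := 0) (b := 1)
      (fun s => β (planeVec ![s, 1 - s]) 0) (1 : ℝ)
    simpa using this
  have s2 : ∫ s in (0 : ℝ)..1, β (planeVec ![0, 1 - s]) 1 = ∫ s in (0 : ℝ)..1, β (planeVec ![0, s]) 1 := by
    have := intervalIntegral.integral_comp_sub_left (a := 0) (b := 1)
      (fun s => β (planeVec ![0, s]) 1) (1 : ℝ)
    simpa using this
  rw [s1, s2]
  ring

namespace CurvedMesh

variable {Ω : Set Plane} {ι : Type} (M : CurvedMesh Ω ι)

/-- Stokes' theorem on a mesh element. -/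
lemma integral_planeCurl_elem (i : ι) {α : Plane → Plane} (hα : ContDiff ℝ ∞ α) :
    ∫ p in M.elem i, planeCurl α p
      = ∑ k, ∫ s in (0 : ℝ)..1, dotp (α (M.edgeParam i k s)) (M.tangent i k s) := by
  set F := M.map i
  have hF : ContDiff ℝ ∞ F := M.smooth i
  have hdF : ContDiff ℝ ∞ (fderiv ℝ F) := hF.fderiv_right (m := ∞) le_rfl
  have hdFa : ∀ a, ContDiff ℝ ∞ fun x => fderiv ℝ F x (coordVec a) := fun a =>
    hdF.clm_apply contDiff_const
  have hco : ∀ {u : Plane → Plane}, ContDiff ℝ ∞ u → ∀ a, ContDiff ℝ ∞ fun x => u x a := fun hu a =>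
    (coordL a).contDiff.comp hu
  have hαF : ContDiff ℝ ∞ fun x => α (F x) := hα.comp hF
  set b : Fin 2 → Plane → ℝ := fun a x => dotp (α (F x)) (fderiv ℝ F x (coordVec a))
  have hb : ∀ a, ContDiff ℝ ∞ (b a) := fun a =>
    ((hco hαF 0).mul (hco (hdFa a) 0)).add ((hco hαF 1).mul (hco (hdFa a) 1))
  set β : Plane → Plane := fun x => planeVec ![b 0 x, b 1 x]
  have hβ : ContDiff ℝ ∞ β := contDiff_planeVec.comp ((hb 0).prodMk (hb 1))
  have hβd : ∀ x v a, fderiv ℝ β x v a = fderiv ℝ (b a) x v := by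
    intro x v a
    have h1 : HasFDerivAt (fun z => β z a) (coordL a ∘L fderiv ℝ β x) x :=
      (coordL a).hasFDerivAt.comp x (hβ.differentiable (by simp) x).hasFDerivAt
    have h2 : (fun z => β z a) = b a := by funext z; fin_cases a <;> simp [β]
    rw [h2] at h1
    rw [h1.fderiv]; rfl
  have hbd : ∀ x v a, fderiv ℝ (b a) x v
      = dotp (fderiv ℝ α (F x) (fderiv ℝ F x v)) (fderiv ℝ F x (coordVec a))
        + dotp (α (F x)) (fderiv ℝ (fderiv ℝ F) x v (coordVec a)) := by
    intro x v a
    have h1 : ∀ c, HasFDerivAt (fun z => α (F z) c) (coordL c ∘L fderiv ℝ α (F x) ∘L fderiv ℝ F x) x :=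
      fun c => (coordL c).hasFDerivAt.comp x ((hα.differentiable (by simp) _).hasFDerivAt.comp x
        (hF.differentiable (by simp) x).hasFDerivAt)
    have h2 : ∀ c, HasFDerivAt (fun z => fderiv ℝ F z (coordVec a) c)
        (coordL c ∘L (fderiv ℝ (fderiv ℝ F) x).flip (coordVec a)) x := fun c => by
      have := ((hdF.differentiable (by simp) x).hasFDerivAt.clm_apply
        (hasFDerivAt_const (coordVec a) x))
      simp only [ContinuousLinearMap.comp_zero, zero_add] at this
      exact (coordL c).hasFDerivAt.comp x this
    have h3 := ((h1 0).mul (h2 0)).add ((h1 1).mul (h2 1))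
    rw [show fderiv ℝ (b a) x = _ from h3.fderiv]
    simp [dotp]
    ring
  -- Pullback commutes with the exterior derivative: `β` is the pullback of the 1-form `α` by `F`,
  -- and the second derivatives of `F` cancel by symmetry.
  have hdβ : ∀ x, planeCurl β x = (fderiv ℝ F x).det * planeCurl α (F x) := by
    intro x
    have hsym := (hF.contDiffAt (x := x)).isSymmSndFDerivAt (by
      simpa using (WithTop.coe_le_coe.2 le_top : ((2 : ℕ∞) : WithTop ℕ∞) ≤ ∞)) (coordVec 0) (coordVec 1)
    simp only [planeCurl, hβd, hbd]
    rw [hsym, clm_det_eq, clm_apply_coord (fderiv ℝ α (F x)) (fderiv ℝ F x (coordVec 0)),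
      clm_apply_coord (fderiv ℝ α (F x)) (fderiv ℝ F x (coordVec 1))]
    simp [dotp]
    ring
  have h1 := integral_image_eq_integral_abs_det_fderiv_smul volume isCompact_refTriangle.measurableSet
    (fun x _ => ((hF.differentiable (by simp) x).hasFDerivAt).hasFDerivWithinAt) (M.injOn i) (planeCurl α)
  have h2 : ∫ x in refTriangle, |(fderiv ℝ F x).det| • planeCurl α (F x)
      = ∫ x in refTriangle, planeCurl β x := by
    refine setIntegral_congr_fun isCompact_refTriangle.measurableSet fun x hx => ?_
    simp only [hdβ, abs_of_pos (M.det_pos i x hx), smul_eq_mul, F]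
  rw [elem, h1, h2, integral_planeCurl_refTriangle hβ]
  refine Finset.sum_congr rfl fun k _ => intervalIntegral.integral_congr fun s _ => ?_
  simp only [M.tangent_eq, edgeParam]
  change dotp (β (refEdge k s)) (refDir k)
    = dotp (α (F (refEdge k s))) (fderiv ℝ F (refEdge k s) (refDir k))
  rw [clm_apply_coord (fderiv ℝ F (refEdge k s)) (refDir k)]
  simp [dotp, β, b]
  ring

variable {M} {g σ : PwTensor ι}

lemma pd_eq {i : ι} {f f' : Plane → ℝ} (hf' : Differentiable ℝ f') (h : EqOn f f' (M.elem i))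
    {p : Plane} (hp : p ∈ M.elem i) (a : Fin 2) : M.pd i a f p = fderiv ℝ f' p (coordVec a) := by
  rw [pd, fderivWithin_congr h (h hp), (hf' p).fderivWithin (M.uniqueDiffOn_elem i p hp)]

lemma continuousOn_pd {i : ι} {f : Plane → ℝ} (h : SmoothUpTo (M.elem i) f) (a : Fin 2) :
    ContinuousOn (M.pd i a f) (M.elem i) := by
  obtain ⟨f', hf', he⟩ := h
  refine ContinuousOn.congr (f := fun p => fderiv ℝ f' p (coordVec a)) ?_
    fun p hp => pd_eq (hf'.differentiable (by simp)) he hp a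
  exact ((hf'.continuous_fderiv (by simp)).clm_apply continuous_const).continuousOn

lemma SmoothUpTo_continuousOn {S : Set Plane} {F : Type} [NormedAddCommGroup F] [NormedSpace ℝ F]
    {f : Plane → F} (h : SmoothUpTo S f) : ContinuousOn f S := by
  obtain ⟨f', hf', he⟩ := h
  exact hf'.continuous.continuousOn.congr he

lemma christoffel₂_symm (hg : M.IsReggeMetric g) {i : ι} {p : Plane} (hp : p ∈ M.elem i)
    (a b c : Fin 2) : M.christoffel₂ g i a b c p = M.christoffel₂ g i b a c p := by
  have hpd : ∀ a b c, M.pd i a (fun q => g i q b c) p = M.pd i a (fun q => g i q c b) p := by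
    intro a b c
    have h : EqOn (fun q => g i q b c) (fun q => g i q c b) (M.elem i) := fun q hq =>
      ((hg.regge.symm i q hq).apply c b)
    rw [pd, fderivWithin_congr h (h hp), pd]
  simp only [christoffel₂]
  refine Finset.sum_congr rfl fun d _ => ?_
  rw [christoffel₁, christoffel₁, hpd a b d, hpd b d a, hpd d a b]
  ring

lemma IsReggeMetric.sqrt_det_pos (hg : M.IsReggeMetric g) {i : ι} {p : Plane} (hp : p ∈ M.elem i) :
    0 < Real.sqrt (g i p).det := Real.sqrt_pos.2 (hg.isMetricMatrix hp).det_pos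

lemma IsReggeMetric.continuousOn_christoffel₂ (hg : M.IsReggeMetric g) (i : ι) (a b c : Fin 2) :
    ContinuousOn (M.christoffel₂ g i a b c) (M.elem i) := by
  have h : ∀ a b, ContinuousOn (fun p => g i p a b) (M.elem i) := fun a b =>
    SmoothUpTo_continuousOn (hg.regge.smooth i a b)
  have hdet : ContinuousOn (fun p => (g i p).det⁻¹) (M.elem i) := by
    refine ContinuousOn.inv₀ ?_ fun p hp => (hg.isMetricMatrix hp).det_pos.ne'
    simp only [Matrix.det_fin_two]
    exact ((h 0 0).mul (h 1 1)).sub ((h 0 1).mul (h 1 0))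
  have hinv : ∀ c d, ContinuousOn (fun p => (g i p)⁻¹ c d) (M.elem i) := by
    intro c d
    simp only [Matrix.inv_def, Ring.inverse_eq_inv', Matrix.adjugate_fin_two, Matrix.smul_apply,
      smul_eq_mul]
    refine hdet.mul ?_
    fin_cases c <;> fin_cases d
    · exact h 1 1
    · exact (h 0 1).neg
    · exact (h 1 0).neg
    · exact h 0 0
  have hpd := fun a b c => continuousOn_pd (hg.regge.smooth i b c) a
  refine continuousOn_finsetSum _ fun d _ => (hinv c d).mul (continuousOn_const.mul ?_)
  exact ((hpd _ _ _).add (hpd _ _ _)).sub (hpd _ _ _)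

lemma IsReggeMetric.continuousOn_covDerivTensor (hg : M.IsReggeMetric g) (hσ : M.IsRegge σ) (i : ι)
    (a b c : Fin 2) : ContinuousOn (M.covDerivTensor g σ i a b c) (M.elem i) := by
  have h : ∀ a b, ContinuousOn (fun p => σ i p a b) (M.elem i) := fun a b =>
    SmoothUpTo_continuousOn (hσ.smooth i a b)
  exact ((continuousOn_pd (hσ.smooth i b c) a).sub (continuousOn_finsetSum _ fun m _ =>
    (hg.continuousOn_christoffel₂ i a b m).mul (h m c))).sub (continuousOn_finsetSum _ fun m _ =>
    (hg.continuousOn_christoffel₂ i a c m).mul (h b m))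

/-- The components of `curl_g σ`, times the volume density, are continuous. -/
lemma IsReggeMetric.continuousOn_curlComp (hg : M.IsReggeMetric g) (hσ : M.IsRegge σ) (i : ι)
    (a : Fin 2) :
    ContinuousOn (fun p => M.curlComp g σ i a p * Real.sqrt (g i p).det) (M.elem i) := by
  refine ContinuousOn.congr ((hg.continuousOn_covDerivTensor hσ i 0 a 1).sub
    (hg.continuousOn_covDerivTensor hσ i 1 a 0)) fun p hp => ?_
  rw [curlComp, div_mul_cancel₀ _ (hg.sqrt_det_pos hp).ne']
  rfl

lemma IsReggeMetric.continuousOn_curlApp (hg : M.IsReggeMetric g) (hσ : M.IsRegge σ) {i : ι}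
    {X : PwField ι} (hX : ContinuousOn (X i) (M.elem i)) :
    ContinuousOn (fun p => M.curlApp g σ X i p * Real.sqrt (g i p).det) (M.elem i) := by
  have h : (fun p => M.curlApp g σ X i p * Real.sqrt (g i p).det)
      = fun p => ∑ a, M.curlComp g σ i a p * Real.sqrt (g i p).det * X i p a := by
    funext p
    rw [curlApp, Finset.sum_mul]
    exact Finset.sum_congr rfl fun a _ => by ring
  rw [h]
  exact continuousOn_finsetSum _ fun a _ => (hg.continuousOn_curlComp hσ i a).mul
    ((coordL a).continuous.comp_continuousOn hX)

/-- Integration by parts in the pairing with a piecewise smooth field. -/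
theorem curlPairing_eq [Fintype ι] (hg : M.IsReggeMetric g) (hσ : M.IsRegge σ) {φ : PwField ι}
    (hφ : ∀ i, SmoothUpTo (M.elem i) (φ i)) : M.curlPairing g σ φ
      = (∑ i, M.elemIntegral g i (M.curlApp g σ φ i)) - ∑ i, ∑ k, ∫ s in (0 : ℝ)..1,
        tensorApp (σ i (M.edgeParam i k s)) (φ i (M.edgeParam i k s)) (M.tangent i k s) := by
  rw [curlPairing, ← Finset.sum_sub_distrib]
  refine Finset.sum_congr rfl fun i _ => ?_
  obtain ⟨S, hS, -, hSe⟩ := hσ.exists_extension i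
  obtain ⟨X, hX, hXe⟩ := hφ i
  have hXc : ∀ a, ContDiff ℝ ∞ fun p => X p a := fun a => (coordL a).contDiff.comp hX
  set A : Fin 2 → Plane → ℝ := fun b p => S p 0 b * X p 0 + S p 1 b * X p 1
  have hA : ∀ b, ContDiff ℝ ∞ (A b) := fun b =>
    ((hS 0 b).mul (hXc 0)).add ((hS 1 b).mul (hXc 1))
  set α : Plane → Plane := fun p => planeVec ![A 0 p, A 1 p]
  have hα : ContDiff ℝ ∞ α := contDiff_planeVec.comp ((hA 0).prodMk (hA 1))
  have hαd : ∀ p v b, fderiv ℝ α p v b = fderiv ℝ (A b) p v := by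
    intro p v b
    have h1 : HasFDerivAt (fun z => α z b) (coordL b ∘L fderiv ℝ α p) p :=
      (coordL b).hasFDerivAt.comp p (hα.differentiable (by simp) p).hasFDerivAt
    have h2 : (fun z => α z b) = A b := by funext z; fin_cases b <;> simp [α]
    rw [h2] at h1
    rw [h1.fderiv]; rfl
  have hAd : ∀ p v b, fderiv ℝ (A b) p v = (fderiv ℝ (fun q => S q 0 b) p v * X p 0
      + S p 0 b * fderiv ℝ (fun q => X q 0) p v) + (fderiv ℝ (fun q => S q 1 b) p v * X p 1
      + S p 1 b * fderiv ℝ (fun q => X q 1) p v) := by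
    intro p v b
    have hd : ∀ {u : Plane → ℝ}, ContDiff ℝ ∞ u → HasFDerivAt u (fderiv ℝ u p) p := fun hu =>
      (hu.differentiable (by simp) p).hasFDerivAt
    have h3 := ((hd (hS 0 b)).mul (hd (hXc 0))).add ((hd (hS 1 b)).mul (hd (hXc 1)))
    rw [show fderiv ℝ (A b) p = _ from h3.fderiv]
    simp
    ring
  -- The product rule for the 1-form `α` = σ(φ, ·). Its exterior derivative splits into the density
  -- of (curl σ)(φ) minus that of σ(rot φ); the Christoffel terms cancel by the symmetry `h10`.
  have hpt : ∀ p ∈ M.elem i, (∑ m, ∑ q, σ i p m q * M.rotComp g φ i m q p) * Real.sqrt (g i p).det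
      = M.curlApp g σ φ i p * Real.sqrt (g i p).det - planeCurl α p := by
    intro p hp
    have hne := (hg.sqrt_det_pos hp).ne'
    have hpS : ∀ a b c, M.pd i a (fun q => σ i q b c) p
        = fderiv ℝ (fun q => S q b c) p (coordVec a) := fun a b c =>
      pd_eq ((hS b c).differentiable (by simp)) (fun q hq => by simp only [hSe q hq]) hp a
    have hpX : ∀ a b, M.pd i a (fun q => φ i q b) p = fderiv ℝ (fun q => X q b) p (coordVec a) :=
      fun a b => pd_eq ((hXc b).differentiable (by simp)) (fun q hq => by simp only [hXe hq]) hp a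
    have h10 : ∀ c, M.christoffel₂ g i 1 0 c p = M.christoffel₂ g i 0 1 c p := fun c =>
      christoffel₂_symm hg hp 1 0 c
    have hl : (∑ m, ∑ q, σ i p m q * M.rotComp g φ i m q p) * Real.sqrt (g i p).det
        = ∑ m, ∑ q, σ i p m q * ∑ l, altSymb q l * M.covDerivField g φ i l m p := by
      rw [Finset.sum_mul]
      refine Finset.sum_congr rfl fun m _ => ?_
      rw [Finset.sum_mul]
      refine Finset.sum_congr rfl fun q _ => ?_
      rw [rotComp, mul_assoc, div_mul_cancel₀ _ hne]
    have hr : M.curlApp g σ φ i p * Real.sqrt (g i p).det = ∑ a,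
        (M.covDerivTensor g σ i 0 a 1 p - M.covDerivTensor g σ i 1 a 0 p) * φ i p a := by
      rw [curlApp, Finset.sum_mul]
      refine Finset.sum_congr rfl fun a _ => ?_
      rw [curlComp, mul_right_comm, div_mul_cancel₀ _ hne]
    rw [hl, hr]
    simp only [planeCurl, hαd, hAd, Fin.sum_univ_two, covDerivTensor, covDerivField, hpS, hpX, h10,
      hSe p hp, hXe hp, altSymb]
    simp
    ring
  have hmeas : MeasurableSet (M.elem i) := (M.isCompact_elem i).measurableSet
  rw [elemIntegral, elemIntegral, setIntegral_congr_fun hmeas hpt, integral_sub, integral_planeCurl_elem M i hα]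
  · congr 1
    refine Finset.sum_congr rfl fun k _ => intervalIntegral.integral_congr fun s hs => ?_
    rw [uIcc_of_le zero_le_one] at hs
    have he := M.edgeParam_mem_elem i k hs
    simp only [hSe _ he, hXe he, tensorApp_expand]
    simp [dotp, α, A]
    ring
  · exact (hg.continuousOn_curlApp hσ (SmoothUpTo_continuousOn (hφ i))).integrableOn_compact
      (M.isCompact_elem i)
  · exact (continuous_planeCurl hα).continuousOn.integrableOn_compact (M.isCompact_elem i)

end CurvedMesh

end

noncomputable section

open Filter Topology

set_option maxSynthPendingDepth 3

/-! ### Functions smooth up to the boundary -/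

namespace SmoothUpTo

variable {S : Set Plane} {F : Type} [NormedAddCommGroup F] [NormedSpace ℝ F]

lemma of_contDiff {f : Plane → F} (hf : ContDiff ℝ ∞ f) : SmoothUpTo S f := ⟨f, hf, fun _ _ => rfl⟩

lemma congr {f f' : Plane → F} (hf : SmoothUpTo S f) (h : EqOn f' f S) : SmoothUpTo S f' := by
  obtain ⟨u, hu, hue⟩ := hf
  exact ⟨u, hu, fun p hp => (h hp).trans (hue hp)⟩

lemma smul {a : Plane → ℝ} {f : Plane → F} (ha : SmoothUpTo S a) (hf : SmoothUpTo S f) :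
    SmoothUpTo S fun p => a p • f p := by
  obtain ⟨u, hu, hue⟩ := ha
  obtain ⟨v, hv, hve⟩ := hf
  exact ⟨fun p => u p • v p, hu.smul hv, fun p hp => by simp only [hue hp, hve hp]⟩

lemma sub {f f' : Plane → F} (hf : SmoothUpTo S f) (hf' : SmoothUpTo S f') :
    SmoothUpTo S fun p => f p - f' p := by
  obtain ⟨u, hu, hue⟩ := hf
  obtain ⟨v, hv, hve⟩ := hf'
  exact ⟨fun p => u p - v p, hu.sub hv, fun p hp => by simp only [hue hp, hve hp]⟩

lemma sum {κ : Type} (s : Finset κ) {f : κ → Plane → F} (hf : ∀ n ∈ s, SmoothUpTo S (f n)) :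
    SmoothUpTo S fun p => ∑ n ∈ s, f n p := by
  classical
  induction s using Finset.induction_on with
  | empty => simpa using of_contDiff (S := S) (contDiff_const (c := (0 : F)))
  | insert a s has ih =>
    obtain ⟨u, hu, hue⟩ := hf a (Finset.mem_insert_self a s)
    obtain ⟨v, hv, hve⟩ := ih fun n hn => hf n (Finset.mem_insert_of_mem hn)
    refine ⟨fun p => u p + v p, hu.add hv, fun p hp => ?_⟩
    simp only [Finset.sum_insert has, hue hp]
    rw [← hve hp]

lemma contDiffAt {f : Plane → F} (hf : SmoothUpTo S f) {p : Plane} (hp : p ∈ interior S) :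
    ContDiffAt ℝ ∞ f p := by
  obtain ⟨u, hu, hue⟩ := hf
  refine hu.contDiffAt.congr_of_eventuallyEq ?_
  filter_upwards [mem_interior_iff_mem_nhds.1 hp] with q hq using hue hq

end SmoothUpTo

/-- A smooth function on an open set that vanishes off a compact subset extends by zero. -/
lemma ContDiffOn.contDiff_indicator {F : Type} [NormedAddCommGroup F] [NormedSpace ℝ F]
    {U K : Set Plane} {f : Plane → F} (hf : ContDiffOn ℝ ∞ f U) (hU : IsOpen U) (hK : IsCompact K)
    (hKU : K ⊆ U) (h0 : ∀ p ∈ U, p ∉ K → f p = 0) : ContDiff ℝ ∞ (U.indicator f) := by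
  rw [contDiff_iff_contDiffAt]
  intro p
  by_cases hp : p ∈ U
  · refine (hf.contDiffAt (hU.mem_nhds hp)).congr_of_eventuallyEq ?_
    filter_upwards [hU.mem_nhds hp] with q hq using indicator_of_mem hq f
  · refine contDiffAt_const (c := (0 : F)) |>.congr_of_eventuallyEq ?_
    filter_upwards [hK.isClosed.isOpen_compl.mem_nhds fun h => hp (hKU h)] with q hq
    by_cases hqU : q ∈ U
    · rw [indicator_of_mem hqU, h0 q hqU hq]
    · exact indicator_of_notMem hqU f

namespace CurvedMesh

variable {Ω : Set Plane} {ι : Type} {M : CurvedMesh Ω ι} {g : PwTensor ι}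

/-! ### Smooth functions and fields on the glued manifold -/

/-- Charts through which smoothness on the glued manifold can be tested. -/
structure IsTestChart (M : CurvedMesh Ω ι) (g : PwTensor ι) (e : OpenPartialHomeomorph Plane Plane) :
    Prop where
  glued : M.IsGluedChart g e
  compat : ∀ f, M.IsGluedChart g f → ∀ p ∈ e.source, p ∈ f.source → CompatAt e f p
  diff : ∀ m, ∀ p ∈ M.elem m, p ∈ e.source → DifferentiableWithinAt ℝ e (M.elem m) p

lemma EdgeTube.isTestChart {i j : ι} {k : Fin 3} (T : M.EdgeTube g i j k) (hg : M.IsReggeMetric g) :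
    M.IsTestChart g T.e where
  glued := T.isGluedChart hg
  compat _ hf _ hp hpf := T.compatAt_of_isGluedChart hg hf hp hpf
  diff _ _ hm hp := by
    obtain ⟨f, ς, h⟩ := T.exists_hasSide hp hm
    exact (h.hasFDerivWithinAt hp hm).differentiableWithinAt

lemma isTestChart_innerChart (i : ι) : M.IsTestChart g (M.innerChart i) where
  glued := isGluedChart_innerChart i
  compat _ hf p hp hpf := (smoothCompat_iff.1 (hf.compat_elem i) p ⟨hpf, hp⟩).symm
  diff _ _ _ _ := differentiableAt_id.differentiableWithinAt

/-- Smoothness in an arbitrary glued chart follows from that in one test chart at each point,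
through the smooth transition between them. -/
lemma isGluedSmoothFun_of_testChart {f : Plane → ℝ} (h : ∀ p ∈ M.punctured, (∀ᶠ q in 𝓝 p, f q = 0) ∨
    ∃ e, M.IsTestChart g e ∧ p ∈ e.source ∧ ContDiffAt ℝ ∞ (f ∘ e.symm) (e p)) :
    M.IsGluedSmoothFun g f := by
  intro e' he' y hy
  refine ContDiffAt.contDiffWithinAt ?_
  have hp := e'.map_target hy
  rcases h _ (he'.source_subset hp) with h0 | ⟨e, he, hpe, hf⟩
  · refine contDiffAt_const (c := (0 : ℝ)) |>.congr_of_eventuallyEq ?_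
    exact (e'.continuousAt_symm hy).eventually h0
  · have h1 := contDiffAt_comp_symm hp hpe hf (he.compat e' he' _ hpe hp).2
    rwa [e'.right_inv hy] at h1

/-- In another glued chart the representing field is the pushforward of `Y` by the transition map,
extended by zero. It is smooth at the border of the overlap because the field vanishes off the
compact set `K`; on an edge, the chain rule holds for one-sided derivatives. -/
lemma IsTestChart.isTestField {e : OpenPartialHomeomorph Plane Plane} (he : M.IsTestChart g e)
    {K : Set Plane} (hK : IsCompact K) (hKe : K ⊆ e.source) {Y : Plane → Plane}
    (hY : ContDiffOn ℝ ∞ Y e.target) {X : PwField ι}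
    (hX : ∀ m, ∀ p ∈ M.elem m, p ∈ e.source → fderivWithin ℝ e (M.elem m) p (X m p) = Y (e p))
    (hX0 : ∀ m, ∀ p ∈ M.elem m, p ∉ K → X m p = 0) :
    M.IsTestField g X ∧ M.CompactSupportIn X e.source := by
  classical
  have hY0 : ∀ p ∈ e.source, p ∉ K → Y (e p) = 0 := by
    intro p hp hpK
    obtain ⟨m, hm⟩ := M.exists_mem_elem (he.glued.source_subset hp).1
    rw [← hX m p hm hp, hX0 m p hm hpK, map_zero]
  refine ⟨⟨fun e' he' => ?_, K, hK, hKe.trans he.glued.source_subset, hX0⟩, K, hK, hKe, hX0⟩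
  refine ⟨fun y => if e'.symm y ∈ e.source then
    fderiv ℝ (e' ∘ e.symm) (e (e'.symm y)) (Y (e (e'.symm y))) else 0, fun y hy => ?_, ?_⟩
  · refine ContDiffAt.contDiffWithinAt ?_
    have hp := e'.map_target hy
    by_cases hpe : e'.symm y ∈ e.source
    · obtain ⟨h1, h2⟩ := he.compat e' he' _ hpe hp
      rw [e'.right_inv hy] at h2
      have h3 : ContDiffAt ℝ ∞ (fun z => fderiv ℝ (e' ∘ e.symm) (e (e'.symm z)) (Y (e (e'.symm z)))) y := by
        refine ContDiffAt.clm_apply ?_ ?_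
        · exact ContDiffAt.comp (g := fderiv ℝ (e' ∘ e.symm)) y
            (h1.fderiv_right (m := ∞) le_rfl) h2
        · exact ContDiffAt.comp (g := Y) y
            (hY.contDiffAt (e.open_target.mem_nhds (e.map_source hpe))) h2
      refine h3.congr_of_eventuallyEq ?_
      filter_upwards [(e'.continuousAt_symm hy).eventually_mem (e.open_source.mem_nhds hpe)] with z hz
      exact if_pos hz
    · refine contDiffAt_const (c := (0 : Plane)) |>.congr_of_eventuallyEq ?_
      filter_upwards [(e'.continuousAt_symm hy).eventually_mem
        (hK.isClosed.isOpen_compl.mem_nhds fun h => hpe (hKe h))] with z hz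
      split_ifs with h
      · rw [hY0 _ h hz, map_zero]
      · rfl
  · rintro m p ⟨hm, hp⟩
    simp only [e'.left_inv hp]
    split_ifs with hpe
    · have h1 := (he.compat e' he' _ hpe hp).1
      have h2 := (h1.differentiableAt (by simp)).hasFDerivAt.comp_hasFDerivWithinAt p
        (he.diff m p hm hpe).hasFDerivWithinAt
      have h3 : HasFDerivWithinAt e' (fderiv ℝ (e' ∘ e.symm) (e p) ∘L fderivWithin ℝ e (M.elem m) p)
          (M.elem m) p := by
        refine h2.congr_of_eventuallyEq ?_ ?_
        · filter_upwards [mem_nhdsWithin_of_mem_nhds (e.open_source.mem_nhds hpe)] with q hq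
          simp [e.left_inv hq]
        · simp [e.left_inv hpe]
      rw [h3.fderivWithin (M.uniqueDiffOn_elem m p hm), ← hX m p hm hpe]
      rfl
    · rw [hX0 m p hm fun h => hpe (hKe h), map_zero]

lemma isTestField_sum {N : ℕ} {X : Fin N → PwField ι} (h : ∀ n, M.IsTestField g (X n)) :
    M.IsTestField g fun i p => ∑ n, X n i p := by
  constructor
  · intro e he
    choose Y hY hYX using fun n => (h n).smooth e he
    refine ⟨fun y => ∑ n, Y n y, ContDiffOn.sum fun n _ => hY n, fun i p hp => ?_⟩
    rw [map_sum]
    exact Finset.sum_congr rfl fun n _ => hYX n i p hp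
  · choose K hK hKs hK0 using fun n => (h n).support
    refine ⟨⋃ n, K n, isCompact_iUnion hK, iUnion_subset hKs, fun i p hp hpK => ?_⟩
    exact Finset.sum_eq_zero fun n _ => hK0 n i p hp fun h => hpK (mem_iUnion.2 ⟨n, h⟩)

/-! ### Functions and fields in a tube -/

namespace EdgeTube

variable {i j : ι} {k : Fin 3} (T : M.EdgeTube g i j k)

variable {T} in
-- The smooth extension of `v` is `H` composed with the inverse of the side map, extended by zero.
-- At points of the element outside the tube it vanishes too: a coordinate point in the support of
-- `H` lies in the box and so would put the point into the tube.
lemma HasSide.smoothUpTo {m : ι} {f : OpenPartialHomeomorph Plane Plane} {ς : ℝ}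
    (h : T.HasSide m f ς) {F : Type} [NormedAddCommGroup F] [NormedSpace ℝ F] {H : Plane → F}
    (hH : ContDiff ℝ ∞ H) (hc : HasCompactSupport H) (hs : tsupport H ⊆ T.box) {v : Plane → F}
    (hv : ∀ p ∈ M.elem m, p ∈ T.e.source → v p = H (T.e p))
    (hv0 : ∀ p ∈ M.elem m, p ∉ T.e.source → v p = 0) : SmoothUpTo (M.elem m) v := by
  have hbs : T.box ⊆ f.source := T.box_subset.trans h.isSideMap.box
  refine ⟨f.target.indicator fun p => H (f.symm p), ?_, fun p hp => ?_⟩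
  · refine ContDiffOn.contDiff_indicator (K := f '' tsupport H) (hH.comp_contDiffOn h.contDiffOn_symm)
      f.open_target (hc.isCompact.image_of_continuousOn (f.continuousOn.mono (hs.trans hbs))) ?_ ?_
    · rintro _ ⟨y, hy, rfl⟩; exact f.map_source (hbs (hs hy))
    · intro p hp hpK
      refine image_eq_zero_of_notMem_tsupport fun h' => hpK ⟨_, h', f.right_inv hp⟩
  · by_cases hps : p ∈ T.e.source
    · rw [indicator_of_mem (h.mem_target hps hp), hv p hp hps, h.e_eq hps hp]
    · rw [hv0 p hp hps]
      by_cases hpf : p ∈ f.target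
      · rw [indicator_of_mem hpf, image_eq_zero_of_notMem_tsupport (f := H)]
        intro h'
        have hb := hs h'
        have hfp : f (f.symm p) = p := f.right_inv hpf
        have h0 := (h.isSideMap.mem_iff _ (T.box_subset hb)).1 (by rwa [hfp])
        have := T.symm_mem_source hb
        rw [h.symm_eq hb h0, hfp] at this
        exact hps this
      · rw [indicator_of_notMem hpf]

/-- The side map of the tube in the element `m`. -/
def sideMap (m : ι) : OpenPartialHomeomorph Plane Plane := by
  classical exact if m = i then T.fp else T.fm

variable {T} in
lemma HasSide.sideMap_eq {m : ι} {f : OpenPartialHomeomorph Plane Plane} {ς : ℝ}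
    (h : T.HasSide m f ς) : T.sideMap m = f := by
  rcases h with ⟨rfl, rfl, rfl⟩ | ⟨rfl, rfl, rfl⟩
  · exact if_pos rfl
  · exact if_neg T.neighbor.ne.symm

/-- The function on the plane with values `χ` in tube coordinates. -/
def pullFun (χ : Plane → ℝ) (p : Plane) : ℝ := by
  classical exact if p ∈ T.e.source then χ (T.e p) else 0

/-- The piecewise field with components `Y` in tube coordinates. -/
def pullField (Y : Plane → Plane) : PwField ι := fun m p => by
  classical exact if p ∈ T.e.source then fderiv ℝ (T.sideMap m) (T.e p) (Y (T.e p)) else 0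

variable {T}

lemma pullFun_of_mem {χ : Plane → ℝ} {p : Plane} (hp : p ∈ T.e.source) : T.pullFun χ p = χ (T.e p) :=
  if_pos hp

lemma pullFun_of_notMem {χ : Plane → ℝ} {p : Plane} (hp : p ∉ T.e.source) : T.pullFun χ p = 0 :=
  if_neg hp

lemma pullField_of_mem {Y : Plane → Plane} {m : ι} {p : Plane} (hp : p ∈ T.e.source) :
    T.pullField Y m p = fderiv ℝ (T.sideMap m) (T.e p) (Y (T.e p)) := if_pos hp

lemma pullField_of_notMem {Y : Plane → Plane} {m : ι} {p : Plane} (hp : p ∉ T.e.source) :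
    T.pullField Y m p = 0 := if_neg hp

lemma hasSide_or_disjoint (T : M.EdgeTube g i j k) (m : ι) :
    (∃ f ς, T.HasSide m f ς) ∨ ∀ p ∈ M.elem m, p ∉ T.e.source := by
  by_cases h : ∃ f ς, T.HasSide m f ς
  · exact Or.inl h
  · exact Or.inr fun p hm hp => h (T.exists_hasSide hp hm)

section

variable {χ : Plane → ℝ} (hχ : ContDiff ℝ ∞ χ) (hc : HasCompactSupport χ) (hs : tsupport χ ⊆ T.box)

include hχ hc hs

lemma smoothUpTo_pullFun (m : ι) : SmoothUpTo (M.elem m) (T.pullFun χ) := by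
  rcases T.hasSide_or_disjoint m with ⟨f, ς, h⟩ | h
  · exact h.smoothUpTo hχ hc hs (fun p _ hp => pullFun_of_mem hp) fun p _ hp => pullFun_of_notMem hp
  · exact (SmoothUpTo.of_contDiff (contDiff_const (c := (0 : ℝ)))).congr fun p hp =>
      pullFun_of_notMem (h p hp)

omit hχ in
lemma isCompact_pull_support : IsCompact (T.e.symm '' tsupport χ) ∧ T.e.symm '' tsupport χ ⊆ T.e.source := by
  constructor
  · refine hc.isCompact.image_of_continuousOn (T.e.continuousOn_symm.mono ?_)
    rw [T.target_eq]; exact hs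
  · rintro _ ⟨y, hy, rfl⟩; exact T.symm_mem_source (hs hy)

lemma isGluedSmoothFun_pullFun (hg : M.IsReggeMetric g) : M.IsGluedSmoothFun g (T.pullFun χ) := by
  obtain ⟨hK, hKs⟩ := isCompact_pull_support hc hs
  refine isGluedSmoothFun_of_testChart fun p _ => ?_
  by_cases hp : p ∈ T.e.source
  · refine Or.inr ⟨T.e, T.isTestChart hg, hp, hχ.contDiffAt.congr_of_eventuallyEq ?_⟩
    filter_upwards [T.isOpen_box.mem_nhds (T.e_mem_box hp)] with y hy
    rw [Function.comp_apply, pullFun_of_mem (T.symm_mem_source hy), T.e_symm hy]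
  · left
    filter_upwards [hK.isClosed.isOpen_compl.mem_nhds fun h => hp (hKs h)] with q hq
    by_cases hqs : q ∈ T.e.source
    · rw [pullFun_of_mem hqs, image_eq_zero_of_notMem_tsupport (f := χ)]
      exact fun h => hq ⟨_, h, T.e.left_inv hqs⟩
    · exact pullFun_of_notMem hqs

end

section

variable {Y : Plane → Plane} (hY : ContDiff ℝ ∞ Y) (hc : HasCompactSupport Y) (hs : tsupport Y ⊆ T.box)

include hY hc hs

lemma smoothUpTo_pullField (m : ι) : SmoothUpTo (M.elem m) (T.pullField Y m) := by
  rcases T.hasSide_or_disjoint m with ⟨f, ς, h⟩ | h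
  · have hfd : ContDiff ℝ ∞ fun y => fderiv ℝ f y (Y y) :=
      (h.isSideMap.smooth.fderiv_right (m := ∞) le_rfl).clm_apply hY
    have hsub : (Function.support fun y => fderiv ℝ f y (Y y)) ⊆ Function.support Y := by
      intro y hy h0
      exact hy (by simp [h0])
    have hts : tsupport (fun y => fderiv ℝ f y (Y y)) ⊆ tsupport Y := closure_mono hsub
    refine h.smoothUpTo hfd (hc.mono hsub) (hts.trans hs)
      (fun p _ hp => ?_) fun p _ hp => pullField_of_notMem hp
    rw [pullField_of_mem hp, h.sideMap_eq]
  · exact (SmoothUpTo.of_contDiff (contDiff_const (c := (0 : Plane)))).congr fun p hp =>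
      pullField_of_notMem (h p hp)

lemma isTestField_pullField (hg : M.IsReggeMetric g) :
    M.IsTestField g (T.pullField Y) ∧ M.CompactSupportIn (T.pullField Y) T.e.source := by
  have hK : IsCompact (T.e.symm '' tsupport Y) := by
    refine hc.isCompact.image_of_continuousOn (T.e.continuousOn_symm.mono ?_)
    rw [T.target_eq]; exact hs
  have hKs : T.e.symm '' tsupport Y ⊆ T.e.source := by
    rintro _ ⟨y, hy, rfl⟩; exact T.symm_mem_source (hs hy)
  refine (T.isTestChart hg).isTestField hK hKs hY.contDiffOn (fun m p hm hp => ?_) fun m p hm hp => ?_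
  · obtain ⟨f, ς, h⟩ := T.exists_hasSide hp hm
    rw [h.fderivWithin hp hm, pullField_of_mem hp, h.sideMap_eq]
    have h1 := (h.comp_fderiv (h.e_mem_source hp)).1
    rw [h.f_e hp hm] at h1
    exact congrArg (fun A : Plane →L[ℝ] Plane => A (Y (T.e p))) h1
  · by_cases hps : p ∈ T.e.source
    · rw [pullField_of_mem hps, image_eq_zero_of_notMem_tsupport (f := Y), map_zero]
      exact fun h => hp ⟨_, h, T.e.left_inv hps⟩
    · exact pullField_of_notMem hps

end

/-- The components of a normal continuous field in tube coordinates. -/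
lemma exists_coordField (T : M.EdgeTube g i j k) (hg : M.IsReggeMetric g) {W : PwField ι}
    (hW : M.IsNormalCont g W) : ∃ V : ι → Plane → Plane, (∀ m, ContDiff ℝ ∞ (V m)) ∧
      (∀ m f ς, T.HasSide m f ς →
        (∀ y ∈ T.box, 0 ≤ ς * y 0 → fderiv ℝ f y (V m y) = W m (f y)) ∧
        ∀ s ∈ Ioo T.a T.b, fderiv ℝ f (planeVec ![0, s]) (V m (planeVec ![0, s]) 0 • coordVec 0)
          = tensorApp (g m (M.edgeParam i k s)) (W m (M.edgeParam i k s))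
              (unitNormalOf (g m (M.edgeParam i k s)) (ς • M.tangent i k s)) •
            unitNormalOf (g m (M.edgeParam i k s)) (ς • M.tangent i k s)) ∧
      ∀ s ∈ Ioo T.a T.b, V i (planeVec ![0, s]) 0 = V j (planeVec ![0, s]) 0 := by
  have hex : ∀ m, ∃ V : Plane → Plane, ContDiff ℝ ∞ V ∧ ∀ f ς, T.HasSide m f ς →
      ∀ y ∈ T.box, 0 ≤ ς * y 0 → fderiv ℝ f y (V y) = W m (f y) := by
    intro m
    rcases T.hasSide_or_disjoint m with ⟨f, ς, h⟩ | h
    · obtain ⟨W', hW', hWe⟩ := hW.smooth m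
      have h1 : ContDiffOn ℝ ∞ (fun y => fderiv ℝ f.symm (f y) (W' (f y))) f.source := by
        refine ContDiffOn.clm_apply ?_ (hW'.comp h.isSideMap.smooth).contDiffOn
        exact (h.contDiffOn_symm.fderiv_of_isOpen f.open_target (m := ∞) le_rfl).comp
          h.isSideMap.smooth.contDiffOn fun y hy => f.map_source hy
      obtain ⟨V, hV, -, U, -, hKU, -, hVU⟩ := h1.exists_extension f.open_source
        (isCompact_closedPlaneBox T.ρ T.a T.b) h.isSideMap.box
      refine ⟨V, hV, fun f' ς' h' y hy h0 => ?_⟩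
      have hff : f' = f := by rw [← h'.sideMap_eq, h.sideMap_eq]
      subst hff
      have hyc := T.box_subset hy
      rw [hVU (hKU hyc), hWe ((h'.isSideMap.mem_iff y hyc).2 h0)]
      exact congrArg (fun A : Plane →L[ℝ] Plane => A (W' (f' y)))
        (h.comp_fderiv (h.isSideMap.box hyc)).2
    · refine ⟨0, contDiff_const, fun f ς h' y hy h0 =>
        absurd (T.symm_mem_source hy) (h _ ((h'.symm_mem_iff hy).1.2 h0))⟩
  choose V hV hVW using hex
  have hbox : ∀ s ∈ Ioo T.a T.b, planeVec ![0, s] ∈ T.box := fun s hs =>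
    ⟨by simp [T.ρ_pos], by simpa using hs⟩
  have hne : ∀ s ∈ Ioo T.a T.b, ∀ ς : ℝ, ς = 1 ∨ ς = -1 → ς • M.tangent i k s ≠ 0 := by
    intro s hs ς hς
    refine smul_ne_zero (by rcases hς with rfl | rfl <;> norm_num) (M.tangent_ne_zero i k
      (Ioo_subset_Icc_self (T.Ioo_mem (Ioo_subset_Icc_self hs))))
  have hmet : ∀ m f ς, T.HasSide m f ς → ∀ s ∈ Ioo T.a T.b,
      IsMetricMatrix (g m (M.edgeParam i k s)) ∧ M.edgeParam i k s ∈ M.elem m := by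
    intro m f ς h s hs
    have hmem : M.edgeParam i k s ∈ M.elem m := by
      rw [← h.isSideMap.curve s (Ioo_subset_Icc_self hs)]
      exact (h.isSideMap.mem_iff _ (T.box_subset (hbox s hs))).2 (by simp)
    exact ⟨hg.isMetricMatrix hmem, hmem⟩
  -- Pairing `W` with the unit normal removes the component along the edge, and the radial
  -- coordinate vector on the axis is `ς` times that normal.
  have hnormal : ∀ m f ς, T.HasSide m f ς → ∀ s ∈ Ioo T.a T.b,
      V m (planeVec ![0, s]) 0 = ς * tensorApp (g m (M.edgeParam i k s)) (W m (M.edgeParam i k s))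
        (unitNormalOf (g m (M.edgeParam i k s)) (ς • M.tangent i k s)) := by
    intro m f ς h s hs
    obtain ⟨hm, hmem⟩ := hmet m f ς h s hs
    have hcurve := h.isSideMap.curve s (Ioo_subset_Icc_self hs)
    have hFs : fderiv ℝ f (planeVec ![0, s]) (coordVec 1) = M.tangent i k s := by
      have h1 : HasDerivAt (fun t => f (planeVec ![0, t])) (fderiv ℝ f (planeVec ![0, s]) (coordVec 1)) s :=
        HasFDerivAt.comp_hasDerivAt (l := f) s
          (h.isSideMap.smooth.differentiable (by simp) _).hasFDerivAt (hasDerivAt_planeVec_snd 0 s)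
      refine h1.unique ((M.hasDerivAt_edgeParam i k s).congr_of_eventuallyEq ?_)
      filter_upwards [isOpen_Ioo.mem_nhds hs] with t ht
      exact h.isSideMap.curve t (Ioo_subset_Icc_self ht)
    have h2 := hVW m f ς h _ (hbox s hs) (by simp)
    rw [hcurve, clm_apply_coord, hFs, h.isSideMap.radial s (Ioo_subset_Icc_self hs)] at h2
    change V m (planeVec ![0, s]) 0 • ς • unitNormalOf _ (ς • M.tangent i k s) + _ = _ at h2
    have h3 := tensorApp_unitNormalOf_self hm (hne s hs ς h.sign)
    have h4 : tensorApp (g m (M.edgeParam i k s)) (M.tangent i k s)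
        (unitNormalOf (g m (M.edgeParam i k s)) (ς • M.tangent i k s)) = 0 := by
      have := tensorApp_unitNormalOf_tangent hm (τ := ς • M.tangent i k s)
      rw [tensorApp_comm hm.symm, tensorApp_smul_left] at this
      rcases h.sign with rfl | rfl <;> simpa using this
    rw [← h2, tensorApp_add_left, tensorApp_smul_left, tensorApp_smul_left, tensorApp_smul_left, h3, h4]
    linear_combination -(V m (planeVec ![0, s]) 0) * h.sign_mul
  refine ⟨V, hV, fun m f ς h => ⟨hVW m f ς h, fun s hs => ?_⟩, fun s hs => ?_⟩
  · rw [map_smul, h.isSideMap.radial s (Ioo_subset_Icc_self hs), hnormal m f ς h s hs, smul_smul]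
    change (_ * _ * ς) • unitNormalOf _ (ς • M.tangent i k s) = _
    congr 1
    linear_combination (tensorApp (g m (M.edgeParam i k s)) (W m (M.edgeParam i k s))
        (unitNormalOf (g m (M.edgeParam i k s)) (ς • M.tangent i k s))) * h.sign_mul
  · rw [hnormal i _ _ T.hasSide_p s hs, hnormal j _ _ T.hasSide_m s hs]
    have hs1 := T.Ioo_mem (Ioo_subset_Icc_self hs)
    obtain ⟨l, hl⟩ := T.neighbor.exists_edge_eq
    have h1 := M.edgeCoord_mem_Ioo hl hs1
    have h2 := (M.edgeParam_edgeCoord j l (hl ▸ M.edgeParam_mem_edge i k hs1)).2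
    obtain ⟨c, hc, hc'⟩ := M.tangent_antiparallel T.neighbor.ne hs1 h1 h2
    -- Here normal continuity enters: the inward normal components from the two sides have sum zero,
    -- and the signs `ς` = 1, -1 turn this into equality of the first coordinates.
    have h3 := hW.jump i k j l T.neighbor.ne s hs1 _ h1 h2.symm (T.neighbor.mem s hs1)
    have h4 : ∀ i k s, M.unitNormal g i k s = unitNormalOf (g i (M.edgeParam i k s)) (M.tangent i k s) :=
      fun _ _ _ => rfl
    rw [h4, h4, h2, hc', show -c • M.tangent i k s = c • (-1 : ℝ) • M.tangent i k s by
      rw [smul_smul, mul_neg_one], unitNormalOf_smul _ hc] at h3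
    rw [one_smul]
    linarith

end EdgeTube

end CurvedMesh

end

noncomputable section

open Filter Topology

set_option maxSynthPendingDepth 3

/-! ### Weak divergence -/

/-- The Euclidean divergence. -/
def pdiv (u : Plane → Plane) (y : Plane) : ℝ :=
  fderiv ℝ u y (coordVec 0) 0 + fderiv ℝ u y (coordVec 1) 1

lemma continuous_pdiv {u : Plane → Plane} (hu : ContDiff ℝ ∞ u) : Continuous (pdiv u) := by
  have h : ∀ a, Continuous fun y => fderiv ℝ u y (coordVec a) a := fun a =>
    (coordL a).continuous.comp ((hu.continuous_fderiv (by simp)).clm_apply continuous_const)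
  exact (h 0).add (h 1)

lemma pdiv_eq_zero_of_notMem_tsupport {u : Plane → Plane} {y : Plane} (hy : y ∉ tsupport u) :
    pdiv u y = 0 := by
  have : fderiv ℝ u y = 0 := by
    by_contra h
    exact hy (support_fderiv_subset ℝ h)
  simp [pdiv, this]

lemma hasCompactSupport_pdiv {u : Plane → Plane} (hc : HasCompactSupport u) :
    HasCompactSupport (pdiv u) :=
  HasCompactSupport.intro hc.isCompact fun _ hy => pdiv_eq_zero_of_notMem_tsupport hy

lemma pdiv_smul {a : Plane → ℝ} {u : Plane → Plane} {y : Plane} (ha : DifferentiableAt ℝ a y)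
    (hu : DifferentiableAt ℝ u y) :
    pdiv (fun z => a z • u z) y = fderiv ℝ a y (u y) + a y * pdiv u y := by
  rw [pdiv, pdiv, fderiv_fun_smul ha hu, clm_apply_coord (fderiv ℝ a y) (u y)]
  simp
  ring

lemma pdiv_congr {u v : Plane → Plane} {y : Plane} (h : u =ᶠ[𝓝 y] v) : pdiv u y = pdiv v y := by
  rw [pdiv, pdiv, h.fderiv_eq]

/-- By Fubini the derivative in the second variable integrates to zero on whole lines, and the
derivative in the first is reduced to a statement on one-dimensional sections, to be used for the
line and the two half-lines. -/
lemma setIntegral_pdiv_eq_zero {u : Plane → Plane} (hu : ContDiff ℝ ∞ u) (hc : HasCompactSupport u)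
    {S : Set ℝ} (hS : MeasurableSet S)
    (h : ∀ f : ℝ → ℝ, ContDiff ℝ 1 f → HasCompactSupport f →
      (∃ s, ∀ r, f r = u (planeVec ![r, s]) 0) → ∫ r in S, deriv f r = 0) :
    ∫ y in {y : Plane | y 0 ∈ S}, pdiv u y = 0 := by
  set F : Fin 2 → ℝ × ℝ → ℝ := fun a q => fderiv ℝ u (planeVec ![q.1, q.2]) (coordVec a) a
  have hFc : ∀ a, Continuous (F a) := fun a => (coordL a).continuous.comp
    (((hu.continuous_fderiv (by simp)).comp contDiff_planeVec.continuous).clm_apply continuous_const)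
  have hFs : ∀ a, HasCompactSupport (F a) := by
    intro a
    refine HasCompactSupport.intro (hc.isCompact.image planeProd.continuous) fun q hq => ?_
    have : fderiv ℝ u (planeVec ![q.1, q.2]) = 0 := by
      by_contra h'
      exact hq ⟨_, support_fderiv_subset ℝ h', by simp⟩
    simp [F, this]
  have hFi : ∀ a, Integrable (F a) := fun a => (hFc a).integrable_of_hasCompactSupport (hFs a)
  have hline : ∀ L : ℝ → Plane, ContDiff ℝ ∞ L → ∀ a c : Fin 2, (∀ t, L t a = t) →
      ContDiff ℝ 1 (fun t => u (L t) c) ∧ HasCompactSupport fun t => u (L t) c := by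
    intro L hL a c hLa
    refine ⟨((coordL c).contDiff.comp (hu.comp hL)).of_le (by simp), ?_⟩
    refine HasCompactSupport.intro (hc.isCompact.image (coordL a).continuous) fun t ht => ?_
    have : u (L t) = 0 := image_eq_zero_of_notMem_tsupport fun h' => ht ⟨_, h', hLa t⟩
    simp [this]
  have hder : ∀ L : ℝ → Plane, ∀ t v, HasDerivAt L v t → ∀ c : Fin 2,
      HasDerivAt (fun t => u (L t) c) (fderiv ℝ u (L t) v c) t := by
    intro L t v hL c
    have h1 : HasDerivAt (fun t => u (L t)) (fderiv ℝ u (L t) v) t :=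
      HasFDerivAt.comp_hasDerivAt (l := u) t (hu.differentiable (by simp) _).hasFDerivAt hL
    exact (coordL c).hasFDerivAt.comp_hasDerivAt t h1
  have hSm : MeasurableSet {y : Plane | y 0 ∈ S} := (contDiff_coord 0).continuous.measurable hS
  rw [← integral_indicator hSm, integral_plane]
  have h1 : (fun q : ℝ × ℝ => {y : Plane | y 0 ∈ S}.indicator (pdiv u) (planeVec ![q.1, q.2]))
      = (S ×ˢ univ).indicator fun q => F 0 q + F 1 q := by
    funext q
    by_cases hq : q.1 ∈ S
    · rw [indicator_of_mem (by simpa using hq), indicator_of_mem (by simpa using hq)]; rfl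
    · rw [indicator_of_notMem (by simpa using hq), indicator_of_notMem (by simpa using hq)]
  rw [h1, integral_indicator (hS.prod MeasurableSet.univ),
    integral_add (hFi 0).integrableOn (hFi 1).integrableOn]
  have hI : ∀ a, Integrable (F a) ((volume.restrict S).prod (volume.restrict (univ : Set ℝ))) := by
    intro a
    rw [Measure.prod_restrict]
    exact (hFi a).integrableOn
  have h2 : ∫ q in S ×ˢ univ, F 1 q = 0 := by
    rw [Measure.volume_eq_prod, ← Measure.prod_restrict, integral_prod _ (hI 1)]
    refine (integral_congr_ae (Eventually.of_forall fun r => ?_)).trans (integral_zero _ _)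
    rw [Measure.restrict_univ]
    obtain ⟨h3, h4⟩ := hline (fun s => planeVec ![r, s])
      (contDiff_planeVec.comp (contDiff_const.prodMk contDiff_id)) 1 1 fun t => by simp
    have h5 : ∀ s, HasDerivAt (fun s => u (planeVec ![r, s]) 1) (F 1 (r, s)) s := fun s =>
      hder _ s _ (hasDerivAt_planeVec_snd r s) 1
    refine integral_eq_zero_of_hasDerivAt_of_integrable h5 ?_
      (h3.continuous.integrable_of_hasCompactSupport h4)
    have h6 : (fun s => F 1 (r, s)) = deriv fun s => u (planeVec ![r, s]) 1 :=
      funext fun s => (h5 s).deriv.symm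
    rw [h6]
    exact (h3.continuous_deriv le_rfl).integrable_of_hasCompactSupport h4.deriv
  have h3 : ∫ q in S ×ˢ univ, F 0 q = 0 := by
    rw [Measure.volume_eq_prod, ← Measure.prod_restrict, integral_prod_symm _ (hI 0)]
    refine (integral_congr_ae (Eventually.of_forall fun s => ?_)).trans (integral_zero _ _)
    obtain ⟨h3, h4⟩ := hline (fun r => planeVec ![r, s])
      (contDiff_planeVec.comp (contDiff_id.prodMk contDiff_const)) 0 0 fun t => by simp
    have h6 : (fun r => F 0 (r, s)) = deriv fun r => u (planeVec ![r, s]) 0 :=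
      funext fun r => (hder _ r _ (hasDerivAt_planeVec_fst r s) 0).deriv.symm
    rw [h6]
    exact h _ h3 h4 ⟨s, fun _ => rfl⟩
  rw [h2, h3, add_zero]

lemma integral_pdiv_eq_zero {u : Plane → Plane} (hu : ContDiff ℝ ∞ u) (hc : HasCompactSupport u) :
    ∫ y, pdiv u y = 0 := by
  have := setIntegral_pdiv_eq_zero hu hc MeasurableSet.univ fun f hf hfc _ => by
    rw [Measure.restrict_univ]
    exact integral_eq_zero_of_hasDerivAt_of_integrable
      (fun x => (hf.differentiable one_ne_zero x).hasDerivAt)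
      ((hf.continuous_deriv le_rfl).integrable_of_hasCompactSupport hfc.deriv)
      (hf.continuous.integrable_of_hasCompactSupport hfc)
  simpa using this

/-- The only boundary term in the divergence theorem is the normal component on the axis, which is
zero. -/
lemma setIntegral_pdiv_halfplane {u : Plane → Plane} (hu : ContDiff ℝ ∞ u) (hc : HasCompactSupport u)
    (h0 : ∀ y : Plane, y 0 = 0 → u y 0 = 0) :
    ∫ y in {y : Plane | 0 ≤ y 0}, pdiv u y = 0 ∧ ∫ y in {y : Plane | 0 ≤ y 0}ᶜ, pdiv u y = 0 := by
  constructor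
  · have h1 : {y : Plane | 0 ≤ y 0} = {y : Plane | y 0 ∈ Ici (0 : ℝ)} := rfl
    rw [h1]
    refine setIntegral_pdiv_eq_zero hu hc measurableSet_Ici fun f hf hfc ⟨s, hs⟩ => ?_
    rw [integral_Ici_eq_integral_Ioi, hfc.integral_Ioi_deriv_eq hf, hs, h0 _ (by simp), neg_zero]
  · have h1 : {y : Plane | 0 ≤ y 0}ᶜ = {y : Plane | y 0 ∈ Iio (0 : ℝ)} := by
      ext y; simp
    rw [h1]
    refine setIntegral_pdiv_eq_zero hu hc measurableSet_Iio fun f hf hfc ⟨s, hs⟩ => ?_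
    rw [← integral_Iic_eq_integral_Iio, hfc.integral_Iic_deriv_eq hf, hs, h0 _ (by simp)]

section

variable {ζ : Plane → ℝ} {u : Plane → Plane}

lemma pdiv_smul_eq (hζ : ContDiff ℝ ∞ ζ) (hu : ContDiff ℝ ∞ u) :
    pdiv (fun y => ζ y • u y) = fun y => fderiv ℝ ζ y (u y) + pdiv u y * ζ y := by
  funext y
  rw [pdiv_smul (hζ.differentiable (by simp) y) (hu.differentiable (by simp) y), mul_comm (ζ y)]

lemma integrable_fderiv_apply (hζ : ContDiff ℝ ∞ ζ) (hu : ContDiff ℝ ∞ u) (hc : HasCompactSupport ζ) :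
    Integrable (fun y => fderiv ℝ ζ y (u y)) ∧ Integrable fun y => pdiv u y * ζ y :=
  ⟨((hζ.continuous_fderiv (by simp)).clm_apply hu.continuous).integrable_of_hasCompactSupport
    (HasCompactSupport.intro hc.isCompact fun y hy => by
      rw [show fderiv ℝ ζ y = 0 from by by_contra h; exact hy (support_fderiv_subset ℝ h)]; rfl),
  ((continuous_pdiv hu).mul hζ.continuous).integrable_of_hasCompactSupport hc.mul_left⟩

/-- The weak divergence of a field that is smooth near the support of the test function. -/
lemma integral_fderiv_eq_neg (hζ : ContDiff ℝ ∞ ζ) (hc : HasCompactSupport ζ) (hu : ContDiff ℝ ∞ u) :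
    ∫ y, fderiv ℝ ζ y (u y) = - ∫ y, pdiv u y * ζ y := by
  obtain ⟨h1, h2⟩ := integrable_fderiv_apply hζ hu hc
  have h3 : ∫ y, pdiv (fun y => ζ y • u y) y = 0 := integral_pdiv_eq_zero (hζ.smul hu) hc.smul_right
  rw [pdiv_smul_eq hζ hu, integral_add h1 h2] at h3
  linarith

/-- The function `f` on the right half-plane, `f'` on the left one. -/
def halfPiece {F : Type} (f f' : Plane → F) (y : Plane) : F := if 0 ≤ y 0 then f y else f' y

lemma integral_halfPiece {f f' : Plane → ℝ} (hf : Integrable f) (hf' : Integrable f') :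
    ∫ y, halfPiece f f' y = (∫ y in {y : Plane | 0 ≤ y 0}, f y) + ∫ y in {y : Plane | 0 ≤ y 0}ᶜ, f' y := by
  classical
  have hH : MeasurableSet {y : Plane | 0 ≤ y 0} :=
    (isClosed_le continuous_const (contDiff_coord 0).continuous).measurableSet
  rw [← integral_piecewise hH hf.integrableOn hf'.integrableOn]
  congr 1

/-- Since the normal components vanish on the axis from both sides, the piecewise divergence is the
weak divergence, without a singular part on the axis. -/
lemma integral_fderiv_halfPiece {v : Plane → Plane} (hζ : ContDiff ℝ ∞ ζ) (hc : HasCompactSupport ζ)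
    (hu : ContDiff ℝ ∞ u) (hu0 : ∀ y : Plane, y 0 = 0 → u y 0 = 0)
    (hv : ContDiff ℝ ∞ v) (hv0 : ∀ y : Plane, y 0 = 0 → v y 0 = 0) :
    ∫ y, fderiv ℝ ζ y (halfPiece u v y) = - ∫ y, halfPiece (pdiv u) (pdiv v) y * ζ y := by
  obtain ⟨a1, a2⟩ := integrable_fderiv_apply hζ hu hc
  obtain ⟨b1, b2⟩ := integrable_fderiv_apply hζ hv hc
  have h1 : (fun y => fderiv ℝ ζ y (halfPiece u v y))
      = halfPiece (fun y => fderiv ℝ ζ y (u y)) fun y => fderiv ℝ ζ y (v y) := by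
    funext y; by_cases hy : 0 ≤ y 0 <;> simp [halfPiece, hy]
  have h2 : (fun y => halfPiece (pdiv u) (pdiv v) y * ζ y)
      = halfPiece (fun y => pdiv u y * ζ y) fun y => pdiv v y * ζ y := by
    funext y; by_cases hy : 0 ≤ y 0 <;> simp [halfPiece, hy]
  rw [h1, h2, integral_halfPiece a1 b1, integral_halfPiece a2 b2]
  have h3 : ∫ y in _, pdiv (fun y => ζ y • u y) y = 0 :=
    (setIntegral_pdiv_halfplane (hζ.smul hu) hc.smul_right fun y hy => by simp [hu0 y hy]).1
  have h4 : ∫ y in _, pdiv (fun y => ζ y • v y) y = 0 :=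
    (setIntegral_pdiv_halfplane (hζ.smul hv) hc.smul_right fun y hy => by simp [hv0 y hy]).2
  rw [pdiv_smul_eq hζ hu, integral_add a1.integrableOn a2.integrableOn] at h3
  rw [pdiv_smul_eq hζ hv, integral_add b1.integrableOn b2.integrableOn] at h4
  linarith

end

/-- A bound for the norm of a field with small support. -/
lemma wpDivNorm_le {p : ℝ} (hp : 0 < p) {O Q S : Set Plane} (hOQ : O ⊆ Q) (hQ : MeasurableSet Q)
    (hQf : volume Q ≠ ⊤) (hS : MeasurableSet S) {w w₀ : Plane → Plane} {d₀ : Plane → ℝ} {B : ℝ} (hww : ∀ᵐ y ∂volume.restrict Q, w y = w₀ y)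
    (hwm : AEStronglyMeasurable w₀ (volume.restrict Q)) (hdm : AEStronglyMeasurable d₀ (volume.restrict Q))
    (hwB : ∀ y ∈ Q, ‖w₀ y‖ ≤ B) (hdB : ∀ y ∈ Q, ‖d₀ y‖ ≤ B)
    (hwS : ∀ y ∈ Q, y ∉ S → w₀ y = 0) (hdS : ∀ y ∈ Q, y ∉ S → d₀ y = 0)
    (hweak : ∀ ζ : Plane → ℝ, ContDiff ℝ ∞ ζ → HasCompactSupport ζ → tsupport ζ ⊆ Q →
      ∫ y, fderiv ℝ ζ y (w₀ y) = - ∫ y, d₀ y * ζ y) {ε : ℝ}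
    (hvol : 2 * (ENNReal.ofReal B ^ p * volume (S ∩ Q)) ≤ ENNReal.ofReal ε ^ p) :
    wpDivNorm p O w ≤ ENNReal.ofReal ε := by
  have : IsFiniteMeasure (volume.restrict Q) := ⟨by simpa using hQf.lt_top⟩
  have hwi : IntegrableOn w₀ Q := Integrable.of_bound hwm B (by
    filter_upwards [ae_restrict_mem hQ] with y hy using hwB y hy)
  have hdi : IntegrableOn d₀ Q := Integrable.of_bound hdm B (by
    filter_upwards [ae_restrict_mem hQ] with y hy using hdB y hy)
  have hwi' : IntegrableOn w Q := hwi.congr (by filter_upwards [hww] with y hy using hy.symm)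
  have hres : volume.restrict O ≤ volume.restrict Q := Measure.restrict_mono hOQ le_rfl
  have hwO : ∀ᵐ y ∂volume.restrict O, w y = w₀ y := ae_mono hres hww
  -- Test functions supported in `O` are supported in `Q`, so the weak identity for the explicit
  -- representative `w₀` is inherited by `O`, of which nothing but inclusion in `Q` has to be known.
  have hdiv : IsWeakDiv O w d₀ := by
    refine ⟨(hwi'.mono_set hOQ).locallyIntegrableOn, (hdi.mono_set hOQ).locallyIntegrableOn,
      fun ζ hζ hc hs => ?_⟩
    rw [integral_congr_ae (g := fun y => fderiv ℝ ζ y (w₀ y))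
      (by filter_upwards [hwO] with y hy using by rw [hy]),
      setIntegral_eq_integral_of_forall_compl_eq_zero, setIntegral_eq_integral_of_forall_compl_eq_zero,
      hweak ζ hζ hc (hs.trans hOQ)]
    · intro y hy
      rw [image_eq_zero_of_notMem_tsupport (f := ζ) fun h => hy (hs h), mul_zero]
    · intro y hy
      have : fderiv ℝ ζ y = 0 := by
        by_contra h
        exact hy (hs (support_fderiv_subset ℝ h))
      rw [this]; rfl
  have hnorm : ∀ {F : Type} [NormedAddCommGroup F] (f : Plane → F), (∀ y ∈ Q, ‖f y‖ ≤ B) →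
      (∀ y ∈ Q, y ∉ S → f y = 0) → eLpNorm f (ENNReal.ofReal p) (volume.restrict O) ^ p
        ≤ ENNReal.ofReal B ^ p * volume (S ∩ Q) := by
    intro F _ f hf hf0
    refine (ENNReal.rpow_le_rpow (eLpNorm_mono_measure f hres) hp.le).trans ?_
    rw [eLpNorm_eq_lintegral_rpow_enorm_toReal (by simpa using hp) (by simp),
      ENNReal.toReal_ofReal hp.le, ← ENNReal.rpow_mul, one_div_mul_cancel hp.ne', ENNReal.rpow_one]
    calc ∫⁻ y in Q, ‖f y‖ₑ ^ p ≤ ∫⁻ y in Q, S.indicator (fun _ => ENNReal.ofReal B ^ p) y := by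
          refine setLIntegral_mono' hQ fun y hy => ?_
          by_cases hyS : y ∈ S
          · rw [indicator_of_mem hyS]
            refine ENNReal.rpow_le_rpow ?_ hp.le
            rw [← ofReal_norm]
            exact ENNReal.ofReal_le_ofReal (hf y hy)
          · rw [hf0 y hy hyS]
            simp [hp]
      _ = ENNReal.ofReal B ^ p * volume (S ∩ Q) := by
          rw [lintegral_indicator hS, setLIntegral_const, Measure.restrict_apply hS]
  refine (iInf₂_le d₀ hdiv).trans ?_
  have h1 : eLpNorm w (ENNReal.ofReal p) (volume.restrict O)
      = eLpNorm w₀ (ENNReal.ofReal p) (volume.restrict O) := eLpNorm_congr_ae hwO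
  rw [h1]
  calc _ ≤ (ENNReal.ofReal ε ^ p) ^ (1 / p) := by
        refine ENNReal.rpow_le_rpow ?_ (by positivity)
        refine (add_le_add (hnorm w₀ hwB hwS) (hnorm d₀ hdB hdS)).trans ?_
        rwa [← two_mul]
    _ = ENNReal.ofReal ε := by
        rw [← ENNReal.rpow_mul, mul_one_div_cancel hp.ne', ENNReal.rpow_one]

end

/-! ### Approximation across an interior edge -/

noncomputable section

open Filter Topology

set_option maxSynthPendingDepth 3

/-- A smooth cutoff at the scale `δ` around the origin of the line. -/
structure IsCutoff (C δ : ℝ) (η : ℝ → ℝ) : Prop where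
  pos : 0 < δ
  smooth : ContDiff ℝ ∞ η
  mem : ∀ r, η r ∈ Icc (0 : ℝ) 1
  eq_one : ∀ r, |r| ≤ δ / 2 → η r = 1
  eq_zero : ∀ r, δ ≤ |r| → η r = 0
  deriv_le : ∀ r, |deriv η r| * |r| ≤ C

/-- The product of the derivative with `|r|` is invariant under scaling, so one profile gives a
bound `C` that does not depend on the scale `δ`. -/
lemma exists_isCutoff : ∃ C : ℝ, ∀ δ > 0, ∃ η, IsCutoff C δ η := by
  obtain ⟨η, h1, h2, h3, ⟨V, -, hKV, hV⟩, h5⟩ := (isCompact_closedBall (0 : ℝ) (1 / 2)).exists_smooth_cutoff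
    (Metric.isOpen_ball (x := 0) (ε := 1)) (Metric.closedBall_subset_ball (by norm_num))
  have hd : Continuous fun r : ℝ => |deriv η r| * |r| :=
    ((h1.continuous_deriv (by simp)).abs).mul continuous_abs
  obtain ⟨C, hC⟩ := hd.bounded_above_of_compact_support (h2.deriv.comp_left abs_zero).mul_right
  refine ⟨C, fun δ hδ => ⟨fun r => η (r / δ), hδ, h1.comp (contDiff_id.div_const δ), fun r => h5 _,
    fun r hr => hV _ (hKV ?_), fun r hr => ?_, fun r => ?_⟩⟩
  · rw [mem_closedBall_zero_iff, Real.norm_eq_abs, abs_div, abs_of_pos hδ, div_le_iff₀ hδ]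
    linarith
  · refine image_eq_zero_of_notMem_tsupport fun h => ?_
    have := h3 h
    rw [mem_ball_zero_iff, Real.norm_eq_abs, abs_div, abs_of_pos hδ, div_lt_one hδ] at this
    linarith
  · have h6 : HasDerivAt (fun r => η (r / δ)) (deriv η (r / δ) * (1 / δ)) r :=
      ((h1.differentiable (by simp) _).hasDerivAt).comp r ((hasDerivAt_id r).div_const δ)
    rw [h6.deriv]
    refine le_trans (le_of_eq ?_) ((le_abs_self _).trans (hC (r / δ)))
    rw [abs_mul, abs_div, abs_div, abs_one]
    ring

lemma measurableSet_halfplane : MeasurableSet {y : Plane | 0 ≤ y 0} :=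
  (isClosed_le continuous_const (contDiff_coord 0).continuous).measurableSet

lemma volume_axis : volume {y : Plane | y 0 = 0} = 0 := by
  have h1 : {y : Plane | y 0 = 0} = planeProd ⁻¹' (({0} : Set ℝ) ×ˢ univ) := by
    ext y; simp
  rw [h1, measurePreserving_planeProd.measure_preimage
    ((measurableSet_singleton _).prod MeasurableSet.univ).nullMeasurableSet,
    Measure.volume_eq_prod, Measure.prod_prod]
  simp

/-- Continuity of the measure from above: the strips decrease to the zero set of `β` in `Q`. -/
lemma tendsto_volume_strip {Q : Set Plane} (hQ : volume Q ≠ ⊤) {β : Plane → ℝ} (hβ : Measurable β)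
    (hQm : MeasurableSet Q) (h0 : volume (Q ∩ {y | β y = 0}) = 0) (hβ0 : ∀ y ∈ Q, 0 ≤ β y) :
    Tendsto (fun δ : ℝ => volume ({y | β y ≤ δ} ∩ Q)) (𝓝[>] 0) (𝓝 0) := by
  have h1 : ⋂ δ > (0 : ℝ), ({y | β y ≤ δ} ∩ Q) = Q ∩ {y | β y = 0} := by
    ext y
    simp only [mem_iInter, mem_inter_iff, mem_ofPred_eq]
    constructor
    · intro h
      have hy := (h 1 one_pos).2
      exact ⟨hy, le_antisymm (le_of_forall_gt_imp_ge_of_dense fun δ hδ => (h δ hδ).1) (hβ0 y hy)⟩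
    · rintro ⟨hy, h⟩ δ hδ
      exact ⟨h.le.trans hδ.le, hy⟩
  rw [← h0, ← h1]
  refine tendsto_measure_biInter_gt (fun δ _ => ?_) (fun δ δ' _ h => ?_) ⟨1, one_pos, ?_⟩
  · exact ((measurableSet_le hβ measurable_const).inter hQm).nullMeasurableSet
  · exact inter_subset_inter_left _ fun y hy => le_trans hy h
  · exact ((measure_mono inter_subset_right).trans_lt hQ.lt_top).ne

/-- The derivative of the cutoff multiplies dβ(u), which is O(|β|); the scale-invariant bound of the
cutoff compensates the factor 1/δ. -/
lemma pdiv_cutoff_le {C δ : ℝ} {η : ℝ → ℝ} (hη : IsCutoff C δ η) {β : Plane → ℝ} {u : Plane → Plane}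
    {y : Plane} (hβ : DifferentiableAt ℝ β y) (hu : DifferentiableAt ℝ u y) {L D : ℝ}
    (hL0 : 0 ≤ L) (hL : |fderiv ℝ β y (u y)| ≤ L * |β y|) (hD : |pdiv u y| ≤ D) :
    |pdiv (fun z => η (β z) • u z) y| ≤ L * C + D := by
  have h1 : HasFDerivAt (fun z => η (β z)) (deriv η (β y) • fderiv ℝ β y) y :=
    ((hη.smooth.differentiable (by simp) _).hasDerivAt).comp_hasFDerivAt y hβ.hasFDerivAt
  rw [pdiv_smul h1.differentiableAt hu, h1.fderiv]
  have h2 := hη.mem (β y)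
  refine (abs_add_le _ _).trans (add_le_add ?_ ?_)
  · have hC := hη.deriv_le (β y)
    change |deriv η (β y) * fderiv ℝ β y (u y)| ≤ _
    rw [abs_mul]
    calc _ ≤ |deriv η (β y)| * (L * |β y|) := by gcongr
      _ = L * (|deriv η (β y)| * |β y|) := by ring
      _ ≤ _ := by gcongr
  · rw [abs_mul, abs_of_nonneg h2.1]
    nlinarith [abs_nonneg (pdiv u y), h2.2]

/-- A compactly supported smooth field is Lipschitz; compare with the foot on the axis. -/
lemma abs_le_mul_abs_fst {u : Plane → Plane} (hu : ContDiff ℝ ∞ u) (hc : HasCompactSupport u)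
    (h0 : ∀ y : Plane, y 0 = 0 → u y 0 = 0) : ∃ L, 0 ≤ L ∧ ∀ y : Plane, |u y 0| ≤ L * |y 0| := by
  obtain ⟨L, hL⟩ := (hu.of_le (by simp)).lipschitzWith_of_hasCompactSupport hc one_ne_zero
  refine ⟨L, L.2, fun y => ?_⟩
  have h1 := hL.dist_le_mul y (planeVec ![0, y 1])
  have h2 : ‖y - planeVec ![0, y 1]‖ = |y 0| := by
    rw [EuclideanSpace.norm_eq]
    simp [Real.sqrt_sq_eq_abs]
  rw [dist_eq_norm, dist_eq_norm, h2] at h1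
  have h3 : |u y 0| = ‖(u y - u (planeVec ![0, y 1])) 0‖ := by
    simp [h0 (planeVec ![0, y 1]) (by simp)]
  rw [h3]
  exact (PiLp.norm_apply_le _ _).trans h1

namespace CurvedMesh

variable {Ω : Set Plane} {ι : Type} {M : CurvedMesh Ω ι} {g : PwTensor ι}

namespace EdgeTube

variable {i j : ι} {k : Fin 3} {T : M.EdgeTube g i j k}

lemma pushforward_apply [Fintype ι] {m : ι} {f : OpenPartialHomeomorph Plane Plane} {ς : ℝ}
    (h : T.HasSide m f ς) {y : Plane} (hy : y ∈ T.box) (h0 : 0 < ς * y 0) (X : PwField ι) :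
    M.pushforward T.e X y = fderiv ℝ f.symm (f y) (X m (f y)) := by
  have hs := T.symm_mem_source hy
  have hm := (h.symm_mem_iff hy).2.2 h0
  rw [pushforward, Finset.sum_eq_single m, indicator_of_mem hm,
    (h.contDiffAt_interior hs hm).2.fderiv, h.symm_eq hy h0.le]
  · intro m' _ hm'
    exact indicator_of_notMem (fun h' => M.interior_disjoint hm'.symm hm (_root_.interior_subset h')) _
  · simp

/-- In a tube, a normal continuous field is approximated by test fields. -/
theorem exists_approx [Fintype ι] (T : M.EdgeTube g i j k) (hg : M.IsReggeMetric g) {W : PwField ι}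
    (hW : M.IsNormalCont g W) {χ : Plane → ℝ} (hχ : ContDiff ℝ ∞ χ) (hc : HasCompactSupport χ)
    (hs : tsupport χ ⊆ T.box) (C : ℝ) : ∃ B : ℝ, ∀ δ η, IsCutoff C δ η → ∃ φ : PwField ι,
      (M.IsTestField g φ ∧ M.CompactSupportIn φ T.e.source) ∧ (∀ m, SmoothUpTo (M.elem m) (φ m)) ∧
      (∀ m, ∀ p ∈ M.elem m, ‖φ m p - T.pullFun χ p • W m p‖ ≤ B) ∧
      (∀ m, ∀ p ∈ M.elem m, (p ∈ T.e.source → δ ≤ |T.e p 0|) → φ m p = T.pullFun χ p • W m p) ∧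
      (∀ m f ς, T.HasSide m f ς → ∀ s ∈ Ioo T.a T.b, φ m (M.edgeParam i k s)
          = (χ (planeVec ![0, s]) * tensorApp (g m (M.edgeParam i k s)) (W m (M.edgeParam i k s))
              (unitNormalOf (g m (M.edgeParam i k s)) (ς • M.tangent i k s))) •
            unitNormalOf (g m (M.edgeParam i k s)) (ς • M.tangent i k s)) ∧
      ∀ p > 0, ∀ O ⊆ T.box, ∀ ε, 2 * (ENNReal.ofReal B ^ p * volume ({y : Plane | |y 0| ≤ δ} ∩ T.box))
          ≤ ENNReal.ofReal ε ^ p →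
        wpDivNorm p O (M.pushforward T.e fun m x => φ m x - T.pullFun χ x • W m x)
          ≤ ENNReal.ofReal ε := by
  obtain ⟨V, hV, hVW, hVij⟩ := T.exists_coordField hg hW
  -- The first component on the axis, continued constantly in the first coordinate. It is common to
  -- both sides, since those components agree.
  set N : Plane → Plane := fun y => χ y • V i (planeVec ![0, y 1]) 0 • coordVec 0
  set u : ι → Plane → Plane := fun m y => N y - χ y • V m y
  have hχ0 : ∀ y, y ∉ T.box → χ y = 0 := fun y hy =>
    image_eq_zero_of_notMem_tsupport fun h => hy (hs h)
  have hN : ContDiff ℝ ∞ N := by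
    have h1 : ContDiff ℝ ∞ fun y : Plane => V i (planeVec ![0, y 1]) 0 := (coordL 0).contDiff.comp ((hV i).comp (contDiff_planeVec.comp
      (contDiff_const.prodMk (contDiff_coord 1))))
    exact hχ.smul (h1.smul (contDiff_const (c := coordVec 0)))
  have hu : ∀ m, ContDiff ℝ ∞ (u m) := fun m => hN.sub (hχ.smul (hV m))
  have hsub : ∀ {F : Type} [NormedAddCommGroup F] {v : Plane → F}, (∀ y, χ y = 0 → v y = 0) →
      HasCompactSupport v ∧ tsupport v ⊆ tsupport χ := fun {F} _ {v} hv =>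
    ⟨hc.mono fun y hy h => hy (hv y h), closure_mono fun y hy h => hy (hv y h)⟩
  have huχ : ∀ m y, χ y = 0 → u m y = 0 := fun m y hy => by simp [u, N, hy]
  have huc : ∀ m, HasCompactSupport (u m) := fun m => (hsub (huχ m)).1
  -- Normal continuity in the form used for the divergence: on the axis `N` has the same first
  -- component as `χ • V m` from both sides.
  have hu0 : ∀ m f ς, T.HasSide m f ς → ∀ y : Plane, y 0 = 0 → u m y 0 = 0 := by
    intro m f ς h y hy
    by_cases hyb : y ∈ T.box
    · have h1 : V i (planeVec ![0, y 1]) 0 = V m y 0 := by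
        rw [plane_eq_of_fst_zero hy]
        rcases h.eq_or_eq with rfl | rfl
        · simp
        · simpa using hVij (y 1) hyb.2
      simp [u, N, coordVec, h1]
    · simp [huχ m y (hχ0 y hyb)]
  have hb : ∀ m f ς, T.HasSide m f ς → ∃ b, ∀ b' ≥ b, 0 ≤ b' ∧ (∀ y, ‖fderiv ℝ f y (u m y)‖ ≤ b') ∧
      (∀ y, ‖u m y‖ ≤ b') ∧ ∀ δ η, IsCutoff C δ η → ∀ y,
        |pdiv (fun z => η (z 0) • u m z) y| ≤ b' := by
    intro m f ς h
    have h1 : Continuous fun y => fderiv ℝ f y (u m y) :=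
      (h.isSideMap.smooth.continuous_fderiv (by simp)).clm_apply (hu m).continuous
    obtain ⟨b₁, hb₁⟩ := h1.bounded_above_of_compact_support
      (hsub fun y hy => by rw [huχ m y hy, map_zero]).1
    obtain ⟨b₂, hb₂⟩ := (hu m).continuous.bounded_above_of_compact_support (huc m)
    obtain ⟨L, hL0, hL⟩ := abs_le_mul_abs_fst (hu m) (huc m) (hu0 m f ς h)
    obtain ⟨D, hD⟩ := (continuous_pdiv (hu m)).bounded_above_of_compact_support
      (hasCompactSupport_pdiv (huc m))
    refine ⟨max b₁ (max b₂ (L * C + D)), fun b' hb' => ⟨(norm_nonneg _).trans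
      ((hb₁ 0).trans ((le_max_left _ _).trans hb')), fun y => (hb₁ y).trans ((le_max_left _ _).trans hb'),
      fun y => (hb₂ y).trans (((le_max_left _ _).trans (le_max_right _ _)).trans hb'),
      fun δ η hη y => (?_ : _ ≤ L * C + D).trans
        (((le_max_right _ _).trans (le_max_right _ _)).trans hb')⟩⟩
    have h2 : HasFDerivAt (fun z : Plane => z 0) (coordL 0) y := (coordL 0).hasFDerivAt
    refine pdiv_cutoff_le hη h2.differentiableAt ((hu m).differentiable (by simp) y) hL0 ?_ (hD y)
    rw [h2.fderiv]; exact hL y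
  obtain ⟨bi, hbi⟩ := hb _ _ _ T.hasSide_p
  obtain ⟨bj, hbj⟩ := hb _ _ _ T.hasSide_m
  set B := max bi bj
  have hB : ∀ m f ς, T.HasSide m f ς → 0 ≤ B ∧ (∀ y, ‖fderiv ℝ f y (u m y)‖ ≤ B) ∧
      (∀ y, ‖u m y‖ ≤ B) ∧ ∀ δ η, IsCutoff C δ η → ∀ y,
        |pdiv (fun z => η (z 0) • u m z) y| ≤ B := by
    rintro m f ς (⟨rfl, rfl, rfl⟩ | ⟨rfl, rfl, rfl⟩)
    · exact hbi B (le_max_left _ _)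
    · exact hbj B (le_max_right _ _)
  have hB0 : 0 ≤ B := (hB _ _ _ T.hasSide_p).1
  refine ⟨B, fun δ η hη => ?_⟩
  have hηs : ContDiff ℝ ∞ fun z : Plane => η (z 0) := hη.smooth.comp (contDiff_coord 0)
  -- Equal to `N` within δ/2 of the axis, where the two sides therefore fit together smoothly, and
  -- to `χ • V m` beyond distance δ.
  set Z : ι → Plane → Plane := fun m y => χ y • V m y + η (y 0) • u m y
  have hZ : ∀ m, ContDiff ℝ ∞ (Z m) := fun m => (hχ.smul (hV m)).add (hηs.smul (hu m))
  have hZN : ∀ m, ∀ y : Plane, |y 0| ≤ δ / 2 → Z m y = N y := by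
    intro m y hy
    simp only [Z, u, hη.eq_one _ hy, one_smul]
    abel
  set Y : Plane → Plane := halfPiece (Z i) (Z j)
  have hYZ : ∀ m f ς, T.HasSide m f ς → ∀ y : Plane, 0 ≤ ς * y 0 → Y y = Z m y := by
    rintro m f ς (⟨rfl, rfl, rfl⟩ | ⟨rfl, rfl, rfl⟩) y hy
    · exact if_pos (by linarith)
    · rcases lt_or_eq_of_le hy with h | h
      · exact if_neg (by linarith)
      · have h0 : |y 0| ≤ δ / 2 := by
          rw [show y 0 = 0 by linarith, abs_zero]; linarith [hη.pos]
        rw [hZN _ y h0, ← hZN i y h0]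
        exact if_pos (by linarith)
  have hY : ContDiff ℝ ∞ Y := by
    rw [contDiff_iff_contDiffAt]
    intro y
    have hc0 : ContinuousAt (fun y : Plane => y 0) y := (contDiff_coord 0).continuous.continuousAt
    rcases lt_trichotomy (y 0) 0 with h | h | h
    · refine (hZ j).contDiffAt.congr_of_eventuallyEq ?_
      filter_upwards [hc0.eventually (gt_mem_nhds h)] with z hz
      exact hYZ _ _ _ T.hasSide_m z (by linarith)
    · refine hN.contDiffAt.congr_of_eventuallyEq ?_
      have : ∀ᶠ z in 𝓝 y, |z 0| < δ / 2 :=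
        hc0.abs.eventually (gt_mem_nhds (show |y 0| < δ / 2 by rw [h, abs_zero]; linarith [hη.pos]))
      filter_upwards [this] with z hz
      obtain ⟨m, f, ς, hm, h0⟩ := T.exists_hasSide_of_sign z
      rw [hYZ m f ς hm z h0, hZN m z hz.le]
    · refine (hZ i).contDiffAt.congr_of_eventuallyEq ?_
      filter_upwards [hc0.eventually (lt_mem_nhds h)] with z hz
      exact hYZ _ _ _ T.hasSide_p z (by linarith)
  have hYχ : ∀ y, χ y = 0 → Y y = 0 := by
    intro y hy
    obtain ⟨m, f, ς, hm, h0⟩ := T.exists_hasSide_of_sign y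
    rw [hYZ m f ς hm y h0]
    simp [Z, hy, huχ m y hy]
  obtain ⟨hYc, hYs⟩ := hsub hYχ
  have hval : ∀ m f ς, T.HasSide m f ς → ∀ y ∈ T.box, 0 ≤ ς * y 0 →
      fderiv ℝ f y (Y y) - χ y • W m (f y) = η (y 0) • fderiv ℝ f y (u m y) := by
    intro m f ς h y hy h0
    rw [hYZ m f ς h y h0, ← (hVW m f ς h).1 y hy h0, ← map_smul, ← map_smul, ← map_sub]
    simp only [Z, add_sub_cancel_left]
  have hdiff : ∀ m, ∀ p ∈ M.elem m, p ∈ T.e.source → ∃ f ς, T.HasSide m f ς ∧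
      T.pullField Y m p - T.pullFun χ p • W m p = η (T.e p 0) • fderiv ℝ f (T.e p) (u m (T.e p)) := by
    intro m p hm hp
    obtain ⟨f, ς, h⟩ := T.exists_hasSide hp hm
    have := hval m f ς h _ (T.e_mem_box hp) ((h.mem_iff hp).1.1 hm)
    rw [h.f_e hp hm] at this
    exact ⟨f, ς, h, by rw [pullField_of_mem hp, pullFun_of_mem hp, h.sideMap_eq, this]⟩
  refine ⟨T.pullField Y, isTestField_pullField hY hYc (hYs.trans hs) hg,
    smoothUpTo_pullField hY hYc (hYs.trans hs), fun m p hm => ?_, fun m p hm hδ => ?_,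
    fun m f ς h s hs => ?_, fun q hq O hO ε hvol => ?_⟩
  · by_cases hp : p ∈ T.e.source
    · obtain ⟨f, ς, h, heq⟩ := hdiff m p hm hp
      rw [heq, norm_smul, Real.norm_eq_abs, abs_of_nonneg (hη.mem _).1]
      have := (hB m f ς h).2.1 (T.e p)
      nlinarith [(hη.mem (T.e p 0)).2, norm_nonneg (fderiv ℝ f (T.e p) (u m (T.e p)))]
    · rw [pullField_of_notMem hp, pullFun_of_notMem hp]
      simpa using hB0
  · by_cases hp : p ∈ T.e.source
    · obtain ⟨f, ς, h, heq⟩ := hdiff m p hm hp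
      rw [hη.eq_zero _ (hδ hp), zero_smul] at heq
      exact sub_eq_zero.1 heq
    · rw [pullField_of_notMem hp, pullFun_of_notMem hp, zero_smul]
  · obtain ⟨h1, h2⟩ := T.edgeParam_mem_source hs
    have h3 : V i (planeVec ![0, s]) 0 = V m (planeVec ![0, s]) 0 := by
      rcases h.eq_or_eq with rfl | rfl
      · rfl
      · exact hVij s hs
    rw [pullField_of_mem h1, h2, h.sideMap_eq, hYZ m f ς h _ (by simp), hZN m _ (by
      simp; linarith [hη.pos])]
    simp only [N, planeVec_apply]
    rw [map_smul, mul_smul, ← (hVW m f ς h).2 s hs, ← h3]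
    rfl
  -- The error in tube coordinates is `w i` on one half-plane and `w j` on the other. The first
  -- component of both vanishes on the axis, and both are supported in the strip of width δ.
  · set w : ι → Plane → Plane := fun m y => η (y 0) • u m y
    have hw : ∀ m, ContDiff ℝ ∞ (w m) := fun m => hηs.smul (hu m)
    have hw0 : ∀ m f ς, T.HasSide m f ς → ∀ y : Plane, y 0 = 0 → w m y 0 = 0 := by
      intro m f ς h y hy
      simp [w, hu0 m f ς h y hy]
    have hcase : ∀ {F : Type} (a : ι → Plane → F) (y : Plane), ∃ m f ς, T.HasSide m f ς ∧
        0 ≤ ς * y 0 ∧ halfPiece (a i) (a j) y = a m y := by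
      intro F a y
      by_cases hy : 0 ≤ y 0
      · exact ⟨_, _, _, T.hasSide_p, by linarith, if_pos hy⟩
      · exact ⟨_, _, _, T.hasSide_m, by linarith, if_neg hy⟩
    have hfar : ∀ m, ∀ y : Plane, y ∉ {y : Plane | |y 0| ≤ δ} → w m =ᶠ[𝓝 y] fun _ => 0 := by
      intro m y hy
      have hc0 : ContinuousAt (fun y : Plane => |y 0|) y :=
        (contDiff_coord 0).continuous.abs.continuousAt
      filter_upwards [hc0.eventually (lt_mem_nhds (not_le.1 hy))] with z hz
      simp only [w]
      rw [hη.eq_zero _ hz.le, zero_smul]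
    refine wpDivNorm_le hq hO T.isOpen_box.measurableSet ?_ ?_ (w₀ := halfPiece (w i) (w j))
      (d₀ := halfPiece (pdiv (w i)) (pdiv (w j))) (B := B) ?_ ?_ ?_ (fun y _ => ?_) (fun y _ => ?_)
      (fun y _ hyS => ?_) (fun y _ hyS => ?_) (fun ζ hζ hζc _ => ?_) hvol
    · exact ((measure_mono T.box_subset).trans_lt
        (isCompact_closedPlaneBox _ _ _).measure_lt_top).ne
    · exact (isClosed_le (contDiff_coord 0).continuous.abs continuous_const).measurableSet
    · have h0 : ∀ᵐ y : Plane, y 0 ≠ 0 := by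
        rw [ae_iff]; simpa using volume_axis
      filter_upwards [ae_restrict_mem T.isOpen_box.measurableSet, ae_restrict_of_ae h0] with y hy hy0
      obtain ⟨m, f, ς, h, hς, heq⟩ := hcase w y
      have hpos : 0 < ς * y 0 := lt_of_le_of_ne hς (by rcases h.sign with rfl | rfl <;> simp [hy0, Ne.symm hy0])
      rw [heq, pushforward_apply h hy hpos]
      have hsrc := T.symm_mem_source hy
      have hsy := h.symm_eq hy hς
      rw [← hsy, pullField_of_mem hsrc, pullFun_of_mem hsrc, T.e_symm hy, h.sideMap_eq, hsy,
        hval m f ς h y hy hς, ← map_smul]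
      exact congrArg (fun A : Plane →L[ℝ] Plane => A (η (y 0) • u m y))
        (h.comp_fderiv (h.isSideMap.box (T.box_subset hy))).1
    · exact (StronglyMeasurable.ite measurableSet_halfplane (hw i).continuous.stronglyMeasurable
        (hw j).continuous.stronglyMeasurable).aestronglyMeasurable
    · exact (StronglyMeasurable.ite measurableSet_halfplane (continuous_pdiv (hw i)).stronglyMeasurable
        (continuous_pdiv (hw j)).stronglyMeasurable).aestronglyMeasurable
    · obtain ⟨m, f, ς, h, -, heq⟩ := hcase w y
      rw [heq, norm_smul, Real.norm_eq_abs, abs_of_nonneg (hη.mem _).1]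
      have := (hB m f ς h).2.2.1 y
      nlinarith [(hη.mem (y 0)).2, norm_nonneg (u m y)]
    · obtain ⟨m, f, ς, h, -, heq⟩ := hcase (fun m => pdiv (w m)) y
      rw [heq]
      exact (hB m f ς h).2.2.2 δ η hη y
    · obtain ⟨m, f, ς, h, -, heq⟩ := hcase w y
      rw [heq]; exact (hfar m y hyS).self_of_nhds
    · obtain ⟨m, f, ς, h, -, heq⟩ := hcase (fun m => pdiv (w m)) y
      rw [heq, pdiv_congr (hfar m y hyS)]
      simp [pdiv]
    · exact integral_fderiv_halfPiece hζ hζc (hw i) (hw0 _ _ _ T.hasSide_p) (hw j)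
        (hw0 _ _ _ T.hasSide_m)

end EdgeTube

end CurvedMesh

end

/-! ### Approximation inside an element and at the boundary of the domain -/

noncomputable section

open Filter Topology

set_option maxSynthPendingDepth 3

/-- Each point of the unit triangle is at distance `refBary k` from the `k`-th edge. -/
lemma exists_refEdge_dist (k : Fin 3) {x : Plane} (hx : x ∈ refTriangle) :
    ∃ s ∈ Icc (0 : ℝ) 1, ‖x - refEdge k s‖ = refBary k x := by
  obtain ⟨h0, h1, h2⟩ := hx
  have hsq : ∀ {t : ℝ}, 0 ≤ t → Real.sqrt (t ^ 2) = t := fun h => Real.sqrt_sq h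
  fin_cases k
  · refine ⟨x 0, ⟨h0, by linarith⟩, ?_⟩
    rw [EuclideanSpace.norm_eq]
    simp [refEdge, refBary, hsq h1]
  · refine ⟨1 - x 0, ⟨by linarith, by linarith⟩, ?_⟩
    rw [EuclideanSpace.norm_eq]
    simp only [refEdge, refBary, Fin.sum_univ_two, PiLp.sub_apply, planeVec_apply]
    rw [← hsq (show 0 ≤ 1 - x 0 - x 1 by linarith)]
    congr 1
    simp
    ring
  · refine ⟨1 - x 1, ⟨by linarith, by linarith⟩, ?_⟩
    rw [EuclideanSpace.norm_eq]
    simp [refEdge, refBary, hsq h0]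

namespace CurvedMesh

variable {Ω : Set Plane} {ι : Type} {M : CurvedMesh Ω ι} {g : PwTensor ι}

/-- A smooth function that vanishes on an edge is bounded by the barycentric coordinate. -/
lemma exists_le_bary (i : ι) (k : Fin 3) {h : Plane → ℝ} (hh : ContDiff ℝ ∞ h)
    (h0 : ∀ s ∈ Ioo (0 : ℝ) 1, h (M.edgeParam i k s) = 0) :
    ∃ L, 0 ≤ L ∧ ∀ p ∈ M.elem i, |h p| ≤ L * M.bary i k p := by
  have hH : ContDiff ℝ ∞ (h ∘ M.map i) := hh.comp (M.smooth i)
  obtain ⟨L, hL⟩ := isCompact_refTriangle.exists_bound_of_continuousOn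
    (hH.continuous_fderiv (by simp)).continuousOn
  have h1 : ∀ s ∈ Icc (0 : ℝ) 1, h (M.edgeParam i k s) = 0 := by
    have hcl : IsClosed {s | h (M.edgeParam i k s) = 0} :=
      isClosed_eq (hh.continuous.comp (M.contDiff_edgeParam i k).continuous) continuous_const
    have := hcl.closure_subset_iff.2 (show Ioo (0 : ℝ) 1 ⊆ _ from h0)
    rwa [closure_Ioo zero_ne_one] at this
  refine ⟨max L 0, le_max_right _ _, ?_⟩
  rintro _ ⟨x, hx, rfl⟩
  obtain ⟨s, hs, hsx⟩ := exists_refEdge_dist k hx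
  rw [M.bary_map i k hx, ← hsx]
  have h2 := convex_refTriangle.norm_image_sub_le_of_norm_fderiv_le (f := h ∘ M.map i) (C := max L 0)
    (fun y _ => hH.differentiable (by simp) y) (fun y hy => (hL y hy).trans (le_max_left _ _))
    (refEdge_mem (k := k) hs) hx
  have h3 : (h ∘ M.map i) (refEdge k s) = 0 := h1 s hs
  rwa [h3, sub_zero] at h2

lemma innerChart_apply (i : ι) : ⇑(M.innerChart i) = id := rfl

lemma pushforward_innerChart [Fintype ι] {i : ι} {y : Plane} (hy : y ∈ interior (M.elem i))
    (X : PwField ι) : M.pushforward (M.innerChart i) X y = X i y := by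
  rw [pushforward, Finset.sum_eq_single i]
  · change (interior (M.elem i)).indicator _ y = _
    rw [indicator_of_mem hy, innerChart_apply, fderiv_id]
    rfl
  · intro m _ hm
    exact indicator_of_notMem (fun h' => M.interior_disjoint hm.symm hy (_root_.interior_subset h')) _
  · simp

/-- A tangential field on the boundary of the domain. -/
lemma IsNormalCont.cross_eq_zero {W : PwField ι} (hg : M.IsReggeMetric g) (hW : M.IsNormalCont g W)
    {i : ι} {k : Fin 3} {s : ℝ} (hs : s ∈ Ioo (0 : ℝ) 1) (h : M.edgeParam i k s ∉ Ω) :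
    cross (M.tangent i k s) (W i (M.edgeParam i k s)) = 0 := by
  have hm := hg.isMetricMatrix (M.edgeParam_mem_elem i k (Ioo_subset_Icc_self hs))
  have h0 := M.tangent_ne_zero i k (Ioo_subset_Icc_self hs)
  have h1 := hW.bdry i k s hs h
  change tensorApp _ _ (unitNormalOf _ _) = 0 at h1
  rw [tensorApp_comm hm.symm, tensorApp_unitNormalOf hm] at h1
  refine (mul_eq_zero.1 h1).resolve_left (inv_ne_zero (Real.sqrt_ne_zero'.2 ?_))
  exact tensorApp_normalOf_self_pos hm h0

section

variable {i : ι} {Θ : Plane → ℝ} {N : Set Plane} (hΘ : SmoothUpTo (M.elem i) Θ) (hN : IsOpen N)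
  (hNv : M.vertices ⊆ N)
  (hNe : ∀ k, ∀ s ∈ Ioo (0 : ℝ) 1, M.edgeParam i k s ∈ Ω → M.edgeParam i k s ∈ N)
  (hN0 : ∀ p ∈ N, p ∈ M.elem i → Θ p = 0)

include hΘ hN hNv hNe hN0

omit hNv in
-- At interior edges the function vanishes nearby; boundary edges and vertices do not belong to the
-- manifold.
lemma isGluedSmoothFun_indicator :
    M.IsGluedSmoothFun g ((M.elem i).indicator Θ) := by
  refine isGluedSmoothFun_of_testChart fun p hp => ?_
  by_cases hi : p ∈ M.elem i
  · rcases M.mem_elem_cases i hi with h | h | ⟨k, s, hs, rfl⟩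
    · exact absurd h hp.2
    · refine Or.inr ⟨M.innerChart i, isTestChart_innerChart i, h, ?_⟩
      change ContDiffAt ℝ ∞ ((M.elem i).indicator Θ) p
      refine (hΘ.contDiffAt h).congr_of_eventuallyEq ?_
      filter_upwards [mem_interior_iff_mem_nhds.1 h] with q hq using indicator_of_mem hq _
    · left
      filter_upwards [hN.mem_nhds (hNe k s hs hp.1)] with q hq
      by_cases hqi : q ∈ M.elem i
      · rw [indicator_of_mem hqi, hN0 q hq hqi]
      · exact indicator_of_notMem hqi _
  · left
    filter_upwards [(M.isClosed_elem i).isOpen_compl.mem_nhds hi] with q hq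
    exact indicator_of_notMem hq _

omit hΘ hNv in
-- The support lies in a closed subset of the element that avoids the interior edges, so the only
-- points of the manifold in its closure are inner points of the element.
lemma closure_support_indicator :
    closure (Function.support ((M.elem i).indicator Θ) ∩ M.punctured) ∩ M.punctured
      ⊆ interior (M.elem i) := by
  rintro p ⟨hp, hpp⟩
  have hsub : Function.support ((M.elem i).indicator Θ) ∩ M.punctured ⊆ M.elem i ∩ Nᶜ := by
    rintro q ⟨hq, -⟩
    have hqi : q ∈ M.elem i := by
      by_contra h
      exact hq (indicator_of_notMem h _)
    refine ⟨hqi, fun hqN => hq ?_⟩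
    rw [indicator_of_mem hqi, hN0 q hqN hqi]
  have hcl : p ∈ M.elem i ∩ Nᶜ :=
    closure_minimal hsub ((M.isClosed_elem i).inter hN.isClosed_compl) hp
  rcases M.mem_elem_cases i hcl.1 with h | h | ⟨k, s, hs, rfl⟩
  · exact absurd h hpp.2
  · exact h
  · exact absurd (hNe k s hs hpp.1) hcl.2

/-- In an element, a normal continuous field is approximated by test fields that vanish near the
boundary. -/
theorem exists_inner_approx [Fintype ι] (hg : M.IsReggeMetric g) {W : PwField ι}
    (hW : M.IsNormalCont g W) (C : ℝ) : ∃ (B : ℝ) (β : Plane → ℝ), Continuous β ∧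
      (∀ p ∈ interior (M.elem i), 0 < β p) ∧ ∀ δ η, IsCutoff C δ η → ∃ φ : PwField ι,
      (M.IsTestField g φ ∧ M.CompactSupportIn φ (M.innerChart i).source) ∧
      (∀ m, SmoothUpTo (M.elem m) (φ m)) ∧ (∀ m, m ≠ i → ∀ p, φ m p = 0) ∧
      (∀ p ∈ M.elem i, ‖φ i p - Θ p • W i p‖ ≤ B) ∧
      (∀ p ∈ M.elem i, δ ≤ β p → φ i p = Θ p • W i p) ∧
      (∀ k, ∀ s ∈ Ioo (0 : ℝ) 1, φ i (M.edgeParam i k s) = 0) ∧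
      ∀ p > 0, ∀ O ⊆ interior (M.elem i), ∀ ε,
        2 * (ENNReal.ofReal B ^ p * volume ({y : Plane | β y ≤ δ} ∩ interior (M.elem i)))
          ≤ ENNReal.ofReal ε ^ p →
        wpDivNorm p O (M.pushforward (M.innerChart i)
          fun m x => φ m x - (M.elem i).indicator Θ x • W m x) ≤ ENNReal.ofReal ε := by
  classical
  obtain ⟨u, hu, hue⟩ := hΘ.smul (hW.smooth i)
  have hbex : ∀ k, ∃ b : Plane → ℝ, ContDiff ℝ ∞ b ∧ ∀ p ∈ M.elem i, b =ᶠ[𝓝 p] M.bary i k := by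
    intro k
    obtain ⟨b, hb, -, V, hV, hKV, -, hVb⟩ := (M.contDiffOn_bary i k).exists_extension
      (M.homeo i).open_target (M.isCompact_elem i) (M.elem_subset_target i)
    exact ⟨b, hb, fun p hp => hVb.eventuallyEq_of_mem (hV.mem_nhds (hKV hp))⟩
  choose b hb hbe using hbex
  have hbb : ∀ k, ∀ p ∈ M.elem i, b k p = M.bary i k p := fun k p hp => (hbe k p hp).self_of_nhds
  have hb0 : ∀ k, ∀ p ∈ M.elem i, 0 ≤ b k p := fun k p hp => by
    rw [hbb k p hp]
    exact (M.mem_elem_iff i (M.elem_subset_target i hp)).1 hp k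
  -- A substitute for the distance to the boundary of the element, positive inside; the error will
  -- be supported in `β ≤ δ`.
  set β : Plane → ℝ := fun p => min (b 0 p) (min (b 1 p) (b 2 p))
  have hβ : Continuous β := (hb 0).continuous.min ((hb 1).continuous.min (hb 2).continuous)
  have hβk : ∀ k p, β p ≤ b k p := by
    intro k p
    fin_cases k
    · exact min_le_left _ _
    · exact (min_le_right _ _).trans (min_le_left _ _)
    · exact (min_le_right _ _).trans (min_le_right _ _)
  -- Only boundary edges need a cutoff. Near the vertices and the interior edges `Θ` is already
  -- zero.
  set Bd : Finset (Fin 3) := Finset.univ.filter fun k => ∀ s ∈ Ioo (0 : ℝ) 1, M.edgeParam i k s ∉ Ω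
  have hBd : ∀ {k}, k ∈ Bd ↔ ∀ s ∈ Ioo (0 : ℝ) 1, M.edgeParam i k s ∉ Ω := fun {k} => by simp [Bd]
  -- `W` is tangent to a boundary edge, so the derivative of its barycentric coordinate along `u`
  -- vanishes there and is bounded by a multiple of that coordinate.
  have hLex : ∀ k, ∃ L, k ∈ Bd → 0 ≤ L ∧ ∀ p ∈ M.elem i, |fderiv ℝ (b k) p (u p)| ≤ L * |b k p| := by
    intro k
    by_cases hk : k ∈ Bd
    · have hsm : ContDiff ℝ ∞ fun p => fderiv ℝ (b k) p (u p) :=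
        ((hb k).fderiv_right (m := ∞) le_rfl).clm_apply hu
      obtain ⟨L, hL0, hL⟩ := exists_le_bary (M := M) i k hsm fun s hs => by
        have hmem := M.edgeParam_mem_elem i k (Ioo_subset_Icc_self hs)
        obtain ⟨A, hA, c, -, hAc⟩ := M.hasFDerivAt_bary i k (Ioo_subset_Icc_self hs)
        rw [(hA.congr_of_eventuallyEq (hbe k _ hmem)).fderiv, ← hue hmem]
        change A (Θ _ • W i _) = 0
        rw [map_smul, hAc, hW.cross_eq_zero hg hs (hBd.1 hk s hs), mul_zero, smul_zero]
      refine ⟨L, fun _ => ⟨hL0, fun p hp => ?_⟩⟩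
      rw [abs_of_nonneg (hb0 k p hp), hbb k p hp]
      exact hL p hp
    · exact ⟨0, fun h => absurd h hk⟩
  choose L hL using hLex
  obtain ⟨B₁, hB₁⟩ := (M.isCompact_elem i).exists_bound_of_continuousOn hu.continuous.continuousOn
  obtain ⟨B₂, hB₂⟩ := (M.isCompact_elem i).exists_bound_of_continuousOn (continuous_pdiv hu).continuousOn
  set B := max B₁ (∑ k ∈ Bd, L k * C + B₂)
  refine ⟨B, β, hβ, fun p hp => ?_, fun δ η hη => ?_⟩
  · have hp' := M.mem_interior_elem_iff i |>.1 hp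
    have h1 : ∀ k, 0 < b k p := fun k => by rw [hbb k p hp'.1]; exact hp'.2 k
    exact lt_min (h1 0) (lt_min (h1 1) (h1 2))
  have hηb : ∀ k, ContDiff ℝ ∞ fun p => 1 - η (b k p) := fun k =>
    contDiff_const.sub (hη.smooth.comp (hb k))
  -- Zero near the boundary edges and 1 where `δ ≤ β`; multiplication by it gives the field compact
  -- support in the open element.
  set P : Plane → ℝ := fun p => ∏ k ∈ Bd, (1 - η (b k p))
  have hP : ContDiff ℝ ∞ P := contDiff_prod fun k _ => hηb k
  have h01 : ∀ k p, 0 ≤ 1 - η (b k p) ∧ 1 - η (b k p) ≤ 1 := fun k p =>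
    ⟨by linarith [(hη.mem (b k p)).2], by linarith [(hη.mem (b k p)).1]⟩
  have hP01 : ∀ p, 0 ≤ P p ∧ P p ≤ 1 := fun p =>
    ⟨Finset.prod_nonneg fun k _ => (h01 k p).1, Finset.prod_le_one (fun k _ => (h01 k p).1)
      fun k _ => (h01 k p).2⟩
  have hP1 : ∀ p, δ ≤ β p → P p = 1 := fun p hp => Finset.prod_eq_one fun k _ => by
    rw [hη.eq_zero _ ((hp.trans (hβk k p)).trans (le_abs_self _)), sub_zero]
  have hPabs : ∀ p, |P p - 1| ≤ 1 := fun p => by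
    rw [abs_le]; constructor <;> linarith [(hP01 p).1, (hP01 p).2]
  set X : Plane → Plane := fun p => P p • Θ p • W i p
  set φ : PwField ι := fun m p => if m = i then X p else 0
  have hφi : ∀ p, φ i p = X p := fun p => if_pos rfl
  have hXs : SmoothUpTo (M.elem i) X := (SmoothUpTo.of_contDiff hP).smul (hΘ.smul (hW.smooth i))
  set K : Set Plane := closure {p | p ∈ M.elem i ∧ X p ≠ 0}
  have hKi : K ⊆ M.elem i := closure_minimal (fun p hp => hp.1) (M.isClosed_elem i)
  have hKc : IsCompact K := (M.isCompact_elem i).of_isClosed_subset isClosed_closure hKi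
  have hnot : ∀ p, (∀ᶠ q in 𝓝 p, q ∈ M.elem i → X q = 0) → p ∉ K := by
    intro p hp hpK
    obtain ⟨q, hq, hq'⟩ := mem_closure_iff_nhds.1 hpK _ hp
    exact hq'.2 (hq hq'.1)
  have hbdry : ∀ k ∈ Bd, ∀ s ∈ Ioo (0 : ℝ) 1, ∀ᶠ q in 𝓝 (M.edgeParam i k s), X q = 0 := by
    intro k hk s hs
    have hmem := M.edgeParam_mem_elem i k (Ioo_subset_Icc_self hs)
    have h1 : b k (M.edgeParam i k s) = 0 := by
      rw [hbb k _ hmem, M.bary_edgeParam i k k (Ioo_subset_Icc_self hs)]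
      fin_cases k <;> simp [refBary, refEdge]
    have h2 : ∀ᶠ q in 𝓝 (M.edgeParam i k s), |b k q| < δ / 2 :=
      (hb k).continuous.abs.continuousAt.eventually
        (gt_mem_nhds (show |b k (M.edgeParam i k s)| < δ / 2 by rw [h1, abs_zero]; linarith [hη.pos]))
    filter_upwards [h2] with q hq
    have : P q = 0 := Finset.prod_eq_zero hk (by rw [hη.eq_one _ hq.le, sub_self])
    simp only [X, this, zero_smul]
  have hedge : ∀ k, ∀ s ∈ Ioo (0 : ℝ) 1,
      ∀ᶠ q in 𝓝 (M.edgeParam i k s), q ∈ M.elem i → X q = 0 := by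
    intro k s hs
    by_cases hk : k ∈ Bd
    · filter_upwards [hbdry k hk s hs] with q hq _ using hq
    · have hE : M.edgeParam i k s ∈ Ω := by
        rcases M.edge_dichotomy i k with h | h
        · exact h s hs
        · exact absurd (hBd.2 h) hk
      filter_upwards [hN.mem_nhds (hNe k s hs hE)] with q hq hqi
      simp only [X, hN0 q hq hqi, zero_smul, smul_zero]
  -- Vertices and interior edges are excluded by `Θ`, boundary edges by `P`.
  have hKint : K ⊆ interior (M.elem i) := by
    intro p hp
    rcases M.mem_elem_cases i (hKi hp) with h | h | ⟨k, s, hs, rfl⟩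
    · refine absurd hp (hnot p ?_)
      filter_upwards [hN.mem_nhds (hNv h)] with q hq hqi
      simp only [X, hN0 q hq hqi, zero_smul, smul_zero]
    · exact h
    · exact absurd hp (hnot _ (hedge k s hs))
  have hXu : ∀ p ∈ M.elem i, X p - Θ p • W i p = (P p - 1) • u p := by
    intro p hp
    rw [← hue hp, sub_smul, one_smul]
  refine ⟨φ, ?_, fun m => ?_, fun m hm p => if_neg hm, fun p hp => ?_, fun p hp hδ => ?_,
    fun k s hs => ?_, fun q hq O hO ε hvol => ?_⟩
  · refine (isTestChart_innerChart i).isTestField hKc hKint (Y := X)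
      (fun p hp => (hXs.contDiffAt hp).contDiffWithinAt) (fun m p hm hp => ?_) fun m p hm hpK => ?_
    · have hmi : m = i := by
        by_contra h
        exact M.interior_disjoint (Ne.symm h) hp hm
      subst hmi
      rw [innerChart_apply, fderivWithin_id (M.uniqueDiffOn_elem m p hm), hφi]
      rfl
    · by_cases hmi : m = i
      · subst hmi
        rw [hφi]
        by_contra h
        exact hpK (subset_closure ⟨hm, h⟩)
      · exact if_neg hmi
  · by_cases hmi : m = i
    · subst hmi
      exact hXs.congr fun p _ => hφi p
    · exact (SmoothUpTo.of_contDiff (contDiff_const (c := (0 : Plane)))).congr fun p _ => if_neg hmi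
  · rw [hφi, hXu p hp, norm_smul, Real.norm_eq_abs]
    have h1 := hB₁ p hp
    have h2 : B₁ ≤ B := le_max_left _ _
    nlinarith [hPabs p, norm_nonneg (u p), abs_nonneg (P p - 1)]
  · rw [hφi]
    simp only [X, hP1 p hδ, one_smul]
  · rw [hφi]
    exact (hedge k s hs).self_of_nhds (M.edgeParam_mem_elem i k (Ioo_subset_Icc_self hs))
  · set w : Plane → Plane := fun p => (P p - 1) • u p
    have hw : ContDiff ℝ ∞ w := (hP.sub contDiff_const).smul hu
    have hfar : ∀ p, p ∉ {y : Plane | β y ≤ δ} → w =ᶠ[𝓝 p] fun _ => 0 := by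
      intro p hp
      filter_upwards [hβ.continuousAt.eventually (lt_mem_nhds (not_le.1 hp))] with z hz
      simp only [w, hP1 z hz.le, sub_self, zero_smul]
    have hint : ∀ p ∈ interior (M.elem i), p ∈ M.elem i := fun p hp => _root_.interior_subset hp
    refine wpDivNorm_le hq hO isOpen_interior.measurableSet ?_ ?_ (w₀ := w) (d₀ := pdiv w) (B := B)
      ?_ hw.continuous.aestronglyMeasurable (continuous_pdiv hw).aestronglyMeasurable (fun p hp => ?_)
      (fun p hp => ?_) (fun p _ hpS => (hfar p hpS).self_of_nhds)
      (fun p _ hpS => by rw [pdiv_congr (hfar p hpS)]; simp [pdiv])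
      (fun ζ hζ hζc _ => integral_fderiv_eq_neg hζ hζc hw) hvol
    · exact ((measure_mono _root_.interior_subset).trans_lt (M.isCompact_elem i).measure_lt_top).ne
    · exact (isClosed_le hβ continuous_const).measurableSet
    · filter_upwards [ae_restrict_mem isOpen_interior.measurableSet] with p hp
      rw [pushforward_innerChart hp, indicator_of_mem (hint p hp), hφi, hXu p (hint p hp)]
    · rw [norm_smul, Real.norm_eq_abs]
      have h1 := hB₁ p (hint p hp)
      have h2 : B₁ ≤ B := le_max_left _ _
      nlinarith [hPabs p, norm_nonneg (u p), abs_nonneg (P p - 1)]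
    · have hpi := hint p hp
      have hfac : ∀ k, HasFDerivAt (fun p => 1 - η (b k p)) (-(deriv η (b k p) • fderiv ℝ (b k) p)) p := by
        intro k
        have h1 : HasFDerivAt (fun z => η (b k z)) (deriv η (b k p) • fderiv ℝ (b k) p) p :=
          ((hη.smooth.differentiable (by simp) _).hasDerivAt).comp_hasFDerivAt p
            ((hb k).differentiable (by simp) p).hasFDerivAt
        simpa using h1.const_sub 1
      have hPd := HasFDerivAt.finsetProd (u := Bd) fun k _ => hfac k
      have hPd' : HasFDerivAt (fun p => P p - 1) _ p := hPd.sub_const 1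
      -- In each term of the product rule the other factors are in `[0, 1]`, and the differentiated
      -- one costs at most `L k * C`, independently of `δ`.
      have h2 : |fderiv ℝ (fun p => P p - 1) p (u p)| ≤ ∑ k ∈ Bd, L k * C := by
        rw [hPd'.fderiv, _root_.sum_apply]
        refine (Finset.abs_sum_le_sum_abs _ _).trans (Finset.sum_le_sum fun k hk => ?_)
        obtain ⟨hL0, hLk⟩ := hL k hk
        have h3 : |∏ l ∈ Bd.erase k, (1 - η (b l p))| ≤ 1 := by
          rw [abs_of_nonneg (Finset.prod_nonneg fun l _ => (h01 l p).1)]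
          exact Finset.prod_le_one (fun l _ => (h01 l p).1) fun l _ => (h01 l p).2
        have h4 := hη.deriv_le (b k p)
        have h5 := hLk p hpi
        change |(∏ l ∈ Bd.erase k, (1 - η (b l p))) * -(deriv η (b k p) * fderiv ℝ (b k) p (u p))| ≤ _
        rw [abs_mul, abs_neg, abs_mul]
        calc _ ≤ 1 * (|deriv η (b k p)| * (L k * |b k p|)) := by gcongr
          _ = L k * (|deriv η (b k p)| * |b k p|) := by ring
          _ ≤ _ := by gcongr
      have h6 := hB₂ p hpi
      rw [Real.norm_eq_abs] at h6
      refine le_trans ?_ (le_max_right _ _)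
      rw [Real.norm_eq_abs, show w = fun p => (P p - 1) • u p from rfl,
        pdiv_smul hPd'.differentiableAt (hu.differentiable (by simp) p)]
      refine (abs_add_le _ _).trans (add_le_add h2 ?_)
      rw [abs_mul]
      nlinarith [hPabs p, abs_nonneg (pdiv u p), abs_nonneg (P p - 1)]

end

end CurvedMesh

end

noncomputable section

open Filter Topology

set_option maxSynthPendingDepth 3

namespace CurvedMesh

variable {Ω : Set Plane} {ι : Type} {M : CurvedMesh Ω ι} {g : PwTensor ι}

/-! ### The distance to the vertices -/

lemma segment_mem_interior {x z : Plane} (hx : x ∈ refTriangle) (hz : z ∈ interior refTriangle) {s : ℝ}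
    (hs : s ∈ Icc (0 : ℝ) 1) : x + s • (z - x) ∈ refTriangle ∧
      (0 < s → x + s • (z - x) ∈ interior refTriangle) := by
  have h1 : x + s • (z - x) = (1 - s) • x + s • z := by module
  have hb : ∀ k, refBary k (x + s • (z - x)) = (1 - s) * refBary k x + s * refBary k z := fun k => by
    rw [h1, refBary_combo k x z (by ring)]
  have hx' := mem_refTriangle_iff.1 hx
  have hz' := mem_interior_refTriangle_iff.1 hz
  constructor
  · refine mem_refTriangle_iff.2 fun k => ?_
    rw [hb]
    have := mul_nonneg (sub_nonneg.2 hs.2) (hx' k)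
    have := mul_nonneg hs.1 (hz' k).le
    linarith
  · intro h0
    refine mem_interior_refTriangle_iff.2 fun k => ?_
    rw [hb]
    have := mul_nonneg (sub_nonneg.2 hs.2) (hx' k)
    have := mul_pos h0 (hz' k)
    linarith

lemma map_mem_interior (i : ι) {x : Plane} (hx : x ∈ interior refTriangle) :
    M.map i x ∈ interior (M.elem i) := by
  have h := _root_.interior_subset hx
  refine M.mem_interior_elem_iff i |>.2 ⟨M.map_mem_elem i h, fun k => ?_⟩
  rw [M.bary_map i k h]
  exact mem_interior_refTriangle_iff.1 hx k

/-- Segments that end at an inner point of the unit triangle have all other points but the starting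
one inside. Their images are admissible paths from or to any point of the element, of length at most
a constant times that of the segment. -/
lemma exists_segment_path (hg : M.IsReggeMetric g) (i : ι) : ∃ C, 0 ≤ C ∧ ∀ x ∈ refTriangle,
    ∀ z ∈ interior refTriangle, (∃ ℓ ≤ C * ‖z - x‖, M.PathOfLength g (M.map i x) (M.map i z) ℓ) ∧
      ∃ ℓ ≤ C * ‖z - x‖, M.PathOfLength g (M.map i z) (M.map i x) ℓ := by
  obtain ⟨G, hG, -, hGe⟩ := hg.regge.exists_extension i
  obtain ⟨A, hA⟩ := (M.isCompact_elem i).exists_bound_of_continuousOn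
    (contDiff_tensorL hG).continuous.continuousOn
  obtain ⟨D, hD⟩ := isCompact_refTriangle.exists_bound_of_continuousOn
    ((M.smooth i).continuous_fderiv (by simp)).continuousOn
  have key : ∀ x v : Plane, (∀ s ∈ Icc (0 : ℝ) 1, x + s • v ∈ refTriangle) →
      (∀ s ∈ Ioo (0 : ℝ) 1, x + s • v ∈ interior refTriangle) →
      ∃ ℓ ≤ Real.sqrt |A| * |D| * ‖v‖, M.PathOfLength g (M.map i x) (M.map i (x + v)) ℓ := by
    intro x v h1 h2
    set c : ℝ → Plane := fun s => M.map i (x + s • v)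
    have hc : ContDiff ℝ ∞ c :=
      (M.smooth i).comp (contDiff_const.add (contDiff_id.smul contDiff_const))
    have hd : ∀ s, deriv c s = fderiv ℝ (M.map i) (x + s • v) v := by
      intro s
      have h3 : HasDerivAt (fun s : ℝ => x + s • v) v s := by
        simpa using ((hasDerivAt_id s).smul_const v).const_add x
      exact (HasFDerivAt.comp_hasDerivAt (l := M.map i) s
        ((M.smooth i).differentiable (by simp) _).hasFDerivAt h3).deriv
    have hp := PathOfLength.single (M := M) (g := g) i c (hc.of_le (by simp))
      (fun s hs => M.map_mem_elem i (h1 s hs))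
      fun s hs => M.interior_subset_punctured i (map_mem_interior i (h2 s hs))
    have h0 : c 0 = M.map i x := by simp [c]
    have h1' : c 1 = M.map i (x + v) := by simp [c]
    rw [h0, h1'] at hp
    refine ⟨_, ?_, hp⟩
    have hb : ∀ s ∈ Icc (0 : ℝ) 1, Real.sqrt (tensorApp (g i (c s)) (deriv c s) (deriv c s))
        ≤ Real.sqrt |A| * |D| * ‖v‖ := by
      intro s hs
      have hmem := M.map_mem_elem i (h1 s hs)
      have h4 : ‖deriv c s‖ ≤ |D| * ‖v‖ := by
        rw [hd s]
        refine (ContinuousLinearMap.le_opNorm _ _).trans ?_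
        gcongr
        exact (hD _ (h1 s hs)).trans (le_abs_self D)
      have h5 : tensorApp (g i (c s)) (deriv c s) (deriv c s) ≤ |A| * (|D| * ‖v‖) ^ 2 := by
        rw [← tensorL_apply]
        refine (Real.le_norm_self _).trans ((ContinuousLinearMap.le_opNorm₂ _ _ _).trans ?_)
        have h6 : ‖tensorL (g i (c s))‖ ≤ |A| := by
          rw [hGe _ hmem]
          exact (hA _ hmem).trans (le_abs_self A)
        rw [pow_two, mul_assoc]
        gcongr
      calc _ ≤ Real.sqrt (|A| * (|D| * ‖v‖) ^ 2) := Real.sqrt_le_sqrt h5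
        _ = _ := by rw [Real.sqrt_mul (abs_nonneg A), Real.sqrt_sq (by positivity)]; ring
    have h7 := intervalIntegral.norm_integral_le_of_norm_le_const (a := (0 : ℝ)) (b := 1)
      (C := Real.sqrt |A| * |D| * ‖v‖) (f := fun s => Real.sqrt (tensorApp (g i (c s)) (deriv c s) (deriv c s)))
      fun s hs => by
        rw [uIoc_of_le zero_le_one] at hs
        rw [Real.norm_eq_abs, abs_of_nonneg (Real.sqrt_nonneg _)]
        exact hb s ⟨hs.1.le, hs.2⟩
    rw [sub_zero, abs_one, mul_one] at h7
    exact (le_abs_self _).trans h7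
  refine ⟨Real.sqrt |A| * |D|, by positivity, fun x hx z hz => ⟨?_, ?_⟩⟩
  · have := key x (z - x) (fun s hs => (segment_mem_interior hx hz hs).1)
      fun s hs => (segment_mem_interior hx hz (Ioo_subset_Icc_self hs)).2 hs.1
    rwa [add_sub_cancel] at this
  · have hrev : ∀ s : ℝ, z + s • (x - z) = x + (1 - s) • (z - x) := fun s => by module
    have := key z (x - z) (fun s hs => by
        rw [hrev]; exact (segment_mem_interior hx hz ⟨by linarith [hs.2], by linarith [hs.1]⟩).1)
      fun s hs => by
        rw [hrev]
        exact (segment_mem_interior hx hz ⟨by linarith [hs.2], by linarith [hs.1]⟩).2 (by linarith [hs.2])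
    rwa [add_sub_cancel, norm_sub_rev] at this

lemma finite_vertices [Finite ι] (M : CurvedMesh Ω ι) : M.vertices.Finite := by
  have : M.vertices = range fun n : ι × Fin 3 => M.edgeParam n.1 n.2 0 := by
    ext V
    constructor
    · rintro ⟨i, k, rfl⟩; exact ⟨(i, k), rfl⟩
    · rintro ⟨n, rfl⟩; exact ⟨n.1, n.2, rfl⟩
  rw [this]
  exact finite_range _

/-- Points that are close to a vertex are so for the `g`-distance. -/
lemma eventually_gdist_le (hg : M.IsReggeMetric g) (i : ι) (V : Plane) {ε : ℝ} (hε : 0 < ε) :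
    ∀ᶠ r in 𝓝[>] (0 : ℝ), ∀ p ∈ M.elem i, dist p V ≤ r → M.gdist g p V ≤ ε := by
  by_cases hV : V ∈ M.elem i
  · obtain ⟨C, hC0, hC⟩ := exists_segment_path hg i
    obtain ⟨xV, hxV, rfl⟩ := hV
    have hcont : ContinuousAt (M.homeo i).symm (M.map i xV) :=
      (M.homeo i).continuousAt_symm (M.elem_subset_target i (M.map_mem_elem i hxV))
    obtain ⟨c, hc⟩ := interior_refTriangle_nonempty
    -- The path from `p` to the vertex makes a detour through an inner point `z`, since a direct one
    -- might follow the boundary of the domain. In the unit triangle its two segments have lengths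
    -- at most `2 * ρ` and `ρ`, which gives at most ε.
    set ρ := ε / (3 * (C + 1))
    have hρ : 0 < ρ := by positivity
    obtain ⟨s, hs, hs1⟩ : ∃ s ∈ Ioc (0 : ℝ) 1, ‖s • (c - xV)‖ ≤ ρ := by
      refine ⟨min 1 (ρ / (‖c - xV‖ + 1)), ⟨by positivity, min_le_left _ _⟩, ?_⟩
      rw [norm_smul, Real.norm_eq_abs, abs_of_pos (by positivity)]
      calc _ ≤ ρ / (‖c - xV‖ + 1) * (‖c - xV‖ + 1) := by
            gcongr
            · exact min_le_right _ _
            · linarith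
        _ = ρ := by field_simp
    set z := xV + s • (c - xV)
    have hz : z ∈ interior refTriangle := (segment_mem_interior hxV hc ⟨hs.1.le, hs.2⟩).2 hs.1
    have hzV : ‖z - xV‖ ≤ ρ := by simpa [z] using hs1
    obtain ⟨r₀, hr₀, hr⟩ := Metric.continuousAt_iff.1 hcont ρ hρ
    filter_upwards [Ioo_mem_nhdsGT hr₀] with r hrr p hp hpr
    have h1 := hr (hpr.trans_lt hrr.2)
    rw [M.homeo_symm_map i hxV] at h1
    set x := (M.homeo i).symm p
    have hx : x ∈ refTriangle := M.homeo_symm_mem i hp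
    have hpx : M.map i x = p := M.map_homeo_symm i (M.elem_subset_target i hp)
    obtain ⟨ℓ₁, hℓ₁, hpath₁⟩ := (hC x hx z hz).1
    obtain ⟨ℓ₂, hℓ₂, hpath₂⟩ := (hC xV hxV z hz).2
    have h2 := (PathOfLength.concat _ _ _ _ _
      (M.interior_subset_punctured i (map_mem_interior i hz)) hpath₁ hpath₂).gdist_le
    rw [hpx] at h2
    have h3 : ‖z - x‖ ≤ 2 * ρ := by
      have : z - x = (z - xV) - (x - xV) := by abel
      rw [this]
      refine (norm_sub_le _ _).trans ?_
      rw [← dist_eq_norm x]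
      linarith
    calc _ ≤ ℓ₁ + ℓ₂ := h2
      _ ≤ C * (2 * ρ) + C * ρ := by
          refine add_le_add (hℓ₁.trans ?_) (hℓ₂.trans ?_) <;> gcongr
      _ ≤ (C + 1) * (3 * ρ) := by nlinarith
      _ = ε := by simp only [ρ]; field_simp
  · have h1 : 0 < Metric.infDist V (M.elem i) :=
      ((M.isClosed_elem i).notMem_iff_infDist_pos
        (⟨_, M.edgeParam_mem_elem i 0 (s := 0) (by simp)⟩)).1 hV
    filter_upwards [Ioo_mem_nhdsGT h1] with r hr p hp hpr
    have := Metric.infDist_le_dist_of_mem (x := V) hp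
    rw [dist_comm] at this
    linarith [hr.2]

/-- Points close to a vertex in the plane are also close for the path distance, uniformly because
there are finitely many vertices and elements. Thus all cutoffs can be built with the Euclidean
distance. -/
lemma eventually_lt_infDist_of_away [Finite ι] (hg : M.IsReggeMetric g) {ε : ℝ} (hε : 0 < ε)
    (hne : M.vertices.Nonempty) :
    ∀ᶠ r in 𝓝[>] (0 : ℝ), ∀ p ∈ M.awayFromVertices g ε, r ≤ Metric.infDist p M.vertices := by
  have h1 : ∀ᶠ r in 𝓝[>] (0 : ℝ), ∀ V ∈ M.vertices, ∀ i, ∀ p ∈ M.elem i, dist p V ≤ r →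
      M.gdist g p V ≤ ε :=
    (eventually_all_finite M.finite_vertices).2 fun V _ => eventually_all.2 fun i =>
      eventually_gdist_le hg i V hε
  filter_upwards [h1] with r hr p hp
  refine (Metric.le_infDist hne).2 fun V hV => ?_
  by_contra h
  obtain ⟨i, hi⟩ := M.exists_mem_elem hp.1
  exact absurd (hr V hV i p hi (not_le.1 h).le) (not_le.2 (hp.2 V hV))

lemma tendsto_volume_near_vertices [Finite ι] (hne : M.vertices.Nonempty) (i : ι) :
    Tendsto (fun r : ℝ => volume ({p | Metric.infDist p M.vertices ≤ r} ∩ M.elem i)) (𝓝[>] 0) (𝓝 0) := by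
  refine tendsto_volume_strip (M.isCompact_elem i).measure_lt_top.ne
    (Metric.continuous_infDist_pt _).measurable (M.isClosed_elem i).measurableSet ?_
    fun _ _ => Metric.infDist_nonneg
  refine measure_mono_null (fun p hp => ?_) (M.finite_vertices.measure_zero volume)
  exact (M.finite_vertices.isClosed.mem_iff_infDist_zero hne).2 hp.2

lemma eventually_lt_infDist_edge [Finite ι] (hne : M.vertices.Nonempty) {κ : ℝ} (hκ : 0 < κ) :
    ∀ᶠ r in 𝓝[>] (0 : ℝ), ∀ i k, ∀ s ∈ Icc κ (1 - κ),
      r < Metric.infDist (M.edgeParam i k s) M.vertices := by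
  refine eventually_all.2 fun i => eventually_all.2 fun k => ?_
  rcases (Icc κ (1 - κ)).eq_empty_or_nonempty with h | h
  · simp [h]
  have hc : ContinuousOn (fun s => Metric.infDist (M.edgeParam i k s) M.vertices) (Icc κ (1 - κ)) :=
    ((Metric.continuous_infDist_pt _).comp (M.contDiff_edgeParam i k).continuous).continuousOn
  obtain ⟨s₀, hs₀, hmin⟩ := isCompact_Icc.exists_isMinOn h hc
  have h1 : 0 < Metric.infDist (M.edgeParam i k s₀) M.vertices :=
    (M.finite_vertices.isClosed.notMem_iff_infDist_pos hne).1
      (M.edgeParam_not_mem_vertices i k ⟨by linarith [hs₀.1], by linarith [hs₀.2]⟩)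
  filter_upwards [Ioo_mem_nhdsGT h1] with r hr s hs
  exact hr.2.trans_le (hmin hs)

/-- Continuity at the two ends of each edge, which are vertices. It turns a distance from the
vertices into a range of edge parameters common to all edges. -/
lemma exists_infDist_edge_lt [Finite ι] (M : CurvedMesh Ω ι) {r : ℝ} (hr : 0 < r) :
    ∃ κ, 0 < κ ∧ κ < 1 / 2 ∧ ∀ i k, ∀ s ∈ Icc (0 : ℝ) 1, s ∉ Icc κ (1 - κ) →
      Metric.infDist (M.edgeParam i k s) M.vertices < r := by
  have h1 : ∀ᶠ κ in 𝓝[>] (0 : ℝ), ∀ i k, (∀ s, dist s 0 ≤ κ → Metric.infDist (M.edgeParam i k s) M.vertices < r)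
      ∧ ∀ s, dist s 1 ≤ κ → Metric.infDist (M.edgeParam i k s) M.vertices < r := by
    have key : ∀ i k t, M.edgeParam i k t ∈ M.vertices → ∀ᶠ κ in 𝓝[>] (0 : ℝ),
        ∀ s, dist s t ≤ κ → Metric.infDist (M.edgeParam i k s) M.vertices < r := by
      intro i k t ht
      have hc : Continuous fun s => Metric.infDist (M.edgeParam i k s) M.vertices :=
        (Metric.continuous_infDist_pt _).comp (M.contDiff_edgeParam i k).continuous
      have h2 : ∀ᶠ s in 𝓝 t, Metric.infDist (M.edgeParam i k s) M.vertices < r :=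
        hc.continuousAt.eventually (gt_mem_nhds
          (show Metric.infDist (M.edgeParam i k t) M.vertices < r by rwa [Metric.infDist_zero_of_mem ht]))
      obtain ⟨κ₀, hκ₀, h3⟩ := Metric.eventually_nhds_iff.1 h2
      filter_upwards [Ioo_mem_nhdsGT hκ₀] with κ hκ s hs using h3 (hs.trans_lt hκ.2)
    exact eventually_all.2 fun i => eventually_all.2 fun k =>
      (key i k 0 ⟨i, k, rfl⟩).and (key i k 1 (M.edgeParam_one i k))
  obtain ⟨κ, h2, h3⟩ := (h1.and (Ioo_mem_nhdsGT (show (0 : ℝ) < 1 / 2 by norm_num))).exists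
  refine ⟨κ, h3.1, h3.2, fun i k s hs hs' => ?_⟩
  rcases lt_or_ge s κ with h | h
  · exact (h2 i k).1 s (by rw [Real.dist_eq, abs_le]; constructor <;> linarith [hs.1, h3.1])
  · have : 1 - κ < s := by
      by_contra hc
      exact hs' ⟨h, not_lt.1 hc⟩
    exact (h2 i k).2 s (by rw [Real.dist_eq, abs_le]; constructor <;> linarith [hs.2, h3.1])

end CurvedMesh

end

noncomputable section

open Filter Topology

set_option maxSynthPendingDepth 3

namespace CurvedMesh

variable {Ω : Set Plane} {ι : Type} {M : CurvedMesh Ω ι} {g σ : PwTensor ι}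

/-! ### Estimates of the pairings -/

lemma exists_curlApp_bound (hg : M.IsReggeMetric g) (hσ : M.IsRegge σ) (i : ι) :
    ∃ D, 0 ≤ D ∧ ∀ p ∈ M.elem i, ∀ X Y : PwField ι, |M.curlApp g σ X i p * Real.sqrt (g i p).det
      - M.curlApp g σ Y i p * Real.sqrt (g i p).det| ≤ D * ‖X i p - Y i p‖ := by
  choose D hD using fun a => (M.isCompact_elem i).exists_bound_of_continuousOn
    (hg.continuousOn_curlComp hσ i a)
  refine ⟨∑ a, |D a|, Finset.sum_nonneg fun a _ => abs_nonneg _, fun p hp X Y => ?_⟩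
  have h1 : M.curlApp g σ X i p * Real.sqrt (g i p).det - M.curlApp g σ Y i p * Real.sqrt (g i p).det
      = ∑ a, M.curlComp g σ i a p * Real.sqrt (g i p).det * (X i p - Y i p) a := by
    rw [curlApp, curlApp, Finset.sum_mul, Finset.sum_mul, ← Finset.sum_sub_distrib]
    exact Finset.sum_congr rfl fun a _ => by simp only [PiLp.sub_apply]; ring
  rw [h1, Finset.sum_mul]
  refine (Finset.abs_sum_le_sum_abs _ _).trans (Finset.sum_le_sum fun a _ => ?_)
  rw [abs_mul]
  exact mul_le_mul ((hD a p hp).trans (le_abs_self _)) (PiLp.norm_apply_le (X i p - Y i p) a)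
    (abs_nonneg _) (abs_nonneg _)

lemma unitNormal_eq (i : ι) (k : Fin 3) (s : ℝ) : M.unitNormal g i k s
    = unitNormalOf (g i (M.edgeParam i k s)) (M.tangent i k s) := rfl

/-- The boundary term of the extended pairing, with respect to the parameter of the edge. -/
def edgeTerm (M : CurvedMesh Ω ι) (g σ : PwTensor ι) (W : PwField ι) (i : ι) (k : Fin 3) (s : ℝ) : ℝ :=
  tensorApp (g i (M.edgeParam i k s)) (W i (M.edgeParam i k s)) (M.unitNormal g i k s) *
    tensorApp (σ i (M.edgeParam i k s)) (M.unitNormal g i k s) (M.tangent i k s)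

lemma continuousOn_edgeTerm (hg : M.IsReggeMetric g) (hσ : M.IsRegge σ) {W : PwField ι}
    (hW : ∀ i, SmoothUpTo (M.elem i) (W i)) (i : ι) (k : Fin 3) :
    ContinuousOn (M.edgeTerm g σ W i k) (Icc 0 1) := by
  obtain ⟨G, hG, -, hGe⟩ := hg.regge.exists_extension i
  obtain ⟨S, hS, -, hSe⟩ := hσ.exists_extension i
  obtain ⟨X, hX, hXe⟩ := hW i
  have hγ := M.contDiff_edgeParam i k
  have hτ := M.contDiff_tangent i k
  have h1 : ContinuousOn (fun s =>
      tensorApp (G (M.edgeParam i k s)) (X (M.edgeParam i k s))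
        (unitNormalOf (G (M.edgeParam i k s)) (M.tangent i k s)) *
      tensorApp (S (M.edgeParam i k s)) (unitNormalOf (G (M.edgeParam i k s)) (M.tangent i k s))
        (M.tangent i k s)) (Icc 0 1) := by
    intro s hs
    have hmem := M.edgeParam_mem_elem i k hs
    have hGs : ∀ a b, ContDiffAt ℝ ∞ (fun s => G (M.edgeParam i k s) a b) s := fun a b =>
      ((hG a b).comp hγ).contDiffAt
    have hSs : ∀ a b, ContDiffAt ℝ ∞ (fun s => S (M.edgeParam i k s) a b) s := fun a b =>
      ((hS a b).comp hγ).contDiffAt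
    have hn := ContDiffAt.unitNormalOf hGs hτ.contDiffAt (by
      rw [← hGe _ hmem]; exact hg.isMetricMatrix hmem) (M.tangent_ne_zero i k hs)
    exact ((ContDiffAt.tensorApp hGs (hX.comp hγ).contDiffAt hn).mul
      (ContDiffAt.tensorApp hSs hn hτ.contDiffAt)).continuousAt.continuousWithinAt
  refine h1.congr fun s hs => ?_
  have hmem := M.edgeParam_mem_elem i k hs
  rw [edgeTerm, unitNormal_eq, hGe _ hmem, hSe _ hmem, hXe hmem]

lemma bdryIntegral_eq (hg : M.IsReggeMetric g) (W : PwField ι) (i : ι) :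
    M.bdryIntegral g i (fun k s =>
        tensorApp (g i (M.edgeParam i k s)) (W i (M.edgeParam i k s)) (M.unitNormal g i k s) *
        tensorApp (σ i (M.edgeParam i k s)) (M.unitNormal g i k s) (M.unitTangent g i k s))
      = ∑ k, ∫ s in (0 : ℝ)..1, M.edgeTerm g σ W i k s := by
  refine Finset.sum_congr rfl fun k _ => intervalIntegral.integral_congr fun s hs => ?_
  rw [uIcc_of_le zero_le_one] at hs
  have hpos := hg.pos i _ (M.edgeParam_mem_elem i k hs) _ (M.tangent_ne_zero i k hs)
  have hne := (Real.sqrt_pos.2 hpos).ne'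
  simp only [edgeTerm, unitTangent, tensorApp_smul_right]
  field_simp

lemma abs_integral_le_of_ends {h : ℝ → ℝ} (hh : ContinuousOn h (Icc 0 1)) {A κ : ℝ} (hκ : 0 < κ)
    (hκ' : κ < 1 / 2) (hA : ∀ s ∈ Ioo (0 : ℝ) 1, |h s| ≤ A)
    (h0 : ∀ s ∈ Icc κ (1 - κ), h s = 0) : |∫ s in (0 : ℝ)..1, h s| ≤ 2 * A * κ := by
  have hi : ∀ a ∈ Icc (0 : ℝ) 1, ∀ b ∈ Icc (0 : ℝ) 1, IntervalIntegrable h volume a b := fun a ha b hb =>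
    (hh.mono (uIcc_subset_Icc ha hb)).intervalIntegrable
  have m0 : (0 : ℝ) ∈ Icc (0 : ℝ) 1 := by simp
  have m1 : (1 : ℝ) ∈ Icc (0 : ℝ) 1 := by simp
  have mκ : κ ∈ Icc (0 : ℝ) 1 := ⟨by linarith, by linarith⟩
  have mκ' : 1 - κ ∈ Icc (0 : ℝ) 1 := ⟨by linarith, by linarith⟩
  rw [← intervalIntegral.integral_add_adjacent_intervals (hi 0 m0 κ mκ) (hi κ mκ 1 m1),
    ← intervalIntegral.integral_add_adjacent_intervals (hi κ mκ _ mκ') (hi _ mκ' 1 m1)]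
  have h1 : ∫ s in κ..(1 - κ), h s = 0 := by
    rw [intervalIntegral.integral_congr (g := fun _ => (0 : ℝ)), intervalIntegral.integral_zero]
    intro s hs
    rw [uIcc_of_le (by linarith)] at hs
    exact h0 s hs
  have hae : ∀ᵐ s : ℝ, s ≠ 1 := by rw [ae_iff]; simp
  have h2 : |∫ s in (0 : ℝ)..κ, h s| ≤ A * |κ - 0| := by
    rw [← Real.norm_eq_abs]
    refine intervalIntegral.norm_integral_le_of_norm_le_const fun s hs => ?_
    rw [uIoc_of_le hκ.le] at hs
    exact hA s ⟨hs.1, by linarith [hs.2]⟩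
  have h3 : |∫ s in (1 - κ)..1, h s| ≤ A * |1 - (1 - κ)| := by
    rw [← Real.norm_eq_abs]
    refine intervalIntegral.norm_integral_le_of_norm_le_const_ae ?_
    filter_upwards [hae] with s hs1 hs
    rw [uIoc_of_le (by linarith)] at hs
    exact hA s ⟨by linarith [hs.1], lt_of_le_of_ne hs.2 hs1⟩
  rw [sub_zero, abs_of_pos hκ] at h2
  rw [sub_sub_cancel, abs_of_pos hκ] at h3
  rw [h1, zero_add]
  refine (abs_add_le _ _).trans ?_
  linarith

/-- After integration by parts the area terms are Lipschitz in the field, and for a normal field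
with coefficient `c` the edge terms differ by `c - 1` times a bounded function. That difference is
zero except on two parameter intervals of length `κ` at the ends of each edge. -/
theorem exists_pairing_bound [Fintype ι] (hg : M.IsReggeMetric g) (hσ : M.IsRegge σ) {W : PwField ι}
    (hW : ∀ i, SmoothUpTo (M.elem i) (W i)) : ∃ D, 0 ≤ D ∧ ∀ φ : PwField ι,
      (∀ i, SmoothUpTo (M.elem i) (φ i)) → ∀ κ, 0 < κ → κ < 1 / 2 →
      (∀ i k, ∀ s ∈ Ioo (0 : ℝ) 1, ∃ c ∈ Icc (0 : ℝ) 1, φ i (M.edgeParam i k s)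
        = (c * tensorApp (g i (M.edgeParam i k s)) (W i (M.edgeParam i k s)) (M.unitNormal g i k s)) •
          M.unitNormal g i k s ∧ (s ∈ Icc κ (1 - κ) → c = 1)) →
      |M.curlPairing g σ φ - M.curlPairingExt g σ W|
        ≤ D * ((∑ i, ∫ p in M.elem i, ‖φ i p - W i p‖) + κ) := by
  choose D hD0 hD using exists_curlApp_bound hg hσ
  choose A hA using fun i k => isCompact_Icc.exists_bound_of_continuousOn
    (continuousOn_edgeTerm hg hσ hW i k)
  have hA0 : ∀ i k, 0 ≤ A i k := fun i k => (norm_nonneg _).trans (hA i k 0 (by simp))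
  refine ⟨(∑ i, D i) + ∑ i, ∑ k, 2 * A i k, add_nonneg (Finset.sum_nonneg fun i _ => hD0 i)
    (Finset.sum_nonneg fun i _ => Finset.sum_nonneg fun k _ => mul_nonneg two_pos.le (hA0 i k)), fun φ hφ κ hκ hκ' hφe => ?_⟩
  have hφc := fun i => SmoothUpTo_continuousOn (hφ i)
  have hWc := fun i => SmoothUpTo_continuousOn (hW i)
  have hvol : ∀ i, |M.elemIntegral g i (M.curlApp g σ φ i) - M.elemIntegral g i (M.curlApp g σ W i)|
      ≤ D i * ∫ p in M.elem i, ‖φ i p - W i p‖ := by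
    intro i
    have hc := M.isCompact_elem i
    rw [elemIntegral, elemIntegral, ← integral_sub
      ((hg.continuousOn_curlApp hσ (hφc i)).integrableOn_compact hc)
      ((hg.continuousOn_curlApp hσ (hWc i)).integrableOn_compact hc), ← integral_const_mul]
    rw [← Real.norm_eq_abs]
    have hint : IntegrableOn (fun p => ‖φ i p - W i p‖) (M.elem i) :=
      ((hφc i).sub (hWc i)).norm.integrableOn_compact hc
    refine norm_integral_le_of_norm_le (hint.const_mul _) ?_
    filter_upwards [ae_restrict_mem hc.measurableSet] with p hp using hD i p hp φ W
  have hbd : ∀ i k, |(∫ s in (0 : ℝ)..1,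
      tensorApp (σ i (M.edgeParam i k s)) (φ i (M.edgeParam i k s)) (M.tangent i k s))
      - ∫ s in (0 : ℝ)..1, M.edgeTerm g σ W i k s| ≤ 2 * A i k * κ := by
    intro i k
    have hγ := M.contDiff_edgeParam i k
    have hmaps : MapsTo (M.edgeParam i k) (Icc 0 1) (M.elem i) := fun s hs => M.edgeParam_mem_elem i k hs
    have c1 : ContinuousOn (fun s => tensorApp (σ i (M.edgeParam i k s)) (φ i (M.edgeParam i k s))
        (M.tangent i k s)) (Icc 0 1) := by
      obtain ⟨S, hS, -, hSe⟩ := hσ.exists_extension i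
      obtain ⟨X, hX, hXe⟩ := hφ i
      have := continuous_tensorApp (fun a b => ((hS a b).comp hγ).continuous) (hX.comp hγ).continuous
        (M.contDiff_tangent i k).continuous
      refine this.continuousOn.congr fun s hs => ?_
      rw [hSe _ (hmaps hs), hXe (hmaps hs)]
      rfl
    have c2 := continuousOn_edgeTerm hg hσ hW i k
    rw [← intervalIntegral.integral_sub (by
        exact ContinuousOn.intervalIntegrable (by rwa [uIcc_of_le zero_le_one]))
      (ContinuousOn.intervalIntegrable (by rwa [uIcc_of_le zero_le_one]))]
    have hval : ∀ s ∈ Ioo (0 : ℝ) 1, ∃ c ∈ Icc (0 : ℝ) 1,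
        tensorApp (σ i (M.edgeParam i k s)) (φ i (M.edgeParam i k s)) (M.tangent i k s)
          - M.edgeTerm g σ W i k s = (c - 1) * M.edgeTerm g σ W i k s ∧ (s ∈ Icc κ (1 - κ) → c = 1) := by
      intro s hs
      obtain ⟨c, hc, h1, h2⟩ := hφe i k s hs
      refine ⟨c, hc, ?_, h2⟩
      rw [h1, tensorApp_smul_left, edgeTerm]
      ring
    refine abs_integral_le_of_ends (h := fun s => tensorApp (σ i (M.edgeParam i k s))
      (φ i (M.edgeParam i k s)) (M.tangent i k s) - M.edgeTerm g σ W i k s)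
      (c1.sub c2) hκ hκ' (fun s hs => ?_) fun s hs => ?_
    · obtain ⟨c, hc, h1, -⟩ := hval s hs
      rw [h1, abs_mul]
      have h3 := hA i k s (Ioo_subset_Icc_self hs)
      rw [Real.norm_eq_abs] at h3
      have h4 : |c - 1| ≤ 1 := by rw [abs_le]; constructor <;> linarith [hc.1, hc.2]
      nlinarith [abs_nonneg (M.edgeTerm g σ W i k s), abs_nonneg (c - 1)]
    · obtain ⟨c, hc, h1, h2⟩ := hval s ⟨by linarith [hs.1], by linarith [hs.2]⟩
      rw [h1, h2 hs, sub_self, zero_mul]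
  rw [curlPairing_eq hg hσ hφ, curlPairingExt]
  simp only [bdryIntegral_eq hg]
  rw [sub_sub_sub_comm, ← Finset.sum_sub_distrib, ← Finset.sum_sub_distrib]
  refine (abs_sub _ _).trans ?_
  have hnn : ∀ i, 0 ≤ ∫ p in M.elem i, ‖φ i p - W i p‖ := fun i =>
    integral_nonneg fun _ => norm_nonneg _
  have hS1 : |∑ i, (M.elemIntegral g i (M.curlApp g σ φ i) - M.elemIntegral g i (M.curlApp g σ W i))|
      ≤ (∑ i, D i) * ∑ i, ∫ p in M.elem i, ‖φ i p - W i p‖ := by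
    refine (Finset.abs_sum_le_sum_abs _ _).trans ?_
    rw [Finset.mul_sum]
    refine Finset.sum_le_sum fun i _ => (hvol i).trans ?_
    gcongr
    exact Finset.single_le_sum (f := D) (fun j _ => hD0 j) (Finset.mem_univ i)
  have hS2 : |∑ i, ((∑ k, ∫ s in (0 : ℝ)..1,
      tensorApp (σ i (M.edgeParam i k s)) (φ i (M.edgeParam i k s)) (M.tangent i k s))
      - ∑ k, ∫ s in (0 : ℝ)..1, M.edgeTerm g σ W i k s)| ≤ (∑ i, ∑ k, 2 * A i k) * κ := by
    refine (Finset.abs_sum_le_sum_abs _ _).trans ?_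
    rw [Finset.sum_mul]
    refine Finset.sum_le_sum fun i _ => ?_
    rw [← Finset.sum_sub_distrib, Finset.sum_mul]
    exact (Finset.abs_sum_le_sum_abs _ _).trans (Finset.sum_le_sum fun k _ => hbd i k)
  refine (add_le_add hS1 hS2).trans ?_
  have e1 : 0 ≤ ∑ i, D i := Finset.sum_nonneg fun i _ => hD0 i
  have e2 : 0 ≤ ∑ i, ∑ k, 2 * A i k := Finset.sum_nonneg fun i _ => Finset.sum_nonneg fun k _ => by
    have := hA0 i k; positivity
  have e3 : 0 ≤ ∑ i, ∫ p in M.elem i, ‖φ i p - W i p‖ := Finset.sum_nonneg fun i _ => hnn i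
  nlinarith [mul_nonneg e1 hκ.le, mul_nonneg e2 e3]

end CurvedMesh

end

/-! ### Families of approximating fields as the cutoff scale tends to zero -/

noncomputable section

open Filter Topology

set_option maxSynthPendingDepth 3

namespace CurvedMesh

variable {Ω : Set Plane} {ι : Type} {M : CurvedMesh Ω ι} {g : PwTensor ι}

lemma volume_elem_diff_interior (i : ι) : volume (M.elem i \ interior (M.elem i)) = 0 := by
  have h1 : volume (refTriangle \ interior refTriangle) = 0 := by
    refine measure_mono_null (fun x hx => ?_) (convex_refTriangle.addHaar_frontier volume)
    exact ⟨subset_closure hx.1, hx.2⟩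
  refine measure_mono_null ?_ (addHaar_image_eq_zero_of_differentiableOn_of_addHaar_eq_zero volume
    ((M.smooth i).differentiable (by simp)).differentiableOn h1)
  rintro _ ⟨⟨x, hx, rfl⟩, hn⟩
  exact ⟨x, ⟨hx, fun h => hn (map_mem_interior i h)⟩, rfl⟩

lemma ae_mem_interior (i : ι) : ∀ᵐ p ∂volume.restrict (M.elem i), p ∈ interior (M.elem i) := by
  rw [ae_restrict_iff' (M.isClosed_elem i).measurableSet, ae_iff]
  refine measure_mono_null (fun p hp => ?_) (volume_elem_diff_interior (M := M) i)
  simpa using hp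

/-- A family of test fields that approximates `ψ • W` in the chart `e`. -/
structure IsApprox [Fintype ι] (M : CurvedMesh Ω ι) (g : PwTensor ι) (W : PwField ι)
    (e : OpenPartialHomeomorph Plane Plane) (ψ : Plane → ℝ) (F : ℝ → PwField ι) : Prop where
  test : ∀ δ > 0, M.IsTestField g (F δ) ∧ M.CompactSupportIn (F δ) e.source
  smooth : ∀ δ > 0, ∀ m, SmoothUpTo (M.elem m) (F δ m)
  mult : ∀ m, ∃ ψ', SmoothUpTo (M.elem m) ψ' ∧ ∀ p ∈ interior (M.elem m), ψ p = ψ' p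
  bound : ∃ B, ∀ δ > 0, ∀ m, ∀ p ∈ interior (M.elem m), ‖F δ m p - ψ p • W m p‖ ≤ B
  lim : ∀ m, ∀ p ∈ interior (M.elem m), ∀ᶠ δ in 𝓝[>] (0 : ℝ), F δ m p = ψ p • W m p
  norm : ∀ q > 0, ∀ ε > 0, ∀ᶠ δ in 𝓝[>] (0 : ℝ), ∀ O ⊆ e.target,
    wpDivNorm q O (M.pushforward e fun m x => F δ m x - ψ x • W m x) ≤ ENNReal.ofReal ε

/-- Dominated convergence: at each interior point the error is eventually zero, it is bounded
uniformly in `δ`, and the boundary of an element is a null set. -/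
lemma IsApprox.tendsto_integral [Fintype ι] {W : PwField ι} {e : OpenPartialHomeomorph Plane Plane}
    {ψ : Plane → ℝ} {F : ℝ → PwField ι} (h : M.IsApprox g W e ψ F)
    (hW : ∀ i, SmoothUpTo (M.elem i) (W i)) (i : ι) :
    (∀ δ > 0, IntegrableOn (fun p => ‖F δ i p - ψ p • W i p‖) (M.elem i)) ∧
    Tendsto (fun δ => ∫ p in M.elem i, ‖F δ i p - ψ p • W i p‖) (𝓝[>] 0) (𝓝 0) := by
  obtain ⟨ψ', hψ', hψe⟩ := h.mult i
  obtain ⟨B, hB⟩ := h.bound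
  have hc := M.isCompact_elem i
  have hint : ∀ δ > 0, IntegrableOn (fun p => ‖F δ i p - ψ p • W i p‖) (M.elem i) := by
    intro δ hδ
    have h1 := (SmoothUpTo_continuousOn ((h.smooth δ hδ i).sub (hψ'.smul (hW i)))).norm
    refine (h1.integrableOn_compact hc).congr ?_
    filter_upwards [ae_mem_interior (M := M) i] with p hp
    rw [hψe p hp]
  refine ⟨hint, ?_⟩
  have hlim := tendsto_integral_filter_of_dominated_convergence (μ := volume.restrict (M.elem i))
    (l := 𝓝[>] (0 : ℝ)) (F := fun δ p => ‖F δ i p - ψ p • W i p‖) (f := fun _ => (0 : ℝ)) (fun _ => B)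
    (by filter_upwards [self_mem_nhdsWithin] with δ hδ using (hint δ hδ).aestronglyMeasurable)
    (by
      filter_upwards [self_mem_nhdsWithin] with δ hδ
      filter_upwards [ae_mem_interior (M := M) i] with p hp
      rw [norm_norm]
      exact hB δ hδ i p hp)
    (continuousOn_const.integrableOn_compact hc)
    (by
      filter_upwards [ae_mem_interior (M := M) i] with p hp
      refine tendsto_const_nhds.congr' ?_
      filter_upwards [h.lim i p hp] with δ hδ
      rw [hδ, sub_self, norm_zero])
  simpa using hlim

lemma eventually_measure_le {μ : ℝ → ENNReal} (hμ : Tendsto μ (𝓝[>] 0) (𝓝 0)) (B : ℝ) {q ε : ℝ}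
    (hq : 0 < q) (hε : 0 < ε) :
    ∀ᶠ δ in 𝓝[>] (0 : ℝ), 2 * (ENNReal.ofReal B ^ q * μ δ) ≤ ENNReal.ofReal ε ^ q := by
  have h1 : Tendsto (fun δ => 2 * (ENNReal.ofReal B ^ q * μ δ)) (𝓝[>] 0)
      (𝓝 (2 * (ENNReal.ofReal B ^ q * 0))) := by
    refine ENNReal.Tendsto.const_mul (ENNReal.Tendsto.const_mul hμ (Or.inr ?_)) (Or.inr (by simp))
    exact ENNReal.rpow_ne_top_of_nonneg hq.le ENNReal.ofReal_ne_top
  rw [mul_zero, mul_zero] at h1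
  have h2 : 0 < ENNReal.ofReal ε ^ q := ENNReal.rpow_pos (by simpa using hε) ENNReal.ofReal_ne_top
  filter_upwards [h1.eventually (gt_mem_nhds h2)] with δ hδ using hδ.le

lemma EdgeTube.exists_isApprox [Fintype ι] {i j : ι} {k : Fin 3} (T : M.EdgeTube g i j k)
    (hg : M.IsReggeMetric g) {W : PwField ι} (hW : M.IsNormalCont g W) {χ : Plane → ℝ}
    (hχ : ContDiff ℝ ∞ χ) (hc : HasCompactSupport χ) (hs : tsupport χ ⊆ T.box) :
    ∃ F, M.IsApprox g W T.e (T.pullFun χ) F ∧ ∀ δ > 0, ∀ m f ς, T.HasSide m f ς →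
      ∀ s ∈ Ioo T.a T.b, F δ m (M.edgeParam i k s)
          = (χ (planeVec ![0, s]) * tensorApp (g m (M.edgeParam i k s)) (W m (M.edgeParam i k s))
              (unitNormalOf (g m (M.edgeParam i k s)) (ς • M.tangent i k s))) •
            unitNormalOf (g m (M.edgeParam i k s)) (ς • M.tangent i k s) := by
  obtain ⟨C, hC⟩ := exists_isCutoff
  choose! η hη using hC
  obtain ⟨B, hB⟩ := T.exists_approx hg hW hχ hc hs C
  choose! F hF using fun δ (hδ : δ > 0) => hB δ (η δ) (hη δ hδ)
  refine ⟨F, ⟨fun δ hδ => (hF δ hδ).1, fun δ hδ => (hF δ hδ).2.1, fun m =>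
    ⟨_, smoothUpTo_pullFun hχ hc hs m, fun _ _ => rfl⟩, ⟨B, fun δ hδ m p hp =>
    (hF δ hδ).2.2.1 m p (_root_.interior_subset hp)⟩, fun m p hp => ?_, fun q hq ε hε => ?_⟩,
    fun δ hδ => (hF δ hδ).2.2.2.2.1⟩
  · by_cases hps : p ∈ T.e.source
    · have h1 : 0 < |T.e p 0| := by
        obtain ⟨f, ς, h⟩ := T.exists_hasSide hps (_root_.interior_subset hp)
        have := (h.mem_iff hps).2.1 hp
        refine abs_pos.2 fun h0 => ?_
        rw [h0, mul_zero] at this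
        exact lt_irrefl _ this
      filter_upwards [Ioo_mem_nhdsGT h1] with δ hδ
      exact (hF δ hδ.1).2.2.2.1 m p (_root_.interior_subset hp) fun _ => hδ.2.le
    · filter_upwards [self_mem_nhdsWithin] with δ hδ
      exact (hF δ hδ).2.2.2.1 m p (_root_.interior_subset hp) fun h => absurd h hps
  · have hlim := tendsto_volume_strip (Q := T.box) (β := fun y : Plane => |y 0|)
      ((measure_mono T.box_subset).trans_lt (isCompact_closedPlaneBox _ _ _).measure_lt_top).ne
      (contDiff_coord 0).continuous.abs.measurable T.isOpen_box.measurableSet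
      (measure_mono_null (fun y hy => by simpa using hy.2) volume_axis) fun _ _ => abs_nonneg _
    filter_upwards [eventually_measure_le hlim B hq hε, self_mem_nhdsWithin] with δ h1 h2 O hO
    exact (hF δ h2).2.2.2.2.2 q hq O (hO.trans T.target_eq.subset) ε h1

lemma exists_isApprox_inner [Fintype ι] {i : ι} {Θ : Plane → ℝ} {N : Set Plane}
    (hΘ : SmoothUpTo (M.elem i) Θ) (hN : IsOpen N) (hNv : M.vertices ⊆ N)
    (hNe : ∀ k, ∀ s ∈ Ioo (0 : ℝ) 1, M.edgeParam i k s ∈ Ω → M.edgeParam i k s ∈ N)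
    (hN0 : ∀ p ∈ N, p ∈ M.elem i → Θ p = 0) (hg : M.IsReggeMetric g) {W : PwField ι}
    (hW : M.IsNormalCont g W) :
    ∃ F, M.IsApprox g W (M.innerChart i) ((M.elem i).indicator Θ) F ∧ ∀ δ > 0, ∀ m k,
      ∀ s ∈ Ioo (0 : ℝ) 1, F δ m (M.edgeParam m k s) = 0 := by
  obtain ⟨C, hC⟩ := exists_isCutoff
  choose! η hη using hC
  obtain ⟨B, β, hβ, hβ0, hB⟩ := exists_inner_approx hΘ hN hNv hNe hN0 hg hW C
  choose! F hF using fun δ (hδ : δ > 0) => hB δ (η δ) (hη δ hδ)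
  have hnot : ∀ m, m ≠ i → ∀ p ∈ interior (M.elem m), (M.elem i).indicator Θ p = 0 := fun m hm p hp =>
    indicator_of_notMem (M.interior_disjoint hm hp) _
  have hint : ∀ p ∈ interior (M.elem i), p ∈ M.elem i := fun p hp => _root_.interior_subset hp
  refine ⟨F, ⟨fun δ hδ => (hF δ hδ).1, fun δ hδ => (hF δ hδ).2.1, fun m => ?_, ⟨max B 0, fun δ hδ m p hp => ?_⟩,
    fun m p hp => ?_, fun q hq ε hε => ?_⟩, fun δ hδ m k s hs => ?_⟩
  · by_cases hm : m = i
    · subst hm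
      exact ⟨Θ, hΘ, fun p hp => indicator_of_mem (hint p hp) _⟩
    · exact ⟨fun _ => 0, SmoothUpTo.of_contDiff contDiff_const, hnot m hm⟩
  · by_cases hm : m = i
    · subst hm
      rw [indicator_of_mem (hint p hp)]
      exact ((hF δ hδ).2.2.2.1 p (hint p hp)).trans (le_max_left _ _)
    · rw [hnot m hm p hp, (hF δ hδ).2.2.1 m hm]
      simp
  · by_cases hm : m = i
    · subst hm
      rw [indicator_of_mem (hint p hp)]
      filter_upwards [Ioo_mem_nhdsGT (hβ0 p hp)] with δ hδ
      exact (hF δ hδ.1).2.2.2.2.1 p (hint p hp) hδ.2.le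
    · filter_upwards [self_mem_nhdsWithin] with δ hδ
      rw [hnot m hm p hp, (hF δ hδ).2.2.1 m hm, zero_smul]
  · have hlim := tendsto_volume_strip (Q := interior (M.elem i)) (β := β)
      ((measure_mono _root_.interior_subset).trans_lt (M.isCompact_elem i).measure_lt_top).ne
      hβ.measurable isOpen_interior.measurableSet
      (measure_mono_null (t := ∅) (fun y hy => absurd hy.2 (hβ0 y hy.1).ne') measure_empty)
      fun p hp => (hβ0 p hp).le
    filter_upwards [eventually_measure_le hlim B hq hε, self_mem_nhdsWithin] with δ h1 h2 O hO
    exact (hF δ h2).2.2.2.2.2.2 q hq O hO ε h1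
  · by_cases hm : m = i
    · subst hm
      exact (hF δ hδ).2.2.2.2.2.1 k s hs
    · exact (hF δ hδ).2.2.1 m hm _

end CurvedMesh

end

noncomputable section

open Filter Topology

set_option maxSynthPendingDepth 3

namespace CurvedMesh

variable {Ω : Set Plane} {ι : Type} {M : CurvedMesh Ω ι} {g : PwTensor ι}

/-! ### The interior edges -/

/-- The interior edges, each one once. -/
def InnerEdge [Fintype ι] (M : CurvedMesh Ω ι) : Type :=
  {t : ι × Fin 3 × ι // M.IsNeighbor t.1 t.2.2 t.2.1 ∧
    Fintype.equivFin ι t.1 < Fintype.equivFin ι t.2.2}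

instance [Fintype ι] : Finite M.InnerEdge := Subtype.finite

namespace InnerEdge

variable [Fintype ι]

/-- The parametrization of an interior edge. -/
def param (t : M.InnerEdge) : ℝ → Plane := M.edgeParam t.1.1 t.1.2.1

lemma exists_eq {i j : ι} {k : Fin 3} (h : M.IsNeighbor i j k) :
    ∃ t : M.InnerEdge, M.edge t.1.1 t.1.2.1 = M.edge i k ∧ (i = t.1.1 ∨ i = t.1.2.2) := by
  rcases lt_trichotomy (Fintype.equivFin ι i) (Fintype.equivFin ι j) with h1 | h1 | h1
  · exact ⟨⟨(i, k, j), h, h1⟩, rfl, Or.inl rfl⟩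
  · exact absurd ((Fintype.equivFin ι).injective h1) h.ne
  · obtain ⟨l, hl⟩ := h.exists_edge_eq
    exact ⟨⟨(j, l, i), h.symm hl, h1⟩, hl.symm, Or.inr rfl⟩

/-- Only two elements meet at an inner point of an edge, and the order of their indices selects one
of the two descriptions. -/
lemma eq_of_param_eq {t t' : M.InnerEdge} {s s' : ℝ} (hs : s ∈ Ioo (0 : ℝ) 1) (hs' : s' ∈ Ioo (0 : ℝ) 1)
    (h : t.param s = t'.param s') : t = t' := by
  obtain ⟨⟨i, k, j⟩, hn, hlt⟩ := t
  obtain ⟨⟨i', k', j'⟩, hn', hlt'⟩ := t'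
  simp only at hn hlt hn' hlt'
  change M.edgeParam i k s = M.edgeParam i' k' s' at h
  have h1 : M.edgeParam i k s ∈ M.elem i' := by
    rw [h]; exact M.edgeParam_mem_elem i' k' (Ioo_subset_Icc_self hs')
  have h2 : M.edgeParam i k s ∈ M.elem j' := by
    rw [h]; exact hn'.shared (M.edgeParam_mem_edge i' k' hs')
  have hii : i' = i ∧ j' = j := by
    rcases hn.eq_or_eq hs h1 with rfl | rfl <;> rcases hn.eq_or_eq hs h2 with rfl | rfl
    · exact absurd rfl hn'.ne
    · exact ⟨rfl, rfl⟩
    · exact absurd hlt (lt_asymm hlt')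
    · exact absurd rfl hn'.ne
  obtain ⟨rfl, rfl⟩ := hii
  have : k' = k := M.edge_eq_of_edgeParam_mem i' hs (h ▸ M.edgeParam_mem_edge i' k' hs')
  subst this
  rfl

end InnerEdge

lemma eventually_disjoint_thickening {A B : Set Plane} (hA : IsCompact A) (hB : IsCompact B)
    (h : Disjoint A B) : ∀ᶠ ρ in 𝓝[>] (0 : ℝ), Disjoint (Metric.thickening ρ A) (Metric.thickening ρ B) := by
  obtain ⟨ρ₀, hρ₀, h1⟩ := h.exists_thickenings hA hB.isClosed
  filter_upwards [Ioo_mem_nhdsGT hρ₀] with ρ hρ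
  exact h1.mono (Metric.thickening_mono hρ.2.le _) (Metric.thickening_mono hρ.2.le _)

/-- Disjoint tubes around the interior edges, with cutoff functions, and a cutoff function that
vanishes near the vertices. -/
structure TubeSystem [Fintype ι] (M : CurvedMesh Ω ι) (g : PwTensor ι) (r : ℝ) where
  tube : ∀ t : M.InnerEdge, M.EdgeTube g t.1.1 t.1.2.2 t.1.2.1
  disjoint : ∀ t t', t ≠ t' → Disjoint (tube t).e.source (tube t').e.source
  χ : M.InnerEdge → Plane → ℝ
  χ_smooth : ∀ t, ContDiff ℝ ∞ (χ t)
  χ_compact : ∀ t, HasCompactSupport (χ t)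
  χ_support : ∀ t, tsupport (χ t) ⊆ (tube t).box
  χ_mem : ∀ t y, χ t y ∈ Icc (0 : ℝ) 1
  core : ∀ t, ∀ s ∈ Ioo (0 : ℝ) 1, r ≤ Metric.infDist (t.param s) M.vertices →
    s ∈ Ioo (tube t).a (tube t).b ∧ ∀ᶠ y in 𝓝 (planeVec ![0, s]), χ t y = 1
  θ : Plane → ℝ
  θ_smooth : ContDiff ℝ ∞ θ
  θ_mem : ∀ p, θ p ∈ Icc (0 : ℝ) 1
  θ_zero : ∀ p, Metric.infDist p M.vertices < r → θ p = 0
  θ_one : ∀ p, 2 * r ≤ Metric.infDist p M.vertices → θ p = 1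

/-- Truncating the edges near their ends leaves pairwise disjoint compact arcs, which have disjoint
neighbourhoods to hold the tubes. The truncated ends are within `r` of the vertices, where `θ`
vanishes, so the tubes are not needed there. A tube extends beyond the core arc, half-way to the
ends in the parameter, to leave room for its cutoff. -/
lemma exists_tubeSystem [Fintype ι] (hΩ : IsOpen Ω) (hg : M.IsReggeMetric g)
    (hne : M.vertices.Nonempty) {r : ℝ} (hr : 0 < r) : Nonempty (M.TubeSystem g r) := by
  obtain ⟨κ, hκ, hκ', hends⟩ := M.exists_infDist_edge_lt hr
  set A : M.InnerEdge → Set Plane := fun t => t.param '' Icc (κ / 2) (1 - κ / 2)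
  have hsub : ∀ s ∈ Icc (κ / 2) (1 - κ / 2), s ∈ Ioo (0 : ℝ) 1 := fun s hs =>
    ⟨by linarith [hs.1], by linarith [hs.2]⟩
  have hA : ∀ t, IsCompact (A t) := fun t => isCompact_Icc.image (M.contDiff_edgeParam _ _).continuous
  have hdis : ∀ t t', t ≠ t' → Disjoint (A t) (A t') := by
    intro t t' htt
    rw [Set.disjoint_left]
    rintro _ ⟨s, hs, rfl⟩ ⟨s', hs', h⟩
    exact htt (InnerEdge.eq_of_param_eq (hsub s hs) (hsub s' hs') h.symm)
  have hev : ∀ᶠ ρ in 𝓝[>] (0 : ℝ), ∀ t t', t ≠ t' →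
      Disjoint (Metric.thickening ρ (A t)) (Metric.thickening ρ (A t')) :=
    eventually_all.2 fun t => eventually_all.2 fun t' => by
      by_cases h : t = t'
      · exact Eventually.of_forall fun _ h' => absurd h h'
      · filter_upwards [eventually_disjoint_thickening (hA t) (hA t') (hdis t t' h)] with ρ hρ _ using hρ
  obtain ⟨ρ, h1, hρ⟩ := (hev.and self_mem_nhdsWithin).exists
  have hρ0 : 0 < ρ := hρ
  choose T hTa hTb hTO using fun t : M.InnerEdge => IsNeighbor.exists_edgeTube hΩ hg t.2.1
    (a := κ / 2) (b := 1 - κ / 2) (by linarith) (by linarith) (by linarith)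
    (Metric.isOpen_thickening (δ := ρ) (E := A t))
    fun s hs => Metric.self_subset_thickening hρ0 _ ⟨s, hs, rfl⟩
  have hcore : ∀ t, IsCompact ((fun s => planeVec ![0, s]) '' Icc κ (1 - κ)) ∧
      (fun s => planeVec ![0, s]) '' Icc κ (1 - κ) ⊆ (T t).box := by
    intro t
    refine ⟨isCompact_Icc.image (continuous_planeVec_snd 0), ?_⟩
    rintro _ ⟨s, hs, rfl⟩
    refine ⟨by simp [(T t).ρ_pos], ?_⟩
    rw [hTa, hTb]
    exact ⟨by simp; linarith [hs.1], by simp; linarith [hs.2]⟩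
  choose χ hχ1 hχ2 hχ3 hχ4 hχ5 using fun t =>
    (hcore t).1.exists_smooth_cutoff (T t).isOpen_box (hcore t).2
  have hcpt : IsCompact (Metric.cthickening r M.vertices) :=
    M.finite_vertices.isCompact.cthickening
  obtain ⟨c, hc1, -, hc3, ⟨V, -, hV1, hV2⟩, hc5⟩ := hcpt.exists_smooth_cutoff
    (Metric.isOpen_thickening (δ := 2 * r) (E := M.vertices))
    (Metric.cthickening_subset_thickening' (by linarith) (by linarith) _)
  refine ⟨⟨T, fun t t' h => (h1 t t' h).mono (hTO t) (hTO t'), χ, hχ1, hχ2, hχ3, fun t y => hχ5 t y,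
    fun t s hs hd => ?_, fun p => 1 - c p, contDiff_const.sub hc1, fun p => ?_, fun p hp => ?_, fun p hp => ?_⟩⟩
  · have hs' : s ∈ Icc κ (1 - κ) := by
      by_contra h
      exact absurd (hends t.1.1 t.1.2.1 s (Ioo_subset_Icc_self hs) h) (not_lt.2 hd)
    refine ⟨by rw [hTa, hTb]; exact ⟨by linarith [hs'.1], by linarith [hs'.2]⟩, ?_⟩
    obtain ⟨U, hU, hKU, hU1⟩ := hχ4 t
    filter_upwards [hU.mem_nhds (hKU ⟨s, hs', rfl⟩)] with y hy using hU1 y hy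
  · have := hc5 p
    exact ⟨by linarith [this.2], by linarith [this.1]⟩
  · have : p ∈ Metric.cthickening r M.vertices :=
      Metric.thickening_subset_cthickening _ _ ((Metric.mem_thickening_iff_infDist_lt hne).2 hp)
    simp [hV2 p (hV1 this)]
  · have : c p = 0 := image_eq_zero_of_notMem_tsupport fun h =>
      absurd ((Metric.mem_thickening_iff_infDist_lt hne).1 (hc3 h)) (not_lt.2 hp)
    simp [this]

namespace TubeSystem

variable [Fintype ι] {r : ℝ} (S : M.TubeSystem g r)

instance : Fintype M.InnerEdge := Fintype.ofFinite _

/-- The cutoff function of a tube, on the plane. -/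
def bump (t : M.InnerEdge) : Plane → ℝ := (S.tube t).pullFun (S.χ t)

/-- The sum of the cutoff functions of the tubes. -/
def bumpSum (p : Plane) : ℝ := ∑ t, S.bump t p

/-- The cutoff function inside the elements. -/
def rest (p : Plane) : ℝ := S.θ p * (1 - S.bumpSum p)

lemma bump_mem (t : M.InnerEdge) (p : Plane) : S.bump t p ∈ Icc (0 : ℝ) 1 := by
  by_cases hp : p ∈ (S.tube t).e.source
  · rw [bump, EdgeTube.pullFun_of_mem hp]; exact S.χ_mem t _
  · rw [bump, EdgeTube.pullFun_of_notMem hp]; simp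

lemma bump_eq_zero {t t' : M.InnerEdge} (h : t' ≠ t) {p : Plane} (hp : p ∈ (S.tube t).e.source) :
    S.bump t' p = 0 :=
  EdgeTube.pullFun_of_notMem fun hp' => Set.disjoint_left.1 (S.disjoint t' t h) hp' hp

lemma bumpSum_eq {t : M.InnerEdge} {p : Plane} (hp : p ∈ (S.tube t).e.source) :
    S.bumpSum p = S.χ t ((S.tube t).e p) := by
  rw [bumpSum, Finset.sum_eq_single t (fun t' _ h => S.bump_eq_zero h hp) (by simp), bump,
    EdgeTube.pullFun_of_mem hp]

lemma bumpSum_mem (p : Plane) : S.bumpSum p ∈ Icc (0 : ℝ) 1 := by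
  by_cases h : ∃ t, p ∈ (S.tube t).e.source
  · obtain ⟨t, ht⟩ := h
    rw [S.bumpSum_eq ht]; exact S.χ_mem t _
  · push Not at h
    have h0 : S.bumpSum p = 0 := Finset.sum_eq_zero fun t _ => EdgeTube.pullFun_of_notMem (h t)
    simp [h0]

lemma rest_mem (p : Plane) : S.rest p ∈ Icc (0 : ℝ) 1 ∧ S.bumpSum p + S.rest p ≤ 1 := by
  have h1 := S.bumpSum_mem p
  have h2 := S.θ_mem p
  have h3 : 0 ≤ S.rest p := mul_nonneg h2.1 (by linarith [h1.2])
  have h4 : S.rest p ≤ 1 - S.bumpSum p :=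
    mul_le_of_le_one_left (by linarith [h1.2]) h2.2
  exact ⟨⟨h3, by linarith [h1.1]⟩, by linarith⟩

lemma smoothUpTo_rest (m : ι) : SmoothUpTo (M.elem m) S.rest := by
  have h1 : SmoothUpTo (M.elem m) S.bumpSum := SmoothUpTo.sum _ fun t _ =>
    EdgeTube.smoothUpTo_pullFun (S.χ_smooth t) (S.χ_compact t) (S.χ_support t) m
  exact (SmoothUpTo.of_contDiff S.θ_smooth).smul
    ((SmoothUpTo.of_contDiff (contDiff_const (c := (1 : ℝ)))).sub h1)

/-- A neighbourhood of the vertices and of the interior edges. -/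
def nearEdges : Set Plane :=
  {p | Metric.infDist p M.vertices < r} ∪ ⋃ t, interior {p | p ∈ (S.tube t).e.source ∧
    S.χ t ((S.tube t).e p) = 1}

lemma isOpen_nearEdges : IsOpen S.nearEdges :=
  (isOpen_lt (Metric.continuous_infDist_pt _) continuous_const).union
    (isOpen_iUnion fun _ => isOpen_interior)

lemma vertices_subset_nearEdges (hr : 0 < r) : M.vertices ⊆ S.nearEdges := fun V hV =>
  Or.inl (by rw [mem_ofPred_eq, Metric.infDist_zero_of_mem hV]; exact hr)

lemma param_mem_nearEdges (t : M.InnerEdge) {s : ℝ} (hs : s ∈ Ioo (0 : ℝ) 1) :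
    t.param s ∈ S.nearEdges := by
  rcases lt_or_ge (Metric.infDist (t.param s) M.vertices) r with h | h
  · exact Or.inl h
  · obtain ⟨h1, h2⟩ := S.core t s hs h
    obtain ⟨h3, h4⟩ := (S.tube t).edgeParam_mem_source h1
    refine Or.inr (mem_iUnion.2 ⟨t, mem_interior_iff_mem_nhds.2 ?_⟩)
    rw [← h4] at h2
    filter_upwards [(S.tube t).e.open_source.mem_nhds h3,
      ((S.tube t).e.continuousAt h3).eventually h2] with p hp hp1 using ⟨hp, hp1⟩

lemma exists_param_eq (hΩ : IsOpen Ω) {i : ι} {k : Fin 3} {s : ℝ} (hs : s ∈ Ioo (0 : ℝ) 1)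
    (h : M.edgeParam i k s ∈ Ω) : ∃ t : M.InnerEdge, ∃ s' ∈ Ioo (0 : ℝ) 1,
      t.param s' = M.edgeParam i k s ∧ (i = t.1.1 ∨ i = t.1.2.2) := by
  obtain ⟨j, hj⟩ := M.exists_isNeighbor hΩ i k hs h
  obtain ⟨t, ht, hi⟩ := InnerEdge.exists_eq hj
  exact ⟨t, _, M.edgeCoord_mem_Ioo ht.symm hs,
    (M.edgeParam_edgeCoord _ _ (ht ▸ M.edgeParam_mem_edge i k hs)).2, hi⟩

lemma edge_mem_nearEdges (hΩ : IsOpen Ω) {i : ι} {k : Fin 3} {s : ℝ} (hs : s ∈ Ioo (0 : ℝ) 1)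
    (h : M.edgeParam i k s ∈ Ω) : M.edgeParam i k s ∈ S.nearEdges := by
  obtain ⟨t, s', hs', h1, -⟩ := exists_param_eq hΩ hs h
  rw [← h1]; exact S.param_mem_nearEdges t hs'

lemma rest_eq_zero {p : Plane} (hp : p ∈ S.nearEdges) : S.rest p = 0 := by
  rcases hp with h | h
  · rw [rest, S.θ_zero p h, zero_mul]
  · obtain ⟨t, ht⟩ := mem_iUnion.1 h
    obtain ⟨h1, h2⟩ := _root_.interior_subset ht
    rw [rest, S.bumpSum_eq h1, h2, sub_self, mul_zero]

/-- The charts of the tubes and of the interiors of the elements. -/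
def chart (n : M.InnerEdge ⊕ ι) : OpenPartialHomeomorph Plane Plane :=
  Sum.elim (fun t => (S.tube t).e) (fun i => M.innerChart i) n

/-- The partition of unity subordinate to the charts. -/
def weight (n : M.InnerEdge ⊕ ι) : Plane → ℝ :=
  Sum.elim (fun t => S.bump t) (fun i => (M.elem i).indicator S.rest) n

lemma isGluedChart_chart (hg : M.IsReggeMetric g) (n : M.InnerEdge ⊕ ι) : M.IsGluedChart g (S.chart n) := by
  rcases n with t | i
  · exact (S.tube t).isGluedChart hg
  · exact isGluedChart_innerChart i

lemma isGluedSmoothFun_weight (hΩ : IsOpen Ω) (hg : M.IsReggeMetric g) (n : M.InnerEdge ⊕ ι) :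
    M.IsGluedSmoothFun g (S.weight n) := by
  rcases n with t | i
  · exact EdgeTube.isGluedSmoothFun_pullFun (S.χ_smooth t) (S.χ_compact t) (S.χ_support t) hg
  · exact isGluedSmoothFun_indicator (S.smoothUpTo_rest i) S.isOpen_nearEdges
      (fun k s hs h => S.edge_mem_nearEdges hΩ hs h) fun p hp _ => S.rest_eq_zero hp

lemma weight_nonneg (n : M.InnerEdge ⊕ ι) (p : Plane) : 0 ≤ S.weight n p := by
  rcases n with t | i
  · exact (S.bump_mem t p).1
  · exact indicator_nonneg (fun p _ => (S.rest_mem p).1.1) p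

/-- A point of the manifold that lies in several elements is on an interior edge, where `rest` is
zero; so no value is counted twice. -/
lemma sum_weight (hΩ : IsOpen Ω) {p : Plane} (hp : p ∈ M.punctured) :
    ∑ n, S.weight n p = S.bumpSum p + S.rest p := by
  rw [Fintype.sum_sum_type]
  congr 1
  change ∑ i, (M.elem i).indicator S.rest p = S.rest p
  obtain ⟨i, hi⟩ := M.exists_mem_elem hp.1
  rcases M.mem_elem_cases i hi with h | h | ⟨k, s, hs, rfl⟩
  · exact absurd h hp.2
  · rw [Finset.sum_eq_single i, indicator_of_mem hi]
    · exact fun m _ hm => indicator_of_notMem (M.interior_disjoint hm.symm h) _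
    · simp
  · have h0 := S.rest_eq_zero (S.edge_mem_nearEdges hΩ hs hp.1)
    rw [h0]
    refine Finset.sum_eq_zero fun m _ => ?_
    by_cases hm : M.edgeParam i k s ∈ M.elem m
    · rw [indicator_of_mem hm, h0]
    · exact indicator_of_notMem hm _

lemma sum_weight_eq_one (hΩ : IsOpen Ω) {p : Plane} (hp : p ∈ M.punctured)
    (h : 2 * r ≤ Metric.infDist p M.vertices) : ∑ n, S.weight n p = 1 := by
  rw [S.sum_weight hΩ hp, rest, S.θ_one p h]
  ring

lemma closure_support_weight (hΩ : IsOpen Ω) (n : M.InnerEdge ⊕ ι) :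
    closure (Function.support (S.weight n) ∩ M.punctured) ∩ M.punctured ⊆ (S.chart n).source := by
  rcases n with t | i
  · obtain ⟨hK, hKs⟩ := EdgeTube.isCompact_pull_support (T := S.tube t) (S.χ_compact t) (S.χ_support t)
    refine fun p hp => hKs (closure_minimal (fun q hq => ?_) hK.isClosed hp.1)
    by_contra hqK
    refine hq.1 ?_
    by_cases hqs : q ∈ (S.tube t).e.source
    · refine (EdgeTube.pullFun_of_mem hqs).trans
        (image_eq_zero_of_notMem_tsupport (f := S.χ t) fun h => hqK ⟨_, h, (S.tube t).e.left_inv hqs⟩)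
    · exact EdgeTube.pullFun_of_notMem hqs
  · exact closure_support_indicator S.isOpen_nearEdges
      (fun k s hs h => S.edge_mem_nearEdges hΩ hs h) fun p hp _ => S.rest_eq_zero hp

end TubeSystem

end CurvedMesh

end

/-! ### Summing the local approximations -/

noncomputable section

open Filter Topology

set_option maxSynthPendingDepth 3

namespace CurvedMesh

variable {Ω : Set Plane} {ι : Type} {M : CurvedMesh Ω ι} {g : PwTensor ι}

lemma EdgeTube.edgeParam_mem_source_iff {i j : ι} {k : Fin 3} (T : M.EdgeTube g i j k) {s : ℝ}
    (hs : s ∈ Icc (0 : ℝ) 1) : M.edgeParam i k s ∈ T.e.source ↔ s ∈ Ioo T.a T.b := by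
  refine ⟨fun h => ?_, fun h => (T.edgeParam_mem_source h).1⟩
  have h1 := (T.e_fst_eq_zero_iff h).1 (T.mem_edge_of_mem_edge h ⟨s, hs, rfl⟩)
  have h2 := (T.e_mem_box h).2
  rw [M.edgeParam_injOn i k hs (Ioo_subset_Icc_self (T.Ioo_mem (Ioo_subset_Icc_self h2))) h1]
  exact h2

/-- The signed tangent of the tube and the boundary tangent of `m` are positive multiples of each
other, so they have the same unit normal. -/
lemma EdgeTube.HasSide.unitNormal_eq {i j m : ι} {k l : Fin 3} {T : M.EdgeTube g i j k}
    {f : OpenPartialHomeomorph Plane Plane} {ς s t : ℝ} (h : T.HasSide m f ς) (hs : s ∈ Ioo (0 : ℝ) 1)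
    (ht : t ∈ Ioo (0 : ℝ) 1) (hst : M.edgeParam i k s = M.edgeParam m l t) :
    unitNormalOf (g m (M.edgeParam i k s)) (ς • M.tangent i k s) = M.unitNormal g m l t := by
  obtain ⟨l', hl'⟩ := h.isSideCurve.tangent
  obtain ⟨t', ht', h1, c, hc, h2⟩ := hl' s hs
  have h3 : M.edgeParam m l' t' = M.edgeParam m l t := h1.trans hst
  have hl : l = l' := M.edge_eq_of_edgeParam_mem m ht' (h3 ▸ M.edgeParam_mem_edge m l ht)
  subst hl
  have htt := M.edgeParam_injOn m l (Ioo_subset_Icc_self ht') (Ioo_subset_Icc_self ht) h3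
  subst htt
  rw [CurvedMesh.unitNormal_eq, h2, unitNormalOf_smul _ hc, hst]
  rfl

namespace TubeSystem

variable [Fintype ι] {r : ℝ} (S : M.TubeSystem g r)

/-- On an edge the inner fields vanish, and of the tubes only that of the edge itself can contain
the point. Hence `c` is its cutoff function on the axis, or 0 past the ends of the tube. On boundary
edges the field and the normal component of `W` are both zero, which permits `c = 1`. -/
theorem exists_family (hΩ : IsOpen Ω) (hr : 0 < r) (hg : M.IsReggeMetric g) {W : PwField ι}
    (hW : M.IsNormalCont g W) : ∃ F : M.InnerEdge ⊕ ι → ℝ → PwField ι,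
      (∀ n, M.IsApprox g W (S.chart n) (S.weight n) (F n)) ∧
      ∀ δ > 0, ∀ i k, ∀ s ∈ Ioo (0 : ℝ) 1, ∃ c ∈ Icc (0 : ℝ) 1, ∑ n, F n δ i (M.edgeParam i k s)
        = (c * tensorApp (g i (M.edgeParam i k s)) (W i (M.edgeParam i k s)) (M.unitNormal g i k s)) •
          M.unitNormal g i k s ∧ (r ≤ Metric.infDist (M.edgeParam i k s) M.vertices → c = 1) := by
  choose F₁ hF₁ hF₁e using fun t => (S.tube t).exists_isApprox hg hW (S.χ_smooth t) (S.χ_compact t)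
    (S.χ_support t)
  choose F₂ hF₂ hF₂e using fun i => exists_isApprox_inner (S.smoothUpTo_rest i) S.isOpen_nearEdges
    (S.vertices_subset_nearEdges hr) (fun k s hs h => S.edge_mem_nearEdges hΩ hs h)
    (fun p hp _ => S.rest_eq_zero hp) hg hW
  refine ⟨Sum.elim F₁ F₂, ?_, fun δ hδ i k s hs => ?_⟩
  · rintro (t | i)
    · exact hF₁ t
    · exact hF₂ i
  have hmem := M.edgeParam_mem_elem i k (Ioo_subset_Icc_self hs)
  have hsum : ∑ n, Sum.elim F₁ F₂ n δ i (M.edgeParam i k s) = ∑ t, F₁ t δ i (M.edgeParam i k s) := by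
    rw [Fintype.sum_sum_type]
    simp only [Sum.elim_inl, Sum.elim_inr, hF₂e _ δ hδ i k s hs, Finset.sum_const_zero, add_zero]
  have hzero : ∀ t, M.edgeParam i k s ∉ (S.tube t).e.source → F₁ t δ i (M.edgeParam i k s) = 0 := by
    intro t ht
    obtain ⟨K, -, hK, hK0⟩ := ((hF₁ t).test δ hδ).2
    exact hK0 i _ hmem fun h => ht (hK h)
  rw [hsum]
  by_cases hE : M.edgeParam i k s ∈ Ω
  · obtain ⟨t, s', hs', hst, hi⟩ := exists_param_eq hΩ hs hE
    have hother : ∀ t', t' ≠ t → F₁ t' δ i (M.edgeParam i k s) = 0 := by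
      intro t' ht'
      refine hzero t' fun h => ht' ?_
      have h1 := ((S.tube t').e_fst_eq_zero_iff h).1
        ((S.tube t').mem_edge_of_mem_edge h (M.edgeParam_mem_edge i k hs))
      have h2 := (S.tube t').Ioo_mem (Ioo_subset_Icc_self ((S.tube t').e_mem_box h).2)
      exact InnerEdge.eq_of_param_eq h2 hs' (h1.symm.trans hst.symm)
    rw [Finset.sum_eq_single t (fun t' _ h => hother t' h) (by simp)]
    have hst' : M.edgeParam t.1.1 t.1.2.1 s' = M.edgeParam i k s := hst
    by_cases hs'' : s' ∈ Ioo (S.tube t).a (S.tube t).b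
    · obtain ⟨f, ς, h⟩ : ∃ f ς, (S.tube t).HasSide i f ς := by
        rcases hi with hi | hi
        · exact ⟨_, _, Or.inl ⟨hi, rfl, rfl⟩⟩
        · exact ⟨_, _, Or.inr ⟨hi, rfl, rfl⟩⟩
      have h1 := hF₁e t δ hδ i f ς h s' hs''
      rw [h.unitNormal_eq hs' hs hst', hst'] at h1
      exact ⟨_, S.χ_mem t _, h1, fun hd => (S.core t s' hs' (by rwa [hst])).2.self_of_nhds⟩
    · refine ⟨0, by simp, ?_, fun hd => absurd (S.core t s' hs' (by rwa [hst])).1 hs''⟩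
      rw [zero_mul, zero_smul]
      refine hzero t fun h => hs'' ?_
      rw [← hst'] at h
      exact ((S.tube t).edgeParam_mem_source_iff (Ioo_subset_Icc_self hs')).1 h
  · refine ⟨1, by simp, ?_, fun _ => rfl⟩
    rw [hW.bdry i k s hs hE, mul_zero, zero_smul]
    exact Finset.sum_eq_zero fun t _ => hzero t fun h => hE ((S.tube t).mem_punctured h).1

/-- The difference splits into the local errors and the defect of the partition of unity times `W`;
the defect is at most 1 and lives within `2 * r` of the vertices. -/
lemma integral_norm_sub_le (hΩ : IsOpen Ω) {W : PwField ι} (hW : ∀ i, SmoothUpTo (M.elem i) (W i))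
    {F : M.InnerEdge ⊕ ι → ℝ → PwField ι} (hF : ∀ n, M.IsApprox g W (S.chart n) (S.weight n) (F n))
    (i : ι) {B : ℝ} (hB : ∀ p ∈ M.elem i, ‖W i p‖ ≤ B) {δ : ℝ} (hδ : 0 < δ) :
    ∫ p in M.elem i, ‖∑ n, F n δ i p - W i p‖
      ≤ (∑ n, ∫ p in M.elem i, ‖F n δ i p - S.weight n p • W i p‖)
        + (volume ({p | Metric.infDist p M.vertices ≤ 2 * r} ∩ M.elem i)).toReal * B := by
  have hc := M.isCompact_elem i
  have hm : MeasurableSet {p | Metric.infDist p M.vertices ≤ 2 * r} :=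
    (isClosed_le (Metric.continuous_infDist_pt _) continuous_const).measurableSet
  have hfin : IsFiniteMeasure (volume.restrict (M.elem i)) := ⟨by simpa using hc.measure_lt_top⟩
  have hi1 : ∀ n, IntegrableOn (fun p => ‖F n δ i p - S.weight n p • W i p‖) (M.elem i) := fun n =>
    ((hF n).tendsto_integral hW i).1 δ hδ
  have hi2 : IntegrableOn ({p | Metric.infDist p M.vertices ≤ 2 * r}.indicator fun _ => B) (M.elem i) :=
    (integrable_const B).indicator hm
  have h1 : (volume ({p | Metric.infDist p M.vertices ≤ 2 * r} ∩ M.elem i)).toReal * B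
      = ∫ p in M.elem i, {p | Metric.infDist p M.vertices ≤ 2 * r}.indicator (fun _ => B) p := by
    rw [integral_indicator_const _ hm, measureReal_def, Measure.restrict_apply hm, smul_eq_mul]
  rw [h1, ← integral_finsetSum _ fun n _ => hi1 n, ← integral_add (integrable_finsetSum _ fun n _ => hi1 n) hi2]
  refine integral_mono_ae ?_ ((integrable_finsetSum _ fun n _ => hi1 n).add hi2) ?_
  · have hs : SmoothUpTo (M.elem i) fun p => ∑ n, F n δ i p :=
      SmoothUpTo.sum _ fun n _ => (hF n).smooth δ hδ i
    exact ((SmoothUpTo_continuousOn (hs.sub (hW i))).norm).integrableOn_compact hc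
  · filter_upwards [ae_mem_interior (M := M) i] with p hp
    have hpp := M.interior_subset_punctured i hp
    have hpe : p ∈ M.elem i := _root_.interior_subset hp
    have h2 : ∑ n, F n δ i p - W i p = ∑ n, (F n δ i p - S.weight n p • W i p)
        + ((∑ n, S.weight n p) - 1) • W i p := by
      rw [Finset.sum_sub_distrib, sub_smul, Finset.sum_smul, one_smul]
      abel
    rw [h2]
    refine (norm_add_le _ _).trans (add_le_add (norm_sum_le _ _) ?_)
    rw [norm_smul, Real.norm_eq_abs]
    by_cases hd : Metric.infDist p M.vertices ≤ 2 * r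
    · rw [indicator_of_mem (by exact hd), S.sum_weight hΩ hpp]
      obtain ⟨h3, h4⟩ := S.rest_mem p
      have h5 := S.bumpSum_mem p
      have h6 : |S.bumpSum p + S.rest p - 1| ≤ 1 := by
        rw [abs_le]; constructor <;> linarith [h5.1, h3.1]
      have h7 := hB p hpe
      nlinarith [norm_nonneg (W i p), abs_nonneg (S.bumpSum p + S.rest p - 1)]
    · rw [indicator_of_notMem (by exact hd), S.sum_weight_eq_one hΩ hpp (not_le.1 hd).le]
      simp

end TubeSystem

end CurvedMesh

end

/-! ### Choice of the parameters -/

open Filter Topology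

theorem mainTheorem10 {ι : Type} [Fintype ι] (Ω : Set Plane) (hΩ_open : IsOpen Ω)
    (hΩ_conn : IsConnected Ω) (hΩ_bdd : Bornology.IsBounded Ω) (M : CurvedMesh Ω ι)
    (g : PwTensor ι) (hg : M.IsReggeMetric g)
    (σ : PwTensor ι) (hσ : M.IsRegge σ)
    (W : PwField ι) (hW : M.IsNormalCont g W)
    (ε₁ : ℝ) (hε₁ : 0 < ε₁) (ε₀ : ℝ) (hε₀ : 0 < ε₀) :
    ∃ p : ℝ, 2 < p ∧ ∃ ε₂ : ℝ, 0 < ε₂ ∧ ε₂ ≤ ε₀ ∧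
    ∃ (N : ℕ) (e : Fin N → OpenPartialHomeomorph Plane Plane) (ψ : Fin N → Plane → ℝ)
      (φ : PwField ι) (φs : Fin N → PwField ι),
      (∀ n, M.IsGluedChart g (e n)) ∧
      M.awayFromVertices g ε₂ ⊆ ⋃ n, (e n).source ∧
      M.IsPartitionOfUnityOn g (M.awayFromVertices g ε₂) (fun n => (e n).source) ψ ∧
      M.IsTestField g φ ∧
      (∀ n, M.IsTestField g (φs n) ∧ M.CompactSupportIn (φs n) (e n).source) ∧
      (∀ i, ∀ x ∈ M.elem i, φ i x = ∑ n, φs n i x) ∧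
      |M.curlPairing g σ φ - M.curlPairingExt g σ W| ≤ ε₁ ∧
      ∀ n, wpDivNorm p (e n '' ((e n).source ∩ M.awayFromVertices g ε₂))
        (M.pushforward (e n) (fun i x => φs n i x - ψ n x • W i x)) ≤ ENNReal.ofReal ε₁ := by
  obtain ⟨p₀, hp₀⟩ := hΩ_conn.nonempty
  have hne : M.vertices.Nonempty := by
    obtain ⟨i, -⟩ := M.exists_mem_elem hp₀
    exact ⟨_, i, 0, rfl⟩
  obtain ⟨D, hD0, hD⟩ := CurvedMesh.exists_pairing_bound hg hσ hW.smooth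
  -- The pairing error is at most `D` times a sum of three quantities: local errors, the part near
  -- the vertices, and the edge ends `κ`. Each receives η/3; the denominator `D + 1` covers `D = 0`.
  set η := ε₁ / (D + 1)
  have hη : 0 < η := by positivity
  set κ := min (1 / 4) (η / 3)
  have hκ : 0 < κ := by positivity
  have hκ' : κ < 1 / 2 := (min_le_left _ _).trans_lt (by norm_num)
  choose B hB using fun i =>
    (M.isCompact_elem i).exists_bound_of_continuousOn (CurvedMesh.SmoothUpTo_continuousOn (hW.smooth i))
  have hvol : Tendsto (fun ρ : ℝ => ∑ i,
      (volume ({p | Metric.infDist p M.vertices ≤ ρ} ∩ M.elem i)).toReal * B i) (𝓝[>] 0) (𝓝 0) := by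
    have h1 : ∀ i, Tendsto (fun ρ : ℝ =>
        (volume ({p | Metric.infDist p M.vertices ≤ ρ} ∩ M.elem i)).toReal * B i) (𝓝[>] 0) (𝓝 0) := by
      intro i
      have h2 := ((ENNReal.tendsto_toReal ENNReal.zero_ne_top).comp
        (CurvedMesh.tendsto_volume_near_vertices hne i)).mul_const (B i)
      simpa using h2
    simpa using tendsto_finsetSum Finset.univ fun i _ => h1 i
  -- `ρ` is so small that `awayFromVertices g ε₀` stays at Euclidean distance `ρ` from the vertices,
  -- the part of `W` within `ρ` of them is negligible, and edge points with parameter in `[κ, 1 -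
  -- κ]` are farther away than `ρ`.
  obtain ⟨ρ, ⟨⟨⟨hρ1, hρ2⟩, hρ3⟩, hρ⟩⟩ := ((((CurvedMesh.eventually_lt_infDist_of_away hg hε₀ hne).and
    (hvol.eventually (gt_mem_nhds (show (0 : ℝ) < η / 3 by positivity)))).and
    (CurvedMesh.eventually_lt_infDist_edge hne hκ)).and self_mem_nhdsWithin).exists
  have hρ0 : 0 < ρ := hρ
  -- The cutoff `θ` reaches 1 at distance `2 * r`, so the partition of unity has sum 1 from distance
  -- `ρ` on.
  set r := ρ / 2
  have hr : 0 < r := by positivity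
  have h2r : 2 * r = ρ := by simp only [r]; ring
  obtain ⟨S⟩ := CurvedMesh.exists_tubeSystem hΩ_open hg hne hr
  obtain ⟨F, hF, hFe⟩ := S.exists_family hΩ_open hr hg hW
  have hlim : Tendsto (fun δ => ∑ i, ∑ n, ∫ p in M.elem i, ‖F n δ i p - S.weight n p • W i p‖)
      (𝓝[>] 0) (𝓝 0) := by
    simpa using tendsto_finsetSum Finset.univ fun i _ => tendsto_finsetSum Finset.univ fun n _ =>
      ((hF n).tendsto_integral hW.smooth i).2
  have hnorm : ∀ᶠ δ in 𝓝[>] (0 : ℝ), ∀ n, ∀ O ⊆ (S.chart n).target,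
      wpDivNorm 3 O (M.pushforward (S.chart n) fun m x => F n δ m x - S.weight n x • W m x)
        ≤ ENNReal.ofReal ε₁ := eventually_all.2 fun n => (hF n).norm 3 (by norm_num) ε₁ hε₁
  -- With charts and partition fixed, the cutoff scale is chosen last, for the finitely many charts
  -- at once.
  obtain ⟨δ, ⟨⟨hδ1, hδ2⟩, hδ⟩⟩ := ((hnorm.and
    (hlim.eventually (gt_mem_nhds (show (0 : ℝ) < η / 3 by positivity)))).and self_mem_nhdsWithin).exists
  have hδ0 : 0 < δ := hδ
  set E := Fintype.equivFin (M.InnerEdge ⊕ ι)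
  have hreindex : ∀ {G : Type} [AddCommMonoid G] (f : M.InnerEdge ⊕ ι → G),
      ∑ n, f (E.symm n) = ∑ n, f n := fun f => E.symm.sum_comp f
  have haway : ∀ p ∈ M.awayFromVertices g ε₀, 2 * r ≤ Metric.infDist p M.vertices ∧ p ∈ M.punctured := by
    intro p hp
    have h1 := hρ1 p hp
    refine ⟨by rwa [h2r], hp.1, fun hV => ?_⟩
    rw [Metric.infDist_zero_of_mem hV] at h1
    linarith
  have hone : ∀ p ∈ M.awayFromVertices g ε₀, ∑ n, S.weight n p = 1 := fun p hp =>
    S.sum_weight_eq_one hΩ_open (haway p hp).2 (haway p hp).1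
  have hsupp := S.closure_support_weight hΩ_open
  -- Any finite exponent above 2 would do, since the approximation holds for all positive ones. The
  -- radius `ε₀` itself serves as `ε₂`.
  refine ⟨3, by norm_num, ε₀, hε₀, le_rfl, _, fun n => S.chart (E.symm n), fun n => S.weight (E.symm n),
    fun i x => ∑ n, F (E.symm n) δ i x, fun n => F (E.symm n) δ, fun n => S.isGluedChart_chart hg _,
    fun p hp => ?_, ⟨fun n => S.isGluedSmoothFun_weight hΩ_open hg _, fun n p _ => S.weight_nonneg _ p,
      fun p hp => ?_, fun p hp => ?_, fun n => hsupp _⟩,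
    CurvedMesh.isTestField_sum fun n => ((hF _).test δ hδ0).1, fun n => (hF _).test δ hδ0,
    fun i x _ => rfl, ?_, fun n => hδ1 _ _ ?_⟩
  -- Covering follows from the partition of unity: where the sum is 1 some weight is nonzero, and
  -- its support lies in its chart.
  · have h1 : ∃ n, S.weight n p ≠ 0 := by
      by_contra! h
      have := hone p hp
      rw [Finset.sum_eq_zero fun n _ => h n] at this
      exact zero_ne_one this
    obtain ⟨n, hn⟩ := h1
    have hpp := (haway p hp).2
    exact mem_iUnion.2 ⟨E n, by
      change p ∈ (S.chart (E.symm (E n))).source; rw [E.symm_apply_apply]; exact hsupp n ⟨subset_closure ⟨hn, hpp⟩, hpp⟩⟩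
  · rw [hreindex fun n => S.weight n p, S.sum_weight hΩ_open hp]
    exact (S.rest_mem p).2
  · rw [hreindex fun n => S.weight n p]
    exact hone p hp
  · have hφ : (fun i x => ∑ n, F (E.symm n) δ i x) = fun i x => ∑ n, F n δ i x := by
      funext i x
      exact hreindex fun n => F n δ i x
    rw [hφ]
    have hb := hD (fun i x => ∑ n, F n δ i x)
      (fun i => SmoothUpTo.sum _ fun n _ => (hF n).smooth δ hδ0 i) κ hκ hκ' fun i k s hs => by
        obtain ⟨c, hc, h1, h2⟩ := hFe δ hδ0 i k s hs
        refine ⟨c, hc, h1, fun hsκ => h2 ?_⟩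
        have := hρ3 i k s hsκ
        linarith
    refine hb.trans ?_
    have h1 : ∑ i, ∫ p in M.elem i, ‖∑ n, F n δ i p - W i p‖ ≤ η / 3 + η / 3 := by
      calc _ ≤ ∑ i, ((∑ n, ∫ p in M.elem i, ‖F n δ i p - S.weight n p • W i p‖)
            + (volume ({p | Metric.infDist p M.vertices ≤ 2 * r} ∩ M.elem i)).toReal * B i) :=
            Finset.sum_le_sum fun i _ => S.integral_norm_sub_le hΩ_open hW.smooth hF i (hB i) hδ0
        _ ≤ _ := by
            rw [Finset.sum_add_distrib, h2r]
            exact add_le_add hδ2.le hρ2.le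
    have h3 : κ ≤ η / 3 := min_le_right _ _
    calc _ ≤ D * (η / 3 + η / 3 + η / 3) := by gcongr
      _ ≤ (D + 1) * η := by nlinarith
      _ = ε₁ := by simp only [η]; field_simp
  · rintro _ ⟨x, hx, rfl⟩
    exact (S.chart _).map_source hx.1
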